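/- **Setting.** Let $N$ be a ground set with $|N| = n \ge 1$, let $\mathcal I \subseteq 2^N$ be (the independent sets of) a matroid on $N$ of rank $r$, and let $f : 2^N \to \mathbb R_{\ge 0}$ be monotone and submodular with $f(\emptyset) = 0$. Let $O^* \in \arg\max_{S \in \mathcal I} f(S)$. A *persistent noisy value oracle* for $f$ is $\tilde f(S) = \xi_S f(S)$, where $(\xi_S)_{S \subseteq N}$ are independent nonnegative random variables (one per set) with a common unknown law $\mathcal D$ of mean $1$. The law $\mathcal D$ is *sub-exponential with parameters* $\nu, \alpha \ge 0$ if, for $\xi \sim \mathcal D$, $\mathbb E[e^{\lambda(\xi - \mathbb E \xi)}] \le e^{\nu^2\lambda^2/2}$ for all $|\lambda| \le 1/\alpha$ (for all $\lambda$ if $\alpha = 0$). **Algorithm.** The algorithm receives $n, \varepsilon, \nu, \alpha$ and has access to $\tilde f$ and to an independence oracle for $\mathcal I$. It uses integers $m \ge \max\{2, 8\nu^2\}\frac{n^4}{\varepsilon^2}(n + \log (4n))$, $t \ge \log_2(4m)$, $h = t^2$. 1. Take a basis $B_0$ of $\mathcal I$ (if $r < h$, return $\emptyset$). Draw $H \subseteq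 B_0$ with $|H| = h$ uniformly, and draw $m$ distinct $t$-element subsets $H_1, \dots, H_m$ of $H$ uniformly without replacement. Put $\hat F(S) = \frac1m \sum_{i} \tilde f(S \cup H_i)$ and $\mathcal I_H = \{S \subseteq N \setminus H : S \cup H \in \mathcal I\}$. 2. Run measured continuous greedy on $\hat F$ and $\mathcal I_H$. With $k = n - h$ and $\delta = k^{-4}$, start at $x = 0$ and do $1/\delta$ rounds. In each round, for every $i$ let $\hat\omega_i$ be the average of $\hat F(R \cup \{i\}) - \hat F(R)$ over at least $\frac{10}{\delta^2}\log(2k)$ independent random sets $R$ (containing each $j$ independently with probability $x_j$); choose $\hat I \in \arg\max_{I \in \mathcal I_H} \sum_{i \in I} \hat\omega_i$; set $x_i \leftarrow x_i + \delta(1 - x_i)\mathbf 1[i \in \hat I]$. 3. Convert the final $x$ into a set $S_H \in \mathcal I_H$ by randomized pipage rounding, without access to $\tilde f$. That is, repeatedly move inside the matroid polytope of $\mathcal I_H$ along a direction $\pm(e_i - e_j)$ or $\pm e_i$, the sign being random with probabilities that preserve the mean, until the point is integral. 4. Return $\mathrm{ALG} = S_H \cup H'$, where $H'$ is a uniformly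 random $t$-element subset of $H$. **Theorem.** There are an absolute constant $C > 0$ and, for every $\nu \ge 0$, a constant $c_\nu > 0$, such that the integer parameters above and the choices left open (the basis, ties, the pipage steps) can be fixed so that the algorithm is computed by a single program of a probabilistic random access machine over the reals (unit-cost exact arithmetic and comparison of reals, coins of given bias, unit-cost calls to the two oracles) and the following hold. * *Polynomial time and feasibility.* For all $n \ge 1$, $\varepsilon > 0$, $\nu, \alpha \ge 0$, all matroids and all oracle answers, the program always halts within a number of steps bounded by a fixed polynomial in $n$, $1/\varepsilon$ and $\nu$, and $\mathrm{ALG} \in \mathcal I$. * *Approximation.* Let $\mathcal D$ be sub-exponential with parameters $(\nu, \alpha)$, and let $0 < \varepsilon < 2\nu^2/\alpha$ (only $\varepsilon > 0$ if $\alpha = 0$). If $n \ge \frac1\varepsilon$ and $r \ge c_\nu \cdot \frac1\varepsilon \log^2\!\big(\frac n\varepsilon\big)$, then $$\mathbb E[f(\mathrm{ALG})] \ \ge\ \Big(1 - \frac1e - C\varepsilon\Big) f(O^*),$$ where the expectation is over the noise and the coins of the algorithm. -/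

import Mathlib

open scoped NNReal ENNReal

namespace NoisySubmodular

noncomputable section

/-! ### Set functions and the noisy value oracle -/

/-- Diminishing marginal values. -/
def Submodular {n : ℕ} (f : Finset (Fin n) → ℝ) : Prop :=
  ∀ A B : Finset (Fin n), A ⊆ B → ∀ x, x ∉ B →
    f (insert x B) - f B ≤ f (insert x A) - f A

/-- A distribution on the line is sub-exponential with parameters `(ν, a)`. The condition
`|l| * a ≤ 1` is `|l| ≤ 1 / a`, read as no restriction on `l` when `a = 0`. -/
def IsSubExponential (D : MeasureTheory.Measure ℝ) (ν a : ℝ) : Prop :=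
  ∀ l : ℝ, |l| * a ≤ 1 →
    MeasureTheory.Integrable (fun x => Real.exp (l * (x - ∫ y, y ∂D))) D ∧
      ∫ x, Real.exp (l * (x - ∫ y, y ∂D)) ∂D ≤ Real.exp (ν ^ 2 * l ^ 2 / 2)

/-- The noise multipliers `ξ S` are independent random variables, all with law `D`, where `D` is a
distribution on the nonnegative reals with mean one. Persistence is built in: there is a
single multiplier per set. -/
structure IsNoise {n : ℕ} {Ω : Type*} [MeasurableSpace Ω] (P : MeasureTheory.Measure Ω)
    (ξ : Finset (Fin n) → Ω → ℝ) (D : MeasureTheory.Measure ℝ) : Prop where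
  measurable : ∀ S, Measurable (ξ S)
  law : ∀ S, P.map (ξ S) = D
  indep : ProbabilityTheory.iIndepFun ξ P
  nonneg : ∀ᵐ x ∂D, 0 ≤ x
  unbiased : ∫ x, x ∂D = 1

/-- The persistent noisy oracle at the outcome `ω`. -/
def noisyValue {n : ℕ} {Ω : Type*} (f : Finset (Fin n) → ℝ) (ξ : Finset (Fin n) → Ω → ℝ) (ω : Ω) :
    Finset (Fin n) → ℝ :=
  fun S => ξ S ω * f S

/-! ### Elementary random choices -/

/-- A coin that shows `true` with probability `p` (clamped to the unit interval). -/
def coin (p : ℝ) : PMF Bool := PMF.bernoulli (min p.toNNReal 1) (min_le_right _ _)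

/-- A uniformly random member of a finite family of sets; the empty family is never used. -/
def uniform {β : Type} [Inhabited β] (s : Finset β) : PMF β :=
  open Classical in if h : s.Nonempty then PMF.uniformOfFinset s h else PMF.pure default

/-- `s` independent samples. -/
def iid {β : Type} (μ : PMF β) : ℕ → PMF (List β)
  | 0 => PMF.pure []
  | s + 1 => μ.bind fun b => (iid μ s).map fun L => b :: L

/-- The random subset of a list of elements that contains each `i` independently with
probability `x i`. -/
def randomSubset {n : ℕ} (x : Fin n → ℝ) : List (Fin n) → PMF (Finset (Fin n))
  | [] => PMF.pure ∅
  | i :: L => (coin (x i)).bind fun b =>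
      (randomSubset x L).map fun R => if b then insert i R else R

/-! ### Measured continuous greedy -/

/-- Independence in the contraction of `M` by `H`. -/
def ContractIndep {n : ℕ} (M : Matroid (Fin n)) (H S : Finset (Fin n)) : Prop :=
  Disjoint S H ∧ M.Indep (↑(S ∪ H) : Set (Fin n))

/-- The indicator vector of a set. -/
def indicator {n : ℕ} (S : Finset (Fin n)) : Fin n → ℝ := fun i => if i ∈ S then 1 else 0

/-- The matroid polytope of the contraction of `M` by `H`. -/
def polytope {n : ℕ} (M : Matroid (Fin n)) (H : Finset (Fin n)) : Set (Fin n → ℝ) :=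
  convexHull ℝ (indicator '' {S | ContractIndep M H S})

/-- `I` is an independent set of the contraction with maximum weight among all of them. -/
def IsMaxWeight {n : ℕ} (M : Matroid (Fin n)) (H : Finset (Fin n)) (w : Fin n → ℝ)
    (I : Finset (Fin n)) : Prop :=
  ContractIndep M H I ∧ ∀ J, ContractIndep M H J → ∑ i ∈ J, w i ≤ ∑ i ∈ I, w i

/-- The current fractional point, when the sets chosen so far are listed with the latest first:
`x ← x + δ (1 - x) 1_I` for each chosen set `I`, starting at the origin. -/
def fracPoint {n : ℕ} (δ : ℝ) : List (Finset (Fin n)) → Fin n → ℝ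
  | [] => fun _ => 0
  | I :: L => fun i => fracPoint δ L i + δ * (1 - fracPoint δ L i) * indicator I i

/-- The average, over the sampled sets `R`, of the marginal value of `i` with respect to `R`. -/
def estimate {n : ℕ} (g : Finset (Fin n) → ℝ) (s : ℕ) (Rs : List (Finset (Fin n))) (i : Fin n) :
    ℝ :=
  (Rs.map fun R => g (insert i R) - g R).sum / s

/-- The sets chosen in the first `k` rounds of measured continuous greedy with step `δ` on the value
oracle `g`, with `s` samples per round, where `sel w` is the chosen maximum-weight independent
set for the weights `w`. -/
def greedyHistory {n : ℕ} (δ : ℝ) (s : ℕ) (sel : (Fin n → ℝ) → Finset (Fin n))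
    (g : Finset (Fin n) → ℝ) : ℕ → PMF (List (Finset (Fin n)))
  | 0 => PMF.pure []
  | k + 1 => (greedyHistory δ s sel g k).bind fun L =>
      (iid (randomSubset (fracPoint δ L) (List.finRange n)) s).map fun Rs =>
        sel (estimate g s Rs) :: L

/-- The step size on a ground set of `k` elements. -/
def stepSize (k : ℕ) : ℝ := ((k : ℝ) ^ 4)⁻¹

/-- Measured continuous greedy on a ground set of `k` elements: `k ^ 4` rounds with step `k ^ (-4)`
followed by rounding. The rounding does not see the value oracle. -/
def measuredContinuousGreedy {n : ℕ} (k s : ℕ) (sel : (Fin n → ℝ) → Finset (Fin n))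
    (round : List (Finset (Fin n)) → PMF (Finset (Fin n))) (g : Finset (Fin n) → ℝ) :
    PMF (Finset (Fin n)) :=
  (greedyHistory (stepSize k) s sel g (k ^ 4)).bind round

/-- Directions of pipage steps: two coordinates are traded against each other, or a single
coordinate is traded against slack (the point need not lie in the base polytope). -/
def IsPipageDirection {n : ℕ} (d : Fin n → ℝ) : Prop :=
  (∃ i, d = Pi.single i 1) ∨ ∃ i j, i ≠ j ∧ d = Pi.single i 1 - Pi.single j 1

/-- `PipageRounding Q y μ`: the random set with law `μ` arises from the point `y` of the polytope
`Q` by finitely many randomized pipage steps. A step moves, inside `Q`, from `y` to `y + a d`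
or to `y - b d` with the probabilities that keep the mean equal to `y`. -/
inductive PipageRounding {n : ℕ} (Q : Set (Fin n → ℝ)) :
    (Fin n → ℝ) → PMF (Finset (Fin n)) → Prop
  | integral (S : Finset (Fin n)) (hS : indicator S ∈ Q) :
      PipageRounding Q (indicator S) (PMF.pure S)
  | step (y d : Fin n → ℝ) (a b : ℝ) (μ₁ μ₂ : PMF (Finset (Fin n))) (hd : IsPipageDirection d)
      (ha : 0 ≤ a) (hb : 0 ≤ b) (hab : 0 < a + b) (hy : y ∈ Q)
      (h₁ : y + a • d ∈ Q) (h₂ : y - b • d ∈ Q)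
      (r₁ : PipageRounding Q (y + a • d) μ₁) (r₂ : PipageRounding Q (y - b • d) μ₂) :
      PipageRounding Q y ((coin (b / (a + b))).bind fun c => if c then μ₁ else μ₂)

/-! ### The meta-algorithm -/

/-- The sampled noisy surrogate: the average of `v (S ∪ T)` over the sampled sets `T`. -/
def sampledSurrogate {n : ℕ} (v : Finset (Fin n) → ℝ) (T : Finset (Finset (Fin n)))
    (S : Finset (Fin n)) : ℝ :=
  (∑ H' ∈ T, v (S ∪ H')) / T.card

/-- The meta-algorithm with value oracle `v`, basis `B₀` and parameters `h, t, m`; `A H g` is the law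
of the solution that the inner algorithm finds for the contraction by `H` with value oracle `g`.
The `m` smoothing subsets are drawn without replacement. If the basis has fewer than `h` elements
there is no smoothing set and the empty set is returned. -/
def metaAlgorithm {n : ℕ} (B₀ : Finset (Fin n)) (h t m : ℕ)
    (A : Finset (Fin n) → (Finset (Fin n) → ℝ) → PMF (Finset (Fin n)))
    (v : Finset (Fin n) → ℝ) : PMF (Finset (Fin n)) :=
  if h ≤ B₀.card then
    (uniform (B₀.powersetCard h)).bind fun H =>
      (uniform ((H.powersetCard t).powersetCard m)).bind fun T =>
        (A H (sampledSurrogate v T)).bind fun S =>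
          (uniform (H.powersetCard t)).map fun H' => S ∪ H'
  else PMF.pure ∅

/-! ### The machine model

A probabilistic random access machine over the reals with two memories, one for natural numbers and
one for reals, indirect addressing, exact arithmetic, comparison, biased coins, a value oracle and
an independence oracle. Every instruction takes one step. There are no real constants, no
rounding, and no multiplication of natural numbers. -/

structure State where
  nat : ℕ → ℕ
  real : ℕ → ℝ

def State.setNat (σ : State) (a k : ℕ) : State := { σ with nat := Function.update σ.nat a k }

def State.setReal (σ : State) (a : ℕ) (x : ℝ) : State :=
  { σ with real := Function.update σ.real a x }

/-- The subset of `Fin n` whose characteristic vector is stored from the address in cell `a` on. -/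
def State.block (σ : State) (n a : ℕ) : Finset (Fin n) :=
  Finset.univ.filter fun i : Fin n => σ.nat (σ.nat a + i) ≠ 0

inductive Instr where
  | constN (a k : ℕ)
  | addN (a b c : ℕ)
  | subN (a b c : ℕ)
  | ltN (a b c : ℕ)
  | loadN (a b : ℕ)
  | storeN (a b : ℕ)
  | castR (a b : ℕ)
  | addR (a b c : ℕ)
  | subR (a b c : ℕ)
  | mulR (a b c : ℕ)
  | divR (a b c : ℕ)
  | ltR (a b c : ℕ)
  | loadR (a b : ℕ)
  | storeR (a b : ℕ)
  | flip (a b : ℕ)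
  | value (a b : ℕ)
  | indep (a b : ℕ)

/-- Effect of an instruction, with value oracle `v` and independence oracle for `M`. -/
def exec {n : ℕ} (M : Matroid (Fin n)) (v : Finset (Fin n) → ℝ) (σ : State) : Instr → PMF State
  | .constN a k => PMF.pure (σ.setNat a k)
  | .addN a b c => PMF.pure (σ.setNat a (σ.nat b + σ.nat c))
  | .subN a b c => PMF.pure (σ.setNat a (σ.nat b - σ.nat c))
  | .ltN a b c => PMF.pure (σ.setNat a (if σ.nat b < σ.nat c then 1 else 0))
  | .loadN a b => PMF.pure (σ.setNat a (σ.nat (σ.nat b)))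
  | .storeN a b => PMF.pure (σ.setNat (σ.nat a) (σ.nat b))
  | .castR a b => PMF.pure (σ.setReal a (σ.nat b : ℝ))
  | .addR a b c => PMF.pure (σ.setReal a (σ.real b + σ.real c))
  | .subR a b c => PMF.pure (σ.setReal a (σ.real b - σ.real c))
  | .mulR a b c => PMF.pure (σ.setReal a (σ.real b * σ.real c))
  | .divR a b c => PMF.pure (σ.setReal a (σ.real b / σ.real c))
  | .ltR a b c => open Classical in
      PMF.pure (σ.setNat a (if σ.real b < σ.real c then 1 else 0))
  | .loadR a b => PMF.pure (σ.setReal a (σ.real (σ.nat b)))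
  | .storeR a b => PMF.pure (σ.setReal (σ.nat a) (σ.real b))
  | .flip a b => (coin (σ.real b)).map fun c => σ.setNat a (if c then 1 else 0)
  | .value a b => PMF.pure (σ.setReal a (v (σ.block n b)))
  | .indep a b => open Classical in
      PMF.pure (σ.setNat a (if M.Indep (↑(σ.block n b) : Set (Fin n)) then 1 else 0))

/-- Programs. Tests ask whether the natural number in cell `a` is nonzero. -/
inductive Cmd where
  | instr (i : Instr)
  | seq (c d : Cmd)
  | ite (a : ℕ) (c d : Cmd)
  | loop (a : ℕ) (c : Cmd)

/-- One step of the machine; a configuration is the stack of commands still to be executed together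
with the memory. The machine has halted when the stack is empty. -/
def step {n : ℕ} (M : Matroid (Fin n)) (v : Finset (Fin n) → ℝ) :
    List Cmd × State → PMF (List Cmd × State)
  | ([], σ) => PMF.pure ([], σ)
  | (.instr i :: K, σ) => (exec M v σ i).map fun τ => (K, τ)
  | (.seq c d :: K, σ) => PMF.pure (c :: d :: K, σ)
  | (.ite a c d :: K, σ) => PMF.pure ((if σ.nat a ≠ 0 then c else d) :: K, σ)
  | (.loop a c :: K, σ) => PMF.pure (if σ.nat a ≠ 0 then c :: .loop a c :: K else K, σ)

/-- The configuration after `T` steps. -/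
def runSteps {n : ℕ} (M : Matroid (Fin n)) (v : Finset (Fin n) → ℝ) (p : List Cmd × State) :
    ℕ → PMF (List Cmd × State)
  | 0 => PMF.pure p
  | T + 1 => (runSteps M v p T).bind (step M v)

/-- The input: `n` in the natural cell `0`, the reals `ε, ν, a` in the real cells `0, 1, 2`. -/
def inputState (n : ℕ) (ε ν a : ℝ) : State where
  nat := fun i => if i = 0 then n else 0
  real := fun i => if i = 0 then ε else if i = 1 then ν else if i = 2 then a else 0

/-- Whatever the coins show, the program has halted after at most `T` steps. -/
def HaltsWithin {n : ℕ} (prog : Cmd) (ε ν a : ℝ) (M : Matroid (Fin n))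
    (v : Finset (Fin n) → ℝ) (T : ℕ) : Prop :=
  ∀ p ∈ (runSteps M v ([prog], inputState n ε ν a) T).support, p.1 = []

/-- The law of the set stored, after `T` steps, at the address in the natural cell `1`. -/
def outputLaw {n : ℕ} (prog : Cmd) (ε ν a : ℝ) (M : Matroid (Fin n))
    (v : Finset (Fin n) → ℝ) (T : ℕ) : PMF (Finset (Fin n)) :=
  (runSteps M v ([prog], inputState n ε ν a) T).map fun p => p.2.block n 1

/-- A polynomial time bound in `n`, `1 / ε` and `ν`. -/
def timeBound (K d n : ℕ) (ε ν : ℝ) : ℕ := K * (n + ⌈1 / ε⌉₊ + ⌈ν⌉₊ + 1) ^ d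

/-- The expectation of `f` under the law `μ`. -/
def expect {n : ℕ} (μ : PMF (Finset (Fin n))) (f : Finset (Fin n) → ℝ) : ℝ :=
  ∑ S, (μ S).toReal * f S

end

end NoisySubmodular

open scoped NNReal ENNReal

namespace NoisySubmodular
noncomputable section

/-! ### Running times and output laws of programs -/

section Machine
variable {n : ℕ} {M : Matroid (Fin n)} {v : Finset (Fin n) → ℝ}

/-! Smoothing. For a fixed `H`, let `F(S)` be the average of `f(S ∪ H')` over all `t`-element
subsets `H'` of `H` (`surrogate`). It inherits monotonicity and diminishing returns, it dominates
`f`, and it is exactly the expected value of the returned set `S ∪ H'` once `S` is fixed. So it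
suffices to nearly maximise `F` over the contraction by `H` while seeing only the sampled noisy
average.

Concentration. If `S` is disjoint from `H`, distinct smoothing sets lead to distinct queries, whose
multipliers are independent. For fixed smoothing sets the Chernoff bound is a product over them;
averaged over all choices without replacement it becomes an elementary symmetric mean, and
Maclaurin's inequality (`symSum_le`) bounds it by what independent sampling would give. The relevant
range of values is `V = n f(O)`: on elements that are not loops of the contraction, submodularity
bounds all queried values by `n` times the optimum (`value_le_of_subset_candidates`). A union bound
over all `S` gives error at most `ε f(O) / n` outside an event of probability at most `ε`
(`IsNoise.sum_bad_le`, `failure_le`).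

Greedy and rounding. With estimates accurate to that order, one round of measured continuous greedy
raises the multilinear extension of `F` by `δ (1 - nδ)` times the remaining gap to `F(J)`, up to
small errors, for every independent `J` of the contraction (`greedyRound_ge`). Over `1 / δ` rounds
the gap shrinks to about `1 / e` of its initial value. Pipage rounding loses nothing on average,
because the extension is affine along `e_i` and convex along `e_i - e_j` (`PipageRounding.le_ev`).

Contraction. The comparison set `J` is a part of `O` that depends on `H`. For a random `h`-subset
`H` of a base of size `r`, its value averages at least `(1 - h / r) f(O)`. Replacing `f` on `O` by
an additive minorant reduces this to weights (`exists_contractIndep_value`), and weights are treated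
by peeling off the lightest element (`exists_contractIndep_weight`). The rank hypothesis gives `h ≤
ε r` (`setSize_sq_le`).

Machine. The program is written in a small imperative language whose compiler is proved correct with
a time bound (`Code.compile_correct`). `Sim` couples the random memory with abstract random values,
so the output law of the machine is shown to equal `metaAlgorithm` exactly; feasibility and
approximation are then proved for `metaAlgorithm` alone. Two identities make the algorithm
implementable. Rounding never looks at the value oracle, so it can be interleaved with the greedy
rounds (`foldP_roundStep`); the rounding used is swap rounding of the convex combination built by
greedy, which is a sequence of pipage steps (`swapRound_pipage`). And a uniform member of a family
of sets is drawn by revealing membership one element at a time with exact conditional probabilities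
(`foldP_revealStep_bind`). -/

theorem bind_congr_support {α β : Type*} (μ : PMF α) {f g : α → PMF β}
    (h : ∀ a ∈ μ.support, f a = g a) : μ.bind f = μ.bind g := by
  ext b
  simp only [PMF.bind_apply]
  refine tsum_congr fun a => ?_
  by_cases ha : a ∈ μ.support
  · rw [h a ha]
  · rw [(PMF.apply_eq_zero_iff μ a).2 ha]; simp

/-- `runSteps` appends steps at the end, while execution is analysed from its first step; the two
recursions agree by associativity of `bind`. -/
theorem runSteps_succ (p : List Cmd × State) (T : ℕ) :
    runSteps M v p (T + 1) = (step M v p).bind fun q => runSteps M v q T := by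
  induction T with
  | zero => simp [runSteps]
  | succ T ih =>
    rw [runSteps, ih, PMF.bind_bind]
    rfl

variable (M v) in
/-- From `p` the machine has halted after `N` steps, and the output then has law `law`. -/
def Settles (p : List Cmd × State) (N : ℕ) (law : PMF (Finset (Fin n))) : Prop :=
  ∀ T, N ≤ T → (∀ q ∈ (runSteps M v p T).support, q.1 = []) ∧
    (runSteps M v p T).map (fun q => q.2.block n 1) = law

variable (M v) in
/-- Command `c`, started in `σ`, takes at most `T` steps and ends in a state related by `R` to a
random value with law `μ`. It is stated by continuations. -/
def Triple {X : Type} (c : Cmd) (σ : State) (T : ℕ) (μ : PMF X) (R : X → State → Prop) : Prop :=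
  ∀ (K : List Cmd) (N : ℕ) (κ : X → PMF (Finset (Fin n))),
    (∀ x ∈ μ.support, ∀ τ, R x τ → Settles M v (K, τ) N (κ x)) →
      Settles M v (c :: K, σ) (N + T) (μ.bind κ)

theorem Settles.mono {p : List Cmd × State} {N N' : ℕ} {law : PMF (Finset (Fin n))}
    (h : Settles M v p N law) (hN : N ≤ N') : Settles M v p N' law :=
  fun T hT => h T (hN.trans hT)

/-- The step is presented as the image of a random value, so that each outcome may have its own
continuation law. Outcomes that halt early do no harm because `Settles` speaks of all times from `N`
on. -/
theorem settles_of_step {X : Type} {p : List Cmd × State} {μ : PMF X}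
    {g : X → List Cmd × State} (hp : step M v p = μ.map g) {N : ℕ}
    {κ : X → PMF (Finset (Fin n))} (h : ∀ x ∈ μ.support, Settles M v (g x) N (κ x)) :
    Settles M v p (N + 1) (μ.bind κ) := by
  intro T hT
  obtain ⟨T, rfl⟩ : ∃ T', T = T' + 1 := ⟨T - 1, by omega⟩
  have hT' : N ≤ T := by omega
  rw [runSteps_succ, hp, PMF.bind_map]
  constructor
  · intro q hq
    rw [PMF.mem_support_bind_iff] at hq
    obtain ⟨x, hx, hq⟩ := hq
    exact (h x hx T hT').1 q hq
  · rw [PMF.map_bind]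
    exact bind_congr_support _ fun x hx => (h x hx T hT').2

theorem settles_of_step_pure {p q : List Cmd × State} (hp : step M v p = PMF.pure q) {N : ℕ}
    {law : PMF (Finset (Fin n))} (h : Settles M v q N law) : Settles M v p (N + 1) law := by
  have := settles_of_step (M := M) (v := v) (p := p) (μ := PMF.pure ()) (g := fun _ => q)
    (by simpa [PMF.pure_map] using hp) (κ := fun _ => law) (fun _ _ => h)
  simpa using this

/-- A halted configuration is a fixed point of `step`. -/
theorem settles_nil (σ : State) : Settles M v ([], σ) 0 (PMF.pure (σ.block n 1)) := by
  have key : ∀ T, runSteps M v ([], σ) T = PMF.pure ([], σ) := by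
    intro T
    induction T with
    | zero => rfl
    | succ T ih => rw [runSteps, ih, PMF.pure_bind]; rfl
  intro T _
  rw [key T]
  simp [PMF.pure_map]

namespace Triple
variable {X Y : Type} {c d : Cmd} {σ : State} {T T' : ℕ} {μ : PMF X} {R : X → State → Prop}

theorem mono_time (h : Triple M v c σ T μ R) (hT : T ≤ T') : Triple M v c σ T' μ R :=
  fun K N κ hκ => (h K N κ hκ).mono (by omega)

/-- Since a `Triple` quantifies over all continuations, composition is instantiation: the
continuation of `c` is `d` followed by the rest. The additional step is the one that unpacks the
sequence. -/
theorem seq {ν : X → PMF Y} {R' : Y → State → Prop} (hc : Triple M v c σ T μ R)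
    (hd : ∀ x ∈ μ.support, ∀ τ, R x τ → Triple M v d τ T' (ν x) R') :
    Triple M v (.seq c d) σ (T + T' + 1) (μ.bind ν) R' := by
  intro K N κ hκ
  have h1 : Settles M v (c :: d :: K, σ) (N + T' + T) (μ.bind fun x => (ν x).bind κ) := by
    refine hc (d :: K) (N + T') _ fun x hx τ hτ => ?_
    refine hd x hx τ hτ K N κ fun y hy τ' hτ' => hκ y ?_ τ' hτ'
    rw [PMF.mem_support_bind_iff]
    exact ⟨x, hx, hy⟩
  rw [PMF.bind_bind]
  have := settles_of_step_pure (M := M) (v := v) (p := (.seq c d :: K, σ)) rfl h1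
  exact this.mono (by omega)

theorem ite {a : ℕ} (hc : σ.nat a ≠ 0 → Triple M v c σ T μ R)
    (hd : σ.nat a = 0 → Triple M v d σ T μ R) : Triple M v (.ite a c d) σ (T + 1) μ R := by
  intro K N κ hκ
  by_cases h : σ.nat a = 0
  · exact (settles_of_step_pure (M := M) (v := v) (p := (.ite a c d :: K, σ))
      (q := (d :: K, σ)) (by simp [step, h]) (hd h K N κ hκ)).mono (by omega)
  · exact (settles_of_step_pure (M := M) (v := v) (p := (.ite a c d :: K, σ))
      (q := (c :: K, σ)) (by simp [step, h]) (hc h K N κ hκ)).mono (by omega)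

theorem loop_exit {a : ℕ} (h : σ.nat a = 0) {x : X} (hR : R x σ) :
    Triple M v (.loop a c) σ 1 (PMF.pure x) R := by
  intro K N κ hκ
  rw [PMF.pure_bind]
  exact settles_of_step_pure (M := M) (v := v) (p := (.loop a c :: K, σ))
      (q := (K, σ)) (by simp [step, h]) (hκ x (by simp) σ hR)

/-- A single unrolling. Whole loops are treated where they occur, by induction on the number of
rounds left. -/
theorem loop_iter {a : ℕ} (h : σ.nat a ≠ 0) {ν : X → PMF Y} {R' : Y → State → Prop}
    (hc : Triple M v c σ T μ R)
    (hd : ∀ x ∈ μ.support, ∀ τ, R x τ → Triple M v (.loop a c) τ T' (ν x) R') :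
    Triple M v (.loop a c) σ (T + T' + 1) (μ.bind ν) R' := by
  intro K N κ hκ
  have h1 : Settles M v (c :: .loop a c :: K, σ) (N + T' + T)
      (μ.bind fun x => (ν x).bind κ) := by
    refine hc (.loop a c :: K) (N + T') _ fun x hx τ hτ => ?_
    refine hd x hx τ hτ K N κ fun y hy τ' hτ' => hκ y ?_ τ' hτ'
    rw [PMF.mem_support_bind_iff]
    exact ⟨x, hx, hy⟩
  rw [PMF.bind_bind]
  have := settles_of_step_pure (M := M) (v := v) (p := (.loop a c :: K, σ))
    (q := (c :: .loop a c :: K, σ)) (by simp [step, h]) h1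
  exact this.mono (by omega)

end Triple

variable (M v) in
/-- A command that uses no coin and ends, within `T` steps, in a state satisfying `Q`. -/
abbrev Reaches (c : Cmd) (σ : State) (T : ℕ) (Q : State → Prop) : Prop :=
  Triple M v c σ T (PMF.pure ()) fun _ => Q

namespace Reaches
variable {c d : Cmd} {σ : State} {T T' : ℕ} {Q Q' : State → Prop}

theorem instr {i : Instr} {τ : State} (h : exec M v σ i = PMF.pure τ) (hQ : Q τ) :
    Reaches M v (.instr i) σ 1 Q := by
  intro K N κ hκ
  rw [PMF.pure_bind]
  exact settles_of_step_pure (M := M) (v := v) (p := (.instr i :: K, σ))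
      (q := (K, τ)) (by simp [step, h, PMF.pure_map]) (hκ () (by simp) τ hQ)

theorem seq (hc : Reaches M v c σ T Q) (hd : ∀ τ, Q τ → Reaches M v d τ T' Q') :
    Reaches M v (.seq c d) σ (T + T' + 1) Q' := by
  have := Triple.seq (ν := fun _ => PMF.pure ()) hc (fun _ _ τ hτ => hd τ hτ)
  simpa [Reaches] using this

theorem loop_iter {a : ℕ} (h : σ.nat a ≠ 0) (hc : Reaches M v c σ T Q)
    (hd : ∀ τ, Q τ → Reaches M v (.loop a c) τ T' Q') :
    Reaches M v (.loop a c) σ (T + T' + 1) Q' := by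
  have := Triple.loop_iter (ν := fun _ => PMF.pure ()) h hc (fun _ _ τ hτ => hd τ hτ)
  simpa [Reaches] using this

theorem toTriple {X : Type} {x : X} {R : X → State → Prop}
    (h : Reaches M v c σ T (R x)) : Triple M v c σ T (PMF.pure x) R := by
  intro K N κ hκ
  have := h K N (fun _ => κ x) (fun _ _ τ hτ => hκ x (by simp) τ hτ)
  simpa using this

end Reaches

/-- A command without coins, followed by a random one. -/
theorem Reaches.then {X : Type} {c d : Cmd} {σ : State} {T T' : ℕ} {Q : State → Prop}
    {μ : PMF X} {R : X → State → Prop} (hc : Reaches M v c σ T Q)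
    (hd : ∀ τ, Q τ → Triple M v d τ T' μ R) : Triple M v (.seq c d) σ (T + T' + 1) μ R := by
  have := Triple.seq (ν := fun _ => μ) hc (fun _ _ τ hτ => hd τ hτ)
  simpa using this

theorem Triple.flip {σ : State} {a b : ℕ} {R : Bool → State → Prop}
    (h : ∀ x, R x (σ.setNat a (if x then 1 else 0))) :
    Triple M v (.instr (.flip a b)) σ 1 (coin (σ.real b)) R := by
  intro K N κ hκ
  refine settles_of_step (μ := coin (σ.real b))
    (g := fun x => (K, σ.setNat a (if x then 1 else 0))) ?_ fun x hx => hκ x hx _ (h x)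
  simp only [step, exec, PMF.map_comp]
  rfl

end Machine


/-! ### A small imperative language, compiled to the machine -/

/-- The memory seen by high-level code: natural and real scalars and arrays. -/
structure Mem where
  N : ℕ → ℕ
  A : ℕ → ℕ → ℕ
  X : ℕ → ℝ
  Y : ℕ → ℕ → ℝ

namespace Mem

def setN (a : Mem) (v k : ℕ) : Mem := { a with N := Function.update a.N v k }
def setA (a : Mem) (j i k : ℕ) : Mem :=
  { a with A := Function.update a.A j (Function.update (a.A j) i k) }
def setX (a : Mem) (x : ℕ) (r : ℝ) : Mem := { a with X := Function.update a.X x r }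
def setY (a : Mem) (j i : ℕ) (r : ℝ) : Mem :=
  { a with Y := Function.update a.Y j (Function.update (a.Y j) i r) }

variable (a : Mem)

@[simp] theorem setN_N (v k w : ℕ) : (a.setN v k).N w = if w = v then k else a.N w := by
  simp [setN, Function.update_apply]
@[simp] theorem setN_A (v k : ℕ) : (a.setN v k).A = a.A := rfl
@[simp] theorem setN_X (v k : ℕ) : (a.setN v k).X = a.X := rfl
@[simp] theorem setN_Y (v k : ℕ) : (a.setN v k).Y = a.Y := rfl
@[simp] theorem setA_N (j i k : ℕ) : (a.setA j i k).N = a.N := rfl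
@[simp] theorem setA_A (j i k j' i' : ℕ) :
    (a.setA j i k).A j' i' = if j' = j ∧ i' = i then k else a.A j' i' := by
  by_cases h : j' = j
  · subst h; simp [setA, Function.update_apply]
  · simp [setA, h]
@[simp] theorem setA_X (j i k : ℕ) : (a.setA j i k).X = a.X := rfl
@[simp] theorem setA_Y (j i k : ℕ) : (a.setA j i k).Y = a.Y := rfl
@[simp] theorem setX_N (x : ℕ) (r : ℝ) : (a.setX x r).N = a.N := rfl
@[simp] theorem setX_A (x : ℕ) (r : ℝ) : (a.setX x r).A = a.A := rfl
@[simp] theorem setX_X (x : ℕ) (r : ℝ) (y : ℕ) :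
    (a.setX x r).X y = if y = x then r else a.X y := by
  simp [setX, Function.update_apply]
@[simp] theorem setX_Y (x : ℕ) (r : ℝ) : (a.setX x r).Y = a.Y := rfl
@[simp] theorem setY_N (j i : ℕ) (r : ℝ) : (a.setY j i r).N = a.N := rfl
@[simp] theorem setY_A (j i : ℕ) (r : ℝ) : (a.setY j i r).A = a.A := rfl
@[simp] theorem setY_X (j i : ℕ) (r : ℝ) : (a.setY j i r).X = a.X := rfl
@[simp] theorem setY_Y (j i : ℕ) (r : ℝ) (j' i' : ℕ) :
    (a.setY j i r).Y j' i' = if j' = j ∧ i' = i then r else a.Y j' i' := by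
  by_cases h : j' = j
  · subst h; simp [setY, Function.update_apply]
  · simp [setY, h]

/-- The set whose characteristic vector is array `j`. -/
def set (n : ℕ) (a : Mem) (j : ℕ) : Finset (Fin n) := Finset.univ.filter fun i => a.A j i ≠ 0

end Mem

/-- Natural expressions. -/
inductive NExp where
  | lit (k : ℕ)
  | var (v : ℕ)
  | size
  | arr (j : ℕ) (e : NExp)
  | add (e f : NExp)
  | sub (e f : NExp)
  | lt (e f : NExp)

/-- Real expressions. -/
inductive RExp where
  | var (x : ℕ)
  | arr (j : ℕ) (e : NExp)
  | cast (e : NExp)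
  | add (r s : RExp)
  | sub (r s : RExp)
  | mul (r s : RExp)
  | div (r s : RExp)

/-- High-level programs. `forLoop v w c` executes `c` with the counter `v` running through the
numbers below the value of `w`. -/
inductive Code where
  | skip
  | setN (v : ℕ) (e : NExp)
  | setA (j : ℕ) (e f : NExp)
  | setX (x : ℕ) (r : RExp)
  | setY (j : ℕ) (e : NExp) (r : RExp)
  | ltR (v : ℕ) (r s : RExp)
  | flip (v : ℕ) (r : RExp)
  | value (x j : ℕ)
  | indep (v j : ℕ)
  | seq (c d : Code)
  | cond (e : NExp) (c d : Code)
  | forLoop (v w : ℕ) (c : Code)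

def NExp.eval (n : ℕ) (a : Mem) : NExp → ℕ
  | .lit k => k
  | .var v => a.N v
  | .size => n
  | .arr j e => a.A j (e.eval n a)
  | .add e f => e.eval n a + f.eval n a
  | .sub e f => e.eval n a - f.eval n a
  | .lt e f => if e.eval n a < f.eval n a then 1 else 0

def RExp.eval (n : ℕ) (a : Mem) : RExp → ℝ
  | .var x => a.X x
  | .arr j e => a.Y j (e.eval n a)
  | .cast e => (e.eval n a : ℝ)
  | .add r s => r.eval n a + s.eval n a
  | .sub r s => r.eval n a - s.eval n a
  | .mul r s => r.eval n a * s.eval n a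
  | .div r s => r.eval n a / s.eval n a

/-- Iterate a random transformation while counting in the variable `v`. -/
def countLoop (f : Mem → PMF Mem) (v : ℕ) : ℕ → Mem → PMF Mem
  | 0, a => PMF.pure a
  | k + 1, a => (f a).bind fun a' => countLoop f v k (a'.setN v (a'.N v + 1))

/-- A loop reads its bound once, at entry, whereas the machine compares counter and bound before
every round. The two agree because `Code.ok` forbids the body to write to either. -/
def Code.den {n : ℕ} (M : Matroid (Fin n)) (val : Finset (Fin n) → ℝ) : Code → Mem → PMF Mem
  | .skip, a => PMF.pure a
  | .setN v e, a => PMF.pure (a.setN v (e.eval n a))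
  | .setA j e f, a => PMF.pure (a.setA j (e.eval n a) (f.eval n a))
  | .setX x r, a => PMF.pure (a.setX x (r.eval n a))
  | .setY j e r, a => PMF.pure (a.setY j (e.eval n a) (r.eval n a))
  | .ltR v r s, a => open Classical in
      PMF.pure (a.setN v (if r.eval n a < s.eval n a then 1 else 0))
  | .flip v r, a => (coin (r.eval n a)).map fun b => a.setN v (if b then 1 else 0)
  | .value x j, a => PMF.pure (a.setX x (val (a.set n j)))
  | .indep v j, a => open Classical in
      PMF.pure (a.setN v (if M.Indep (↑(a.set n j) : Set (Fin n)) then 1 else 0))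
  | .seq c d, a => (c.den M val a).bind (d.den M val)
  | .cond e c d, a => if e.eval n a ≠ 0 then c.den M val a else d.den M val a
  | .forLoop v w c, a => countLoop (c.den M val) v (a.N w) (a.setN v 0)

/-! #### Syntactic frame conditions -/

namespace Code

/-- These checks are computable, so the frame facts needed for the concrete program below are closed
by `rfl`. -/
def keepsN (u : ℕ) : Code → Bool
  | .setN v _ | .ltR v _ _ | .flip v _ | .indep v _ => u != v
  | .seq c d | .cond _ c d => c.keepsN u && d.keepsN u
  | .forLoop v _ c => u != v && c.keepsN u
  | _ => true

def keepsA (u : ℕ) : Code → Bool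
  | .setA j _ _ => u != j
  | .seq c d | .cond _ c d => c.keepsA u && d.keepsA u
  | .forLoop _ _ c => c.keepsA u
  | _ => true

def keepsX (u : ℕ) : Code → Bool
  | .setX x _ | .value x _ => u != x
  | .seq c d | .cond _ c d => c.keepsX u && d.keepsX u
  | .forLoop _ _ c => c.keepsX u
  | _ => true

def keepsY (u : ℕ) : Code → Bool
  | .setY j _ _ => u != j
  | .seq c d | .cond _ c d => c.keepsY u && d.keepsY u
  | .forLoop _ _ c => c.keepsY u
  | _ => true

end Code

/-- Memory that agrees with `a` outside what `c` may write to. -/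
structure Frame (c : Code) (a a' : Mem) : Prop where
  N : ∀ u, c.keepsN u = true → a'.N u = a.N u
  A : ∀ u, c.keepsA u = true → a'.A u = a.A u
  X : ∀ u, c.keepsX u = true → a'.X u = a.X u
  Y : ∀ u, c.keepsY u = true → a'.Y u = a.Y u

theorem Frame.rfl' (c : Code) (a : Mem) : Frame c a a :=
  ⟨fun _ _ => rfl, fun _ _ => rfl, fun _ _ => rfl, fun _ _ => rfl⟩

theorem Frame.trans {c : Code} {a b d : Mem} (h : Frame c a b) (h' : Frame c b d) :
    Frame c a d :=
  ⟨fun u hu => (h'.N u hu).trans (h.N u hu), fun u hu => (h'.A u hu).trans (h.A u hu),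
    fun u hu => (h'.X u hu).trans (h.X u hu), fun u hu => (h'.Y u hu).trans (h.Y u hu)⟩

/-! ### Soundness of the frame conditions -/

section
variable {n : ℕ} {M : Matroid (Fin n)} {val : Finset (Fin n) → ℝ}

theorem countLoop_frame {c : Code} {v w : ℕ} {f : Mem → PMF Mem}
    (hf : ∀ a, ∀ a' ∈ (f a).support, Frame c a a') (k : ℕ) (a : Mem) :
    ∀ a' ∈ (countLoop f v k a).support, Frame (.forLoop v w c) a a' := by
  induction k generalizing a with
  | zero =>
    intro a' ha'
    simp only [countLoop, PMF.support_pure, Set.mem_singleton_iff] at ha'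
    subst ha'
    exact Frame.rfl' _ _
  | succ k ih =>
    intro a' ha'
    rw [countLoop, PMF.mem_support_bind_iff] at ha'
    obtain ⟨b, hb, ha'⟩ := ha'
    have h1 := hf a b hb
    refine Frame.trans ?_ (ih _ a' ha')
    refine ⟨fun u hu => ?_, fun u hu => ?_, fun u hu => ?_, fun u hu => ?_⟩
    · simp only [Code.keepsN, Bool.and_eq_true, bne_iff_ne] at hu
      simp [hu.1, h1.N u hu.2]
    · exact h1.A u hu
    · exact h1.X u hu
    · exact h1.Y u hu

theorem Code.frame (c : Code) (a : Mem) : ∀ a' ∈ (c.den M val a).support, Frame c a a' := by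
  induction c generalizing a with
  | seq c d hc hd =>
    intro a' ha'
    rw [Code.den, PMF.mem_support_bind_iff] at ha'
    obtain ⟨b, hb, ha'⟩ := ha'
    have h1 := hc a b hb
    have h2 := hd b a' ha'
    refine ⟨fun u hu => ?_, fun u hu => ?_, fun u hu => ?_, fun u hu => ?_⟩ <;>
      simp only [keepsN, keepsA, keepsX, keepsY, Bool.and_eq_true] at hu
    · exact (h2.N u hu.2).trans (h1.N u hu.1)
    · exact (h2.A u hu.2).trans (h1.A u hu.1)
    · exact (h2.X u hu.2).trans (h1.X u hu.1)
    · exact (h2.Y u hu.2).trans (h1.Y u hu.1)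
  | cond e c d hc hd =>
    intro a' ha'
    rw [Code.den] at ha'
    have : Frame c a a' ∨ Frame d a a' := by
      split_ifs at ha'
      exacts [Or.inl (hc a a' ha'), Or.inr (hd a a' ha')]
    refine ⟨fun u hu => ?_, fun u hu => ?_, fun u hu => ?_, fun u hu => ?_⟩ <;>
      simp only [keepsN, keepsA, keepsX, keepsY, Bool.and_eq_true] at hu <;>
      rcases this with h | h
    exacts [h.N u hu.1, h.N u hu.2, h.A u hu.1, h.A u hu.2, h.X u hu.1, h.X u hu.2,
      h.Y u hu.1, h.Y u hu.2]
  | forLoop v w c hc =>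
    intro a' ha'
    rw [Code.den] at ha'
    refine Frame.trans ?_ (countLoop_frame (w := w) hc _ _ a' ha')
    refine ⟨fun u hu => ?_, fun u hu => rfl, fun u hu => rfl, fun u hu => rfl⟩
    simp only [Code.keepsN, Bool.and_eq_true, bne_iff_ne] at hu
    simp [hu.1]
  | flip v r =>
    intro a' ha'
    simp only [Code.den, PMF.support_map, Set.mem_image] at ha'
    obtain ⟨b, -, rfl⟩ := ha'
    refine ⟨fun u hu => ?_, fun u hu => ?_, fun u hu => ?_, fun u hu => ?_⟩ <;>
      simp_all [keepsN]
  | _ =>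
    intro a' ha'
    simp only [Code.den, PMF.support_pure, Set.mem_singleton_iff] at ha'
    subst ha'
    refine ⟨fun u hu => ?_, fun u hu => ?_, fun u hu => ?_, fun u hu => ?_⟩ <;>
      first
        | rfl
        | (simp_all [keepsN]; done)
        | (funext i; simp_all [keepsA, keepsY])
        | simp_all [keepsX]

end

/-! #### Compilation -/

infixr:60 ";;" => Cmd.seq

/-- Layout of the natural memory: cell `0` is the size `n`, cell `1` the address of the output,
cells `2` to `61` the scalars, cells `62` to `79` a stack of temporaries, the next `n` cells a
buffer for oracle queries. From `80 + n` on, sixteen arrays are interleaved with stride sixteen, so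
each can grow without limit, and the address of an entry is computed by four doublings since
naturals cannot be multiplied. The argument `d` is the height of the stack. -/
def NExp.code : NExp → ℕ → Cmd
  | .lit k, d => .instr (.constN (62 + d) k)
  | .var v, d => .instr (.constN (62 + d) 0);; .instr (.addN (62 + d) (62 + d) (2 + v))
  | .size, d => .instr (.constN (62 + d) 0);; .instr (.addN (62 + d) (62 + d) 0)
  | .arr j e, d => e.code d;; .instr (.constN (63 + d) (80 + j));;
      .instr (.addN (62 + d) (62 + d) (62 + d));; .instr (.addN (62 + d) (62 + d) (62 + d));;
      .instr (.addN (62 + d) (62 + d) (62 + d));; .instr (.addN (62 + d) (62 + d) (62 + d));;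
      .instr (.addN (62 + d) (62 + d) 0);; .instr (.addN (62 + d) (62 + d) (63 + d));;
      .instr (.loadN (62 + d) (62 + d))
  | .add e f, d => e.code d;; f.code (d + 1);; .instr (.addN (62 + d) (62 + d) (63 + d))
  | .sub e f, d => e.code d;; f.code (d + 1);; .instr (.subN (62 + d) (62 + d) (63 + d))
  | .lt e f, d => e.code d;; f.code (d + 1);; .instr (.ltN (62 + d) (62 + d) (63 + d))

/-- The bound `18` keeps the stack of temporaries below the query buffer at address `80`; an array
access uses one cell above the current height. -/
def NExp.ok : NExp → ℕ → Bool
  | .lit _, d | .size, d => decide (d < 18)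
  | .var v, d => decide (d < 18) && decide (v < 60)
  | .arr j e, d => e.ok d && decide (d + 1 < 18) && decide (j < 16)
  | .add e f, d | .sub e f, d | .lt e f, d => e.ok d && f.ok (d + 1)

def NExp.cost : NExp → ℕ
  | .lit _ => 1
  | .var _ | .size => 3
  | .arr _ e => e.cost + 16
  | .add e f | .sub e f | .lt e f => e.cost + f.cost + 3

/-- Real memory: scalars below `40`, a stack of temporaries from `40` to `63`, then four interleaved
arrays. Indices are evaluated at height zero of the natural stack, because no natural temporary is
live during the evaluation of a real expression. -/
def RExp.code : RExp → ℕ → Cmd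
  | .var x, d => .instr (.constN 62 0);; .instr (.castR (40 + d) 62);;
      .instr (.addR (40 + d) (40 + d) x)
  | .arr j e, d => e.code 0;; .instr (.constN 63 (64 + j));;
      .instr (.addN 62 62 62);; .instr (.addN 62 62 62);; .instr (.addN 62 62 63);;
      .instr (.loadR (40 + d) 62)
  | .cast e, d => e.code 0;; .instr (.castR (40 + d) 62)
  | .add r s, d => r.code d;; s.code (d + 1);; .instr (.addR (40 + d) (40 + d) (41 + d))
  | .sub r s, d => r.code d;; s.code (d + 1);; .instr (.subR (40 + d) (40 + d) (41 + d))
  | .mul r s, d => r.code d;; s.code (d + 1);; .instr (.mulR (40 + d) (40 + d) (41 + d))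
  | .div r s, d => r.code d;; s.code (d + 1);; .instr (.divR (40 + d) (40 + d) (41 + d))

def RExp.ok : RExp → ℕ → Bool
  | .var x, d => decide (d < 24) && decide (x < 40)
  | .arr j e, d => e.ok 0 && decide (d < 24) && decide (j < 4)
  | .cast e, d => e.ok 0 && decide (d < 24)
  | .add r s, d | .sub r s, d | .mul r s, d | .div r s, d => r.ok d && s.ok (d + 1)

def RExp.cost : RExp → ℕ
  | .var _ => 5
  | .arr _ e => e.cost + 10
  | .cast e => e.cost + 2
  | .add r s | .sub r s | .mul r s | .div r s => r.cost + s.cost + 3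

/-- Machine code copying array `j` to the contiguous cells from `80` on. -/
def copyCode (j : ℕ) : Cmd :=
  .instr (.constN 62 0);; .instr (.ltN 63 62 0);; .loop 63
    (.instr (.constN 66 (80 + j));; .instr (.addN 64 62 62);; .instr (.addN 64 64 64);;
      .instr (.addN 64 64 64);; .instr (.addN 64 64 64);; .instr (.addN 64 64 0);;
      .instr (.addN 64 64 66);; .instr (.loadN 64 64);; .instr (.constN 66 80);;
      .instr (.addN 65 66 62);; .instr (.storeN 65 64);; .instr (.constN 66 1);;
      .instr (.addN 62 62 66);; .instr (.ltN 63 62 0))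

/-- The loop flag lives in the scratch cell `62`, which the body may overwrite; it is therefore
recomputed at the end of every round. -/
def Code.compile : Code → Cmd
  | .skip => .instr (.constN 62 0)
  | .setN v e => e.code 0;; .instr (.constN 63 0);; .instr (.addN (2 + v) 62 63)
  | .setA j e f => e.code 0;; f.code 1;; .instr (.constN 64 (80 + j));;
      .instr (.addN 62 62 62);; .instr (.addN 62 62 62);; .instr (.addN 62 62 62);;
      .instr (.addN 62 62 62);; .instr (.addN 62 62 0);; .instr (.addN 62 62 64);;
      .instr (.storeN 62 63)
  | .setX x r => r.code 0;; .instr (.constN 62 0);; .instr (.castR 41 62);;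
      .instr (.addR x 40 41)
  | .setY j e r => r.code 0;; e.code 0;; .instr (.constN 63 (64 + j));;
      .instr (.addN 62 62 62);; .instr (.addN 62 62 62);; .instr (.addN 62 62 63);;
      .instr (.storeR 62 40)
  | .ltR v r s => r.code 0;; s.code 1;; .instr (.ltR (2 + v) 40 41)
  | .flip v r => r.code 0;; .instr (.flip (2 + v) 40)
  | .value x j => copyCode j;; .instr (.constN 62 80);; .instr (.value x 62)
  | .indep v j => copyCode j;; .instr (.constN 62 80);; .instr (.indep (2 + v) 62)
  | .seq c d => c.compile;; d.compile
  | .cond e c d => e.code 0;; .ite 62 c.compile d.compile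
  | .forLoop v w c => .instr (.constN (2 + v) 0);; .instr (.ltN 62 (2 + v) (2 + w));;
      .loop 62 (c.compile;; .instr (.constN 62 1);; .instr (.addN (2 + v) (2 + v) 62);;
        .instr (.ltN 62 (2 + v) (2 + w)))

/-- Variables and arrays exist, and loop counters and bounds are not written to by loop bodies. -/
def Code.ok : Code → Bool
  | .skip => true
  | .setN v e => e.ok 0 && decide (v < 60)
  | .setA j e f => e.ok 0 && f.ok 1 && decide (j < 16)
  | .setX x r => r.ok 0 && decide (x < 40)
  | .setY j e r => r.ok 0 && e.ok 0 && decide (j < 4)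
  | .ltR v r s => r.ok 0 && s.ok 1 && decide (v < 60)
  | .flip v r => r.ok 0 && decide (v < 60)
  | .value x j => decide (x < 40) && decide (j < 16)
  | .indep v j => decide (v < 60) && decide (j < 16)
  | .seq c d => c.ok && d.ok
  | .cond e c d => e.ok 0 && c.ok && d.ok
  | .forLoop v w c => decide (v < 60) && decide (w < 60) && v != w && c.keepsN v && c.keepsN w
      && c.ok

/-- The loop bounds of the code are among the variables `P`. -/
def Code.boundsIn (P : List ℕ) : Code → Bool
  | .seq c d | .cond _ c d => c.boundsIn P && d.boundsIn P
  | .forLoop _ w c => decide (w ∈ P) && c.boundsIn P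
  | _ => true

/-- A bound for the running time if no loop bound and no array length exceeds `B`. -/
def Code.cost (B : ℕ) : Code → ℕ
  | .skip => 1
  | .setN _ e => e.cost + 4
  | .setA _ e f => e.cost + f.cost + 17
  | .setX _ r => r.cost + 6
  | .setY _ e r => r.cost + e.cost + 11
  | .ltR _ r s => r.cost + s.cost + 3
  | .flip _ r => r.cost + 2
  | .value _ _ | .indep _ _ => 28 * B + 10
  | .seq c d => c.cost B + d.cost B + 1
  | .cond e c d => e.cost + c.cost B + d.cost B + 2
  | .forLoop _ _ c => B * (c.cost B + 7) + 5

/-- Each loop multiplies the cost by at most `B` up to constants and so raises the degree by one.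
Degrees of parts in sequence are added instead of maximised, which is wasteful but keeps the
induction uniform. -/
theorem Code.cost_le_poly (c : Code) : ∃ K d, ∀ B, c.cost B ≤ K * (B + 1) ^ d := by
  have aux : ∀ {K K' d d' : ℕ} (B : ℕ), K * (B + 1) ^ d + K' * (B + 1) ^ d' ≤
      (K + K') * (B + 1) ^ (d + d') := by
    intro K K' d d' B
    have h1 : (B + 1) ^ d ≤ (B + 1) ^ (d + d') := Nat.pow_le_pow_right (by omega) (by omega)
    have h2 : (B + 1) ^ d' ≤ (B + 1) ^ (d + d') := Nat.pow_le_pow_right (by omega) (by omega)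
    nlinarith [Nat.mul_le_mul_left K h1, Nat.mul_le_mul_left K' h2]
  have one : ∀ (d B : ℕ), 1 ≤ (B + 1) ^ d := fun d B => Nat.one_le_pow _ _ (by omega)
  induction c with
  | seq c d hc hd =>
    obtain ⟨K, d, h⟩ := hc
    obtain ⟨K', d', h'⟩ := hd
    refine ⟨K + K' + 1, d + d', fun B => ?_⟩
    have := aux (K := K) (K' := K') (d := d) (d' := d') B
    have := h B; have := h' B; have := one (d + d') B
    simp only [Code.cost]; nlinarith
  | cond e c d hc hd =>
    obtain ⟨K, d, h⟩ := hc
    obtain ⟨K', d', h'⟩ := hd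
    refine ⟨K + K' + e.cost + 2, d + d', fun B => ?_⟩
    have := aux (K := K) (K' := K') (d := d) (d' := d') B
    have := h B; have := h' B; have := one (d + d') B
    simp only [Code.cost]; nlinarith
  | forLoop v w c hc =>
    obtain ⟨K, d, h⟩ := hc
    refine ⟨K + 12, d + 1, fun B => ?_⟩
    have := h B; have h1 := one d B
    simp only [Code.cost]
    calc B * (c.cost B + 7) + 5 ≤ (B + 1) * (K * (B + 1) ^ d + 12) := by nlinarith
      _ ≤ (B + 1) * (K * (B + 1) ^ d + 12 * (B + 1) ^ d) := by gcongr; omega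
      _ = (K + 12) * (B + 1) ^ (d + 1) := by ring
  | value x j => exact ⟨28, 1, fun B => by simp only [Code.cost, pow_one]; omega⟩
  | indep x j => exact ⟨28, 1, fun B => by simp only [Code.cost, pow_one]; omega⟩
  | skip => exact ⟨1, 0, fun B => by simp [Code.cost]⟩
  | setN v e => exact ⟨e.cost + 4, 0, fun B => by simp [Code.cost]⟩
  | setA j e f => exact ⟨e.cost + f.cost + 17, 0, fun B => by simp [Code.cost]⟩
  | setX x r => exact ⟨r.cost + 6, 0, fun B => by simp [Code.cost]⟩
  | setY j e r => exact ⟨r.cost + e.cost + 11, 0, fun B => by simp [Code.cost]⟩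
  | ltR v r s => exact ⟨r.cost + s.cost + 3, 0, fun B => by simp [Code.cost]⟩
  | flip v r => exact ⟨r.cost + 2, 0, fun B => by simp [Code.cost]⟩

/-! #### Correctness of the compilation -/

/-- The machine state `σ` represents the memory `a`. -/
structure Rep (n : ℕ) (a : Mem) (σ : State) : Prop where
  size : σ.nat 0 = n
  N : ∀ v < 60, σ.nat (2 + v) = a.N v
  A : ∀ j < 16, ∀ i, σ.nat (80 + n + 16 * i + j) = a.A j i
  X : ∀ x < 40, σ.real x = a.X x
  Y : ∀ j < 4, ∀ i, σ.real (64 + 4 * i + j) = a.Y j i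

@[simp] theorem State.setNat_nat (σ : State) (c k b : ℕ) :
    (σ.setNat c k).nat b = if b = c then k else σ.nat b := by
  simp [State.setNat, Function.update_apply]
@[simp] theorem State.setNat_real (σ : State) (c k : ℕ) : (σ.setNat c k).real = σ.real := rfl
@[simp] theorem State.setReal_real (σ : State) (c : ℕ) (r : ℝ) (b : ℕ) :
    (σ.setReal c r).real b = if b = c then r else σ.real b := by
  simp [State.setReal, Function.update_apply]
@[simp] theorem State.setReal_nat (σ : State) (c : ℕ) (r : ℝ) : (σ.setReal c r).nat = σ.nat := rfl

namespace Rep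
variable {n : ℕ} {a : Mem} {σ : State}

theorem scratch (h : Rep n a σ) {c : ℕ} (k : ℕ) (h1 : 62 ≤ c) (h2 : c < 80 + n) :
    Rep n a (σ.setNat c k) := by
  constructor
  · simp [show ¬ (0 = c) by omega, h.size]
  · intro v hv; simp [show ¬ (2 + v = c) by omega, h.N v hv]
  · intro j hj i
    simp only [State.setNat_nat, show ¬ (80 + n + 16 * i + j = c) by omega, if_false]
    exact h.A j hj i
  · exact h.X
  · exact h.Y

theorem scratchReal (h : Rep n a σ) {c : ℕ} (r : ℝ) (h1 : 40 ≤ c) (h2 : c < 64) :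
    Rep n a (σ.setReal c r) := by
  refine ⟨h.size, h.N, h.A, fun x hx => ?_, fun j hj i => ?_⟩
  · simp [show ¬ (x = c) by omega, h.X x hx]
  · simp [show ¬ (64 + 4 * i + j = c) by omega, h.Y j hj i]

theorem setN (h : Rep n a σ) {v : ℕ} (hv : v < 60) (k : ℕ) :
    Rep n (a.setN v k) (σ.setNat (2 + v) k) := by
  refine ⟨?_, fun w hw => ?_, fun j hj i => ?_, h.X, h.Y⟩
  · simp [show ¬ (0 = 2 + v) by omega, h.size]
  · by_cases hwv : w = v
    · simp [hwv]
    · simp [hwv, h.N w hw]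
  · simp only [State.setNat_nat, show ¬ (80 + n + 16 * i + j = 2 + v) by omega, if_false]
    exact h.A j hj i

theorem setA (h : Rep n a σ) {j : ℕ} (hj : j < 16) (i k : ℕ) :
    Rep n (a.setA j i k) (σ.setNat (80 + n + 16 * i + j) k) := by
  refine ⟨?_, fun w hw => ?_, fun j' hj' i' => ?_, h.X, h.Y⟩
  · simp [show ¬ (0 = 80 + n + 16 * i + j) by omega, h.size]
  · simp [show ¬ (2 + w = 80 + n + 16 * i + j) by omega, h.N w hw]
  · by_cases hc : j' = j ∧ i' = i
    · simp [hc.1, hc.2]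
    -- An address determines both the index and the array, since array numbers are below the stride.
    · have : ¬ (80 + n + 16 * i' + j' = 80 + n + 16 * i + j) := by omega
      simp only [State.setNat_nat, this, if_false, Mem.setA_A, hc]
      exact h.A j' hj' i'

theorem setX (h : Rep n a σ) {x : ℕ} (hx : x < 40) (r : ℝ) :
    Rep n (a.setX x r) (σ.setReal x r) := by
  refine ⟨h.size, h.N, h.A, fun y hy => ?_, fun j hj i => ?_⟩
  · by_cases hyx : y = x
    · simp [hyx]
    · simp [hyx, h.X y hy]
  · simp [show ¬ (64 + 4 * i + j = x) by omega, h.Y j hj i]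

theorem setY (h : Rep n a σ) {j : ℕ} (hj : j < 4) (i : ℕ) (r : ℝ) :
    Rep n (a.setY j i r) (σ.setReal (64 + 4 * i + j) r) := by
  refine ⟨h.size, h.N, h.A, fun y hy => ?_, fun j' hj' i' => ?_⟩
  · simp [show ¬ (y = 64 + 4 * i + j) by omega, h.X y hy]
  · by_cases hc : j' = j ∧ i' = i
    · simp [hc.1, hc.2]
    · have : ¬ (64 + 4 * i' + j' = 64 + 4 * i + j) := by omega
      simp only [State.setReal_real, this, if_false, Mem.setY_Y, hc]
      exact h.Y j' hj' i'

end Rep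

section
variable {n : ℕ} {M : Matroid (Fin n)} {val : Finset (Fin n) → ℝ}

theorem Triple.instr_seq {X : Type} {i : Instr} {d : Cmd} {σ τ : State} {T : ℕ} {μ : PMF X}
    {R : X → State → Prop} (h : exec M val σ i = PMF.pure τ) (hd : Triple M val d τ T μ R) :
    Triple M val (.instr i;; d) σ (T + 2) μ R := by
  have := Reaches.then (Reaches.instr (Q := fun τ' => τ' = τ) h rfl) (fun τ' h' => h' ▸ hd)
  exact this.mono_time (by omega)

theorem Triple.instr_last {X : Type} {i : Instr} {σ τ : State} {x : X}
    {R : X → State → Prop} (h : exec M val σ i = PMF.pure τ) (hR : R x τ) :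
    Triple M val (.instr i) σ 1 (PMF.pure x) R :=
  (Reaches.instr h hR).toTriple

/-- The induction also carries the preservation of the lower stack cells, so that a left operand
survives the evaluation of the right one, and of all real cells, so that an index can be computed
while real temporaries are live. -/
theorem NExp.code_correct (e : NExp) : ∀ (d : ℕ) {a : Mem} {σ : State}, e.ok d = true →
    Rep n a σ → Reaches M val (e.code d) σ e.cost fun τ => Rep n a τ ∧
      (∀ d' < d, τ.nat (62 + d') = σ.nat (62 + d')) ∧ τ.nat (62 + d) = e.eval n a ∧
      τ.real = σ.real := by
  have binary : ∀ (e f : NExp) (i : ℕ → Instr) (op : ℕ → ℕ → ℕ)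
      (hi : ∀ d σ, exec M val σ (i d) =
        PMF.pure (σ.setNat (62 + d) (op (σ.nat (62 + d)) (σ.nat (63 + d)))))
      (ihe : ∀ (d : ℕ) {a : Mem} {σ : State}, e.ok d = true →
        Rep n a σ → Reaches M val (e.code d) σ e.cost fun τ => Rep n a τ ∧
          (∀ d' < d, τ.nat (62 + d') = σ.nat (62 + d')) ∧ τ.nat (62 + d) = e.eval n a ∧
          τ.real = σ.real)
      (ihf : ∀ (d : ℕ) {a : Mem} {σ : State}, f.ok d = true →
        Rep n a σ → Reaches M val (f.code d) σ f.cost fun τ => Rep n a τ ∧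
          (∀ d' < d, τ.nat (62 + d') = σ.nat (62 + d')) ∧ τ.nat (62 + d) = f.eval n a ∧
          τ.real = σ.real) (d : ℕ) (hd : d < 18) {a : Mem} {σ : State}, e.ok d = true →
        f.ok (d + 1) = true → Rep n a σ →
        Reaches M val (e.code d;; f.code (d + 1);; .instr (i d)) σ (e.cost + f.cost + 3)
          fun τ => Rep n a τ ∧ (∀ d' < d, τ.nat (62 + d') = σ.nat (62 + d')) ∧
            τ.nat (62 + d) = op (e.eval n a) (f.eval n a) ∧ τ.real = σ.real := by
    intro e f i op hi ihe ihf d hd a σ h1 h2 hσ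
    refine ((ihe d h1 hσ).seq fun τ hτ => (ihf (d + 1) h2 hτ.1).seq fun τ' hτ' =>
      Reaches.instr (hi d τ') ?_).mono_time (by omega)
    obtain ⟨-, h3, h4, h5⟩ := hτ
    obtain ⟨g2, g3, g4, g5⟩ := hτ'
    refine ⟨g2.scratch _ (by omega) (by omega), fun d' hd' => ?_, ?_, ?_⟩
    · simp [show ¬ d' = d by omega, g3 d' (by omega), h3 d' hd']
    · simp [g3 d (by omega), h4, show 63 + d = 62 + (d + 1) by ring, g4]
    · simp [g5, h5]
  have okdepth : ∀ (e : NExp) d, e.ok d = true → d < 18 := by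
    intro e
    induction e <;> intro d h <;> simp_all [NExp.ok]
  induction e with
  | lit k =>
    intro d a σ h hσ
    have hd := okdepth _ _ h
    refine Reaches.instr rfl ⟨hσ.scratch _ (by omega) (by omega), ?_, ?_, rfl⟩
    · intro d' hd'; simp [show ¬ d' = d by omega]
    · simp [NExp.eval]
  | var v =>
    intro d a σ h hσ
    have hd := okdepth _ _ h
    simp only [NExp.ok, Bool.and_eq_true, decide_eq_true_eq] at h
    refine Triple.instr_seq rfl (Reaches.instr rfl
      ⟨(hσ.scratch _ (by omega) (by omega)).scratch _ (by omega) (by omega), ?_, ?_, rfl⟩)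
    · intro d' hd'; simp [show ¬ d' = d by omega]
    · simp [NExp.eval, show ¬ (2 + v = 62 + d) by omega, hσ.N v h.2]
  | size =>
    intro d a σ h hσ
    have hd := okdepth _ _ h
    refine Triple.instr_seq rfl (Reaches.instr rfl
      ⟨(hσ.scratch _ (by omega) (by omega)).scratch _ (by omega) (by omega), ?_, ?_, rfl⟩)
    · intro d' hd'; simp [show ¬ d' = d by omega]
    · simp [NExp.eval, show ¬ (0 = 62 + d) by omega, hσ.size]
  | arr j e ih =>
    intro d a σ h hσ
    simp only [NExp.ok, Bool.and_eq_true, decide_eq_true_eq] at h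
    obtain ⟨⟨h1, h2⟩, h3⟩ := h
    refine ((ih d h1 hσ).seq (T' := 15) fun τ hτ => ?_)
    obtain ⟨g1, g2, g3, g4⟩ := hτ
    refine Triple.instr_seq rfl (Triple.instr_seq rfl (Triple.instr_seq rfl
      (Triple.instr_seq rfl (Triple.instr_seq rfl (Triple.instr_seq rfl (Triple.instr_seq rfl
      (Reaches.instr rfl ?_)))))))
    refine ⟨?_, ?_, ?_, ?_⟩
    · repeat' (refine Rep.scratch ?_ _ (by omega) (by omega))
      exact g1
    · intro d' hd'
      simp [show ¬ d' = d by omega, show ¬ (62 + d' = 63 + d) by omega, g2 d' hd']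
    · have := g1.A j h3 (e.eval n a)
      simp only [State.setNat_nat, if_true, if_false, show ¬ (0 = 62 + d) by omega,
        show ¬ (63 + d = 62 + d) by omega, show ¬ (0 = 63 + d) by omega,
        show ¬ (62 + d = 63 + d) by omega, g3, g1.size, NExp.eval]
      rw [← this]
      repeat rw [if_neg (by omega)]
      congr 1; ring
    · simp [g4]
  | add e f he hf =>
    intro d a σ h hσ
    have hd := okdepth _ _ h
    simp only [NExp.ok, Bool.and_eq_true] at h
    exact binary e f (fun d => .addN (62 + d) (62 + d) (63 + d)) (· + ·) (fun d σ => rfl) he hf d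
      hd h.1 h.2 hσ
  | sub e f he hf =>
    intro d a σ h hσ
    have hd := okdepth _ _ h
    simp only [NExp.ok, Bool.and_eq_true] at h
    exact binary e f (fun d => .subN (62 + d) (62 + d) (63 + d)) (· - ·) (fun d σ => rfl) he hf d
      hd h.1 h.2 hσ
  | lt e f he hf =>
    intro d a σ h hσ
    have hd := okdepth _ _ h
    simp only [NExp.ok, Bool.and_eq_true] at h
    exact binary e f (fun d => .ltN (62 + d) (62 + d) (63 + d)) (fun x y => if x < y then 1 else 0)
      (fun d σ => rfl) he hf d hd h.1 h.2 hσ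

theorem RExp.code_correct (r : RExp) : ∀ (d : ℕ) {a : Mem} {σ : State}, r.ok d = true →
    Rep n a σ → Reaches M val (r.code d) σ r.cost fun τ => Rep n a τ ∧
      (∀ d' < d, τ.real (40 + d') = σ.real (40 + d')) ∧ τ.real (40 + d) = r.eval n a := by
  have binary : ∀ (e f : RExp) (i : ℕ → Instr) (op : ℝ → ℝ → ℝ)
      (hi : ∀ d σ, exec M val σ (i d) =
        PMF.pure (σ.setReal (40 + d) (op (σ.real (40 + d)) (σ.real (41 + d)))))
      (ihe : ∀ (d : ℕ) {a : Mem} {σ : State}, e.ok d = true →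
        Rep n a σ → Reaches M val (e.code d) σ e.cost fun τ => Rep n a τ ∧
          (∀ d' < d, τ.real (40 + d') = σ.real (40 + d')) ∧ τ.real (40 + d) = e.eval n a)
      (ihf : ∀ (d : ℕ) {a : Mem} {σ : State}, f.ok d = true →
        Rep n a σ → Reaches M val (f.code d) σ f.cost fun τ => Rep n a τ ∧
          (∀ d' < d, τ.real (40 + d') = σ.real (40 + d')) ∧ τ.real (40 + d) = f.eval n a)
      (d : ℕ) (hd : d < 24) {a : Mem} {σ : State}, e.ok d = true →
        f.ok (d + 1) = true → Rep n a σ →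
        Reaches M val (e.code d;; f.code (d + 1);; .instr (i d)) σ (e.cost + f.cost + 3)
          fun τ => Rep n a τ ∧ (∀ d' < d, τ.real (40 + d') = σ.real (40 + d')) ∧
            τ.real (40 + d) = op (e.eval n a) (f.eval n a) := by
    intro e f i op hi ihe ihf d hd a σ h1 h2 hσ
    refine ((ihe d h1 hσ).seq fun τ hτ => (ihf (d + 1) h2 hτ.1).seq fun τ' hτ' =>
      Reaches.instr (hi d τ') ?_).mono_time (by omega)
    obtain ⟨-, h3, h4⟩ := hτ
    obtain ⟨g2, g3, g4⟩ := hτ'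
    refine ⟨g2.scratchReal _ (by omega) (by omega), fun d' hd' => ?_, ?_⟩
    · simp [show ¬ d' = d by omega, g3 d' (by omega), h3 d' hd']
    · simp [g3 d (by omega), h4, show 41 + d = 40 + (d + 1) by ring, g4]
  have okdepth : ∀ (e : RExp) d, e.ok d = true → d < 24 := by
    intro e
    induction e <;> intro d h <;> simp_all [RExp.ok]
  induction r with
  | var x =>
    intro d a σ h hσ
    have hd := okdepth _ _ h
    simp only [RExp.ok, Bool.and_eq_true, decide_eq_true_eq] at h
    refine Triple.instr_seq rfl (Triple.instr_seq rfl (Reaches.instr rfl ⟨?_, ?_, ?_⟩))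
    · exact ((hσ.scratch _ (by omega) (by omega)).scratchReal _ (by omega)
        (by omega)).scratchReal _ (by omega) (by omega)
    · intro d' hd'; simp [show ¬ d' = d by omega]
    · simp [RExp.eval, show ¬ (x = 40 + d) by omega, hσ.X x h.2]
  | arr j e =>
    intro d a σ h hσ
    have hd := okdepth _ _ h
    simp only [RExp.ok, Bool.and_eq_true, decide_eq_true_eq] at h
    obtain ⟨⟨h1, h2⟩, h3⟩ := h
    refine ((e.code_correct 0 h1 hσ).seq (T' := 9) fun τ hτ => ?_)
    obtain ⟨g1, -, g3, g4⟩ := hτ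
    refine Triple.instr_seq rfl (Triple.instr_seq rfl (Triple.instr_seq rfl
      (Triple.instr_seq rfl (Reaches.instr rfl ⟨?_, ?_, ?_⟩))))
    · refine Rep.scratchReal ?_ _ (by omega) (by omega)
      repeat' (refine Rep.scratch ?_ _ (by omega) (by omega))
      exact g1
    · intro d' hd'
      simp [show ¬ d' = d by omega, g4]
    · have := g1.Y j h3 (e.eval n a)
      simp only [add_zero] at g3
      simp only [State.setReal_real, State.setNat_real, State.setNat_nat, if_true, if_false,
        show ¬ (63 = 62) by omega, show ¬ (62 = 63) by omega, g3, RExp.eval]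
      rw [← this]
      congr 1; ring
  | cast e =>
    intro d a σ h hσ
    have hd := okdepth _ _ h
    simp only [RExp.ok, Bool.and_eq_true, decide_eq_true_eq] at h
    refine ((e.code_correct 0 h.1 hσ).seq (T' := 1) fun τ hτ => ?_)
    obtain ⟨g1, -, g3, g4⟩ := hτ
    refine Reaches.instr rfl ⟨g1.scratchReal _ (by omega) (by omega), ?_, ?_⟩
    · intro d' hd'
      simp [show ¬ d' = d by omega, g4]
    · simp only [add_zero] at g3
      simp [RExp.eval, g3]
  | add e f he hf =>
    intro d a σ h hσ
    have hd := okdepth _ _ h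
    simp only [RExp.ok, Bool.and_eq_true] at h
    exact binary e f (fun d => .addR (40 + d) (40 + d) (41 + d)) (· + ·) (fun d σ => rfl) he hf d
      hd h.1 h.2 hσ
  | sub e f he hf =>
    intro d a σ h hσ
    have hd := okdepth _ _ h
    simp only [RExp.ok, Bool.and_eq_true] at h
    exact binary e f (fun d => .subR (40 + d) (40 + d) (41 + d)) (· - ·) (fun d σ => rfl) he hf d
      hd h.1 h.2 hσ
  | mul e f he hf =>
    intro d a σ h hσ
    have hd := okdepth _ _ h
    simp only [RExp.ok, Bool.and_eq_true] at h
    exact binary e f (fun d => .mulR (40 + d) (40 + d) (41 + d)) (· * ·) (fun d σ => rfl) he hf d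
      hd h.1 h.2 hσ
  | div e f he hf =>
    intro d a σ h hσ
    have hd := okdepth _ _ h
    simp only [RExp.ok, Bool.and_eq_true] at h
    exact binary e f (fun d => .divR (40 + d) (40 + d) (41 + d)) (· / ·) (fun d σ => rfl) he hf d
      hd h.1 h.2 hσ

/-- The oracles read a contiguous characteristic vector while arrays are interleaved, hence this
transfer to the buffer. A round takes `27` steps for the body and one for the test. -/
theorem copyCode_correct {j : ℕ} (hj : j < 16) {a : Mem} {σ : State} (hσ : Rep n a σ) :
    Reaches M val (copyCode j) σ (28 * n + 6) fun τ => Rep n a τ ∧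
      ∀ i < n, τ.nat (80 + i) = a.A j i := by
  have key : ∀ (k : ℕ) (σ : State), Rep n a σ → ∀ i, σ.nat 62 = i → i + k = n →
      σ.nat 63 = (if i < n then 1 else 0) → (∀ i' < i, σ.nat (80 + i') = a.A j i') →
      Reaches M val (.loop 63
    (.instr (.constN 66 (80 + j));; .instr (.addN 64 62 62);; .instr (.addN 64 64 64);;
      .instr (.addN 64 64 64);; .instr (.addN 64 64 64);; .instr (.addN 64 64 0);;
      .instr (.addN 64 64 66);; .instr (.loadN 64 64);; .instr (.constN 66 80);;
      .instr (.addN 65 66 62);; .instr (.storeN 65 64);; .instr (.constN 66 1);;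
      .instr (.addN 62 62 66);; .instr (.ltN 63 62 0))) σ (28 * k + 1) fun τ => Rep n a τ ∧
      ∀ i < n, τ.nat (80 + i) = a.A j i := by
    intro k
    induction k with
    | zero =>
      intro σ hσ i h1 h2 h3 h4
      have : i = n := by omega
      subst this
      exact Triple.loop_exit (by simpa using h3) ⟨hσ, h4⟩
    | succ k ih =>
      intro σ hσ i h1 h2 h3 h4
      have hin : i < n := by omega
      refine (Reaches.loop_iter (T := 27) (T' := 28 * k + 1)
        (Q := fun τ => Rep n a τ ∧ τ.nat 62 = i + 1 ∧
          τ.nat 63 = (if i + 1 < n then 1 else 0) ∧ ∀ i' < i + 1, τ.nat (80 + i') = a.A j i')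
        (by simp [h3, hin]) ?_ fun τ hτ =>
          ih τ hτ.1 (i + 1) hτ.2.1 (by omega) hτ.2.2.1 hτ.2.2.2).mono_time (by omega)
      refine Triple.instr_seq rfl (Triple.instr_seq rfl (Triple.instr_seq rfl
        (Triple.instr_seq rfl (Triple.instr_seq rfl (Triple.instr_seq rfl (Triple.instr_seq rfl
        (Triple.instr_seq rfl (Triple.instr_seq rfl (Triple.instr_seq rfl (Triple.instr_seq rfl
        (Triple.instr_seq rfl (Triple.instr_seq rfl (Reaches.instr rfl ?_)))))))))))))
      have hA := hσ.A j hj i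
      refine ⟨?_, ?_, ?_, ?_⟩
      · refine Rep.scratch (Rep.scratch (Rep.scratch (Rep.scratch (c := _) ?_ _ ?_ ?_) _
          (by omega) (by omega)) _ (by omega) (by omega)) _ (by omega) (by omega)
        · repeat' (refine Rep.scratch ?_ _ (by omega) (by omega))
          exact hσ
        · simp [h1]; omega
        · simp [h1]; omega
      · simp [h1]
        omega
      · simp [h1, hσ.size]
        simp [show ¬ (62 = 80 + i) by omega,
          show ¬ (0 = 80 + i) by omega]
      · intro i' hi'
        have e1 : i + i + (i + i) + (i + i + (i + i)) +
          (i + i + (i + i) + (i + i + (i + i))) + n + (80 + j) = 80 + n + 16 * i + j := by ring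
        simp [h1, hσ.size]
        rw [if_neg (by omega), if_neg (by omega), if_neg (by omega)]
        by_cases hii : i' = i
        · subst hii
          simp only [if_true]
          rw [e1, hA]
          repeat rw [if_neg (by omega)]
        · rw [if_neg hii]
          repeat rw [if_neg (by omega)]
          exact h4 i' (by omega)
  refine (Triple.instr_seq (T := 28 * n + 1 + 2) rfl (Triple.instr_seq rfl (key n _ ?_ 0 ?_ ?_ ?_
    ?_))).mono_time (by omega)
  · repeat' (refine Rep.scratch ?_ _ (by omega) (by omega))
    exact hσ
  · simp
  · simp
  · simp [hσ.size]
  · simp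

theorem block_eq_set {a : Mem} {τ : State} {j c : ℕ} (hc : τ.nat c = 80)
    (h : ∀ i < n, τ.nat (80 + i) = a.A j i) : τ.block n c = a.set n j := by
  ext i
  simp [State.block, Mem.set, hc, h i i.2]

/-- Structural induction. The variables in `P`, which contain all loop bounds, are never written, so
they stay below `B` throughout; this is what makes `cost B` a valid bound inside nested loops. -/
theorem Code.compile_correct (c : Code) {P : List ℕ} {B : ℕ} (hB : n ≤ B) : c.ok = true →
    c.boundsIn P = true → (∀ w ∈ P, c.keepsN w = true) → ∀ {a : Mem} {σ : State},
    (∀ w ∈ P, a.N w ≤ B) → Rep n a σ →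
    Triple M val c.compile σ (c.cost B) (c.den M val a) (Rep n) := by
  induction c with
  | skip =>
    intro _ _ _ a σ _ hσ
    exact Triple.instr_last rfl (hσ.scratch _ (by omega) (by omega))
  | setN v e =>
    intro hok _ _ a σ _ hσ
    simp only [Code.ok, Bool.and_eq_true, decide_eq_true_eq] at hok
    refine Reaches.then (T' := 3) (e.code_correct 0 hok.1 hσ) fun τ hτ => ?_
    obtain ⟨h1, -, h2, -⟩ := hτ
    refine Triple.instr_seq rfl (Triple.instr_last rfl ?_)
    have := (h1.scratch 0 (c := 63) (by omega) (by omega)).setN hok.2 (e.eval n a)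
    simpa [h2, show (62 : ℕ) + 0 = 62 from rfl] using this
  | setA j e f =>
    intro hok _ _ a σ _ hσ
    simp only [Code.ok, Bool.and_eq_true, decide_eq_true_eq] at hok
    obtain ⟨⟨hok1, hok2⟩, hok3⟩ := hok
    refine (Reaches.then (T' := f.cost + 16) (e.code_correct 0 hok1 hσ) fun τ hτ => ?_).mono_time
      (by simp only [Code.cost]; omega)
    obtain ⟨h1, -, h2, -⟩ := hτ
    refine (Reaches.then (T' := 15) (f.code_correct 1 hok2 h1) fun τ' hτ' => ?_)
    obtain ⟨g1, g2, g3, -⟩ := hτ'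
    have g4 : τ'.nat 62 = e.eval n a := by simpa [← h2] using g2 0 (by omega)
    refine Triple.instr_seq rfl (Triple.instr_seq rfl (Triple.instr_seq rfl
      (Triple.instr_seq rfl (Triple.instr_seq rfl (Triple.instr_seq rfl (Triple.instr_seq rfl
      (Triple.instr_last rfl ?_)))))))
    have e1 : ∀ x : ℕ, x + x + (x + x) + (x + x + (x + x)) + (x + x + (x + x) + (x + x + (x + x)))
        + n + (80 + j) = 80 + n + 16 * x + j := by intro x; ring
    simp [g1.size, g3, g4, e1]
    refine Rep.setA ?_ hok3 _ _
    repeat' (refine Rep.scratch ?_ _ (by omega) (by omega))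
    exact g1
  | setX x r =>
    intro hok _ _ a σ _ hσ
    simp only [Code.ok, Bool.and_eq_true, decide_eq_true_eq] at hok
    refine Reaches.then (T' := 5) (r.code_correct 0 hok.1 hσ) fun τ hτ => ?_
    obtain ⟨h1, -, h2⟩ := hτ
    refine Triple.instr_seq rfl (Triple.instr_seq rfl (Triple.instr_last rfl ?_))
    have := ((h1.scratch 0 (c := 62) (by omega) (by omega)).scratchReal 0 (c := 41) (by omega)
      (by omega)).setX hok.2 (r.eval n a)
    simpa [h2, show (40 : ℕ) + 0 = 40 from rfl] using this
  | setY j e r =>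
    intro hok _ _ a σ _ hσ
    simp only [Code.ok, Bool.and_eq_true, decide_eq_true_eq] at hok
    obtain ⟨⟨hok1, hok2⟩, hok3⟩ := hok
    refine (Reaches.then (T' := e.cost + 10) (r.code_correct 0 hok1 hσ) fun τ hτ => ?_).mono_time
      (by simp only [Code.cost]; omega)
    obtain ⟨h1, -, h2⟩ := hτ
    refine (Reaches.then (T' := 9) (e.code_correct 0 hok2 h1) fun τ' hτ' => ?_)
    obtain ⟨g1, -, g3, g5⟩ := hτ'
    simp only [add_zero] at g3 h2
    refine Triple.instr_seq rfl (Triple.instr_seq rfl (Triple.instr_seq rfl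
      (Triple.instr_seq rfl (Triple.instr_last rfl ?_))))
    have e1 : ∀ x : ℕ, x + x + (x + x) + (64 + j) = 64 + 4 * x + j := by intro x; ring
    simp [g3, g5, h2, e1]
    refine Rep.setY ?_ hok3 _ _
    repeat' (refine Rep.scratch ?_ _ (by omega) (by omega))
    exact g1
  | ltR v r s =>
    intro hok _ _ a σ _ hσ
    simp only [Code.ok, Bool.and_eq_true, decide_eq_true_eq] at hok
    obtain ⟨⟨hok1, hok2⟩, hok3⟩ := hok
    refine (Reaches.then (T' := s.cost + 2) (r.code_correct 0 hok1 hσ) fun τ hτ => ?_).mono_time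
      (by simp only [Code.cost]; omega)
    obtain ⟨h1, -, h2⟩ := hτ
    refine (Reaches.then (T' := 1) (s.code_correct 1 hok2 h1) fun τ' hτ' => ?_)
    obtain ⟨g1, g2, g3⟩ := hτ'
    have g4 : τ'.real 40 = r.eval n a := by simpa [← h2] using g2 0 (by omega)
    refine Triple.instr_last rfl ?_
    rw [g4, show (41 : ℕ) = 40 + 1 from rfl, g3]
    exact g1.setN hok3 _
  | flip v r =>
    intro hok _ _ a σ _ hσ
    simp only [Code.ok, Bool.and_eq_true, decide_eq_true_eq] at hok
    refine Reaches.then (T' := 1) (r.code_correct 0 hok.1 hσ) fun τ hτ => ?_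
    obtain ⟨h1, -, h2⟩ := hτ
    simp only [add_zero] at h2
    intro K N κ hκ
    rw [Code.den, PMF.bind_map, ← h2]
    refine Triple.flip (R := fun b τ' => Rep n (a.setN v (if b then 1 else 0)) τ')
      (fun b => h1.setN hok.2 _) K N _ fun b hb τ' hτ' => hκ _ ?_ τ' hτ'
    simp only [Code.den, PMF.support_map, ← h2]
    exact ⟨b, hb, rfl⟩
  | value x j =>
    intro hok _ _ a σ _ hσ
    simp only [Code.ok, Bool.and_eq_true, decide_eq_true_eq] at hok
    refine (Reaches.then (T' := 3) (copyCode_correct hok.2 hσ) fun τ hτ => ?_).mono_time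
      (by simp only [Code.cost]; omega)
    refine Triple.instr_seq rfl (Triple.instr_last rfl ?_)
    rw [block_eq_set (a := a) (j := j) (by simp) (fun i hi => by
      simp [show ¬ (80 + i = 62) by omega, hτ.2 i hi])]
    exact (hτ.1.scratch _ (by omega) (by omega)).setX hok.1 _
  | indep v j =>
    intro hok _ _ a σ _ hσ
    simp only [Code.ok, Bool.and_eq_true, decide_eq_true_eq] at hok
    refine (Reaches.then (T' := 3) (copyCode_correct hok.2 hσ) fun τ hτ => ?_).mono_time
      (by simp only [Code.cost]; omega)
    refine Triple.instr_seq rfl (Triple.instr_last rfl ?_)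
    rw [block_eq_set (a := a) (j := j) (by simp) (fun i hi => by
      simp [show ¬ (80 + i = 62) by omega, hτ.2 i hi])]
    exact (hτ.1.scratch _ (by omega) (by omega)).setN hok.1 _
  | seq c d hc hd =>
    intro hok hb hP a σ ha hσ
    simp only [Code.ok, Code.boundsIn, Code.keepsN, Bool.and_eq_true] at hok hb hP
    refine Triple.seq (hc hok.1 hb.1 (fun w hw => (hP w hw).1) ha hσ) fun a' ha' τ hτ =>
      hd hok.2 hb.2 (fun w hw => (hP w hw).2) (fun w hw => ?_) hτ
    rw [(c.frame a a' ha').N w (hP w hw).1]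
    exact ha w hw
  | cond e c d hc hd =>
    intro hok hb hP a σ ha hσ
    simp only [Code.ok, Code.boundsIn, Code.keepsN, Bool.and_eq_true] at hok hb hP
    obtain ⟨⟨hok1, hok2⟩, hok3⟩ := hok
    refine (Reaches.then (T' := c.cost B + d.cost B + 1) (e.code_correct 0 hok1 hσ)
      fun τ hτ => ?_).mono_time (by simp only [Code.cost]; omega)
    obtain ⟨h1, -, h2, -⟩ := hτ
    simp only [add_zero] at h2
    refine Triple.ite (fun h => ?_) (fun h => ?_)
    · rw [Code.den, if_pos (by rwa [← h2])]
      exact (hc hok2 hb.1 (fun w hw => (hP w hw).1) ha h1).mono_time (by omega)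
    · rw [Code.den, if_neg (by rw [← h2]; simpa using h)]
      exact (hd hok3 hb.2 (fun w hw => (hP w hw).2) ha h1).mono_time (by omega)
  | forLoop v w c hc =>
    intro hok hb hP a σ ha hσ
    simp only [Code.ok, Code.boundsIn, Code.keepsN, Bool.and_eq_true, decide_eq_true_eq,
      bne_iff_ne] at hok hb hP
    obtain ⟨⟨⟨⟨⟨hv, hw⟩, hvw⟩, kv⟩, kw⟩, hok⟩ := hok
    -- Induction on the number `k` of rounds left, with cell `62` holding the outcome of the
    -- comparison of counter and bound.
    have key : ∀ (k : ℕ) (a : Mem) (σ : State), Rep n a σ → a.N v + k = a.N w →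
        σ.nat 62 = (if a.N v < a.N w then 1 else 0) → (∀ w ∈ P, a.N w ≤ B) →
        Triple M val (.loop 62 (c.compile;; .instr (.constN 62 1);;
          .instr (.addN (2 + v) (2 + v) 62);; .instr (.ltN 62 (2 + v) (2 + w)))) σ
          (k * (c.cost B + 7) + 1) (countLoop (c.den M val) v k a) (Rep n) := by
      intro k
      induction k with
      | zero =>
        intro a σ hσ h1 h2 ha
        exact (Triple.loop_exit (by simpa [← h1] using h2) hσ).mono_time (by omega)
      | succ k ih =>
        intro a σ hσ h1 h2 ha
        rw [countLoop]
        refine (Triple.loop_iter (T := c.cost B + 6) (T' := k * (c.cost B + 7) + 1)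
          (μ := c.den M val a)
          (R := fun a' τ => Rep n (a'.setN v (a'.N v + 1)) τ ∧
            τ.nat 62 = (if a.N v + 1 < a.N w then 1 else 0))
          (by simp [h2]; omega) ?_ ?_).mono_time (by ring_nf; omega)
        · have h3 := hc hok hb.2 (fun w hw => (hP w hw).2) ha hσ
          rw [← PMF.bind_pure (c.den M val a)]
          refine Triple.seq (T' := 5) h3 fun a' ha' τ hτ => ?_
          have hfr := c.frame a a' ha'
          refine Triple.instr_seq rfl (Triple.instr_seq rfl (Triple.instr_last rfl ?_))
          have e1 := hτ.N v hv
          have e2 := hτ.N w hw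
          have e3 := hfr.N v kv
          have e4 := hfr.N w kw
          refine ⟨Rep.scratch ?_ _ (by omega) (by omega), ?_⟩
          · have := (hτ.scratch 1 (c := 62) (by omega) (by omega)).setN hv (a'.N v + 1)
            simpa [show ¬ (2 + v = 62) by omega, e1] using this
          · simp [show ¬ (2 + v = 62) by omega, show ¬ (2 + w = 62) by omega,
              show ¬ (w = v) by omega, e1, e2, e3, e4]
        · intro a' ha' τ hτ
          have hfr := c.frame a a' ha'
          have e3 := hfr.N v kv
          have e4 := hfr.N w kw
          refine ih _ τ hτ.1 ?_ ?_ ?_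
          · simp [show ¬ (w = v) by omega, e3, e4]; omega
          · simp [show ¬ (w = v) by omega, e3, e4, hτ.2]
          · intro u hu
            simp [(hP u hu).1, hfr.N u (hP u hu).2, ha u hu]
    rw [Code.den]
    have hwB := ha w hb.1
    refine (Triple.instr_seq (T := a.N w * (c.cost B + 7) + 1 + 2) rfl (Triple.instr_seq rfl
      (key (a.N w) (a.setN v 0) _ ?_ ?_ ?_ ?_))).mono_time ?_
    · exact (hσ.setN hv 0).scratch _ (by omega) (by omega)
    · simp [show ¬ (w = v) by omega]
    · simp [show ¬ (w = v) by omega, hσ.N w hw]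
    · intro u hu
      simp [(hP u hu).1, ha u hu]
    · simp only [Code.cost]
      have := Nat.mul_le_mul_right (c.cost B + 7) hwB
      omega

end


/-! ### Simulation of random values by random memories -/

/-- The random memory (or value) `μ` simulates the random value `ν`: they can be coupled so that `R`
holds. Stated by continuations. -/
def Sim {A X : Type} (μ : PMF A) (ν : PMF X) (R : X → A → Prop) : Prop :=
  ∀ (Z : Type) (κ : A → PMF Z) (κ' : X → PMF Z),
    (∀ x ∈ ν.support, ∀ a ∈ μ.support, R x a → κ a = κ' x) → μ.bind κ = ν.bind κ'

/-- Every possible outcome of `μ` satisfies `Q`. -/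
def Always {A : Type} (μ : PMF A) (Q : A → Prop) : Prop := ∀ a ∈ μ.support, Q a

namespace Sim
variable {A B X Y : Type} {μ : PMF A} {ν : PMF X} {R : X → A → Prop}

theorem of_always {x : X} (h : Always μ (R x)) : Sim μ (PMF.pure x) R := by
  intro Z κ κ' hκ
  rw [PMF.pure_bind, bind_congr_support μ (g := fun _ => κ' x), PMF.bind_const]
  exact fun a ha => hκ x (by simp) a ha (h a ha)

theorem pure {x : X} {a : A} (h : R x a) : Sim (PMF.pure a) (PMF.pure x) R :=
  of_always (by simpa [Always] using h)

theorem bind {μ' : A → PMF B} {ν' : X → PMF Y} {R' : Y → B → Prop} (h : Sim μ ν R)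
    (h' : ∀ x ∈ ν.support, ∀ a ∈ μ.support, R x a → Sim (μ' a) (ν' x) R') :
    Sim (μ.bind μ') (ν.bind ν') R' := by
  intro Z κ κ' hκ
  rw [PMF.bind_bind, PMF.bind_bind]
  refine h Z _ _ fun x hx a ha hR => h' x hx a ha hR Z κ κ' fun y hy b hb hR' => ?_
  refine hκ y ?_ b ?_ hR' <;> rw [PMF.mem_support_bind_iff]
  exacts [⟨x, hx, hy⟩, ⟨a, ha, hb⟩]

theorem bind_left {μ' : A → PMF B} {ν : PMF Y} {Q : A → Prop} {R' : Y → B → Prop}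
    (h : Always μ Q) (h' : ∀ a ∈ μ.support, Q a → Sim (μ' a) ν R') : Sim (μ.bind μ') ν R' := by
  have := bind (ν := PMF.pure ()) (R := fun _ => Q) (ν' := fun _ => ν) (of_always h)
    (fun _ _ a ha hQ => h' a ha hQ)
  simpa using this

theorem weaken {R' : X → A → Prop} (h : Sim μ ν R)
    (hR : ∀ x ∈ ν.support, ∀ a ∈ μ.support, R x a → R' x a) : Sim μ ν R' :=
  fun Z κ κ' hκ => h Z κ κ' fun x hx a ha hRx => hκ x hx a ha (hR x hx a ha hRx)

theorem map_right (f : X → Y) {R' : Y → A → Prop} (h : Sim μ ν R)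
    (hR : ∀ x ∈ ν.support, ∀ a ∈ μ.support, R x a → R' (f x) a) : Sim μ (ν.map f) R' := by
  intro Z κ κ' hκ
  rw [PMF.bind_map]
  refine h Z κ _ fun x hx a ha hRx => hκ (f x) ?_ a ha (hR x hx a ha hRx)
  rw [PMF.support_map]
  exact ⟨x, hx, rfl⟩

theorem refl (μ : PMF A) : Sim μ μ (fun x a => a = x) := by
  intro Z κ κ' hκ
  exact bind_congr_support _ fun a ha => hκ a ha a ha rfl

theorem map_eq {Z : Type} (h : Sim μ ν R) (f : A → Z) (g : X → Z)
    (hR : ∀ x ∈ ν.support, ∀ a ∈ μ.support, R x a → f a = g x) : μ.map f = ν.map g :=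
  h Z _ _ fun x hx a ha hRx => by simp [hR x hx a ha hRx]

end Sim

/-- Fold a random transformation over a list. -/
def foldP {β X : Type} (f : β → X → PMF X) : List β → X → PMF X
  | [], x => PMF.pure x
  | b :: L, x => (f b x).bind (foldP f L)

section
variable {n : ℕ} {M : Matroid (Fin n)} {val : Finset (Fin n) → ℝ}

infixr:60 "⨾" => Code.seq

theorem Sim.seq {X Y : Type} {c d : Code} {a : Mem} {ν : PMF X} {R : X → Mem → Prop}
    {ν' : X → PMF Y} {R' : Y → Mem → Prop} (h : Sim (c.den M val a) ν R)
    (h' : ∀ x ∈ ν.support, ∀ a', Frame c a a' → R x a' → Sim (d.den M val a') (ν' x) R') :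
    Sim ((c⨾ d).den M val a) (ν.bind ν') R' :=
  h.bind fun x hx a' ha' hR => h' x hx a' (c.frame a a' ha') hR

theorem Sim.seq_always {Y : Type} {c d : Code} {a : Mem} {Q : Mem → Prop}
    {ν : PMF Y} {R' : Y → Mem → Prop} (h : Always (c.den M val a) Q)
    (h' : ∀ a', Frame c a a' → Q a' → Sim (d.den M val a') ν R') :
    Sim ((c⨾ d).den M val a) ν R' :=
  Sim.bind_left h fun a' ha' hQ => h' a' (c.frame a a' ha') hQ

theorem Always.seq {c d : Code} {a : Mem} {Q Q' : Mem → Prop} (h : Always (c.den M val a) Q)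
    (h' : ∀ a', Frame c a a' → Q a' → Always (d.den M val a') Q') :
    Always ((c⨾ d).den M val a) Q' := by
  intro b hb
  rw [Code.den, PMF.mem_support_bind_iff] at hb
  obtain ⟨a', ha', hb⟩ := hb
  exact h' a' (c.frame a a' ha') (h a' ha') b hb

theorem Always.weaken {A : Type} {μ : PMF A} {Q Q' : A → Prop} (h : Always μ Q)
    (hQ : ∀ a ∈ μ.support, Q a → Q' a) : Always μ Q' := fun a ha => hQ a ha (h a ha)

theorem always_pure {A : Type} {a : A} {Q : A → Prop} : Always (PMF.pure a) Q ↔ Q a := by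
  simp [Always]

theorem Sim.forLoop {β X : Type} {c : Code} {v w : ℕ} {a : Mem} (hv : c.keepsN v = true)
    (L : List β) (hL : L.length = a.N w) (f : β → X → PMF X) (R : ℕ → X → Mem → Prop) {x : X}
    (h0 : R 0 x (a.setN v 0))
    (h : ∀ i (hi : i < L.length), ∀ x a', Frame (.forLoop v w c) a a' → a'.N v = i → R i x a' →
      Sim (c.den M val a') (f L[i] x) fun x' b => R (i + 1) x' (b.setN v (i + 1))) :
    Sim ((Code.forLoop v w c).den M val a) (foldP f L x) (R L.length) := by
  rw [Code.den, ← hL]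
  have key : ∀ (k : ℕ) (i : ℕ) (hi : i + k = L.length) (x : X) (b : Mem),
      Frame (.forLoop v w c) a b → b.N v = i → R i x b →
      Sim (countLoop (c.den M val) v k b) (foldP f (L.drop i) x) (R L.length) := by
    intro k
    induction k with
    | zero =>
      intro i hi x b hb hbv hR
      have : i = L.length := by omega
      subst this
      simp only [List.drop_length, countLoop, foldP]
      exact Sim.pure hR
    | succ k ih =>
      intro i hi x b hb hbv hR
      have hi' : i < L.length := by omega
      rw [List.drop_eq_getElem_cons hi', foldP, countLoop]
      refine Sim.bind (h i hi' x b hb hbv hR) fun x' _ b' hb' hR' => ?_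
      have hfr := c.frame b b' hb'
      have e1 : b'.N v = i := (hfr.N v hv).trans hbv
      rw [e1]
      refine ih (i + 1) (by omega) x' _ ?_ (by simp) hR'
      refine hb.trans ⟨fun u hu => ?_, hfr.A, hfr.X, hfr.Y⟩
      simp only [Code.keepsN, Bool.and_eq_true, bne_iff_ne] at hu
      simp [hu.1, hfr.N u hu.2]
  refine key L.length 0 (by omega) x _ ?_ (by simp) h0
  refine ⟨fun u hu => ?_, fun _ _ => rfl, fun _ _ => rfl, fun _ _ => rfl⟩
  simp only [Code.keepsN, Bool.and_eq_true, bne_iff_ne] at hu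
  simp [hu.1]

/-- The invariant is indexed by the number of completed rounds and is restored after the increment
of the counter, which happens outside the body. -/
theorem Always.forLoop {c : Code} {v w : ℕ} {a : Mem} (hv : c.keepsN v = true)
    (I : ℕ → Mem → Prop) (h0 : I 0 (a.setN v 0))
    (h : ∀ i < a.N w, ∀ a', Frame (.forLoop v w c) a a' → a'.N v = i → I i a' →
      Always (c.den M val a') fun b => I (i + 1) (b.setN v (i + 1))) :
    Always ((Code.forLoop v w c).den M val a) (I (a.N w)) := by
  rw [Code.den]
  have key : ∀ (k : ℕ) (i : ℕ) (hi : i + k = a.N w) (b : Mem),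
      Frame (.forLoop v w c) a b → b.N v = i → I i b →
      Always (countLoop (c.den M val) v k b) (I (a.N w)) := by
    intro k
    induction k with
    | zero =>
      intro i hi b hb hbv hR
      have : i = a.N w := by omega
      subst this
      simpa [countLoop, Always] using hR
    | succ k ih =>
      intro i hi b hb hbv hR
      rw [countLoop]
      intro d hd
      rw [PMF.mem_support_bind_iff] at hd
      obtain ⟨b', hb', hd⟩ := hd
      have hfr := c.frame b b' hb'
      have e1 : b'.N v = i := (hfr.N v hv).trans hbv
      rw [e1] at hd
      refine ih (i + 1) (by omega) _ ?_ (by simp) (h i (by omega) b hb hbv hR b' hb') d hd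
      refine hb.trans ⟨fun u hu => ?_, hfr.A, hfr.X, hfr.Y⟩
      simp only [Code.keepsN, Bool.and_eq_true, bne_iff_ne] at hu
      simp [hu.1, hfr.N u hu.2]
  refine key (a.N w) 0 (by omega) _ ?_ (by simp) h0
  refine ⟨fun u hu => ?_, fun _ _ => rfl, fun _ _ => rfl, fun _ _ => rfl⟩
  simp only [Code.keepsN, Bool.and_eq_true, bne_iff_ne] at hu
  simp [hu.1]

end


/-! ### The greedy algorithm for maximum-weight independent sets -/

section Greedy
open Classical
variable {n : ℕ}

def pickStep (w : Fin n → ℝ) (D : Finset (Fin n)) (b : Option (Fin n)) (i : Fin n) :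
    Option (Fin n) :=
  if i ∈ D then b else match b with
    | none => some i
    | some j => if w j < w i then some i else some j

/-- A heaviest element outside `D`. -/
def pick (w : Fin n → ℝ) (D : Finset (Fin n)) : Option (Fin n) :=
  (List.finRange n).foldl (pickStep w D) none

theorem pick_spec (w : Fin n → ℝ) (D : Finset (Fin n)) :
    match pick w D with
    | none => ∀ i, i ∈ D
    | some e => e ∉ D ∧ ∀ i, i ∉ D → w i ≤ w e := by
  have key : ∀ l : List (Fin n), match l.foldl (pickStep w D) none with
      | none => ∀ i ∈ l, i ∈ D
      | some e => e ∉ D ∧ ∀ i ∈ l, i ∉ D → w i ≤ w e := by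
    intro l
    induction l using List.reverseRecOn with
    | nil => simp
    | append_singleton l a ih =>
      rw [List.foldl_append, List.foldl_cons, List.foldl_nil]
      generalize l.foldl (pickStep w D) none = b at ih
      unfold pickStep
      cases b with
      | none =>
        by_cases ha : a ∈ D
        · simp only [ha, if_true]; simp only at ih; grind
        · simp only [ha, if_false]; simp only at ih; grind
      | some j =>
        by_cases ha : a ∈ D
        · simp only [ha, if_true]; simp only at ih; grind
        · by_cases hw : w j < w a
          · simp only [ha, hw, if_true, if_false]; simp only at ih; grind
          · simp only [ha, hw, if_false]; simp only at ih; grind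
  have := key (List.finRange n)
  unfold pick
  generalize (List.finRange n).foldl (pickStep w D) none = b at this
  cases b <;> simpa using this

/-- Treat the element found, if any: `p.1` are the elements seen, `p.2` those taken. -/
def greedyTake (M : Matroid (Fin n)) (H : Finset (Fin n)) (w : Fin n → ℝ)
    (p : Finset (Fin n) × Finset (Fin n)) : Option (Fin n) → Finset (Fin n) × Finset (Fin n)
  | none => p
  | some e => (insert e p.1,
      if e ∉ H ∧ 0 < w e ∧ M.Indep (↑(insert e (p.2 ∪ H)) : Set (Fin n)) then insert e p.2
      else p.2)

/-- One step of the greedy algorithm. -/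
def greedyStep (M : Matroid (Fin n)) (H : Finset (Fin n)) (w : Fin n → ℝ)
    (p : Finset (Fin n) × Finset (Fin n)) : Finset (Fin n) × Finset (Fin n) :=
  greedyTake M H w p (pick w p.1)

def greedySet (M : Matroid (Fin n)) (H : Finset (Fin n)) (w : Fin n → ℝ) : Finset (Fin n) :=
  ((greedyStep M H w)^[n] (∅, ∅)).2

variable {M : Matroid (Fin n)} {H : Finset (Fin n)} {w : Fin n → ℝ}

/-- Invariant of the greedy algorithm. -/
structure GreedyInv (M : Matroid (Fin n)) (H : Finset (Fin n)) (w : Fin n → ℝ)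
    (D I : Finset (Fin n)) : Prop where
  indep : ContractIndep M H I
  sub : I ⊆ D
  opt : ∀ J, J ⊆ D → ContractIndep M H J → ∑ i ∈ J, w i ≤ ∑ i ∈ I, w i
  maximal : ∀ x ∈ D, x ∉ H → 0 < w x → x ∉ I →
    ¬ M.Indep (↑(insert x (I ∪ H)) : Set (Fin n))
  sorted : ∀ x ∈ D, ∀ y, y ∉ D → w y ≤ w x

theorem ContractIndep.subset {I J : Finset (Fin n)} (h : ContractIndep M H J) (hI : I ⊆ J) :
    ContractIndep M H I :=
  ⟨Finset.disjoint_of_subset_left hI h.1,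
    h.2.subset (by exact_mod_cast Finset.union_subset_union_left hI)⟩

/-- Both sets are disjoint from `H`, so adding `H` keeps the strict inequality of cardinalities, and
the matroid augmentation between the enlarged sets must use an element outside `H`. -/
theorem ContractIndep.augment {I J : Finset (Fin n)} (hI : ContractIndep M H I)
    (hJ : ContractIndep M H J) (h : I.card < J.card) :
    ∃ x ∈ J, x ∉ I ∧ x ∉ H ∧ M.Indep (↑(insert x (I ∪ H)) : Set (Fin n)) := by
  have h1 : (I ∪ H).card < (J ∪ H).card := by
    rw [Finset.card_union_of_disjoint hI.1, Finset.card_union_of_disjoint hJ.1]; omega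
  obtain ⟨x, hx, hx'⟩ := hI.2.augment hJ.2 (by
    rw [Set.encard_coe_eq_coe_finsetCard, Set.encard_coe_eq_coe_finsetCard]
    exact_mod_cast h1)
  simp only [Set.mem_sdiff, Finset.mem_coe, Finset.mem_union] at hx
  refine ⟨x, by tauto, by tauto, by tauto, ?_⟩
  simpa using hx'

theorem ContractIndep.insert {I : Finset (Fin n)} {x : Fin n} (hI : ContractIndep M H I)
    (hx : x ∉ H) (h : M.Indep (↑(insert x (I ∪ H)) : Set (Fin n))) :
    ContractIndep M H (insert x I) := by
  refine ⟨by simp [hx, hI.1], ?_⟩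
  rwa [Finset.insert_union]

/-- Let `e` be the new element, no heavier than those already seen. If it is taken, compare a
competitor containing `e` after removing `e` from both sides. If it has positive weight but is
rejected, a competitor `J` containing `e` has at most as many elements as `I`: otherwise augmenting
`I` from `J` would contradict either the rejection of `e` or the maximality of `I`. So `I` augments
`J` without `e` by some `x`, and `x` is at least as heavy as `e`. If its weight is not positive,
dropping `e` from the competitor loses nothing. -/
theorem GreedyInv.step {D I : Finset (Fin n)} (h : GreedyInv M H w D I) :
    GreedyInv M H w (greedyStep M H w (D, I)).1 (greedyStep M H w (D, I)).2 := by
  have hp := pick_spec w D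
  unfold greedyStep
  simp only
  generalize pick w D = b at hp
  cases b with
  | none => exact h
  | some e =>
    obtain ⟨heD, hemax⟩ := hp
    have heI : e ∉ I := fun hh => heD (h.sub hh)
    have sorted : ∀ x ∈ insert e D, ∀ y, y ∉ insert e D → w y ≤ w x := by
      intro x hx y hy
      simp only [Finset.mem_insert, not_or] at hx hy
      rcases hx with rfl | hx
      · exact hemax y hy.2
      · exact h.sorted x hx y hy.2
    simp only [greedyTake]
    split_ifs with hc
    · obtain ⟨heH, hwe, hind⟩ := hc
      refine ⟨h.indep.insert heH hind, Finset.insert_subset_insert _ h.sub, ?_, ?_, sorted⟩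
      · intro J hJ hJi
        rw [Finset.sum_insert heI]
        by_cases heJ : e ∈ J
        · rw [← Finset.add_sum_erase _ _ heJ]
          have := h.opt (J.erase e) (by
            intro y hy
            have h1 := hJ (Finset.mem_of_mem_erase hy)
            have h2 := Finset.ne_of_mem_erase hy
            simpa [h2] using h1) (hJi.subset (Finset.erase_subset _ _))
          linarith
        · have := h.opt J (by
            intro y hy
            have h1 := hJ hy
            have h2 : y ≠ e := fun hh => heJ (hh ▸ hy)
            simpa [h2] using h1) hJi
          linarith
      · intro x hx hxH hwx hxI hxi
        simp only [Finset.mem_insert, not_or] at hx hxI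
        refine h.maximal x (by tauto) hxH hwx hxI.2 (hxi.subset ?_)
        intro y; simp; tauto
    · refine ⟨h.indep, h.sub.trans (Finset.subset_insert _ _), ?_, ?_, sorted⟩
      · intro J hJ hJi
        by_cases heJ : e ∈ J
        · have hsub : J.erase e ⊆ D := by
            intro y hy
            have h1 := hJ (Finset.mem_of_mem_erase hy)
            have h2 := Finset.ne_of_mem_erase hy
            simpa [h2] using h1
          have heH : e ∉ H := Finset.disjoint_left.1 hJi.1 heJ
          have hJe := hJi.subset (Finset.erase_subset e J)
          rw [← Finset.add_sum_erase _ _ heJ]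
          by_cases hwe : 0 < w e
          · have hdep : ¬ M.Indep (↑(insert e (I ∪ H)) : Set (Fin n)) := fun hh =>
              hc ⟨heH, hwe, hh⟩
            have hcard : J.card ≤ I.card := by
              by_contra hlt
              obtain ⟨x, hxJ, hxI, hxH, hxi⟩ := h.indep.augment hJi (by omega)
              have hxD := hJ hxJ
              simp only [Finset.mem_insert] at hxD
              rcases hxD with rfl | hxD
              · exact hdep hxi
              · exact h.maximal x hxD hxH (lt_of_lt_of_le hwe (h.sorted x hxD e heD)) hxI hxi
            obtain ⟨x, hxI, hxJ, hxH, hxi⟩ := hJe.augment h.indep (by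
              rw [Finset.card_erase_of_mem heJ]
              have := Finset.card_pos.2 ⟨e, heJ⟩
              omega)
            have h1 := h.opt (insert x (J.erase e))
              (Finset.insert_subset (h.sub hxI) hsub) (hJe.insert hxH hxi)
            rw [Finset.sum_insert hxJ] at h1
            have := h.sorted x (h.sub hxI) e heD
            linarith
          · have := h.opt _ hsub hJe
            linarith
        · refine h.opt J ?_ hJi
          intro y hy
          have h1 := hJ hy
          have h2 : y ≠ e := fun hh => heJ (hh ▸ hy)
          simpa [h2] using h1
      · intro x hx hxH hwx hxI hxi
        simp only [Finset.mem_insert] at hx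
        rcases hx with rfl | hx
        · exact hc ⟨hxH, hwx, hxi⟩
        · exact h.maximal x hx hxH hwx hxI hxi

/-- Every step sees exactly one new element, so after `n` steps the invariant compares with all
independent sets of the contraction. -/
theorem greedySet_isMaxWeight (hH : M.Indep (↑H : Set (Fin n))) (w : Fin n → ℝ) :
    IsMaxWeight M H w (greedySet M H w) := by
  have key : ∀ k, GreedyInv M H w ((greedyStep M H w)^[k] (∅, ∅)).1
      ((greedyStep M H w)^[k] (∅, ∅)).2 := by
    intro k
    induction k with
    | zero =>
      refine ⟨⟨by simp, by simpa using hH⟩, by simp, ?_, by simp, by simp⟩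
      intro J hJ _
      have : J = ∅ := Finset.subset_empty.1 hJ
      simp [this]
    | succ k ih =>
      rw [Function.iterate_succ_apply']
      exact ih.step
  have hcard : ∀ k ≤ n, ((greedyStep M H w)^[k] (∅, ∅)).1.card = k := by
    intro k
    induction k with
    | zero => simp
    | succ k ih =>
      intro hk
      rw [Function.iterate_succ_apply']
      have ih := ih (by omega)
      generalize (greedyStep M H w)^[k] (∅, ∅) = p at ih
      have hp := pick_spec w p.1
      unfold greedyStep
      generalize pick w p.1 = b at hp
      cases b with
      | none =>
        exfalso
        have : p.1 = Finset.univ := Finset.eq_univ_iff_forall.2 hp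
        rw [this, Finset.card_univ, Fintype.card_fin] at ih
        omega
      | some e => simp [greedyTake, Finset.card_insert_of_notMem hp.1, ih]
  have huniv : ((greedyStep M H w)^[n] (∅, ∅)).1 = Finset.univ := by
    rw [← Finset.card_eq_iff_eq_univ, hcard n le_rfl, Fintype.card_fin]
  have h := key n
  rw [huniv] at h
  exact ⟨h.indep, fun J hJ => h.opt J (Finset.subset_univ _) hJ⟩

/-- With unit weights, weight is cardinality; a base containing the set cannot be larger. -/
theorem isBase_of_isMaxWeight_one {B : Finset (Fin n)}
    (h : IsMaxWeight M ∅ (fun _ => 1) B) : M.IsBase (↑B : Set (Fin n)) := by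
  have hB : M.Indep (↑B : Set (Fin n)) := by simpa using h.1.2
  obtain ⟨B', hB', hsub⟩ := hB.exists_isBase_superset
  have hfin : B'.Finite := Set.toFinite _
  have h1 := h.2 hfin.toFinset ⟨by simp, by simpa using hB'.indep⟩
  simp only [Finset.sum_const, nsmul_eq_mul, mul_one, Nat.cast_le] at h1
  have h2 : B = hfin.toFinset := Finset.eq_of_subset_of_card_le (by
    intro x hx; simpa using hsub hx) h1
  rw [h2]
  simpa using hB'

end Greedy


/-! ### Swap rounding -/

section Rounding
open Classical
variable {n : ℕ}

/-- Exchange between independent sets that need not have the same size. -/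
theorem exists_exchange {M : Matroid (Fin n)} (hE : M.E = Set.univ) {P Q : Finset (Fin n)}
    (hP : M.Indep (↑P : Set (Fin n))) (hQ : M.Indep (↑Q : Set (Fin n))) {i : Fin n} (hiP : i ∈ P)
    (hiQ : i ∉ Q) (hdep : ¬ M.Indep (↑(insert i Q) : Set (Fin n))) :
    ∃ j ∈ Q, j ∉ P ∧ M.Indep (↑(insert j (P.erase i)) : Set (Fin n)) ∧
      M.Indep (↑(insert i (Q.erase j)) : Set (Fin n)) := by
  have hcl : i ∈ M.closure ↑Q := by
    by_contra hcl
    exact hdep (by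
      rw [Finset.coe_insert, hQ.insert_indep_iff]
      exact Or.inl ⟨by simp [hE], hcl⟩)
  have hC := hQ.fundCircuit_isCircuit hcl (by simpa using hiQ)
  -- If no partner exists, every element of the fundamental circuit of `i` in `Q` other than `i`
  -- itself lies in the closure of `P` without `i`. Then so does `i`, against the independence of
  -- `P`.
  by_contra hno
  push Not at hno
  have hPi : M.Indep (↑(P.erase i) : Set (Fin n)) :=
    hP.subset (by exact_mod_cast Finset.erase_subset _ _)
  have hsub : M.fundCircuit i ↑Q \ {i} ⊆ M.closure ↑(P.erase i) := by
    rintro j ⟨hjC, hji⟩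
    simp only [Set.mem_singleton_iff] at hji
    have hjQ : j ∈ Q := by
      have := M.fundCircuit_subset_insert i ↑Q hjC
      simpa [hji] using this
    by_cases hjP : j ∈ P
    · exact M.mem_closure_of_mem (by simp [hji, hjP])
    · have h2 := hno j hjQ hjP
      by_contra hjcl
      refine h2 ?_ ?_
      · rw [Finset.coe_insert, hPi.insert_indep_iff]
        exact Or.inl ⟨by simp [hE], hjcl⟩
      · have := (hQ.mem_fundCircuit_iff hcl (by simpa using hiQ)).1 hjC
        convert this using 1
        ext y
        simp only [Finset.coe_insert, Finset.coe_erase, Set.mem_insert_iff, Set.mem_sdiff,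
          Set.mem_singleton_iff, Finset.mem_coe]
        constructor
        · rintro (rfl | h)
          · exact ⟨Or.inl rfl, Ne.symm hji⟩
          · exact ⟨Or.inr h.1, h.2⟩
        · rintro ⟨rfl | h, h'⟩
          · exact Or.inl rfl
          · exact Or.inr ⟨h, h'⟩
  have h3 : i ∈ M.closure (M.fundCircuit i ↑Q \ {i}) :=
    hC.mem_closure_sdiff_singleton_of_mem (M.mem_fundCircuit i ↑Q)
  have h4 := M.closure_subset_closure_of_subset_closure hsub h3
  have h5 := hP.notMem_closure_sdiff_of_mem (e := i) (by simpa using hiP)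
  rw [Finset.coe_erase] at h4
  exact h5 h4

/-- The element `i` of `P` can be traded against the element `j` of `Q`, in both directions. -/
def Exchangeable (M : Matroid (Fin n)) (P Q : Finset (Fin n)) (i j : Fin n) : Prop :=
  j ∈ Q ∧ j ∉ P ∧ M.Indep (↑(insert j (P.erase i)) : Set (Fin n)) ∧
    M.Indep (↑(insert i (Q.erase j)) : Set (Fin n))

/-- The exchange partner of `i`: an element of `Q` outside `P`. -/
def partner (M : Matroid (Fin n)) (P Q : Finset (Fin n)) (i : Fin n) : Option (Fin n) :=
  (List.finRange n).foldl (fun b j => if Exchangeable M P Q i j then some j else b) none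

theorem foldl_last_spec {β : Type} (p : β → Prop) [DecidablePred p] (l : List β) :
    match l.foldl (fun b j => if p j then some j else b) none with
    | none => ∀ j ∈ l, ¬ p j
    | some j => p j := by
  induction l using List.reverseRecOn with
  | nil => simp
  | append_singleton l a ih =>
    rw [List.foldl_append, List.foldl_cons, List.foldl_nil]
    generalize l.foldl (fun b j => if p j then some j else b) none = b at ih
    by_cases ha : p a
    · simp [ha]
    · cases b with
      | none =>
        simp only [ha, if_false]
        intro j hj
        rcases List.mem_append.1 hj with hj | hj
        · exact ih j hj
        · rwa [List.mem_singleton.1 hj]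
      | some j => simpa [ha] using ih

theorem partner_spec {M : Matroid (Fin n)} (hE : M.E = Set.univ) {P Q : Finset (Fin n)}
    (hP : M.Indep (↑P : Set (Fin n))) (hQ : M.Indep (↑Q : Set (Fin n))) {i : Fin n} (hiP : i ∈ P)
    (hiQ : i ∉ Q) (hdep : ¬ M.Indep (↑(insert i Q) : Set (Fin n))) :
    ∃ j, partner M P Q i = some j ∧ Exchangeable M P Q i j := by
  have h := foldl_last_spec (fun j => Exchangeable M P Q i j) (List.finRange n)
  unfold partner
  generalize (List.finRange n).foldl
    (fun b j => if Exchangeable M P Q i j then some j else b) none = b at h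
  cases b with
  | none =>
    obtain ⟨j, hj⟩ := exists_exchange hE hP hQ hiP hiQ hdep
    exact absurd hj (h j (by simp))
  | some j => exact ⟨j, rfl, h⟩

/-- Treat the element `i` of `P \ Q`: with probability `p` change `Q`, else change `P`. -/
def passStep (M : Matroid (Fin n)) (p : ℝ) (i : Fin n) (s : Finset (Fin n) × Finset (Fin n)) :
    PMF (Finset (Fin n) × Finset (Fin n)) :=
  if i ∈ s.1 ∧ i ∉ s.2 then
    if M.Indep (↑(insert i s.2) : Set (Fin n)) then
      (coin p).map fun c => if c then (s.1, insert i s.2) else (s.1.erase i, s.2)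
    else match partner M s.1 s.2 i with
      | none => PMF.pure s
      | some j => (coin p).map fun c =>
          if c then (s.1, insert i (s.2.erase j)) else (insert j (s.1.erase i), s.2)
  else PMF.pure s

/-- Merge two independent sets with weights `l` and `1`. -/
def mergeSets (M : Matroid (Fin n)) (l : ℕ) (P Q : Finset (Fin n)) : PMF (Finset (Fin n)) :=
  (foldP (passStep M (l / (l + 1))) (List.finRange n) (P, Q)).bind fun s =>
    (foldP (passStep M (1 / (l + 1))) (List.finRange n) (s.2, s.1)).map Prod.fst

/-- Add to `J` the element `i` of `I` with probability `1 - x i`. -/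
def thinStep (x : Fin n → ℝ) (I : Finset (Fin n)) (i : Fin n) (J : Finset (Fin n)) :
    PMF (Finset (Fin n)) :=
  if i ∈ I then (coin (1 - x i)).map fun b => if b then insert i J else J else PMF.pure J

/-- Online swap rounding of the point `fracPoint δ L`; all sets contain `H`. -/
def swapRound (M : Matroid (Fin n)) (H : Finset (Fin n)) (δ : ℝ) :
    List (Finset (Fin n)) → PMF (Finset (Fin n))
  | [] => PMF.pure H
  | I :: L => (swapRound M H δ L).bind fun P =>
      (foldP (thinStep (fracPoint δ L) I) (List.finRange n) H).bind fun J =>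
        mergeSets M L.length P J

/-- The point of the contraction represented by a set that contains `H`. -/
def ptOf (H P : Finset (Fin n)) : Fin n → ℝ := indicator (P \ H)

/-- Independent sets that contain `H`. -/
def Above (M : Matroid (Fin n)) (H P : Finset (Fin n)) : Prop :=
  M.Indep (↑P : Set (Fin n)) ∧ H ⊆ P

variable {M : Matroid (Fin n)} {H : Finset (Fin n)}

theorem Above.contractIndep {P : Finset (Fin n)} (h : Above M H P) :
    ContractIndep M H (P \ H) := by
  refine ⟨Finset.sdiff_disjoint, ?_⟩
  rw [Finset.sdiff_union_of_subset h.2]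
  exact h.1

theorem Above.ptOf_mem {P : Finset (Fin n)} (h : Above M H P) : ptOf H P ∈ polytope M H :=
  subset_convexHull ℝ _ ⟨_, h.contractIndep, rfl⟩

theorem convex_polytope : Convex ℝ (polytope M H) := convex_convexHull ℝ _

/-- Independent sets are closed under subsets, so their hull is closed under shrinking coordinates.
Scaling coordinate `i` by `r` is linear and sends the vertex of `S` to the mixture, with weights `r`
and `1 - r`, of the vertices of `S` and of `S` without `i`; coordinates are treated one after the
other. -/
theorem polytope_scale {y c : Fin n → ℝ} (hy : y ∈ polytope M H) (hc0 : ∀ i, 0 ≤ c i)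
    (hc1 : ∀ i, c i ≤ 1) : (fun i => c i * y i) ∈ polytope M H := by
  have single : ∀ (i : Fin n) (y : Fin n → ℝ) (r : ℝ), 0 ≤ r → r ≤ 1 → y ∈ polytope M H →
      (fun k => if k = i then r * y k else y k) ∈ polytope M H := by
    intro i y r h0 h1 hy
    let φ : (Fin n → ℝ) →ₗ[ℝ] (Fin n → ℝ) :=
      { toFun := fun y k => if k = i then r * y k else y k
        map_add' := by intro a b; ext k; by_cases h : k = i <;> simp [h, mul_add]
        map_smul' := by
          intro a b; ext k; by_cases h : k = i
          · simp [h]; ring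
          · simp [h] }
    have himg : φ '' polytope M H ⊆ polytope M H := by
      rw [polytope, φ.isLinear.image_convexHull]
      refine convexHull_min ?_ (convex_convexHull ℝ _)
      rintro _ ⟨_, ⟨S, hS, rfl⟩, rfl⟩
      have e1 : φ (indicator S) = r • indicator S + (1 - r) • indicator (S.erase i) := by
        ext k
        by_cases h : k = i
        · simp [φ, h, indicator]
        · simp [φ, h, indicator]; split_ifs <;> ring
      rw [e1]
      exact convex_polytope (subset_convexHull ℝ _ ⟨S, hS, rfl⟩)
        (subset_convexHull ℝ _ ⟨S.erase i, ContractIndep.subset hS (Finset.erase_subset _ _), rfl⟩)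
        h0 (by linarith) (by ring)
    exact himg ⟨y, hy, rfl⟩
  have key : ∀ T : Finset (Fin n), (fun i => if i ∈ T then c i * y i else y i) ∈ polytope M H := by
    intro T
    induction T using Finset.induction_on with
    | empty => simpa using hy
    | insert i T hi ih =>
      convert single i _ (c i) (hc0 i) (hc1 i) ih using 1
      ext k
      by_cases h : k = i
      · subst h; simp [hi]
      · simp [h]
  simpa using key Finset.univ

/-- Mass `r` of `Q` can be added to `z` within `Q`. -/
def Room (Q : Set (Fin n → ℝ)) (r : ℝ) (z : Fin n → ℝ) : Prop := ∀ q ∈ Q, r • q + z ∈ Q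

/-- A weighted pair of points is their total weight times their barycentre, which is a single point
of the convex set. -/
theorem Room.two {Q : Set (Fin n → ℝ)} (hQ : Convex ℝ Q) {a b : ℝ} {z : Fin n → ℝ} (ha : 0 ≤ a)
    (hb : 0 ≤ b) (hab : 0 < a + b) (h : Room Q (a + b) z) {p q : Fin n → ℝ} (hp : p ∈ Q)
    (hq : q ∈ Q) : a • p + b • q + z ∈ Q := by
  have := h _ (hQ hp hq (a := a / (a + b)) (b := b / (a + b)) (by positivity) (by positivity)
    (by field_simp))
  convert this using 2
  ext i
  simp only [Pi.add_apply, Pi.smul_apply, smul_eq_mul]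
  field_simp

theorem indicator_insert_eq {S : Finset (Fin n)} {i : Fin n} (hi : i ∉ S) :
    indicator (insert i S) = indicator S + Pi.single i 1 := by
  ext k
  by_cases h : k = i
  · subst h; simp [indicator, hi]
  · simp [indicator, h]

theorem ptOf_insert {P : Finset (Fin n)} {i : Fin n} (hi : i ∉ P) (hiH : i ∉ H) :
    ptOf H (insert i P) = ptOf H P + Pi.single i 1 := by
  rw [ptOf, Finset.insert_sdiff_of_notMem _ hiH, indicator_insert_eq (by simp [hi])]
  rfl

theorem ptOf_erase {P : Finset (Fin n)} {i : Fin n} (hi : i ∈ P) (hiH : i ∉ H) :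
    ptOf H (P.erase i) = ptOf H P - Pi.single i 1 := by
  have := ptOf_insert (H := H) (P := P.erase i) (i := i) (by simp) hiH
  rw [Finset.insert_erase hi] at this
  rw [this, add_sub_cancel_right]

/-- A pipage step in the form in which the algorithm performs it: a coin, an update depending on the
coin, then a continuation. -/
theorem PipageRounding.step_map {X : Type} {Q : Set (Fin n → ℝ)} {y d : Fin n → ℝ} {a b p : ℝ}
    (hd : IsPipageDirection d) (ha : 0 ≤ a) (hb : 0 ≤ b) (hab : 0 < a + b) (hp : p = b / (a + b))
    (hy : y ∈ Q) (u : Bool → X) (ν : X → PMF (Finset (Fin n)))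
    (h₁ : y + a • d ∈ Q ∧ PipageRounding Q (y + a • d) (ν (u true)))
    (h₂ : y - b • d ∈ Q ∧ PipageRounding Q (y - b • d) (ν (u false))) :
    PipageRounding Q y (((coin p).map u).bind ν) := by
  have := PipageRounding.step y d a b _ _ hd ha hb hab hy h₁.1 h₂.1 h₁.2 h₂.2
  rw [PMF.bind_map, hp]
  convert this using 2
  ext1 c
  cases c <;> rfl

theorem passStep_pipage (hE : M.E = Set.univ) {α β : ℝ} (hα : 0 ≤ α) (hβ : 0 ≤ β)
    (hαβ : 0 < α + β) {p : ℝ} (hp : p = α / (β + α)) {z : Fin n → ℝ}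
    (hz : Room (polytope M H) (α + β) z) (i : Fin n) {s : Finset (Fin n) × Finset (Fin n)}
    (h1 : Above M H s.1) (h2 : Above M H s.2)
    (ν : Finset (Fin n) × Finset (Fin n) → PMF (Finset (Fin n)))
    (hν : ∀ s', Above M H s'.1 → Above M H s'.2 → s'.1 \ s'.2 ⊆ (s.1 \ s.2).erase i →
      (s.2 ⊆ s.1 → s'.2 ⊆ s'.1) →
      PipageRounding (polytope M H) (α • ptOf H s'.1 + β • ptOf H s'.2 + z) (ν s')) :
    PipageRounding (polytope M H) (α • ptOf H s.1 + β • ptOf H s.2 + z)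
      ((passStep M p i s).bind ν) := by
  obtain ⟨P, Q⟩ := s
  simp only at h1 h2 hν ⊢
  have mem : ∀ P' Q', Above M H P' → Above M H Q' →
      α • ptOf H P' + β • ptOf H Q' + z ∈ polytope M H := fun P' Q' h h' =>
    Room.two convex_polytope hα hβ hαβ hz h.ptOf_mem h'.ptOf_mem
  unfold passStep
  split_ifs with hc hi
  · obtain ⟨hiP, hiQ⟩ := hc
    simp only at hiP hiQ hi
    have hiH : i ∉ H := fun h => hiQ (h2.2 h)
    have hQ' : Above M H (insert i Q) := ⟨hi, h2.2.trans (Finset.subset_insert _ _)⟩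
    have hP' : Above M H (P.erase i) := ⟨h1.1.subset (by simp),
      fun y hy => Finset.mem_erase.2 ⟨fun h => hiH (h ▸ hy), h1.2 hy⟩⟩
    refine PipageRounding.step_map (d := Pi.single i 1) (a := β) (b := α) (Or.inl ⟨i, rfl⟩) hβ hα
      (by linarith) hp (mem P Q h1 h2) _ ν ?_ ?_
    · have e : α • ptOf H P + β • ptOf H Q + z + β • Pi.single i 1 =
          α • ptOf H P + β • ptOf H (insert i Q) + z := by
        rw [ptOf_insert hiQ hiH, smul_add]; abel
      rw [e]
      refine ⟨mem _ _ h1 hQ', hν (P, insert i Q) h1 hQ' ?_ ?_⟩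
      · intro y; simp; tauto
      · intro h y; simp only [Finset.mem_insert]; rintro (rfl | hy); exacts [hiP, h hy]
    · have e : α • ptOf H P + β • ptOf H Q + z - α • Pi.single i 1 =
          α • ptOf H (P.erase i) + β • ptOf H Q + z := by
        rw [ptOf_erase hiP hiH, smul_sub]; abel
      rw [e]
      refine ⟨mem _ _ hP' h2, hν (P.erase i, Q) hP' h2 ?_ ?_⟩
      · intro y; simp; tauto
      · intro h y hy; exact Finset.mem_erase.2 ⟨fun h' => hiQ (h' ▸ hy), h hy⟩
  · obtain ⟨hiP, hiQ⟩ := hc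
    simp only at hiP hiQ hi
    have hiH : i ∉ H := fun h => hiQ (h2.2 h)
    obtain ⟨j, hj, hjQ, hjP, hind1, hind2⟩ := partner_spec hE h1.1 h2.1 hiP hiQ hi
    simp only [hj]
    have hjH : j ∉ H := fun h => hjP (h1.2 h)
    have hij : i ≠ j := fun h => hiQ (h ▸ hjQ)
    have hQ' : Above M H (insert i (Q.erase j)) := ⟨hind2, fun y hy =>
      Finset.mem_insert_of_mem (Finset.mem_erase.2 ⟨fun h => hjH (h ▸ hy), h2.2 hy⟩)⟩
    have hP' : Above M H (insert j (P.erase i)) := ⟨hind1, fun y hy =>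
      Finset.mem_insert_of_mem (Finset.mem_erase.2 ⟨fun h => hiH (h ▸ hy), h1.2 hy⟩)⟩
    refine PipageRounding.step_map (d := Pi.single i 1 - Pi.single j 1) (a := β) (b := α)
      (Or.inr ⟨i, j, hij, rfl⟩) hβ hα (by linarith) hp (mem P Q h1 h2) _ ν ?_ ?_
    · have e : α • ptOf H P + β • ptOf H Q + z + β • (Pi.single i 1 - Pi.single j 1) =
          α • ptOf H P + β • ptOf H (insert i (Q.erase j)) + z := by
        rw [ptOf_insert (by simp [hiQ]) hiH, ptOf_erase hjQ hjH]; simp only [smul_add, smul_sub]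
        abel
      rw [e]
      refine ⟨mem _ _ h1 hQ', hν (P, insert i (Q.erase j)) h1 hQ' ?_ ?_⟩
      · intro y hy
        simp only [Finset.mem_sdiff, Finset.mem_insert, Finset.mem_erase] at hy ⊢
        refine ⟨by tauto, hy.1, fun hyQ => hy.2 (Or.inr ⟨fun h => hjP (h ▸ hy.1), hyQ⟩)⟩
      · intro h y; simp only [Finset.mem_insert]; rintro (rfl | hy)
        exacts [hiP, h (Finset.mem_of_mem_erase hy)]
    · have e : α • ptOf H P + β • ptOf H Q + z - α • (Pi.single i 1 - Pi.single j 1) =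
          α • ptOf H (insert j (P.erase i)) + β • ptOf H Q + z := by
        rw [ptOf_insert (by simp [hjP]) hjH, ptOf_erase hiP hiH]; simp only [smul_add, smul_sub]
        abel
      rw [e]
      refine ⟨mem _ _ hP' h2, hν (insert j (P.erase i), Q) hP' h2 ?_ ?_⟩
      · intro y hy
        simp only [Finset.mem_sdiff, Finset.mem_insert, Finset.mem_erase] at hy ⊢
        rcases hy.1 with rfl | h
        · exact absurd hjQ hy.2
        · exact ⟨h.1, h.2, hy.2⟩
      · intro h; exact absurd (h hjQ) hjP
  · rw [PMF.pure_bind]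
    refine hν (P, Q) h1 h2 ?_ id
    intro y hy
    refine Finset.mem_erase.2 ⟨?_, hy⟩
    rintro rfl
    exact hc (by simpa using hy)

theorem foldP_passStep_pipage (hE : M.E = Set.univ) {α β : ℝ} (hα : 0 ≤ α) (hβ : 0 ≤ β)
    (hαβ : 0 < α + β) {p : ℝ} (hp : p = α / (β + α)) {z : Fin n → ℝ}
    (hz : Room (polytope M H) (α + β) z) (L : List (Fin n))
    {s : Finset (Fin n) × Finset (Fin n)} (h1 : Above M H s.1) (h2 : Above M H s.2)
    (ν : Finset (Fin n) × Finset (Fin n) → PMF (Finset (Fin n)))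
    (hν : ∀ s', Above M H s'.1 → Above M H s'.2 → s'.1 \ s'.2 ⊆ (s.1 \ s.2) \ L.toFinset →
      (s.2 ⊆ s.1 → s'.2 ⊆ s'.1) →
      PipageRounding (polytope M H) (α • ptOf H s'.1 + β • ptOf H s'.2 + z) (ν s')) :
    PipageRounding (polytope M H) (α • ptOf H s.1 + β • ptOf H s.2 + z)
      ((foldP (passStep M p) L s).bind ν) := by
  induction L generalizing s with
  | nil =>
    rw [foldP, PMF.pure_bind]
    exact hν s h1 h2 (by simp) id
  | cons i L ih =>
    rw [foldP, PMF.bind_bind]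
    refine passStep_pipage hE hα hβ hαβ hp hz i h1 h2 _ fun s' h1' h2' hsub himp => ?_
    refine ih h1' h2' fun s'' h1'' h2'' hsub' himp' => hν s'' h1'' h2'' ?_ fun h => himp' (himp h)
    intro y hy
    have h3 := hsub' hy
    rw [Finset.mem_sdiff] at h3
    have h4 := hsub h3.1
    rw [Finset.mem_erase] at h4
    rw [Finset.mem_sdiff]
    exact ⟨h4.2, by simp [h4.1]; simpa using h3.2⟩

/-- The first pass empties `P \ Q`. The second, with the roles exchanged, empties the other
difference while keeping the inclusion already achieved. The two sets then coincide and carry the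
joint weight. -/
theorem mergeSets_pipage (hE : M.E = Set.univ) {δ : ℝ} (hδ : 0 < δ) (l : ℕ) {z : Fin n → ℝ}
    (hz : Room (polytope M H) (l * δ + δ) z) {P Q : Finset (Fin n)}
    (h1 : Above M H P) (h2 : Above M H Q) (ν : Finset (Fin n) → PMF (Finset (Fin n)))
    (hν : ∀ S, Above M H S →
      PipageRounding (polytope M H) ((l * δ + δ) • ptOf H S + z) (ν S)) :
    PipageRounding (polytope M H) ((l * δ) • ptOf H P + δ • ptOf H Q + z)
      ((mergeSets M l P Q).bind ν) := by
  have hl : 0 ≤ l * δ := by positivity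
  rw [mergeSets, PMF.bind_bind]
  refine foldP_passStep_pipage (s := (P, Q)) hE hl hδ.le (by linarith)
    (by field_simp; ring) hz _ h1 h2 _ fun s h1 h2 hsub _ => ?_
  rw [add_comm ((l * δ) • ptOf H s.1), PMF.bind_map]
  have hsub1 : s.1 ⊆ s.2 := by
    rw [← Finset.sdiff_eq_empty_iff_subset, Finset.eq_empty_iff_forall_notMem]
    intro y hy
    simpa using hsub hy
  refine foldP_passStep_pipage (s := (s.2, s.1)) hE hδ.le hl (by linarith)
    (by field_simp) (by rwa [add_comm]) _ h2 h1 _ fun s' h1' h2' hsub' himp => ?_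
  have e : s'.1 = s'.2 := by
    refine Finset.Subset.antisymm ?_ (himp hsub1)
    rw [← Finset.sdiff_eq_empty_iff_subset, Finset.eq_empty_iff_forall_notMem]
    intro y hy
    simpa using hsub' hy
  have := hν s'.1 h1'
  rw [add_smul, add_comm ((l * δ) • _)] at this
  rw [← e]
  exact this

/-- The part, indexed by a list, of the vector that is `1 - x` on `I` and zero elsewhere. -/
def restVec (x : Fin n → ℝ) (I : Finset (Fin n)) (L : List (Fin n)) : Fin n → ℝ :=
  fun i => if i ∈ L ∧ i ∈ I then 1 - x i else 0

/-- Coordinate `i` of the summand has mass `δ (1 - x i)`. It is raised to `δ` with probability `1 -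
x i` and lowered to zero otherwise, which is a pipage step along `e_i`. -/
theorem foldP_thinStep_pipage {x : Fin n → ℝ} (hx0 : ∀ i, 0 ≤ x i) (hx1 : ∀ i, x i ≤ 1)
    {I : Finset (Fin n)} (hI : ContractIndep M H I) {δ : ℝ} (hδ : 0 < δ) {c : Fin n → ℝ}
    (hc : Room (polytope M H) δ c) (L : List (Fin n)) (hL : L.Nodup)
    {J : Finset (Fin n)} (hHJ : H ⊆ J) (hJI : J ⊆ I ∪ H) (hJL : ∀ i ∈ L, i ∈ I → i ∉ J)
    (ν : Finset (Fin n) → PMF (Finset (Fin n)))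
    (hν : ∀ S, Above M H S → PipageRounding (polytope M H) (δ • ptOf H S + c) (ν S)) :
    PipageRounding (polytope M H) (δ • (ptOf H J + restVec x I L) + c)
      ((foldP (thinStep x I) L J).bind ν) := by
  -- Every intermediate vector is dominated by the indicator of `I`, so it lies in the polytope by
  -- downward closure, and the room around `c` absorbs it.
  have mem : ∀ (J : Finset (Fin n)) (L : List (Fin n)), J ⊆ I ∪ H →
      (∀ i ∈ L, i ∈ I → i ∉ J) → δ • (ptOf H J + restVec x I L) + c ∈ polytope M H := by
    intro J L hJ hJL
    refine hc _ ?_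
    have := polytope_scale (M := M) (H := H) (y := indicator I)
      (c := fun i => if i ∈ J then 1 else if i ∈ L then 1 - x i else 0)
      (subset_convexHull ℝ _ ⟨I, hI, rfl⟩) (fun i => by split_ifs <;> linarith [hx1 i])
      (fun i => by split_ifs <;> linarith [hx0 i])
    convert this using 1
    ext i
    simp only [ptOf, indicator, restVec, Pi.add_apply, Finset.mem_sdiff]
    have hd : i ∈ I → i ∉ H := fun h => Finset.disjoint_left.1 hI.1 h
    have hJi := @hJ i
    have := hJL i
    simp only [Finset.mem_union] at hJi
    by_cases h1 : i ∈ I <;> by_cases h2 : i ∈ J <;> by_cases h3 : i ∈ L <;>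
      by_cases h4 : i ∈ H <;> simp_all
  induction L generalizing J with
  | nil =>
    rw [foldP, PMF.pure_bind]
    have e : restVec x I [] = 0 := by ext; simp [restVec]
    rw [e, add_zero]
    exact hν J ⟨hI.2.subset (by exact_mod_cast hJI), hHJ⟩
  | cons i L ih =>
    rw [List.nodup_cons] at hL
    rw [foldP, PMF.bind_bind]
    unfold thinStep
    split_ifs with hi
    · have hiH : i ∉ H := Finset.disjoint_left.1 hI.1 hi
      have hiJ : i ∉ J := hJL i (by simp) hi
      have e0 : restVec x I (i :: L) = restVec x I L + (1 - x i) • Pi.single i 1 := by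
        ext k
        by_cases hk : k = i
        · subst hk; simp [restVec, hi, hL.1]
        · simp [restVec, hk]
      refine PipageRounding.step_map (d := Pi.single i 1) (a := δ * x i) (b := δ * (1 - x i))
        (Or.inl ⟨i, rfl⟩) (mul_nonneg hδ.le (hx0 i)) (mul_nonneg hδ.le (by linarith [hx1 i]))
        (by ring_nf; exact hδ) (by field_simp; ring) (mem J _ hJI hJL) _ _ ?_ ?_
      · have e : δ • (ptOf H J + restVec x I (i :: L)) + c + (δ * x i) • Pi.single i 1 =
            δ • (ptOf H (insert i J) + restVec x I L) + c := by
          rw [e0, ptOf_insert hiJ hiH]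
          ext k
          simp only [Pi.add_apply, Pi.smul_apply, smul_eq_mul]
          ring
        have hsub : insert i J ⊆ I ∪ H :=
          Finset.insert_subset (Finset.mem_union_left _ hi) hJI
        have hd : ∀ k ∈ L, k ∈ I → k ∉ insert i J := by
          intro k hk hkI
          have : k ≠ i := fun h => hL.1 (h ▸ hk)
          simp [this, hJL k (by simp [hk]) hkI]
        rw [e]
        exact ⟨mem _ _ hsub hd, ih hL.2 (hHJ.trans (Finset.subset_insert _ _)) hsub hd⟩
      · have e : δ • (ptOf H J + restVec x I (i :: L)) + c - (δ * (1 - x i)) • Pi.single i 1 =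
            δ • (ptOf H J + restVec x I L) + c := by
          rw [e0]
          ext k
          simp only [Pi.add_apply, Pi.smul_apply, Pi.sub_apply, smul_eq_mul]
          ring
        have hd : ∀ k ∈ L, k ∈ I → k ∉ J := fun k hk => hJL k (by simp [hk])
        rw [e]
        exact ⟨mem _ _ hJI hd, ih hL.2 hHJ hJI hd⟩
    · rw [PMF.pure_bind]
      have e0 : restVec x I (i :: L) = restVec x I L := by
        ext k
        by_cases hk : k = i
        · subst hk; simp [restVec, hi]
        · simp [restVec, hk]
      rw [e0]
      exact ih hL.2 hHJ hJI fun k hk => hJL k (by simp [hk])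

theorem fracPoint_mem {δ : ℝ} (h0 : 0 ≤ δ) (h1 : δ ≤ 1) (L : List (Finset (Fin n))) (i : Fin n) :
    0 ≤ fracPoint δ L i ∧ fracPoint δ L i ≤ 1 := by
  induction L with
  | nil => simp [fracPoint]
  | cons I L ih =>
    simp only [fracPoint, indicator]
    split_ifs
    · constructor <;> nlinarith
    · simpa using ih

/-- The fractional point is `δ` times a sum of thinned indicators, one for each round. The vector
`z` collects the summands whose rounding comes later, and `Room` says that the mass treated so far
fits on top of it. After the earlier rounds have been rounded to one set of weight `l δ`, the newest
summand is thinned to a set of weight `δ` and the two are merged. -/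
theorem swapRound_pipage (hE : M.E = Set.univ) {δ : ℝ} (hδ : 0 < δ) (hδ1 : δ ≤ 1)
    (hH : M.Indep (↑H : Set (Fin n))) (L : List (Finset (Fin n)))
    (hL : ∀ I ∈ L, ContractIndep M H I) {z : Fin n → ℝ}
    (hz : Room (polytope M H) (L.length * δ) z) (ν : Finset (Fin n) → PMF (Finset (Fin n)))
    (hν : ∀ S, Above M H S →
      PipageRounding (polytope M H) ((L.length * δ) • ptOf H S + z) (ν S)) :
    PipageRounding (polytope M H) (fracPoint δ L + z) ((swapRound M H δ L).bind ν) := by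
  induction L generalizing z ν with
  | nil =>
    rw [swapRound, PMF.pure_bind]
    have := hν H ⟨hH, subset_rfl⟩
    simp only [List.length_nil, Nat.cast_zero, zero_mul, zero_smul] at this
    exact this
  | cons I L ih =>
    have hI := hL I (by simp)
    have hx := fun i => fracPoint_mem hδ.le hδ1 L i
    have e : fracPoint δ (I :: L) + z =
        fracPoint δ L + (δ • (ptOf H H + restVec (fracPoint δ L) I (List.finRange n)) + z) := by
      ext i
      simp only [fracPoint, restVec, ptOf, indicator, Pi.add_apply, Pi.smul_apply, smul_eq_mul]
      by_cases h : i ∈ I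
      · simp [h]; ring
      · simp [h]
    have hlen : (((I :: L).length : ℕ) : ℝ) * δ = L.length * δ + δ := by
      push_cast [List.length_cons]; ring
    rw [hlen] at hz
    rw [e, swapRound, PMF.bind_bind]
    have hy : ptOf H H + restVec (fracPoint δ L) I (List.finRange n) ∈ polytope M H := by
      have := polytope_scale (M := M) (H := H) (y := indicator I)
        (c := fun i => 1 - fracPoint δ L i)
        (subset_convexHull ℝ _ ⟨I, hI, rfl⟩) (fun i => by linarith [(hx i).2])
        (fun i => by linarith [(hx i).1])
      convert this using 1
      ext i
      simp [ptOf, indicator, restVec]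
    have hl : 0 ≤ (L.length : ℝ) * δ := by positivity
    -- While the earlier summands are rounded, the newest one waits unrounded as part of `z`.
    refine ih (fun J hJ => hL J (by simp [hJ])) ?_ _ fun P hP => ?_
    · intro q hq
      rw [← add_assoc]
      exact Room.two convex_polytope hl hδ.le (by linarith) hz hq hy
    · rw [PMF.bind_bind, add_left_comm]
      refine foldP_thinStep_pipage (fun i => (hx i).1) (fun i => (hx i).2) hI hδ ?_ _
        (List.nodup_finRange n) subset_rfl Finset.subset_union_right
        (fun i _ hi => Finset.disjoint_left.1 hI.1 hi) _ fun S hS => ?_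
      · intro q hq
        have := Room.two convex_polytope hl hδ.le (by linarith) hz hP.ptOf_mem hq
        convert this using 1
        abel
      · have := mergeSets_pipage hE hδ L.length hz hP hS ν (by rwa [hlen] at hν)
        convert this using 1
        abel

/-- The rounding of the algorithm. -/
def roundSet (M : Matroid (Fin n)) (H : Finset (Fin n)) (L : List (Finset (Fin n))) :
    PMF (Finset (Fin n)) :=
  (swapRound M H (stepSize (n - H.card)) L).map fun P => P \ H

/-- The `k ^ 4` rounds of step `k ^ (-4)` have total mass one, so nothing is left over and `z = 0`.
For `k = 0` there are no rounds and the origin is the vertex of the empty set. -/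
theorem roundSet_pipage (hE : M.E = Set.univ) (hH : M.Indep (↑H : Set (Fin n)))
    (L : List (Finset (Fin n))) (hlen : L.length = (n - H.card) ^ 4)
    (hL : ∀ I ∈ L, ContractIndep M H I) :
    PipageRounding (polytope M H) (fracPoint (stepSize (n - H.card)) L) (roundSet M H L) := by
  have hHpt : Above M H H := ⟨hH, subset_rfl⟩
  rcases Nat.eq_zero_or_pos (n - H.card) with hk | hk
  · have : L = [] := by simpa [hk] using hlen
    subst this
    have h0 : fracPoint (stepSize (n - H.card)) ([] : List (Finset (Fin n))) = indicator ∅ := by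
      ext i; simp [fracPoint, indicator]
    rw [h0, roundSet, swapRound, PMF.pure_map, Finset.sdiff_self]
    exact PipageRounding.integral ∅ (by simpa [ptOf] using hHpt.ptOf_mem)
  · have hk1 : (1 : ℝ) ≤ ((n - H.card : ℕ) : ℝ) := by exact_mod_cast hk
    have hk4 : (1 : ℝ) ≤ ((n - H.card : ℕ) : ℝ) ^ 4 := one_le_pow₀ hk1
    have hδ : 0 < stepSize (n - H.card) := by unfold stepSize; positivity
    have hδ1 : stepSize (n - H.card) ≤ 1 := inv_le_one_of_one_le₀ hk4
    have hone : (L.length : ℝ) * stepSize (n - H.card) = 1 := by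
      rw [hlen, stepSize]; push_cast; field_simp
    have := swapRound_pipage hE hδ hδ1 hH L hL (z := 0)
      (by rw [hone]; intro q hq; simpa using hq) (fun P => PMF.pure (P \ H)) (fun S hS => by
        rw [hone, one_smul, add_zero]
        exact PipageRounding.integral _ hS.ptOf_mem)
    rw [add_zero] at this
    exact this

end Rounding


/-! ### Sampling and the online form of the rounding -/

section Sampling
open Classical

theorem foldP_append {β X : Type} (f : β → X → PMF X) (L L' : List β) (x : X) :
    foldP f (L ++ L') x = (foldP f L x).bind (foldP f L') := by
  induction L generalizing x with
  | nil => simp [foldP]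
  | cons b L ih =>
    rw [List.cons_append, foldP, foldP, PMF.bind_bind]
    congr 1
    funext y
    exact ih y

theorem foldP_singleton {β X : Type} (f : β → X → PMF X) (b : β) (x : X) :
    foldP f [b] x = f b x := by
  simp [foldP]

theorem coin_apply (p : ℝ) (b : Bool) :
    coin p b = if b then ((min p.toNNReal 1 : ℝ≥0) : ℝ≥0∞)
      else 1 - ((min p.toNNReal 1 : ℝ≥0) : ℝ≥0∞) := by
  cases b <;> rfl

theorem coin_zero : coin 0 = PMF.pure false := by
  ext b; cases b <;> simp [coin_apply]

theorem coin_toReal {p : ℝ} (h0 : 0 ≤ p) (h1 : p ≤ 1) (b : Bool) :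
    (coin p b).toReal = if b then p else 1 - p := by
  have hmin : min p.toNNReal 1 = p.toNNReal := by simpa using h1
  have hle : ((p.toNNReal : ℝ≥0) : ℝ≥0∞) ≤ 1 := by exact_mod_cast (Real.toNNReal_le_one.2 h1)
  cases b
  · simp only [coin_apply, hmin, Bool.false_eq_true, if_false]
    rw [ENNReal.toReal_sub_of_le hle (by simp)]
    simp [h0]
  · simp only [coin_apply, hmin, if_true]
    simp [h0]

variable {β : Type} [Inhabited β]

theorem uniform_apply {s : Finset β} (hs : s.Nonempty) (a : β) :
    uniform s a = if a ∈ s then ((s.card : ℝ≥0∞))⁻¹ else 0 := by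
  rw [uniform, dif_pos hs, PMF.uniformOfFinset_apply]

theorem support_uniform {s : Finset β} (hs : s.Nonempty) : (uniform s).support = ↑s := by
  rw [uniform, dif_pos hs, PMF.support_uniformOfFinset]

theorem uniform_singleton (a : β) : uniform {a} = PMF.pure a := by
  ext b
  rw [uniform_apply (Finset.singleton_nonempty a)]
  simp [PMF.pure_apply]

theorem coin_card_apply {α : Type} {s : Finset α} (hs : s.Nonempty) (p : α → Prop)
    [DecidablePred p] (b : Bool) :
    coin ((s.filter p).card / s.card) b =
      ((s.filter fun a => p a ↔ b = true).card : ℝ≥0∞) / s.card := by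
  have h0 : (0 : ℝ) < s.card := by exact_mod_cast hs.card_pos
  have hle : (s.filter p).card ≤ s.card := Finset.card_filter_le _ _
  have hle' : ((s.filter p).card : ℝ) ≤ s.card := by exact_mod_cast hle
  have h1 := coin_toReal (p := ((s.filter p).card : ℝ) / s.card) (by positivity)
    (div_le_one_of_le₀ hle' h0.le) b
  have hne : coin ((s.filter p).card / s.card) b ≠ ⊤ := PMF.apply_ne_top _ _
  have hne' : ((s.filter fun a => p a ↔ b = true).card : ℝ≥0∞) / s.card ≠ ⊤ :=
    ENNReal.div_ne_top (by simp) (by simpa using hs.ne_empty)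
  rw [← ENNReal.toReal_eq_toReal_iff' hne hne', h1, ENNReal.toReal_div]
  cases b
  · have h2 := Finset.card_filter_add_card_filter_not (s := s) p
    have h3 : ((s.filter p).card : ℝ) + (s.filter fun a => ¬ p a).card = s.card := by
      exact_mod_cast h2
    simp only [Bool.false_eq_true, if_false, iff_false, ENNReal.toReal_natCast]
    field_simp
    linarith
  · simp

/-- The law of total probability for a coin whose bias is the exact proportion. An empty part has
probability zero, so the default value of `uniform` on it does not matter. -/
theorem uniform_split {s : Finset β} (hs : s.Nonempty) (p : β → Prop) [DecidablePred p] :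
    (coin ((s.filter p).card / s.card)).bind
      (fun b => uniform (s.filter fun a => p a ↔ b = true)) = uniform s := by
  ext a
  rw [PMF.bind_apply, tsum_bool, uniform_apply hs]
  have key : ∀ b : Bool, coin ((s.filter p).card / s.card) b *
      uniform (s.filter fun a => p a ↔ b = true) a =
        if a ∈ s ∧ (p a ↔ b = true) then ((s.card : ℝ≥0∞))⁻¹ else 0 := by
    intro b
    rw [coin_card_apply hs]
    by_cases hne : (s.filter fun a => p a ↔ b = true).Nonempty
    · rw [uniform_apply hne]
      simp only [Finset.mem_filter]
      split_ifs with h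
      · rw [ENNReal.div_eq_inv_mul, mul_assoc, ENNReal.mul_inv_cancel, mul_one]
        · simpa using hne.ne_empty
        · simp
      · simp
    · rw [Finset.not_nonempty_iff_eq_empty] at hne
      rw [hne, if_neg]
      · simp
      · intro h
        have : a ∈ s.filter fun a => p a ↔ b = true := by simpa using h
        rw [hne] at this
        simp at this
  rw [key, key]
  by_cases ha : a ∈ s <;> by_cases hp : p a <;> simp [ha, hp]

variable {n : ℕ}

/-- Reveal whether the random member of the family contains `i`. -/
def revealStep (i : Fin n) (F : Finset (Finset (Fin n))) : PMF (Finset (Finset (Fin n))) :=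
  (coin ((F.filter fun S => i ∈ S).card / F.card)).map fun b =>
    F.filter fun S => i ∈ S ↔ b = true

theorem revealStep_nonempty {i : Fin n} {F F' : Finset (Finset (Fin n))} (hF : F.Nonempty)
    (h : F' ∈ (revealStep i F).support) : F'.Nonempty := by
  rw [revealStep, PMF.support_map] at h
  obtain ⟨b, hb, rfl⟩ := h
  rw [PMF.mem_support_iff, coin_card_apply hF] at hb
  rw [← Finset.card_pos]
  by_contra h0
  simp only [not_lt, Nat.le_zero] at h0
  rw [h0] at hb
  simp at hb

/-- Revealing membership with exact conditional probabilities and then drawing from what is left is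
still a uniform draw. When all elements have been revealed a single set is left, so the coins alone
perform the draw. -/
theorem foldP_revealStep_bind (L : List (Fin n)) {F : Finset (Finset (Fin n))}
    (hF : F.Nonempty) : (foldP revealStep L F).bind uniform = uniform F := by
  induction L generalizing F with
  | nil => simp [foldP]
  | cons i L ih =>
    rw [foldP, PMF.bind_bind, bind_congr_support (g := uniform) _
      (fun F' hF' => ih (revealStep_nonempty hF hF')), revealStep, PMF.bind_map]
    exact uniform_split hF _

/-- Add a random new member. -/
def extendStep [DecidableEq β] (X : Finset β) (E : Finset β) : PMF (Finset β) :=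
  (uniform (X \ E)).map fun S => insert S E

theorem eq_uniform_of_const {s : Finset β} (hs : s.Nonempty) {μ : PMF β} {c : ℝ≥0∞}
    (h1 : ∀ a ∈ s, μ a = c) (h0 : ∀ a, a ∉ s → μ a = 0) : μ = uniform s := by
  have hsum : (s.card : ℝ≥0∞) * c = 1 := by
    rw [← μ.tsum_coe, tsum_eq_sum (s := s) (fun a ha => h0 a ha), Finset.sum_congr rfl h1]
    simp
  ext a
  rw [uniform_apply hs]
  split_ifs with ha
  · rw [h1 a ha]
    exact ENNReal.eq_inv_of_mul_eq_one_left (by rwa [mul_comm])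
  · exact h0 a ha

theorem extendStep_apply [DecidableEq β] {X E E' : Finset β} {m : ℕ} (hE : E ⊆ X) (hcE : E.card = m)
    (hE' : E' ⊆ X) (hcE' : E'.card = m + 1) :
    extendStep X E E' = if E ⊆ E' then (((X.card - m : ℕ) : ℝ≥0∞))⁻¹ else 0 := by
  have hlt : E.card < X.card := by have := Finset.card_le_card hE'; omega
  have hcard : (X \ E).card = X.card - m := by rw [Finset.card_sdiff_of_subset hE, hcE]
  have hne : (X \ E).Nonempty := by rw [← Finset.card_pos, hcard]; omega
  rw [extendStep, PMF.map_apply]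
  split_ifs with hsub
  · obtain ⟨x, hx⟩ := Finset.card_eq_one.1 (show (E' \ E).card = 1 by
      rw [Finset.card_sdiff_of_subset hsub]; omega)
    have hx' : x ∈ E' \ E := by rw [hx]; simp
    rw [Finset.mem_sdiff] at hx'
    have hins : E' = insert x E := by
      rw [← Finset.sdiff_union_of_subset hsub, hx]; rfl
    rw [tsum_eq_single x]
    · rw [if_pos hins, uniform_apply hne, if_pos (by simp [hE' hx'.1, hx'.2]), hcard]
    · intro y hy
      split_ifs with hyE
      · rw [uniform_apply hne, if_neg]
        intro hyX
        rw [Finset.mem_sdiff] at hyX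
        have : y ∈ E' \ E := by rw [Finset.mem_sdiff]; exact ⟨by rw [hyE]; simp, hyX.2⟩
        rw [hx] at this
        exact hy (by simpa using this)
      · rfl
  · rw [ENNReal.tsum_eq_zero]
    intro y
    split_ifs with hy
    · exact absurd (by rw [hy]; exact Finset.subset_insert _ _) hsub
    · rfl

/-- Drawing distinct members one after the other and forgetting the order. Each set of size `m + 1`
arises from `m + 1` sets of size `m`, all with the same transition probability, so the law is
constant on the target family; the constant is never evaluated, since normalisation determines it.
-/
theorem foldP_extendStep [DecidableEq β] (X : Finset β) {m : ℕ} (hm : m ≤ X.card) :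
    foldP (fun _ : ℕ => extendStep X) (List.range m) ∅ = uniform (X.powersetCard m) := by
  induction m with
  | zero => simp [foldP, uniform_singleton]
  | succ m ih =>
    rw [List.range_succ, foldP_append, ih (by omega)]
    have hne : (X.powersetCard m).Nonempty := Finset.powersetCard_nonempty.2 (by omega)
    have hne' : (X.powersetCard (m + 1)).Nonempty := Finset.powersetCard_nonempty.2 (by omega)
    refine eq_uniform_of_const hne' (c := ((X.powersetCard m).card : ℝ≥0∞)⁻¹ *
      (((X.card - m : ℕ) : ℝ≥0∞)⁻¹ * ((m + 1 : ℕ) : ℝ≥0∞))) ?_ ?_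
    · intro E' hE'
      rw [Finset.mem_powersetCard] at hE'
      rw [PMF.bind_apply, tsum_eq_sum (s := X.powersetCard m)
        (fun E hE => by rw [uniform_apply hne, if_neg hE, zero_mul])]
      have h1 : ∀ E ∈ X.powersetCard m, uniform (X.powersetCard m) E *
          foldP (fun _ : ℕ => extendStep X) [m] E E' =
          ((X.powersetCard m).card : ℝ≥0∞)⁻¹ *
            if E ⊆ E' then (((X.card - m : ℕ) : ℝ≥0∞))⁻¹ else 0 := by
        intro E hE
        rw [uniform_apply hne, if_pos hE, foldP_singleton]
        rw [Finset.mem_powersetCard] at hE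
        rw [extendStep_apply hE.1 hE.2 hE'.1 hE'.2]
      rw [Finset.sum_congr rfl h1, ← Finset.mul_sum, ← Finset.sum_filter, Finset.sum_const,
        nsmul_eq_mul]
      have h2 : (X.powersetCard m).filter (fun E => E ⊆ E') = E'.powersetCard m := by
        ext E
        simp only [Finset.mem_filter, Finset.mem_powersetCard]
        exact ⟨fun h => ⟨h.2, h.1.2⟩, fun h => ⟨⟨h.1.trans hE'.1, h.2⟩, h.1⟩⟩
      rw [h2, Finset.card_powersetCard m E', hE'.2, Nat.choose_succ_self_right,
        mul_comm (((m + 1 : ℕ) : ℝ≥0∞))]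
    · intro E' hE'
      rw [PMF.apply_eq_zero_iff, PMF.mem_support_bind_iff]
      rintro ⟨E, hE, hEE'⟩
      rw [support_uniform hne, Finset.mem_coe, Finset.mem_powersetCard] at hE
      rw [foldP_singleton, extendStep, PMF.support_map] at hEE'
      obtain ⟨S, hS, rfl⟩ := hEE'
      have hXE : (X \ E).Nonempty := by
        rw [← Finset.card_pos, Finset.card_sdiff_of_subset hE.1]; omega
      rw [support_uniform hXE, Finset.mem_coe, Finset.mem_sdiff] at hS
      refine hE' (Finset.mem_powersetCard.2 ⟨Finset.insert_subset hS.1 hE.1, ?_⟩)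
      rw [Finset.card_insert_of_notMem hS.2, hE.2]

/-- One round of measured continuous greedy, with online rounding. -/
def roundStep (M : Matroid (Fin n)) (H : Finset (Fin n)) (δ : ℝ) (s : ℕ)
    (sel : (Fin n → ℝ) → Finset (Fin n)) (g : Finset (Fin n) → ℝ) (l : ℕ)
    (p : (Fin n → ℝ) × Finset (Fin n)) : PMF ((Fin n → ℝ) × Finset (Fin n)) :=
  (iid (randomSubset p.1 (List.finRange n)) s).bind fun Rs =>
    (foldP (thinStep p.1 (sel (estimate g s Rs))) (List.finRange n) H).bind fun J =>
      (mergeSets M l p.2 J).map fun P =>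
        (fun i => p.1 i + δ * (1 - p.1 i) * indicator (sel (estimate g s Rs)) i, P)

theorem greedyHistory_length {δ : ℝ} {s : ℕ} {sel : (Fin n → ℝ) → Finset (Fin n)}
    {g : Finset (Fin n) → ℝ} (k : ℕ) : ∀ L ∈ (greedyHistory δ s sel g k).support,
    L.length = k := by
  induction k with
  | zero => simp [greedyHistory]
  | succ k ih =>
    intro L hL
    rw [greedyHistory, PMF.mem_support_bind_iff] at hL
    obtain ⟨L', hL', hL⟩ := hL
    rw [PMF.support_map] at hL
    obtain ⟨Rs, -, rfl⟩ := hL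
    simp [ih L' hL']

/-- Rounding depends on the chosen sets but not on the oracle, so its coins commute with the samples
of later rounds. Hence the program need only keep the current point and the current rounded set
instead of the whole history. -/
theorem foldP_roundStep (M : Matroid (Fin n)) (H : Finset (Fin n)) (δ : ℝ) (s : ℕ)
    (sel : (Fin n → ℝ) → Finset (Fin n)) (g : Finset (Fin n) → ℝ) (k : ℕ) :
    foldP (roundStep M H δ s sel g) (List.range k) (fun _ => 0, H) =
      (greedyHistory δ s sel g k).bind fun L =>
        (swapRound M H δ L).map fun P => (fracPoint δ L, P) := by
  induction k with
  | zero => simp [foldP, greedyHistory, swapRound, PMF.pure_map, fracPoint]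
  | succ k ih =>
    rw [List.range_succ, foldP_append, ih, greedyHistory, PMF.bind_bind, PMF.bind_bind]
    refine bind_congr_support _ fun L hL => ?_
    have hlen := greedyHistory_length k L hL
    rw [PMF.bind_map, PMF.bind_map]
    have e1 : ∀ P, (foldP (roundStep M H δ s sel g) [k] ∘ fun P => (fracPoint δ L, P)) P =
        (iid (randomSubset (fracPoint δ L) (List.finRange n)) s).bind fun Rs =>
          (foldP (thinStep (fracPoint δ L) (sel (estimate g s Rs))) (List.finRange n) H).bind
            fun J => (mergeSets M L.length P J).map fun P =>
              (fracPoint δ (sel (estimate g s Rs) :: L), P) := by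
      intro P
      rw [Function.comp_apply, foldP_singleton, roundStep, hlen]
      rfl
    rw [funext e1, PMF.bind_comm]
    congr 1
    funext Rs
    simp only [Function.comp_apply, swapRound]
    rw [PMF.map_bind]
    congr 1
    funext P
    rw [PMF.map_bind]

end Sampling


/-! ### The program -/

namespace Prog
open NExp Code

/-- Find a heaviest element not yet seen. -/
def pickCode : Code :=
  setN 10 (var 0)⨾
  forLoop 6 0 (cond (arr 3 (var 6)) skip
    (cond (lt (var 10) (var 0))
      (ltR 9 (.arr 0 (var 10)) (.arr 0 (var 6))⨾ cond (var 9) (setN 10 (var 6)) skip)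
      (setN 10 (var 6))))

/-- Mark the element found as seen, and take it if possible. -/
def takeCode : Code :=
  cond (lt (var 10) (var 0))
    (setA 3 (var 10) (lit 1)⨾
      cond (arr 0 (var 10)) skip
        (ltR 9 (.cast (lit 0)) (.arr 0 (var 10))⨾
          cond (var 9)
            (setA 2 (var 10) (lit 1)⨾ indep 9 2⨾
              cond (var 9) (setA 1 (var 10) (lit 1)) (setA 2 (var 10) (lit 0)))
            skip))
    skip

/-- Array `0` holds `H`, array `1` the elements taken, array `2` their union with `H` for the
independence test, array `3` the elements seen. Real array `0` holds the weights. -/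
def greedyInitCode : Code :=
  forLoop 6 0 (setA 1 (var 6) (lit 0)⨾ setA 2 (var 6) (arr 0 (var 6))⨾ setA 3 (var 6) (lit 0))

/-- A maximum-weight independent set of the contraction by the set in array `0`. -/
def greedyCode : Code :=
  greedyInitCode⨾ forLoop 31 0 (pickCode⨾ takeCode)

/-- Exchangeability is tested by performing the exchange on the arrays `9` and `10`, asking the
independence oracle, and undoing it. The result is the last partner found, or `n` if there is none.
-/
def partnerCode : Code :=
  setN 10 (var 0)⨾
  forLoop 7 0 (cond (arr 10 (var 7)) (cond (arr 9 (var 7)) skip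
    (setA 10 (var 7) (lit 0)⨾ setA 10 (var 6) (lit 1)⨾ indep 9 10⨾
      setA 10 (var 7) (lit 1)⨾ setA 10 (var 6) (lit 0)⨾
      setA 9 (var 6) (lit 0)⨾ setA 9 (var 7) (lit 1)⨾ indep 11 9⨾
      setA 9 (var 6) (lit 1)⨾ setA 9 (var 7) (lit 0)⨾
      cond (var 9) (cond (var 11) (setN 10 (var 7)) skip) skip)) skip)

/-- One pass of swap rounding. -/
def passCode : Code :=
  forLoop 6 0 (cond (arr 9 (var 6)) (cond (arr 10 (var 6)) skip
    (setA 10 (var 6) (lit 1)⨾ indep 9 10⨾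
      cond (var 9)
        (flip 11 (.var 9)⨾ cond (var 11) skip (setA 10 (var 6) (lit 0)⨾ setA 9 (var 6) (lit 0)))
        (setA 10 (var 6) (lit 0)⨾ partnerCode⨾ flip 11 (.var 9)⨾
          cond (var 11) (setA 10 (var 10) (lit 0)⨾ setA 10 (var 6) (lit 1))
            (setA 9 (var 6) (lit 0)⨾ setA 9 (var 10) (lit 1))))) skip)

def swapCode : Code :=
  forLoop 6 0 (setN 22 (arr 9 (var 6))⨾ setA 9 (var 6) (arr 10 (var 6))⨾ setA 10 (var 6) (var 22))

/-- Merge the sets in the arrays `9` and `10`. -/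
def mergeCode : Code :=
  setX 9 (.div (.cast (var 21)) (.add (.cast (var 21)) (.cast (lit 1))))⨾ passCode⨾ swapCode⨾
  setX 9 (.div (.cast (lit 1)) (.add (.cast (var 21)) (.cast (lit 1))))⨾ passCode

/-- Thin the chosen set and move the fractional point. -/
def thinCode : Code :=
  forLoop 6 0 (setA 10 (var 6) (arr 0 (var 6)))⨾
  forLoop 6 0 (cond (arr 1 (var 6))
    (flip 9 (.sub (.cast (lit 1)) (.arr 1 (var 6)))⨾ cond (var 9) (setA 10 (var 6) (lit 1)) skip⨾
      setY 1 (var 6) (.add (.arr 1 (var 6))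
        (.mul (.var 3) (.sub (.cast (lit 1)) (.arr 1 (var 6)))))) skip)

def sampleCode : Code :=
  forLoop 6 0 (flip 9 (.arr 1 (var 6))⨾ setA 5 (var 6) (var 9))

/-- The smoothing sets are stored row after row in array `7`, and variable `16` walks through the
table, so row offsets need no multiplication. The sum of two characteristic vectors is nonzero
exactly on the union. -/
def unionCode : Code :=
  forLoop 32 0 (setA 8 (var 32) (add (arr 5 (var 32)) (arr 7 (var 16)))⨾
    setN 16 (add (var 16) (lit 1)))

/-- The sampled surrogate at the set in array `5`. -/
def surrogateCode : Code :=
  setX 4 (.cast (lit 0))⨾ setN 16 (lit 0)⨾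
  forLoop 8 1 (unionCode⨾ value 8 8⨾ setX 4 (.add (.var 4) (.var 8)))⨾
  setX 4 (.div (.var 4) (.cast (var 1)))

/-- The sample in array `5` is enlarged by one element at a time; the overwritten entry is saved in
variable `22` and put back. -/
def marginalsCode : Code :=
  surrogateCode⨾ setX 5 (.var 4)⨾
  forLoop 6 0 (setN 22 (arr 5 (var 6))⨾ setA 5 (var 6) (lit 1)⨾ surrogateCode⨾
    setA 5 (var 6) (var 22)⨾ setY 0 (var 6) (.add (.arr 0 (var 6)) (.sub (.var 4) (.var 5))))

def estimateCode : Code :=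
  forLoop 6 0 (setY 0 (var 6) (.cast (lit 0)))⨾
  forLoop 20 2 (sampleCode⨾ marginalsCode)⨾
  forLoop 6 0 (setY 0 (var 6) (.div (.arr 0 (var 6)) (.cast (var 2))))

/-- The counter `21` serves also as the weight of the current rounded set in the merge. -/
def roundsCode : Code :=
  forLoop 21 3 (estimateCode⨾ greedyCode⨾ thinCode⨾ mergeCode)

/-- Count the rows still possible that contain the current element. -/
def countRowsCode : Code :=
  setN 15 (lit 0)⨾ setN 16 (var 6)⨾
  forLoop 8 1 (cond (arr 6 (var 8)) (cond (arr 7 (var 16)) (setN 15 (add (var 15) (lit 1))) skip)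
    skip⨾ setN 16 (add (var 16) (var 0)))

def filterRowsCode : Code :=
  setN 16 (var 6)⨾
  forLoop 8 1 (cond (var 9) (cond (arr 7 (var 16)) skip (setA 6 (var 8) (lit 0)))
    (cond (arr 7 (var 16)) (setA 6 (var 8) (lit 0)) skip)⨾ setN 16 (add (var 16) (var 0)))

/-- A draw keeps, among the sets that agree with the decisions made so far: in variable `12` the
undecided elements of the ground set in array `4`, in `13` the number still to be chosen, in `14`
the forbidden rows that still agree (flagged in array `6`), and in real `6` the number of all
subsets of the right size that agree. The initial binomial coefficient is built by the recursion
over the lower index in real arithmetic. -/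
def drawInitCode : Code :=
  setN 12 (lit 0)⨾ forLoop 6 0 (cond (arr 4 (var 6)) (setN 12 (add (var 12) (lit 1))) skip)⨾
  setX 6 (.cast (lit 1))⨾
  forLoop 6 0 (cond (lt (var 6) (var 18)) (setX 6 (.div (.mul (.var 6)
    (.cast (sub (var 12) (var 6)))) (.cast (add (var 6) (lit 1))))) skip)⨾
  setN 13 (var 18)⨾ setN 14 (var 17)⨾ forLoop 8 1 (setA 6 (var 8) (lt (var 8) (var 17)))

/-- Among the subsets that still agree, the proportion containing an undecided ground element is the
number needed over the number undecided. Subtracting the forbidden rows from numerator and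
denominator gives the conditional probability for the coin. -/
def drawStepCode : Code :=
  countRowsCode⨾
  cond (arr 4 (var 6))
    (setX 7 (.div (.mul (.var 6) (.cast (var 13))) (.cast (var 12)))⨾
      setN 12 (sub (var 12) (lit 1)))
    (setX 7 (.cast (lit 0)))⨾
  flip 9 (.div (.sub (.var 7) (.cast (var 15))) (.sub (.var 6) (.cast (var 14))))⨾
  setA 5 (var 6) (var 9)⨾
  cond (var 9) (setX 6 (.var 7)⨾ setN 14 (var 15)⨾ setN 13 (sub (var 13) (lit 1)))
    (setX 6 (.sub (.var 6) (.var 7))⨾ setN 14 (sub (var 14) (var 15)))⨾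
  filterRowsCode

/-- A random subset, of the size in variable `18`, of the set in array `4`, different from the first
rows of array `7`; the number of these rows is in variable `17`. -/
def drawCode : Code := drawInitCode⨾ forLoop 6 0 drawStepCode

/-- Before each draw, variable `17` is set to the number of rows already present, which makes these
rows forbidden. -/
def drawRowsCode : Code :=
  setN 19 (lit 0)⨾
  forLoop 23 1 (setN 17 (var 23)⨾ drawCode⨾
    forLoop 6 0 (setA 7 (var 19) (arr 5 (var 6))⨾ setN 19 (add (var 19) (lit 1))))

/-- Unit weights and an empty contracted set turn the greedy routine into a search for a base. -/
def baseCode : Code :=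
  forLoop 6 0 (setA 0 (var 6) (lit 0)⨾ setY 0 (var 6) (.cast (lit 1)))⨾ greedyCode⨾
  setN 12 (lit 0)⨾
  forLoop 6 0 (setA 4 (var 6) (arr 1 (var 6))⨾ setA 11 (var 6) (lit 0)⨾
    cond (arr 1 (var 6)) (setN 12 (add (var 12) (lit 1))) skip)

def copyHCode : Code :=
  forLoop 6 0 (setA 0 (var 6) (arr 5 (var 6))⨾ setA 4 (var 6) (arr 5 (var 6))⨾
    setA 9 (var 6) (arr 5 (var 6))⨾ setY 1 (var 6) (.cast (lit 0)))

def outputCode : Code :=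
  forLoop 6 0 (cond (arr 5 (var 6)) (setA 11 (var 6) (lit 1))
    (cond (arr 0 (var 6)) skip (setA 11 (var 6) (arr 9 (var 6)))))

/-- If the base is too small, the output array `11` is left empty. The drawing routine serves three
purposes: `H` inside the base, the distinct smoothing sets inside `H`, and finally `H'`; for the
first and the last no row is forbidden. -/
def mainCode : Code :=
  baseCode⨾
  cond (lt (var 12) (var 5)) skip
    (setN 18 (var 5)⨾ setN 17 (lit 0)⨾ drawCode⨾ copyHCode⨾ setN 18 (var 4)⨾ drawRowsCode⨾
      roundsCode⨾ setN 17 (lit 0)⨾ drawCode⨾ outputCode)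

theorem mainCode_ok : mainCode.ok = true := by decide +kernel

theorem mainCode_boundsIn : mainCode.boundsIn [0, 1, 2, 3] = true := by decide +kernel

theorem mainCode_keeps : ∀ w ∈ [0, 1, 2, 3], mainCode.keepsN w = true := by decide +kernel

end Prog


/-! ### Correctness of the program: greedy algorithm and rounding -/

attribute [simp] NExp.eval RExp.eval

/-! ### Evaluation rules for the language -/

section Den
variable {n : ℕ} {M : Matroid (Fin n)} {val : Finset (Fin n) → ℝ} (a : Mem) (c d : Code)

@[simp] theorem den_skip : Code.skip.den M val a = PMF.pure a := rfl
@[simp] theorem den_setN (v : ℕ) (e : NExp) :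
    (Code.setN v e).den M val a = PMF.pure (a.setN v (e.eval n a)) := rfl
@[simp] theorem den_setA (j : ℕ) (e f : NExp) :
    (Code.setA j e f).den M val a = PMF.pure (a.setA j (e.eval n a) (f.eval n a)) := rfl
@[simp] theorem den_setX (x : ℕ) (r : RExp) :
    (Code.setX x r).den M val a = PMF.pure (a.setX x (r.eval n a)) := rfl
@[simp] theorem den_setY (j : ℕ) (e : NExp) (r : RExp) :
    (Code.setY j e r).den M val a = PMF.pure (a.setY j (e.eval n a) (r.eval n a)) := rfl
open Classical in
@[simp] theorem den_ltR (v : ℕ) (r s : RExp) : (Code.ltR v r s).den M val a =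
    PMF.pure (a.setN v (if r.eval n a < s.eval n a then 1 else 0)) := rfl
@[simp] theorem den_value (x j : ℕ) :
    (Code.value x j).den M val a = PMF.pure (a.setX x (val (a.set n j))) := rfl
open Classical in
@[simp] theorem den_indep (v j : ℕ) : (Code.indep v j).den M val a =
    PMF.pure (a.setN v (if M.Indep (↑(a.set n j) : Set (Fin n)) then 1 else 0)) := rfl
@[simp] theorem den_flip (v : ℕ) (r : RExp) : (Code.flip v r).den M val a =
    (coin (r.eval n a)).map fun b => a.setN v (if b then 1 else 0) := rfl
theorem den_seq : (c⨾ d).den M val a = (c.den M val a).bind (d.den M val) := rfl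
@[simp] theorem den_cond (e : NExp) : (Code.cond e c d).den M val a =
    if e.eval n a ≠ 0 then c.den M val a else d.den M val a := rfl
@[simp] theorem den_skip_seq : (Code.skip⨾ d).den M val a = d.den M val a := by simp [den_seq]
@[simp] theorem den_setN_seq (v : ℕ) (e : NExp) :
    (Code.setN v e⨾ d).den M val a = d.den M val (a.setN v (e.eval n a)) := by simp [den_seq]
@[simp] theorem den_setA_seq (j : ℕ) (e f : NExp) : (Code.setA j e f⨾ d).den M val a =
    d.den M val (a.setA j (e.eval n a) (f.eval n a)) := by simp [den_seq]
@[simp] theorem den_setX_seq (x : ℕ) (r : RExp) :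
    (Code.setX x r⨾ d).den M val a = d.den M val (a.setX x (r.eval n a)) := by simp [den_seq]
open Classical in
@[simp] theorem den_ltR_seq (v : ℕ) (r s : RExp) : (Code.ltR v r s⨾ d).den M val a =
    d.den M val (a.setN v (if r.eval n a < s.eval n a then 1 else 0)) := by simp [den_seq]
@[simp] theorem den_value_seq (x j : ℕ) : (Code.value x j⨾ d).den M val a =
    d.den M val (a.setX x (val (a.set n j))) := by simp [den_seq]
open Classical in
@[simp] theorem den_indep_seq (v j : ℕ) : (Code.indep v j⨾ d).den M val a =
    d.den M val (a.setN v (if M.Indep (↑(a.set n j) : Set (Fin n)) then 1 else 0)) := by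
  simp [den_seq]
@[simp] theorem den_flip_seq (v : ℕ) (r : RExp) : (Code.flip v r⨾ d).den M val a =
    (coin (r.eval n a)).bind fun b => d.den M val (a.setN v (if b then 1 else 0)) := by
  rw [den_seq, den_flip, PMF.bind_map]; rfl
@[simp] theorem den_cond_seq (e : NExp) (c' : Code) : (Code.cond e c c'⨾ d).den M val a =
    if e.eval n a ≠ 0 then (c⨾ d).den M val a else (c'⨾ d).den M val a := by
  rw [den_seq, den_cond]; split_ifs <;> rfl
@[simp] theorem den_seq_assoc (c' : Code) :
    ((c⨾ d)⨾ c').den M val a = (c⨾ d⨾ c').den M val a := by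
  rw [den_seq, den_seq, PMF.bind_bind]; rfl

end Den

namespace Mem
variable {n : ℕ} {a b : Mem} {j j' : ℕ}

theorem mem_set {i : Fin n} : i ∈ a.set n j ↔ a.A j i ≠ 0 := by simp [Mem.set]

theorem set_congr (h : b.A j = a.A j) : b.set n j = a.set n j := by simp [Mem.set, h]

@[simp] theorem set_setN (v k : ℕ) : (a.setN v k).set n j = a.set n j := rfl
@[simp] theorem set_setX (x : ℕ) (r : ℝ) : (a.setX x r).set n j = a.set n j := rfl
@[simp] theorem set_setY (i : ℕ) (r : ℝ) (l : ℕ) : (a.setY l i r).set n j = a.set n j := rfl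

theorem set_setA_of_ne (h : j' ≠ j) (i k : ℕ) : (a.setA j i k).set n j' = a.set n j' := by
  ext x; simp [mem_set, h]

@[simp] theorem set_setA_one (i : Fin n) : (a.setA j i 1).set n j = insert i (a.set n j) := by
  ext x
  simp only [mem_set, setA_A, Finset.mem_insert, Fin.ext_iff]
  by_cases h : (x : ℕ) = i <;> simp [h]

@[simp] theorem set_setA_zero (i : Fin n) : (a.setA j i 0).set n j = (a.set n j).erase i := by
  ext x
  simp only [mem_set, setA_A, Finset.mem_erase, ne_eq, Fin.ext_iff]
  by_cases h : (x : ℕ) = i <;> simp [h]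

end Mem

/-- The code of an optional element: its index, or `n` for none. -/
def encOpt {n : ℕ} : Option (Fin n) → ℕ
  | none => n
  | some i => i

theorem take_finRange_succ {n i : ℕ} (hi : i < n) :
    (List.finRange n).take (i + 1) = (List.finRange n).take i ++ [⟨i, hi⟩] := by
  rw [List.take_succ_eq_append_getElem (by simpa using hi)]
  simp

namespace Prog
open Classical
variable {n : ℕ} {M : Matroid (Fin n)} {val : Finset (Fin n) → ℝ}

theorem pickCode_spec {a : Mem} (h0 : a.N 0 = n) : Always (pickCode.den M val a) fun a' =>
    a'.N 10 = encOpt (pick (fun i => a.Y 0 i) (a.set n 3)) := by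
  rw [pickCode, den_setN_seq]
  refine (Always.forLoop rfl (fun i b => b.N 10 = encOpt (((List.finRange n).take i).foldl
    (pickStep (fun i => a.Y 0 i) (a.set n 3)) none)) (by simp [encOpt, h0]) ?_).weaken ?_
  · intro i hi b hF hbi hb
    have hb0 : b.N 0 = n := by rw [hF.N 0 rfl]; simpa using h0
    have hi : i < n := by simpa [h0] using hi
    have hA : b.A 3 = a.A 3 := hF.A 3 rfl
    have hY : b.Y 0 = a.Y 0 := hF.Y 0 rfl
    rw [take_finRange_succ hi, List.foldl_append, List.foldl_cons, List.foldl_nil]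
    generalize ((List.finRange n).take i).foldl
      (pickStep (fun i => a.Y 0 i) (a.set n 3)) none = o at hb
    have hm : (⟨i, hi⟩ : Fin n) ∈ a.set n 3 ↔ a.A 3 i ≠ 0 := Mem.mem_set
    by_cases hD : a.A 3 i = 0
    · have hm' : (⟨i, hi⟩ : Fin n) ∉ a.set n 3 := by rw [hm]; simpa using hD
      cases o with
      | none =>
        simp only [encOpt] at hb
        simp [pickStep, hA, hbi, hD, hm', hb, hb0, always_pure, encOpt]
      | some j =>
        simp only [encOpt] at hb
        by_cases hw : a.Y 0 j < a.Y 0 i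
        · simp [pickStep, hA, hY, hbi, hD, hm', hb, hb0, always_pure, encOpt, hw]
        · simp [pickStep, hA, hY, hbi, hD, hm', hb, hb0, always_pure, encOpt, hw]
    · simp [pickStep, hA, hbi, hD, hm.2 hD, hb, always_pure]
  · intro b _ hb
    simpa [h0, pick, List.take_of_length_le] using hb

/-- Array `2` is enlarged tentatively for the oracle query. On failure, erasing the element restores
it, because an element not yet seen cannot be among those taken. -/
theorem takeCode_spec {a : Mem} (h0 : a.N 0 = n) {o : Option (Fin n)}
    (ho : a.N 10 = encOpt o) (hoD : ∀ e, o = some e → e ∉ a.set n 3)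
    (hID : a.set n 1 ⊆ a.set n 3)
    (hU : a.set n 2 = a.set n 1 ∪ a.set n 0) : Always (takeCode.den M val a) fun a' =>
    (a'.set n 3, a'.set n 1) =
      greedyTake M (a.set n 0) (fun i => a.Y 0 i) (a.set n 3, a.set n 1) o ∧
    a'.set n 2 = a'.set n 1 ∪ a'.set n 0 := by
  rw [takeCode, den_cond]
  cases o with
  | none =>
    simp only [encOpt] at ho
    simp [ho, h0, always_pure, greedyTake, hU]
  | some e =>
    simp only [encOpt] at ho
    have heD := hoD e rfl
    have hm : e ∈ a.set n 0 ↔ a.A 0 e ≠ 0 := Mem.mem_set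
    by_cases hH : a.A 0 e = 0
    · have hm' : e ∉ a.set n 0 := by rw [hm]; simpa using hH
      by_cases hw : 0 < a.Y 0 e
      · by_cases hind : M.Indep (↑(insert e (a.set n 1 ∪ a.set n 0)) : Set (Fin n))
        · have hind' := hind
          rw [Finset.coe_insert, Finset.coe_union] at hind'
          simp [ho, h0, always_pure, greedyTake, hU, hm', hH, hw, hind', Mem.set_setA_of_ne]
        · have hind' := hind
          rw [Finset.coe_insert, Finset.coe_union] at hind'
          have : e ∉ a.set n 1 := fun h => heD (hID h)
          simp [ho, h0, always_pure, greedyTake, hU, hm', hH, hw, hind', Mem.set_setA_of_ne, this]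
      · simp [ho, h0, always_pure, greedyTake, hU, hm', hH, hw, Mem.set_setA_of_ne]
    · simp [ho, h0, always_pure, greedyTake, hU, hm.2 hH, hH, Mem.set_setA_of_ne]

theorem greedyCode_spec {a : Mem} (h0 : a.N 0 = n) : Always (greedyCode.den M val a) fun a' =>
    a'.set n 1 = greedySet M (a.set n 0) (fun i => a.Y 0 i) := by
  rw [greedyCode]
  have hstart : Always (greedyInitCode.den M val a) fun a' =>
      a'.set n 1 = ∅ ∧ a'.set n 2 = a.set n 0 ∧ a'.set n 3 = ∅ := by
    refine (Always.forLoop rfl (fun i b => ∀ k < i, b.A 1 k = 0 ∧ b.A 2 k = a.A 0 k ∧ b.A 3 k = 0)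
      (by simp) ?_).weaken ?_
    · intro i hi b hF hbi hb
      have hA : b.A 0 = a.A 0 := hF.A 0 rfl
      simp only [den_setA_seq, den_setA, always_pure]
      intro k hk
      rcases Nat.lt_succ_iff_lt_or_eq.1 hk with h | h
      · have := hb k h
        simp [hbi, show k ≠ i by omega, this]
      · simp [hbi, h, hA]
    · intro b _ hb
      rw [h0] at hb
      refine ⟨?_, ?_, ?_⟩ <;> ext i <;> have := hb i i.2 <;> simp [Mem.mem_set, this]
  refine Always.seq hstart fun a₁ hF₁ h₁ => ?_
  have h0₁ : a₁.N 0 = n := by rw [hF₁.N 0 rfl, h0]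
  refine (Always.forLoop rfl (fun i b => (b.set n 3, b.set n 1) =
      (greedyStep M (a.set n 0) (fun i => a.Y 0 i))^[i] (∅, ∅) ∧
      b.set n 2 = b.set n 1 ∪ b.set n 0 ∧ b.set n 1 ⊆ b.set n 3) ?_ ?_).weaken ?_
  · have : a₁.set n 0 = a.set n 0 := Mem.set_congr (hF₁.A 0 rfl)
    simp [h₁, this]
  · intro i hi b hF hbi hb
    have hb0 : b.N 0 = n := by rw [hF.N 0 rfl, h0₁]
    have hH : b.set n 0 = a.set n 0 := Mem.set_congr ((hF.A 0 rfl).trans (hF₁.A 0 rfl))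
    have hY : b.Y 0 = a.Y 0 := (hF.Y 0 rfl).trans (hF₁.Y 0 rfl)
    refine Always.seq (pickCode_spec hb0) fun b₁ hG hb₁ => ?_
    have e3 : b₁.set n 3 = b.set n 3 := Mem.set_congr (hG.A 3 rfl)
    have e2 : b₁.set n 2 = b.set n 2 := Mem.set_congr (hG.A 2 rfl)
    have e1 : b₁.set n 1 = b.set n 1 := Mem.set_congr (hG.A 1 rfl)
    have e0 : b₁.set n 0 = b.set n 0 := Mem.set_congr (hG.A 0 rfl)
    have eY : b₁.Y 0 = b.Y 0 := hG.Y 0 rfl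
    have hp := pick_spec (fun i => a.Y 0 i) (b.set n 3)
    rw [hY] at hb₁
    refine (takeCode_spec ((hG.N 0 rfl).trans hb0) hb₁ ?_ (by rw [e1, e3]; exact hb.2.2)
      (by rw [e2, e1, e0]; exact hb.2.1)).weaken ?_
    · intro e he
      rw [he] at hp
      rw [e3]
      exact hp.1
    · intro b₂ _ hb₂
      rw [e3, e1, e0, eY, hY, hH] at hb₂
      refine ⟨?_, hb₂.2, ?_⟩
      · rw [Function.iterate_succ_apply', ← hb.1]
        exact hb₂.1
      · have h3 := hb₂.1
        simp only [Mem.set_setN]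
        generalize pick (fun i => a.Y 0 i) (b.set n 3) = o at h3
        cases o with
        | none =>
          simp only [greedyTake, Prod.mk.injEq] at h3
          rw [h3.1, h3.2]; exact hb.2.2
        | some e =>
          simp only [greedyTake, Prod.mk.injEq] at h3
          rw [h3.1, h3.2]
          split_ifs
          · exact Finset.insert_subset_insert _ hb.2.2
          · exact hb.2.2.trans (Finset.subset_insert _ _)
  · intro b _ hb
    rw [h0₁] at hb
    rw [greedySet, ← hb.1]

end Prog


theorem Sim.bind_map {A B Y : Type} {μ : PMF A} {κ : A → PMF B} {f : A → Y}
    {R : Y → B → Prop} (h : ∀ a ∈ μ.support, Always (κ a) (R (f a))) :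
    Sim (μ.bind κ) (μ.map f) R := by
  rw [← PMF.bind_pure_comp]
  refine Sim.bind (Sim.refl μ) fun x hx a _ hax => ?_
  subst hax
  exact Sim.of_always (h _ hx)

/-! ### Swap rounding as executed by the program -/

namespace Prog
open Classical
variable {n : ℕ} {M : Matroid (Fin n)} {val : Finset (Fin n) → ℝ}

theorem partnerCode_spec {a : Mem} (h0 : a.N 0 = n) {i : Fin n} (h6 : a.N 6 = i)
    (hi9 : i ∈ a.set n 9) (hi10 : i ∉ a.set n 10) : Always (partnerCode.den M val a) fun a' =>
    a'.N 10 = encOpt (partner M (a.set n 9) (a.set n 10) i) ∧ a'.set n 9 = a.set n 9 ∧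
      a'.set n 10 = a.set n 10 := by
  rw [partnerCode, den_setN_seq]
  refine (Always.forLoop rfl (fun k b => b.N 10 = encOpt (((List.finRange n).take k).foldl
    (fun b j => if Exchangeable M (a.set n 9) (a.set n 10) i j then some j else b) none) ∧
    b.set n 9 = a.set n 9 ∧ b.set n 10 = a.set n 10) (by simp [encOpt, h0]) ?_).weaken ?_
  · intro k hk b hF hbk hb
    have hk : k < n := by simpa [h0] using hk
    obtain ⟨j, rfl⟩ : ∃ j : Fin n, (j : ℕ) = k := ⟨⟨k, hk⟩, rfl⟩
    have hb6 : b.N 6 = i := by rw [hF.N 6 rfl]; simpa using h6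
    rw [take_finRange_succ hk, List.foldl_append, List.foldl_cons, List.foldl_nil]
    obtain ⟨hb1, hb9, hb10⟩ := hb
    generalize ((List.finRange n).take j).foldl
      (fun b j => if Exchangeable M (a.set n 9) (a.set n 10) i j then some j else b) none = o
      at hb1
    have m10 : j ∈ a.set n 10 ↔ b.A 10 j ≠ 0 := by rw [← hb10, Mem.mem_set]
    have m9 : j ∈ a.set n 9 ↔ b.A 9 j ≠ 0 := by rw [← hb9, Mem.mem_set]
    by_cases hjQ : j ∈ a.set n 10
    · by_cases hjP : j ∈ a.set n 9
      · have : ¬ Exchangeable M (a.set n 9) (a.set n 10) i j := fun h => h.2.1 hjP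
        simp [hbk, m10.1 hjQ, m9.1 hjP, always_pure, this, hb1, hb9, hb10]
      · have hij : i ≠ j := fun h => hjP (h ▸ hi9)
        -- Undoing the trial exchange restores both sets exactly, since `i` is not in the second set
        -- and `j` is not in the first.
        have r10 : (insert j (insert i ((a.set n 10).erase j))).erase i = a.set n 10 := by
          ext y; simp only [Finset.mem_erase, Finset.mem_insert]
          constructor
          · rintro ⟨h1, rfl | rfl | h⟩
            exacts [hjQ, absurd rfl h1, h.2]
          · intro h
            refine ⟨fun h' => hi10 (h' ▸ h), ?_⟩
            by_cases hy : y = j <;> tauto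
        have r9 : (insert i (insert j ((a.set n 9).erase i))).erase j = a.set n 9 := by
          ext y; simp only [Finset.mem_erase, Finset.mem_insert]
          constructor
          · rintro ⟨h1, rfl | rfl | h⟩
            exacts [hi9, absurd rfl h1, h.2]
          · intro h
            refine ⟨fun h' => hjP (h' ▸ h), ?_⟩
            by_cases hy : y = i <;> tauto
        have c10 : b.A 10 j ≠ 0 := m10.1 hjQ
        have c9 : b.A 9 j = 0 := by simpa [m9] using hjP
        simp only [den_cond, den_setA_seq, den_indep_seq, NExp.eval, Mem.setN_A, hbk, c10, c9,
          Mem.setA_N, Mem.setN_N, hb6, Mem.set_setA_one, Mem.set_setA_zero, Mem.set_setN, hb9, hb10,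
          Mem.set_setA_of_ne (show (9 : ℕ) ≠ 10 by decide),
          Mem.set_setA_of_ne (show (10 : ℕ) ≠ 9 by decide), r9, r10, ne_eq, not_true_eq_false,
          not_false_eq_true, if_true, if_false]
        by_cases i1 : M.Indep (↑(insert i ((a.set n 10).erase j)) : Set (Fin n))
        · by_cases i2 : M.Indep (↑(insert j ((a.set n 9).erase i)) : Set (Fin n))
          · rw [if_pos (show Exchangeable M (a.set n 9) (a.set n 10) i j from
              ⟨hjQ, hjP, i2, i1⟩)]
            rw [Finset.coe_insert, Finset.coe_erase] at i1 i2
            simp [i1, i2, always_pure, hbk, encOpt, Mem.set_setA_of_ne, hb9, hb10, r9, r10]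
          · rw [if_neg (fun h : Exchangeable M (a.set n 9) (a.set n 10) i j => i2 h.2.2.1)]
            rw [Finset.coe_insert, Finset.coe_erase] at i1 i2
            simp [i1, i2, always_pure, Mem.set_setA_of_ne, hb9, hb10, r9, r10, hb1]
        · rw [if_neg (fun h : Exchangeable M (a.set n 9) (a.set n 10) i j => i1 h.2.2.2)]
          rw [Finset.coe_insert, Finset.coe_erase] at i1
          simp [i1, always_pure, Mem.set_setA_of_ne, hb9, hb10, r9, r10, hb1]
    · have : ¬ Exchangeable M (a.set n 9) (a.set n 10) i j := fun h => hjQ h.1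
      have c10 : b.A 10 j = 0 := by simpa [m10] using hjQ
      simp [hbk, c10, always_pure, this, hb1, hb9, hb10]
  · intro b _ hb
    simpa [h0, partner, List.take_of_length_le] using hb

/-- Independence of both sets is part of the simulation relation because it guarantees that the
partner search succeeds: the code treats the value of variable `10` as an element without checking.
-/
theorem passCode_spec (hE : M.E = Set.univ) {a : Mem} (h0 : a.N 0 = n)
    (hP : M.Indep (↑(a.set n 9) : Set (Fin n))) (hQ : M.Indep (↑(a.set n 10) : Set (Fin n))) :
    Sim (passCode.den M val a)
      (foldP (passStep M (a.X 9)) (List.finRange n) (a.set n 9, a.set n 10))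
      (fun s a' => a'.set n 9 = s.1 ∧ a'.set n 10 = s.2 ∧ M.Indep (↑s.1 : Set (Fin n)) ∧
        M.Indep (↑s.2 : Set (Fin n))) := by
  rw [passCode]
  refine (Sim.forLoop rfl (List.finRange n) (by simp [h0]) _
    (fun (_ : ℕ) (s : Finset (Fin n) × Finset (Fin n)) (b : Mem) => b.set n 9 = s.1 ∧ b.set n 10 = s.2 ∧ M.Indep (↑s.1 : Set (Fin n)) ∧
        M.Indep (↑s.2 : Set (Fin n))) (by simp [hP, hQ]) ?_)
  rintro k hk ⟨P, Q⟩ b hF hbk ⟨hb9, hb10, hiP, hiQ⟩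
  have hk : k < n := by simpa using hk
  obtain ⟨i, rfl⟩ : ∃ j : Fin n, (j : ℕ) = k := ⟨⟨k, hk⟩, rfl⟩
  have hb0 : b.N 0 = n := by rw [hF.N 0 rfl, h0]
  have hX : b.X 9 = a.X 9 := hF.X 9 rfl
  simp only [List.getElem_finRange, Fin.cast_mk, Fin.eta]
  simp only at hb9 hb10 hiP hiQ
  have m10 : i ∈ Q ↔ b.A 10 i ≠ 0 := by rw [← hb10, Mem.mem_set]
  have m9 : i ∈ P ↔ b.A 9 i ≠ 0 := by rw [← hb9, Mem.mem_set]
  unfold passStep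
  by_cases h9 : i ∈ P
  · by_cases h10 : i ∈ Q
    · rw [if_neg (by tauto)]
      refine Sim.of_always ?_
      simp [hbk, m9.1 h9, m10.1 h10, always_pure, hb9, hb10, hiP, hiQ]
    · rw [if_pos (by tauto)]
      have c9 := m9.1 h9
      have c10 : b.A 10 i = 0 := by simpa [m10] using h10
      simp only [den_cond, den_setA_seq, den_indep_seq, NExp.eval, hbk, c10, c9, Mem.setN_N,
        Mem.setA_N, Mem.set_setA_one, hb10, ne_eq, not_true_eq_false, not_false_eq_true, if_true,
        if_false]
      by_cases hind : M.Indep (↑(insert i Q) : Set (Fin n))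
      · simp only [if_pos hind, one_ne_zero, not_false_eq_true, if_true, den_flip_seq, RExp.eval, Mem.setN_X, Mem.setA_X, hX]
        refine Sim.bind_map fun c _ => ?_
        cases c
        · have : M.Indep (↑(P.erase i) : Set (Fin n)) := hiP.subset (by simp)
          rw [Finset.coe_erase] at this
          simp [always_pure, hbk, hb9, hb10, hiQ, Mem.set_setA_of_ne, h10, this]
        · rw [Finset.coe_insert] at hind
          simp [always_pure, hbk, hb9, hb10, hiP, Mem.set_setA_of_ne, hind]
      · simp only [if_neg hind, not_true_eq_false, if_false]
        obtain ⟨j, hj, hjQ, hjP, hind1, hind2⟩ := partner_spec hE hiP hiQ h9 h10 hind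
        simp only [hj]
        have es10 : (insert i Q).erase i = Q := Finset.erase_insert h10
        refine Sim.seq_always (partnerCode_spec (i := i) ?_ ?_ ?_ ?_) fun b' hF' hb' => ?_
        · simp [hb0]
        · simp [hbk]
        · simp [hbk, Mem.set_setA_of_ne, hb9, h9]
        · simp [hbk]
        · obtain ⟨g1, g9, g10⟩ := hb'
          simp only [hbk, Mem.set_setN, Mem.set_setA_one, hb10, es10, hb9, hj, NExp.eval,
            Mem.setN_N, Mem.setA_N, Mem.set_setA_zero, encOpt, if_false,
            Nat.reduceEqDiff, Mem.set_setA_of_ne (show (9 : ℕ) ≠ 10 by decide)] at g1 g9 g10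
          have g6 : b'.N 6 = i := by rw [hF'.N 6 rfl]; simp [hbk]
          have gX : b'.X 9 = a.X 9 := by rw [hF'.X 9 rfl]; simpa using hX
          rw [den_flip_seq]
          simp only [RExp.eval, gX]
          refine Sim.bind_map fun c _ => ?_
          rw [Finset.coe_insert, Finset.coe_erase] at hind1 hind2
          cases c
          · simp [always_pure, g1, g6, g9, g10, Mem.set_setA_of_ne, hind1, hiQ]
          · simp [always_pure, g1, g6, g9, g10, Mem.set_setA_of_ne, hind2, hiP]
  · rw [if_neg (by tauto)]
    refine Sim.of_always ?_
    have c9 : b.A 9 i = 0 := by simpa [m9] using h9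
    simp [hbk, c9, always_pure, hb9, hb10, hiP, hiQ]

theorem swapCode_spec {a : Mem} (h0 : a.N 0 = n) : Always (swapCode.den M val a) fun a' =>
    a'.set n 9 = a.set n 10 ∧ a'.set n 10 = a.set n 9 := by
  rw [swapCode]
  refine (Always.forLoop rfl (fun i b => ∀ k, (k < i → b.A 9 k = a.A 10 k ∧ b.A 10 k = a.A 9 k) ∧
    (i ≤ k → b.A 9 k = a.A 9 k ∧ b.A 10 k = a.A 10 k)) (by simp) ?_).weaken ?_
  · intro i hi b hF hbi hb
    simp only [den_setN_seq, den_setA_seq, den_setA, always_pure]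
    intro k
    have hk := hb k
    constructor
    · intro h
      rcases Nat.lt_succ_iff_lt_or_eq.1 h with h | h
      · simp [hbi, show k ≠ i by omega, hk.1 h]
      · subst h; simp [hbi, hk.2 le_rfl]
    · intro h
      simp [hbi, show k ≠ i by omega, hk.2 (by omega)]
  · intro b _ hb
    rw [h0] at hb
    constructor <;> ext i <;> simp [Mem.mem_set, (hb i).1 i.2]

theorem mergeCode_spec (hE : M.E = Set.univ) {a : Mem} (h0 : a.N 0 = n)
    (hP : M.Indep (↑(a.set n 9) : Set (Fin n))) (hQ : M.Indep (↑(a.set n 10) : Set (Fin n))) :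
    Sim (mergeCode.den M val a) (mergeSets M (a.N 21) (a.set n 9) (a.set n 10))
      (fun P a' => a'.set n 9 = P ∧ M.Indep (↑P : Set (Fin n))) := by
  rw [mergeCode, den_setX_seq, mergeSets]
  have h1 := passCode_spec (M := M) (val := val) hE
    (a := a.setX 9 ((RExp.div (.cast (.var 21)) (.add (.cast (.var 21)) (.cast (.lit 1)))).eval n a))
    (by simpa using h0) (by simpa using hP) (by simpa using hQ)
  simp only [Mem.set_setX, Mem.setX_X, if_true, RExp.eval, NExp.eval, Nat.cast_one] at h1 ⊢
  refine Sim.seq h1 fun s _ b hF ⟨hb9, hb10, hi1, hi2⟩ => ?_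
  have hb0 : b.N 0 = n := by rw [hF.N 0 rfl]; simpa using h0
  refine Sim.seq_always (swapCode_spec hb0) fun b' hF' ⟨hb9', hb10'⟩ => ?_
  have hb0' : b'.N 0 = n := by rw [hF'.N 0 rfl, hb0]
  have hl : b'.N 21 = a.N 21 := by rw [hF'.N 21 rfl, hF.N 21 rfl]; simp
  rw [den_setX_seq]
  have h2 := passCode_spec (M := M) (val := val) hE
    (a := b'.setX 9 ((RExp.div (.cast (.lit 1)) (.add (.cast (.var 21))
      (.cast (.lit 1)))).eval n b'))
    (by simpa using hb0') (by simpa [hb9', hb10] using hi2) (by simpa [hb10', hb9] using hi1)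
  simp only [Mem.set_setX, Mem.setX_X, if_true, RExp.eval, NExp.eval, Nat.cast_one, hl, hb9',
    hb10', hb9, hb10] at h2 ⊢
  exact h2.map_right Prod.fst fun s _ b _ h => ⟨h.1, h.2.2.1⟩

/-- Starting from `H`, thinning stays inside `I ∪ H`, hence produces an independent set for the
merge. -/
theorem foldP_thinStep_support {x : Fin n → ℝ} {I : Finset (Fin n)} (L : List (Fin n))
    (J : Finset (Fin n)) : ∀ J' ∈ (foldP (thinStep x I) L J).support, J' ⊆ I ∪ J := by
  induction L generalizing J with
  | nil =>
    intro J' h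
    simp only [foldP, PMF.support_pure, Set.mem_singleton_iff] at h
    rw [h]; exact Finset.subset_union_right
  | cons i L ih =>
    intro J' hJ'
    rw [foldP, PMF.mem_support_bind_iff] at hJ'
    obtain ⟨J₁, h1, h2⟩ := hJ'
    refine (ih J₁ J' h2).trans (Finset.union_subset Finset.subset_union_left ?_)
    unfold thinStep at h1
    split_ifs at h1 with hi
    · rw [PMF.support_map] at h1
      obtain ⟨b, -, rfl⟩ := h1
      simp only
      split_ifs
      · exact Finset.insert_subset (Finset.mem_union_left _ hi) Finset.subset_union_right
      · exact Finset.subset_union_right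
    · simp only [PMF.support_pure, Set.mem_singleton_iff] at h1
      rw [h1]; exact Finset.subset_union_right

/-- One pass does both tasks: each coordinate is used for its thinning coin before it is updated,
and no other iteration touches it. -/
theorem thinCode_spec {a : Mem} (h0 : a.N 0 = n) :
    Sim (thinCode.den M val a)
      (foldP (thinStep (fun i => a.Y 1 i) (a.set n 1)) (List.finRange n) (a.set n 0))
      (fun J a' => a'.set n 10 = J ∧ ∀ i : Fin n, a'.Y 1 i =
        a.Y 1 i + a.X 3 * (1 - a.Y 1 i) * indicator (a.set n 1) i) := by
  rw [thinCode]
  have hcopy : Always ((Code.forLoop 6 0 (.setA 10 (.var 6) (.arr 0 (.var 6)))).den M val a)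
      fun b => b.set n 10 = a.set n 0 := by
    refine (Always.forLoop rfl (fun i b => ∀ k < i, b.A 10 k = a.A 0 k) (by simp) ?_).weaken ?_
    · intro i hi b hF hbi hb
      simp only [den_setA, always_pure]
      intro k hk
      rcases Nat.lt_succ_iff_lt_or_eq.1 hk with h | h
      · simp [hbi, show k ≠ i by omega, hb k h]
      · simp [hbi, h, hF.A 0 rfl]
    · intro b _ hb
      rw [h0] at hb
      ext i; simp [Mem.mem_set, hb i i.2]
  refine Sim.seq_always hcopy fun a₁ hF₁ h₁ => ?_
  have h10 : a₁.N 0 = n := by rw [hF₁.N 0 rfl, h0]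
  refine (Sim.forLoop rfl (List.finRange n) (by simp [h10]) _ (fun k J b => b.set n 10 = J ∧
    ∀ i : Fin n, b.Y 1 i = if (i : ℕ) < k then
      a.Y 1 i + a.X 3 * (1 - a.Y 1 i) * indicator (a.set n 1) i else a.Y 1 i)
    ⟨by simpa using h₁, fun i => by simp [hF₁.Y 1 rfl]⟩ ?_).weaken ?_
  · rintro k hk J b hF hbk ⟨hb10, hbY⟩
    have hk : k < n := by simpa using hk
    obtain ⟨i, rfl⟩ : ∃ j : Fin n, (j : ℕ) = k := ⟨⟨k, hk⟩, rfl⟩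
    simp only [List.getElem_finRange, Fin.cast_mk, Fin.eta]
    have hA1 : b.A 1 = a.A 1 := (hF.A 1 rfl).trans (hF₁.A 1 rfl)
    have hX : b.X 3 = a.X 3 := (hF.X 3 rfl).trans (hF₁.X 3 rfl)
    have hYi : b.Y 1 i = a.Y 1 i := by rw [hbY]; simp
    have m1 : i ∈ a.set n 1 ↔ a.A 1 i ≠ 0 := Mem.mem_set
    have other : ∀ i' : Fin n, i' ≠ i → ((i' : ℕ) < i + 1 ↔ (i' : ℕ) < i) := by
      intro i' h
      have : (i' : ℕ) ≠ i := fun h' => h (Fin.ext h')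
      omega
    unfold thinStep
    by_cases hi : i ∈ a.set n 1
    · rw [if_pos hi]
      simp only [den_cond, NExp.eval, hbk, hA1, m1.1 hi, ne_eq, not_false_eq_true, if_true,
        den_flip_seq, RExp.eval, hYi, Nat.cast_one]
      refine Sim.bind_map fun c _ => ?_
      have fin : ∀ i' : Fin n, (if (i' : ℕ) = i then a.Y 1 i + a.X 3 * (1 - a.Y 1 i) else b.Y 1 i')
          = if (i' : ℕ) < i + 1 then
      a.Y 1 i' + a.X 3 * (1 - a.Y 1 i') * indicator (a.set n 1) i' else a.Y 1 i' := by
        intro i'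
        by_cases h : i' = i
        · subst h; simp [indicator, hi]
        · rw [if_neg (fun h' => h (Fin.ext h')), hbY]
          simp only [other i' h]
      cases c
      · simp [always_pure, hbk, hb10, hYi, hX, fin]
      · simp [always_pure, hbk, hb10, hYi, hX, fin]
    · rw [if_neg hi]
      have c1 : a.A 1 i = 0 := by simpa [m1] using hi
      refine Sim.of_always ?_
      simp only [den_cond, NExp.eval, hbk, hA1, c1, ne_eq, not_true_eq_false, if_false, den_skip,
        always_pure, Mem.set_setN, Mem.setN_Y]
      refine ⟨hb10, fun i' => ?_⟩
      by_cases h : i' = i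
      · subst h; simp [indicator, hi, hYi]
      · rw [hbY]; simp only [other i' h]
  · rintro J _ b _ ⟨h1, h2⟩
    exact ⟨h1, fun i => by rw [h2]; simp⟩

end Prog


/-! ### Correctness of the program: the rounds of continuous greedy -/

/-- Processing samples as they are drawn has the same law as drawing the whole list first and
folding over it. -/
theorem foldP_iid {β X : Type} (μ : PMF β) (u : X → β → X) {γ : Type} (L : List γ) (x : X) :
    foldP (fun _ x => μ.map (u x)) L x = (iid μ L.length).map fun Rs => Rs.foldl u x := by
  induction L generalizing x with
  | nil => simp [foldP, iid, PMF.pure_map]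
  | cons c L ih =>
    rw [foldP, PMF.bind_map, List.length_cons, iid, PMF.map_bind]
    congr 1
    funext b
    simp only [Function.comp_apply, ih, PMF.map_comp]
    rfl

/-- Row `e` of the table in array `7`. -/
def Mem.row (n : ℕ) (a : Mem) (e : ℕ) : Finset (Fin n) :=
  Finset.univ.filter fun i => a.A 7 (e * n + i) ≠ 0

@[simp] theorem Mem.row_setN {n : ℕ} (a : Mem) (v x : ℕ) : (a.setN v x).row n = a.row n := rfl

/-- The average over the first rows of the table. -/
def rowAverage {n : ℕ} (val : Finset (Fin n) → ℝ) (a : Mem) (S : Finset (Fin n)) : ℝ :=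
  (∑ e ∈ Finset.range (a.N 1), val (S ∪ a.row n e)) / a.N 1

theorem Mem.row_congr {n : ℕ} {a b : Mem} (h : b.A 7 = a.A 7) (e : ℕ) :
    b.row n e = a.row n e := by simp [Mem.row, h]

theorem rowAverage_congr {n : ℕ} {val : Finset (Fin n) → ℝ} {a b : Mem} (h : b.A 7 = a.A 7)
    (h1 : b.N 1 = a.N 1) : rowAverage val b = rowAverage val a := by
  funext S
  simp [rowAverage, Mem.row_congr h, h1]

namespace Prog
open Classical
variable {n : ℕ} {M : Matroid (Fin n)} {val : Finset (Fin n) → ℝ}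

theorem foldP_randomSubset (x : Fin n → ℝ) (L : List (Fin n)) (R : Finset (Fin n)) :
    foldP (fun i R => (coin (x i)).map fun b => if b then insert i R else R) L R =
      (randomSubset x L).map fun R' => R' ∪ R := by
  induction L generalizing R with
  | nil => simp [foldP, randomSubset, PMF.pure_map]
  | cons i L ih =>
    rw [foldP, PMF.bind_map, randomSubset, PMF.map_bind]
    congr 1
    funext b
    simp only [Function.comp_apply, ih, PMF.map_comp]
    congr 1
    funext R'
    cases b <;> simp [Finset.insert_union, Finset.union_insert]

theorem sampleCode_spec {a : Mem} (h0 : a.N 0 = n) :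
    Sim (sampleCode.den M val a) (randomSubset (fun i => a.Y 1 i) (List.finRange n))
      (fun R a' => a'.set n 5 = R) := by
  have e := foldP_randomSubset (fun i : Fin n => a.Y 1 i) (List.finRange n) ∅
  simp only [Finset.union_empty] at e
  rw [show (fun R : Finset (Fin n) => R) = id from rfl, PMF.map_id] at e
  rw [← e, sampleCode]
  refine (Sim.forLoop rfl (List.finRange n) (by simp [h0]) _
    (fun (k : ℕ) (R : Finset (Fin n)) (b : Mem) => ∀ i : Fin n, i ∈ R ↔
      (i : ℕ) < k ∧ b.A 5 i ≠ 0) (by simp) ?_).weaken ?_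
  · intro k hk R b hF hbk hb
    have hk : k < n := by simpa using hk
    obtain ⟨i, rfl⟩ : ∃ j : Fin n, (j : ℕ) = k := ⟨⟨k, hk⟩, rfl⟩
    simp only [List.getElem_finRange, Fin.cast_mk, Fin.eta]
    have hY : b.Y 1 = a.Y 1 := hF.Y 1 rfl
    rw [den_flip_seq]
    simp only [RExp.eval, NExp.eval, hY, hbk]
    refine Sim.bind_map fun c _ => ?_
    have key : ∀ i' : Fin n, i' ≠ i → ((i' : ℕ) < i + 1 ↔ (i' : ℕ) < i) ∧ (i' : ℕ) ≠ i := by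
      intro i' h
      have : (i' : ℕ) ≠ i := fun h' => h (Fin.ext h')
      omega
    simp only [den_setA, always_pure, NExp.eval]
    intro i'
    by_cases h : i' = i
    · subst h
      have := hb i'
      cases c <;> simp [hbk, this]
    · have := hb i'
      obtain ⟨h1, h2⟩ := key i' h
      cases c <;> simp [hbk, this, h1, h2, h]
  · intro R _ b _ hb
    ext i
    rw [Mem.mem_set, hb i]
    simp

theorem unionCode_spec {a : Mem} (h0 : a.N 0 = n) {e : ℕ} (h16 : a.N 16 = e * n) :
    Always (unionCode.den M val a) fun a' =>
      a'.set n 8 = a.set n 5 ∪ a.row n e ∧ a'.N 16 = (e + 1) * n := by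
  rw [unionCode]
  refine (Always.forLoop rfl (fun k b => b.N 16 = e * n + k ∧
    ∀ i < k, b.A 8 i = a.A 5 i + a.A 7 (e * n + i)) (by simp [h16]) ?_).weaken ?_
  · rintro k hk b hF hbk ⟨hb1, hb2⟩
    simp only [den_setA_seq, den_setN, always_pure, NExp.eval]
    refine ⟨by simp [hb1]; ring, fun i hi => ?_⟩
    rcases Nat.lt_succ_iff_lt_or_eq.1 hi with h | h
    · simp [hbk, show i ≠ k by omega, hb2 i h]
    · simp [hbk, h, hb1, hF.A 5 rfl, hF.A 7 rfl]
  · rintro b _ ⟨hb1, hb2⟩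
    rw [h0] at hb1 hb2
    refine ⟨?_, by rw [hb1]; ring⟩
    ext i
    simp only [Mem.mem_set, Finset.mem_union, Mem.row, Finset.mem_filter, Finset.mem_univ,
      true_and, hb2 i i.2]
    omega

theorem surrogateCode_spec {a : Mem} (h0 : a.N 0 = n) :
    Always (surrogateCode.den M val a) fun a' =>
      a'.X 4 = rowAverage val a (a.set n 5) := by
  rw [surrogateCode, den_setX_seq, den_setN_seq]
  simp only [RExp.eval, NExp.eval]
  refine Always.seq (Always.forLoop rfl (fun k b => b.N 16 = k * n ∧
    b.X 4 = ∑ e ∈ Finset.range k, val (a.set n 5 ∪ a.row n e)) (by simp) ?_) ?_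
  · rintro k hk b hF hbk ⟨hb1, hb2⟩
    have hb0 : b.N 0 = n := by rw [hF.N 0 rfl]; simpa using h0
    refine Always.seq (unionCode_spec hb0 hb1) fun b' hF' hb' => ?_
    simp only [den_value_seq, den_setX, always_pure, RExp.eval]
    have e5 : b.A 5 = a.A 5 := hF.A 5 rfl
    have e7 : b.A 7 = a.A 7 := hF.A 7 rfl
    simp [hb'.2, Finset.sum_range_succ, hF'.X 4 rfl, hb2, hb'.1, Mem.set_congr e5,
      Mem.row_congr e7]
  · rintro b hF ⟨hb1, hb2⟩
    have h1 : b.N 1 = a.N 1 := by rw [hF.N 1 rfl]; simp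
    simp [always_pure, rowAverage, hb2, h1]

theorem marginalsCode_spec {a : Mem} (h0 : a.N 0 = n) :
    Always (marginalsCode.den M val a) fun a' => ∀ i : Fin n, a'.Y 0 i = a.Y 0 i +
      (rowAverage val a (insert i (a.set n 5)) - rowAverage val a (a.set n 5)) := by
  rw [marginalsCode]
  refine Always.seq (surrogateCode_spec h0) fun a₁ hF₁ h₁ => ?_
  rw [den_setX_seq]
  simp only [RExp.eval, h₁]
  refine (Always.forLoop rfl (fun k b => (∀ i, b.A 5 i = a.A 5 i) ∧ ∀ i : Fin n, b.Y 0 i =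
    if (i : ℕ) < k then a.Y 0 i +
      (rowAverage val a (insert i (a.set n 5)) - rowAverage val a (a.set n 5))
    else a.Y 0 i) (by simp [hF₁.A 5 rfl, hF₁.Y 0 rfl]) ?_).weaken ?_
  · rintro k hk b hF hbk ⟨hb5, hbY⟩
    have hk : k < n := by simpa [hF₁.N 0 rfl, h0] using hk
    obtain ⟨i, rfl⟩ : ∃ j : Fin n, (j : ℕ) = k := ⟨⟨k, hk⟩, rfl⟩
    have hb0 : b.N 0 = n := by rw [hF.N 0 rfl]; simpa [hF₁.N 0 rfl] using h0
    simp only [den_setN_seq, den_setA_seq, NExp.eval]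
    refine Always.seq (surrogateCode_spec (by simpa using hb0)) fun b' hF' hb' => ?_
    have e7 : b.A 7 = a.A 7 := (hF.A 7 rfl).trans (hF₁.A 7 rfl)
    have e1 : b.N 1 = a.N 1 := by rw [hF.N 1 rfl]; simp [hF₁.N 1 rfl]
    have e5 : b.A 5 = a.A 5 := funext hb5
    rw [rowAverage_congr (a := a) (by funext j; simp [e7]) (by simp [e1])] at hb'
    simp only [Mem.setN_N, hbk, Mem.set_setA_one, Mem.set_setN, Mem.set_congr e5, if_false,
      Nat.reduceEqDiff] at hb'
    have f6 : b'.N 6 = i := by rw [hF'.N 6 rfl]; simp [hbk]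
    have f22 : b'.N 22 = a.A 5 i := by rw [hF'.N 22 rfl]; simp [hbk, hb5]
    have f5 : b'.A 5 = (b.setA 5 i 1).A 5 := by rw [hF'.A 5 rfl]; funext j; simp [hbk]
    have fY : b'.Y 0 = b.Y 0 := by rw [hF'.Y 0 rfl]; simp
    have fX : b'.X 5 = rowAverage val a (a.set n 5) := by
      rw [hF'.X 5 rfl]; simp [hF.X 5 rfl]
    simp only [den_setA_seq, den_setY, always_pure, NExp.eval, RExp.eval]
    refine ⟨fun j => ?_, fun j => ?_⟩
    · by_cases h : j = i
      · simp [h, f6, f22]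
      · simp [h, f6, f5, hb5]
    · by_cases h : j = i
      · subst h
        simp [f6, fY, hb', fX, hbY]
      · have : (j : ℕ) ≠ i := fun h' => h (Fin.ext h')
        have h3 : ((j : ℕ) < i + 1 ↔ (j : ℕ) < i) := by omega
        simp [f6, fY, this, h3, hbY]
  · rintro b _ ⟨_, hb⟩ i
    rw [hb]
    simp [hF₁.N 0 rfl, h0]

theorem foldl_marginals (g : Finset (Fin n) → ℝ) (Rs : List (Finset (Fin n))) (w : Fin n → ℝ) :
    Rs.foldl (fun w R i => w i + (g (insert i R) - g R)) w =
      fun i => w i + (Rs.map fun R => g (insert i R) - g R).sum := by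
  induction Rs generalizing w with
  | nil => simp
  | cons R Rs ih =>
    rw [List.foldl_cons, ih]
    funext i
    simp [add_assoc]

theorem estimateCode_spec {a : Mem} (h0 : a.N 0 = n) :
    Sim (estimateCode.den M val a)
      ((iid (randomSubset (fun i => a.Y 1 i) (List.finRange n)) (a.N 2)).map
        (estimate (rowAverage val a) (a.N 2)))
      (fun w a' => ∀ i : Fin n, a'.Y 0 i = w i) := by
  rw [estimateCode]
  have hclear : Always ((Code.forLoop 6 0 (.setY 0 (.var 6) (.cast (.lit 0)))).den M val a)
      fun b => ∀ i : Fin n, b.Y 0 i = 0 := by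
    refine (Always.forLoop rfl (fun k b => ∀ i < k, b.Y 0 i = 0) (by simp) ?_).weaken ?_
    · intro k hk b hF hbk hb
      simp only [den_setY, always_pure]
      intro i hi
      rcases Nat.lt_succ_iff_lt_or_eq.1 hi with h | h
      · simp [hbk, show i ≠ k by omega, hb i h]
      · simp [hbk, h]
    · intro b _ hb i
      exact hb i (by rw [h0]; exact i.2)
  refine Sim.seq_always hclear fun a₁ hF₁ h₁ => ?_
  have g0 : a₁.N 0 = n := by rw [hF₁.N 0 rfl, h0]
  -- The code accumulates sums of marginals while sampling and divides once at the end.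
  have hs : (iid (randomSubset (fun i : Fin n => a.Y 1 i) (List.finRange n)) (a.N 2)).map
        (estimate (rowAverage val a) (a.N 2)) =
      (foldP (fun _ w => (randomSubset (fun i : Fin n => a.Y 1 i) (List.finRange n)).map
        fun R i => w i + (rowAverage val a (insert i R) - rowAverage val a R))
        (List.range (a.N 2)) (fun _ => 0)).bind
          fun w => PMF.pure fun i => w i / (a.N 2 : ℝ) := by
    rw [foldP_iid, List.length_range, PMF.bind_map, ← PMF.bind_pure_comp]
    congr 1
    funext Rs
    simp only [Function.comp_apply, foldl_marginals]
    congr 1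
    funext i
    simp [estimate]
  rw [hs]
  refine Sim.seq (R := fun (w : Fin n → ℝ) b => ∀ i : Fin n, b.Y 0 i = w i) ?_ ?_
  · refine Sim.forLoop rfl (List.range (a.N 2)) (by simp [hF₁.N 2 rfl]) _
      (fun _ (w : Fin n → ℝ) b => ∀ i : Fin n, b.Y 0 i = w i) (by simpa using h₁) ?_
    intro k hk w b hF hbk hb
    have hb0 : b.N 0 = n := by rw [hF.N 0 rfl, g0]
    have hY : b.Y 1 = a.Y 1 := (hF.Y 1 rfl).trans (hF₁.Y 1 rfl)
    rw [← PMF.bind_pure_comp]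
    have hsm := sampleCode_spec (M := M) (val := val) hb0
    rw [hY] at hsm
    refine Sim.seq hsm fun R _ b' hF' hb' => ?_
    have hb0' : b'.N 0 = n := by rw [hF'.N 0 rfl, hb0]
    refine Sim.of_always ((marginalsCode_spec hb0').weaken fun c _ hc i => ?_)
    have e7 : b'.A 7 = a.A 7 := (hF'.A 7 rfl).trans ((hF.A 7 rfl).trans (hF₁.A 7 rfl))
    have e1 : b'.N 1 = a.N 1 := (hF'.N 1 rfl).trans ((hF.N 1 rfl).trans (hF₁.N 1 rfl))
    rw [rowAverage_congr e7 e1, hb'] at hc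
    simp [hc, hF'.Y 0 rfl, hb]
  · intro w _ b hF hb
    have hb0 : b.N 0 = n := by rw [hF.N 0 rfl, g0]
    have hb2 : b.N 2 = a.N 2 := by rw [hF.N 2 rfl, hF₁.N 2 rfl]
    refine Sim.of_always ?_
    refine (Always.forLoop rfl (fun k c => ∀ i : Fin n, c.Y 0 i =
      if (i : ℕ) < k then w i / (a.N 2 : ℝ) else w i) (by simpa using hb) ?_).weaken ?_
    · intro k hk c hF hck hc
      have hk : k < n := by simpa [hb0] using hk
      obtain ⟨i, rfl⟩ : ∃ j : Fin n, (j : ℕ) = k := ⟨⟨k, hk⟩, rfl⟩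
      have hc2 : c.N 2 = a.N 2 := by rw [hF.N 2 rfl, hb2]
      simp only [den_setY, always_pure]
      intro j
      by_cases h : j = i
      · subst h; simp [hck, hc, hc2]
      · have : (j : ℕ) ≠ i := fun h' => h (Fin.ext h')
        have h3 : ((j : ℕ) < i + 1 ↔ (j : ℕ) < i) := by omega
        simp [hck, this, hc, h3]
    · intro c _ hc i
      rw [hc]
      simp [hb0]

theorem roundsCode_spec (hE : M.E = Set.univ) {a : Mem} (h0 : a.N 0 = n)
    (hH : M.Indep (↑(a.set n 0) : Set (Fin n))) (hP : a.set n 9 = a.set n 0)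
    (hx : ∀ i : Fin n, a.Y 1 i = 0) :
    Sim (roundsCode.den M val a)
      (foldP (roundStep M (a.set n 0) (a.X 3) (a.N 2) (greedySet M (a.set n 0))
        (rowAverage val a)) (List.range (a.N 3)) (fun _ => 0, a.set n 0))
      (fun p a' => a'.set n 9 = p.2) := by
  rw [roundsCode]
  refine (Sim.forLoop rfl (List.range (a.N 3)) (by simp) _
    (fun (_ : ℕ) (p : (Fin n → ℝ) × Finset (Fin n)) (b : Mem) => b.set n 9 = p.2 ∧
      (∀ i : Fin n, b.Y 1 i = p.1 i) ∧ M.Indep (↑p.2 : Set (Fin n)))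
      (by simp [hP, hx, hH]) ?_).weaken fun p _ b _ h => h.1
  rintro k hk ⟨x, P⟩ b hF hbk ⟨hb9, hbY, hPi⟩
  simp only at hb9 hbY hPi
  have hb0 : b.N 0 = n := by rw [hF.N 0 rfl, h0]
  have e7 : b.A 7 = a.A 7 := hF.A 7 rfl
  have eA0 : b.A 0 = a.A 0 := hF.A 0 rfl
  have e1 : b.N 1 = a.N 1 := hF.N 1 rfl
  have e2 : b.N 2 = a.N 2 := hF.N 2 rfl
  have hest := estimateCode_spec (M := M) (val := val) hb0
  rw [rowAverage_congr e7 e1, e2, show (fun i : Fin n => b.Y 1 i) = x from funext hbY] at hest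
  have hstep : roundStep M (a.set n 0) (a.X 3) (a.N 2) (greedySet M (a.set n 0))
        (rowAverage val a) (List.range (a.N 3))[k] (x, P) =
      ((iid (randomSubset x (List.finRange n)) (a.N 2)).map
        (estimate (rowAverage val a) (a.N 2))).bind fun w =>
        (foldP (thinStep x (greedySet M (a.set n 0) w)) (List.finRange n) (a.set n 0)).bind
          fun J => (mergeSets M k P J).map fun P =>
            (fun i => x i + a.X 3 * (1 - x i) * indicator (greedySet M (a.set n 0) w) i, P) := by
    rw [PMF.bind_map, roundStep, List.getElem_range]
    rfl
  rw [hstep]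
  refine Sim.seq hest fun w _ b₁ hF₁ hb₁ => ?_
  have g0 : b₁.N 0 = n := by rw [hF₁.N 0 rfl, hb0]
  have gA0 : b₁.A 0 = a.A 0 := by rw [hF₁.A 0 rfl, eA0]
  refine Sim.seq_always (greedyCode_spec g0) fun b₂ hF₂ hb₂ => ?_
  rw [Mem.set_congr gA0, show (fun i : Fin n => b₁.Y 0 i) = w from funext hb₁] at hb₂
  have k0 : b₂.N 0 = n := by rw [hF₂.N 0 rfl, g0]
  have kA0 : b₂.A 0 = a.A 0 := by rw [hF₂.A 0 rfl, gA0]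
  have hthin := thinCode_spec (M := M) (val := val) k0
  have kY : ∀ i : Fin n, b₂.Y 1 i = x i := fun i => by rw [hF₂.Y 1 rfl, hF₁.Y 1 rfl, hbY]
  have kX : b₂.X 3 = a.X 3 := by rw [hF₂.X 3 rfl, hF₁.X 3 rfl, hF.X 3 rfl]
  rw [funext kY, hb₂, Mem.set_congr kA0, kX] at hthin
  refine Sim.seq hthin fun J hJ b₃ hF₃ hb₃ => ?_
  have hgI := (greedySet_isMaxWeight (M := M) hH w).1.2
  have hJi : M.Indep (↑J : Set (Fin n)) :=
    hgI.subset (by exact_mod_cast foldP_thinStep_support _ _ J hJ)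
  have l0 : b₃.N 0 = n := by rw [hF₃.N 0 rfl, k0]
  -- The loop counter is the number of earlier rounds, which is the weight that the merge gives to
  -- the current set.
  have l21 : b₃.N 21 = k := by rw [hF₃.N 21 rfl, hF₂.N 21 rfl, hF₁.N 21 rfl, hbk]
  have l9 : b₃.set n 9 = P := by
    rw [← hb9]
    exact Mem.set_congr (by rw [hF₃.A 9 rfl, hF₂.A 9 rfl, hF₁.A 9 rfl])
  have hmerge := mergeCode_spec (M := M) (val := val) hE l0 (by rwa [l9]) (by rwa [hb₃.1])
  rw [l21, l9, hb₃.1] at hmerge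
  refine hmerge.map_right _ fun P' _ c hc hP' => ?_
  refine ⟨by simpa using hP'.1, fun i => ?_, hP'.2⟩
  have := (mergeCode.frame b₃ c hc).Y 1 rfl
  simp [this, hb₃.2 i, kY]

end Prog


/-! ### Correctness of the program: random subsets -/

section Prefix
variable {n : ℕ}

theorem card_filter_sdiff {α : Type} [DecidableEq α] {U E : Finset α} (hE : E ⊆ U) (p : α → Prop) [DecidablePred p] :
    (((U \ E).filter p).card : ℝ) = (U.filter p).card - (E.filter p).card := by
  have : (U \ E).filter p = U.filter p \ E.filter p := by
    ext x; simp only [Finset.mem_filter, Finset.mem_sdiff]; tauto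
  rw [this, Finset.card_sdiff_of_subset (Finset.filter_subset_filter _ hE),
    Nat.cast_sub (Finset.card_le_card (Finset.filter_subset_filter _ hE))]

theorem card_filter_image {α β : Type} [DecidableEq β] {s : Finset α} {f : α → β} (hf : Set.InjOn f s)
    (p : β → Prop)
    [DecidablePred p] : ((s.image f).filter p).card = (s.filter fun a => p (f a)).card := by
  rw [Finset.filter_image, Finset.card_image_of_injOn]
  exact hf.mono (Finset.coe_subset.2 (Finset.filter_subset _ _))

/-- The elements of `S` below `k` are those of `A`. -/
def AgreesBelow (k : ℕ) (A S : Finset (Fin n)) : Prop := S.filter (fun j : Fin n => (j : ℕ) < k) = A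

open Classical

theorem agreesBelow_succ {i : Fin n} {A S : Finset (Fin n)} (hA : ∀ j ∈ A, (j : ℕ) < i) (c : Bool) :
    AgreesBelow (i + 1) (if c then insert i A else A) S ↔
      AgreesBelow i A S ∧ (i ∈ S ↔ c = true) := by
  have hi : i ∉ A := fun h => lt_irrefl _ (hA i h)
  have key : ∀ j : Fin n, (j : ℕ) < i + 1 ↔ (j : ℕ) < i ∨ j = i := by
    intro j; rw [Fin.ext_iff]; omega
  simp only [AgreesBelow, Finset.ext_iff, Finset.mem_filter, key]
  constructor
  · intro h
    have h1 := h i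
    have h2 : i ∈ S ↔ c = true := by cases c <;> simpa [hi] using h1
    refine ⟨fun j => ?_, h2⟩
    by_cases hj : j = i
    · subst hj; simp [hi]
    · have := h j
      cases c <;> simpa [hj] using this
  · rintro ⟨h1, h2⟩ j
    by_cases hj : j = i
    · subst hj; cases c <;> simp_all
    · have := h1 j
      cases c <;> simpa [hj] using this

/-- A set that agrees with `A` below `k` is `A` together with an arbitrary choice of `need` elements
of `X` from `k` on. -/
theorem card_agreesBelow {X A : Finset (Fin n)} {k need t : ℕ} (hAX : A ⊆ X)
    (hA : ∀ j ∈ A, (j : ℕ) < k) (ht : need + A.card = t) :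
    ((X.powersetCard t).filter (AgreesBelow k A)).card =
      (X.filter fun j : Fin n => k ≤ (j : ℕ)).card.choose need := by
  rw [← Finset.card_powersetCard]
  refine Finset.card_nbij' (fun S => S.filter fun j : Fin n => k ≤ (j : ℕ)) (fun Z => Z ∪ A) ?_ ?_ ?_ ?_
  · intro S hS
    simp only [Finset.coe_filter, Finset.mem_powersetCard, Set.mem_ofPred_eq, AgreesBelow] at hS
    simp only [Finset.mem_coe, Finset.mem_powersetCard]
    refine ⟨Finset.filter_subset_filter _ hS.1.1, ?_⟩
    have h := Finset.card_filter_add_card_filter_not (s := S) (fun j : Fin n => (j : ℕ) < k)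
    rw [hS.2, hS.1.2] at h
    simp only [not_lt] at h
    omega
  · intro Z hZ
    simp only [Finset.mem_coe, Finset.mem_powersetCard, Finset.subset_iff, Finset.mem_filter] at hZ
    simp only [Finset.coe_filter, Finset.mem_powersetCard, Set.mem_ofPred_eq, AgreesBelow]
    have hd : Disjoint Z A := by
      rw [Finset.disjoint_left]
      intro j h1 h2
      have := (hZ.1 h1).2; have := hA j h2; omega
    refine ⟨⟨Finset.union_subset (fun j hj => (hZ.1 hj).1) hAX, ?_⟩, ?_⟩
    · rw [Finset.card_union_of_disjoint hd, hZ.2, ht]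
    · ext j
      simp only [Finset.mem_filter, Finset.mem_union]
      constructor
      · rintro ⟨h | h, h'⟩
        · have := (hZ.1 h).2; omega
        · exact h
      · exact fun h => ⟨Or.inr h, hA j h⟩
  · intro S hS
    simp only [Finset.coe_filter, Finset.mem_powersetCard, Set.mem_ofPred_eq, AgreesBelow] at hS
    simp only
    rw [← hS.2]
    ext j
    simp only [Finset.mem_union, Finset.mem_filter]
    have := le_or_gt k (j : ℕ)
    tauto
  · intro Z hZ
    simp only [Finset.mem_coe, Finset.mem_powersetCard, Finset.subset_iff, Finset.mem_filter] at hZ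
    ext j
    simp only [Finset.mem_union, Finset.mem_filter]
    constructor
    · rintro ⟨h | h, h'⟩
      · exact h
      · have := hA j h; omega
    · exact fun h => ⟨Or.inl h, (hZ.1 h).2⟩

/-- The number of sets of the given size, agreeing with `A` below `i`, that contain `i`. -/
theorem card_agreesBelow_mem {X A : Finset (Fin n)} {i : Fin n} {need t : ℕ} (hAX : A ⊆ X)
    (hA : ∀ j ∈ A, (j : ℕ) < i) (ht : need + A.card = t) :
    (((X.powersetCard t).filter fun S => AgreesBelow i A S ∧ i ∈ S).card : ℝ) =
      if i ∈ X then ((X.powersetCard t).filter (AgreesBelow i A)).card * (need : ℝ) /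
        ((X.filter fun j : Fin n => (i : ℕ) ≤ (j : ℕ)).card : ℝ) else 0 := by
  have hi : i ∉ A := fun h => lt_irrefl _ (hA i h)
  split_ifs with hiX
  · rw [card_agreesBelow hAX hA ht]
    have hg : X.filter (fun j : Fin n => (i : ℕ) ≤ (j : ℕ)) =
        insert i (X.filter fun j : Fin n => (i + 1 : ℕ) ≤ (j : ℕ)) := by
      ext j
      simp only [Finset.mem_filter, Finset.mem_insert, Fin.ext_iff]
      constructor
      · rintro ⟨h1, h2⟩
        rcases h2.eq_or_lt with h | h
        exacts [Or.inl h.symm, Or.inr ⟨h1, h⟩]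
      · rintro (h | h)
        · have : j = i := Fin.ext h
          subst this; exact ⟨hiX, le_rfl⟩
        · exact ⟨h.1, by omega⟩
    have hgc : (X.filter (fun j : Fin n => (i : ℕ) ≤ (j : ℕ))).card =
        (X.filter fun j : Fin n => (i + 1 : ℕ) ≤ (j : ℕ)).card + 1 := by
      rw [hg, Finset.card_insert_of_notMem (by simp)]
    rw [hgc]
    have hcard := fun need' (h : need' + (insert i A).card = t) =>
      card_agreesBelow (k := i + 1) (X := X) (A := insert i A) (Finset.insert_subset hiX hAX)
        (fun j hj => by
          rcases Finset.mem_insert.1 hj with rfl | h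
          · omega
          · have := hA j h; omega) h
    have hfil : (X.powersetCard t).filter (fun S => AgreesBelow i A S ∧ i ∈ S) =
        (X.powersetCard t).filter (AgreesBelow (i + 1) (insert i A)) := by
      refine Finset.filter_congr fun S _ => ?_
      have := agreesBelow_succ (S := S) hA true
      simp only [if_true, iff_true] at this
      exact this.symm
    rw [hfil]
    cases need with
    | zero =>
      rw [Finset.card_eq_zero.2]
      · simp
      · rw [Finset.filter_eq_empty_iff]
        intro S hS hag
        have h1 : (insert i A).card ≤ S.card := by
          rw [← hag]; exact Finset.card_filter_le _ _
        rw [Finset.card_insert_of_notMem hi, (Finset.mem_powersetCard.1 hS).2] at h1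
        omega
    | succ need =>
      rw [hcard need (by rw [Finset.card_insert_of_notMem hi]; omega)]
      set g := (X.filter fun j : Fin n => (i + 1 : ℕ) ≤ (j : ℕ)).card
      -- The absorption identity for binomial coefficients turns the count with `i` included into
      -- the proportion `need / (g + 1)` of the count without the condition.
      have h1 := Nat.add_one_mul_choose_eq g need
      have h2 : ((g : ℝ) + 1) * (g.choose need : ℝ) = ((g + 1).choose (need + 1) : ℝ) * (need + 1) := by
        exact_mod_cast h1
      push_cast
      rw [← h2]
      field_simp
  · rw [Finset.card_eq_zero.2]
    · simp
    · rw [Finset.filter_eq_empty_iff]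
      rintro S hS ⟨-, h⟩
      exact hiX ((Finset.mem_powersetCard.1 hS).1 h)

end Prefix

/-! ### Counting rows and preparing a draw -/

namespace Prog
open Classical
variable {n : ℕ} {M : Matroid (Fin n)} {val : Finset (Fin n) → ℝ}

theorem countRowsCode_spec {a : Mem} (h0 : a.N 0 = n) : Always (countRowsCode.den M val a) fun a' =>
    a'.N 15 = ((Finset.range (a.N 1)).filter fun e =>
      a.A 6 e ≠ 0 ∧ a.A 7 (e * n + a.N 6) ≠ 0).card := by
  rw [countRowsCode, den_setN_seq, den_setN_seq]
  refine (Always.forLoop rfl (fun k b => b.N 16 = k * n + a.N 6 ∧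
    b.N 15 = ((Finset.range k).filter fun e =>
      a.A 6 e ≠ 0 ∧ a.A 7 (e * n + a.N 6) ≠ 0).card) (by simp) ?_).weaken ?_
  · rintro k hk b hF hbk ⟨hb1, hb2⟩
    have hb0 : b.N 0 = n := by rw [hF.N 0 rfl]; simpa using h0
    have e6 : b.A 6 = a.A 6 := hF.A 6 rfl
    have e7 : b.A 7 = a.A 7 := hF.A 7 rfl
    rw [Finset.range_add_one, Finset.filter_insert]
    by_cases h6 : a.A 6 k = 0
    · simp [hbk, e6, h6, always_pure, hb1, hb2, hb0]; ring
    · by_cases h7 : a.A 7 (k * n + a.N 6) = 0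
      · simp [hbk, e6, e7, h6, h7, always_pure, hb1, hb2, hb0]; ring
      · simp [hbk, e6, e7, h6, h7, always_pure, hb1, hb2, hb0]; ring
  · intro b _ hb
    simpa using hb.2

theorem filterRowsCode_spec {a : Mem} (h0 : a.N 0 = n) :
    Always (filterRowsCode.den M val a) fun a' => ∀ e < a.N 1, a'.A 6 e =
      if (a.A 7 (e * n + a.N 6) ≠ 0 ↔ a.N 9 ≠ 0) then a.A 6 e else 0 := by
  rw [filterRowsCode, den_setN_seq]
  refine (Always.forLoop rfl (fun k b => b.N 16 = k * n + a.N 6 ∧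
    ∀ e, b.A 6 e = if e < k ∧ ¬ (a.A 7 (e * n + a.N 6) ≠ 0 ↔ a.N 9 ≠ 0) then 0 else a.A 6 e)
      (by simp) ?_).weaken ?_
  · rintro k hk b hF hbk ⟨hb1, hb2⟩
    have hb0 : b.N 0 = n := by rw [hF.N 0 rfl]; simpa using h0
    have e7 : b.A 7 = a.A 7 := hF.A 7 rfl
    have e9 : b.N 9 = a.N 9 := by rw [hF.N 9 rfl]; simp
    have hlt : ∀ e, e ≠ k → (e < k + 1 ↔ e < k) := by intro e h; omega
    by_cases h9 : a.N 9 = 0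
    · by_cases h7 : a.A 7 (k * n + a.N 6) = 0
      · simp only [den_cond_seq, den_cond, NExp.eval, e9, h9, e7, hb1, h7, ne_eq,
          not_true_eq_false, if_false, den_skip_seq, den_setN, always_pure]
        refine ⟨by simp [hb1, hb0]; ring, fun e => ?_⟩
        by_cases he : e = k
        · subst he; simp [hb2, h7]
        · simp [hb2, hlt e he, h9]
      · simp only [den_cond_seq, den_cond, NExp.eval, e9, h9, e7, hb1, h7, ne_eq,
          not_true_eq_false, if_false, den_skip_seq, den_setN, always_pure, not_false_eq_true,
          if_true, den_setA_seq]
        refine ⟨by simp [hb1, hb0]; ring, fun e => ?_⟩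
        by_cases he : e = k
        · subst he; simp [hb2, h7, hbk]
        · simp [hb2, hlt e he, h9, hbk, he]
    · by_cases h7 : a.A 7 (k * n + a.N 6) = 0
      · simp only [den_cond_seq, den_cond, NExp.eval, e9, h9, e7, hb1, h7, ne_eq,
          not_true_eq_false, if_false, den_skip_seq, den_setN, always_pure, not_false_eq_true,
          if_true, den_setA_seq]
        refine ⟨by simp [hb1, hb0]; ring, fun e => ?_⟩
        by_cases he : e = k
        · subst he; simp [hb2, h7, h9, hbk]
        · simp [hb2, hlt e he, h9, hbk, he]
      · simp only [den_cond_seq, den_cond, NExp.eval, e9, h9, e7, hb1, h7, ne_eq,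
          not_true_eq_false, if_false, den_skip_seq, den_setN, always_pure, not_false_eq_true,
          if_true]
        refine ⟨by simp [hb1, hb0]; ring, fun e => ?_⟩
        by_cases he : e = k
        · subst he; simp [hb2, h7, h9]
        · simp [hb2, hlt e he, h9]
  · rintro b _ ⟨-, hb⟩ e he
    rw [hb e]
    simp only [Mem.setN_N] at *
    simp only [show (1 : ℕ) ≠ 16 by decide, if_false, he, true_and]
    split_ifs <;> first | rfl | contradiction

/-- The loop for the binomial coefficient runs through `n` rounds and acts only in those below the
subset size, whence the minimum; in a possible draw the subset size is at most `n`. -/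
theorem drawInitCode_spec {a : Mem} (h0 : a.N 0 = n) : Always (drawInitCode.den M val a) fun a' =>
    a'.N 12 = (a.set n 4).card ∧ a'.X 6 = ((a.set n 4).card.choose (min n (a.N 18)) : ℝ) ∧
      a'.N 13 = a.N 18 ∧ a'.N 14 = a.N 17 ∧ ∀ e < a.N 1, a'.A 6 e ≠ 0 ↔ e < a.N 17 := by
  rw [drawInitCode, den_setN_seq]
  refine Always.seq (Always.forLoop rfl (fun k b => b.N 12 =
    ((a.set n 4).filter fun j : Fin n => (j : ℕ) < k).card) (by simp) ?_) ?_
  · intro k hk b hF hbk hb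
    have hk : k < n := by simpa [h0] using hk
    obtain ⟨i, rfl⟩ : ∃ j : Fin n, (j : ℕ) = k := ⟨⟨k, hk⟩, rfl⟩
    have e4 : b.A 4 = a.A 4 := hF.A 4 rfl
    have hfil : (a.set n 4).filter (fun j : Fin n => (j : ℕ) < i + 1) =
        if i ∈ a.set n 4 then insert i ((a.set n 4).filter fun j : Fin n => (j : ℕ) < i)
        else (a.set n 4).filter fun j : Fin n => (j : ℕ) < i := by
      ext j
      by_cases hj : j = i
      · subst hj; split_ifs <;> simp [*]
      · have : (j : ℕ) ≠ i := fun h' => hj (Fin.ext h')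
        have h3 : ((j : ℕ) < i + 1 ↔ (j : ℕ) < i) := by omega
        split_ifs <;> simp only [Finset.mem_filter, Finset.mem_insert, h3, hj, false_or]
    rw [hfil]
    have hm : i ∈ a.set n 4 ↔ a.A 4 i ≠ 0 := Mem.mem_set
    by_cases h4 : a.A 4 i = 0
    · rw [if_neg (by rw [hm]; simpa using h4)]
      simp [hbk, e4, h4, always_pure, hb]
    · rw [if_pos (hm.2 h4), Finset.card_insert_of_notMem (by simp)]
      simp [hbk, e4, h4, always_pure, hb]
  · intro a₁ hF₁ h₁
    have g0 : (a.setN 12 ((NExp.lit 0).eval n a)).N 0 = n := by simpa using h0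
    rw [g0] at h₁
    have h12 : a₁.N 12 = (a.set n 4).card := by
      rw [h₁, Finset.filter_true_of_mem fun j _ => j.2]
    have f0 : a₁.N 0 = n := by rw [hF₁.N 0 rfl, g0]
    have f1 : a₁.N 1 = a.N 1 := by rw [hF₁.N 1 rfl]; simp
    have f17 : a₁.N 17 = a.N 17 := by rw [hF₁.N 17 rfl]; simp
    have f18 : a₁.N 18 = a.N 18 := by rw [hF₁.N 18 rfl]; simp
    rw [den_setX_seq]
    refine Always.seq (Always.forLoop rfl (fun k b => b.X 6 =
      ((a.set n 4).card.choose (min k (a.N 18)) : ℝ)) (by simp) ?_) ?_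
    · intro k hk b hF hbk hb
      have hb18 : b.N 18 = a.N 18 := by rw [hF.N 18 rfl]; simpa using f18
      have hb12 : b.N 12 = (a.set n 4).card := by rw [hF.N 12 rfl]; simpa using h12
      by_cases hlt : k < a.N 18
      · have e1 : min (k + 1) (a.N 18) = k + 1 := by omega
        have e2 : min k (a.N 18) = k := by omega
        rw [e2] at hb
        rw [e1]
        simp only [den_cond, NExp.eval, hbk, hb18, hlt, if_true, ne_eq, one_ne_zero,
          not_false_eq_true, den_setX, always_pure, RExp.eval, hb, hb12, Mem.setX_X, Mem.setN_X]
        have h1 := Nat.choose_succ_right_eq (a.set n 4).card k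
        have h2 : ((a.set n 4).card.choose (k + 1) : ℝ) * (k + 1) =
            ((a.set n 4).card.choose k : ℝ) * (((a.set n 4).card - k : ℕ) : ℝ) := by
          exact_mod_cast h1
        rw [← h2]
        push_cast
        field_simp
      · have e1 : min (k + 1) (a.N 18) = a.N 18 := by omega
        have e2 : min k (a.N 18) = a.N 18 := by omega
        rw [e2] at hb
        rw [e1]
        simp [hbk, hb18, hlt, always_pure, hb]
    · intro a₂ hF₂ h₂
      rw [show (a₁.setX 6 ((RExp.cast (.lit 1)).eval n a₁)).N 0 = n by simpa using f0] at h₂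
      have k18 : a₂.N 18 = a.N 18 := by rw [hF₂.N 18 rfl]; simpa using f18
      have k17 : a₂.N 17 = a.N 17 := by rw [hF₂.N 17 rfl]; simpa using f17
      have k1 : a₂.N 1 = a.N 1 := by rw [hF₂.N 1 rfl]; simpa using f1
      have k12 : a₂.N 12 = (a.set n 4).card := by rw [hF₂.N 12 rfl]; simpa using h12
      rw [den_setN_seq, den_setN_seq]
      refine Always.weaken (Q := fun c => c.N 12 = (a.set n 4).card ∧
        c.X 6 = ((a.set n 4).card.choose (min n (a.N 18)) : ℝ) ∧ c.N 13 = a.N 18 ∧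
        c.N 14 = a.N 17 ∧ ∀ e < a.N 1, c.A 6 e ≠ 0 ↔ e < a.N 17) ?_ fun _ _ h => h
      refine (Always.forLoop rfl (fun k c => ∀ e < k, c.A 6 e ≠ 0 ↔ e < a.N 17)
        (by simp) ?_).weaken ?_
      · intro k hk b hF hbk hb
        have hb17 : b.N 17 = a.N 17 := by rw [hF.N 17 rfl]; simpa using k17
        simp only [den_setA, always_pure]
        intro e he
        rcases Nat.lt_succ_iff_lt_or_eq.1 he with h | h
        · simp [hbk, show e ≠ k by omega, hb e h]
        · subst h; simp [hbk, hb17]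
      · intro c hc hc'
        have hF := Code.frame _ _ _ hc
        refine ⟨?_, ?_, ?_, ?_, ?_⟩
        · rw [hF.N 12 rfl]; simpa using k12
        · rw [hF.X 6 rfl]; simpa using h₂
        · rw [hF.N 13 rfl]; simpa using k18
        · rw [hF.N 14 rfl]; simpa using k17
        · intro e he
          exact hc' e (by simpa [k1] using he)

end Prog


/-! ### Uniform draws, one element at a time -/

namespace Prog
open Classical
variable {n : ℕ} {M : Matroid (Fin n)} {val : Finset (Fin n) → ℝ}

/-- The first `k` entries of the set in array `5`. -/
def bits (n : ℕ) (a : Mem) (k : ℕ) : Finset (Fin n) :=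
  Finset.univ.filter fun j : Fin n => (j : ℕ) < k ∧ a.A 5 j ≠ 0

@[simp] theorem bits_setN (a : Mem) (v x k : ℕ) : bits n (a.setN v x) k = bits n a k := rfl

/-- The state of a random draw after the first `k` elements have been decided. The draw is from the
members of `U` other than the first `q` rows of `a`, and `F` is what remains possible. -/
structure DrawInv (a : Mem) (k : ℕ) (F : Finset (Finset (Fin n))) (b : Mem) : Prop where
  nonempty : F.Nonempty
  family : F = (((a.set n 4).powersetCard (a.N 18)) \
    (Finset.range (a.N 17)).image (a.row n)).filter (AgreesBelow k (bits n b k))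
  rest : b.N 12 = ((a.set n 4).filter fun j : Fin n => k ≤ (j : ℕ)).card
  need : b.N 13 + (bits n b k).card = a.N 18
  total : b.X 6 =
    ((((a.set n 4).powersetCard (a.N 18)).filter (AgreesBelow k (bits n b k))).card : ℝ)
  count : b.N 14 = ((Finset.range (a.N 17)).filter fun e =>
    AgreesBelow k (bits n b k) (a.row n e)).card
  alive : ∀ e < a.N 1, b.A 6 e ≠ 0 ↔ e < a.N 17 ∧ AgreesBelow k (bits n b k) (a.row n e)

/-- The forbidden rows are distinct and belong to the family, so counting rows is counting excluded
members. All counts in memory are therefore exact, and the bias computed by the code is literally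
the proportion used by `revealStep`. -/
theorem drawStepCode_spec {a b : Mem} (h0 : b.N 0 = n) {i : Fin n} (h6 : b.N 6 = i)
    (h1 : b.N 1 = a.N 1) (e4 : b.A 4 = a.A 4) (e7 : b.A 7 = a.A 7) (hq : a.N 17 ≤ a.N 1)
    (hinj : Set.InjOn (a.row n) (Finset.range (a.N 17)))
    (hrow : ∀ e < a.N 17, a.row n e ∈ (a.set n 4).powersetCard (a.N 18))
    {F : Finset (Finset (Fin n))} (hb : DrawInv a i F b) :
    Sim (drawStepCode.den M val b) (revealStep i F) fun F' b' =>
      DrawInv a (i + 1) F' b' := by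
  obtain ⟨hne, hF, hrest, hneed, htot, hcnt, hal⟩ := hb
  set U := (a.set n 4).powersetCard (a.N 18) with hU
  set E := (Finset.range (a.N 17)).image (a.row n) with hE
  set A := bits n b i with hA
  have hEU : E ⊆ U := by
    intro S hS
    obtain ⟨e, he, rfl⟩ := Finset.mem_image.1 hS
    exact hrow e (Finset.mem_range.1 he)
  have hAlt : ∀ j ∈ A, (j : ℕ) < i := by
    intro j hj
    simp only [hA, bits, Finset.mem_filter] at hj
    exact hj.2.1
  -- Some set is still possible, and its part below `i` is `A`.
  have hAX : A ⊆ a.set n 4 := by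
    obtain ⟨S, hS⟩ := hne
    rw [hF, Finset.mem_filter, Finset.mem_sdiff] at hS
    have h2 := hS.2
    rw [AgreesBelow] at h2
    rw [← h2]
    exact (Finset.filter_subset _ _).trans (Finset.mem_powersetCard.1 hS.1.1).1
  have hmem := card_agreesBelow_mem hAX hAlt hneed
  rw [← hU] at hmem
  have hFcard : (F.card : ℝ) = b.X 6 - b.N 14 := by
    rw [hF, card_filter_sdiff hEU, htot, hcnt, hE, card_filter_image hinj]
  set W1 : ℝ := ((U.filter fun S => AgreesBelow i A S ∧ i ∈ S).card : ℝ) with hW1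
  set c1 : ℕ := ((Finset.range (a.N 17)).filter fun e =>
    AgreesBelow i A (a.row n e) ∧ i ∈ a.row n e).card with hc1
  have hF1card : ((F.filter fun S => i ∈ S).card : ℝ) = W1 - c1 := by
    rw [hF, Finset.filter_filter, card_filter_sdiff hEU, hE, card_filter_image hinj]
  rw [drawStepCode]
  refine Sim.seq_always (countRowsCode_spec h0) fun b₁ hF₁ h₁ => ?_
  have h15 : b₁.N 15 = c1 := by
    rw [h₁, hc1, h1]
    congr 1
    ext e
    simp only [Finset.mem_filter, Finset.mem_range]
    constructor
    · rintro ⟨he, h2, h3⟩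
      have := (hal e he).1 h2
      refine ⟨this.1, this.2, ?_⟩
      rw [e7, h6] at h3
      simpa [Mem.row] using h3
    · rintro ⟨he, h2, h3⟩
      refine ⟨he.trans_le hq, (hal e (he.trans_le hq)).2 ⟨he, h2⟩, ?_⟩
      rw [e7, h6]
      simpa [Mem.row] using h3
  have f6 : b₁.N 6 = i := by rw [hF₁.N 6 rfl, h6]
  have f12 : b₁.N 12 = b.N 12 := hF₁.N 12 rfl
  have f13 : b₁.N 13 = b.N 13 := hF₁.N 13 rfl
  have f14 : b₁.N 14 = b.N 14 := hF₁.N 14 rfl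
  have fX : b₁.X 6 = b.X 6 := hF₁.X 6 rfl
  have fA4 : b₁.A 4 = a.A 4 := by rw [hF₁.A 4 rfl, e4]
  have fA5 : b₁.A 5 = b.A 5 := hF₁.A 5 rfl
  have hmi : i ∈ a.set n 4 ↔ a.A 4 i ≠ 0 := Mem.mem_set
  set b₂ : Mem := if a.A 4 i ≠ 0 then (b₁.setX 7 W1).setN 12 (b.N 12 - 1)
    else b₁.setX 7 W1 with hb₂
  have hsplit : ∀ d : Code, (Code.cond (NExp.arr 4 (.var 6))
      (.setX 7 (.div (.mul (.var 6) (.cast (.var 13))) (.cast (.var 12)))⨾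
        .setN 12 (.sub (.var 12) (.lit 1)))
      (.setX 7 (.cast (.lit 0)))⨾ d).den M val b₁ = d.den M val b₂ := by
    intro d
    by_cases h4 : a.A 4 i = 0
    · rw [if_neg (by rw [hmi]; simpa using h4)] at hmem
      rw [hb₂, if_neg (by simpa using h4)]
      simp [fA4, f6, h4, hmem]
    · rw [if_pos (hmi.2 h4)] at hmem
      rw [hb₂, if_pos h4]
      simp [fA4, f6, h4, hmem, fX, f12, f13, htot, hrest]
  rw [hsplit]
  have g6 : b₂.N 6 = i := by rw [hb₂]; split_ifs <;> simp [f6]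
  have g1 : b₂.N 1 = a.N 1 := by rw [hb₂]; split_ifs <;> simp [hF₁.N 1 rfl, h1]
  have g0 : b₂.N 0 = n := by rw [hb₂]; split_ifs <;> simp [hF₁.N 0 rfl, h0]
  have g12 : b₂.N 12 = ((a.set n 4).filter fun j : Fin n => (i : ℕ) + 1 ≤ (j : ℕ)).card := by
    have hg : (a.set n 4).filter (fun j : Fin n => (i : ℕ) + 1 ≤ (j : ℕ)) =
        ((a.set n 4).filter fun j : Fin n => (i : ℕ) ≤ (j : ℕ)).erase i := by
      ext j
      simp only [Finset.mem_filter, Finset.mem_erase, ne_eq, Fin.ext_iff]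
      constructor
      · rintro ⟨h, h'⟩; exact ⟨by omega, h, by omega⟩
      · rintro ⟨h, h', h''⟩; exact ⟨h', by omega⟩
    rw [hg, hb₂]
    split_ifs with h4
    · rw [Finset.card_erase_of_mem (by simp [hmi, h4]), ← hrest]; simp
    · rw [Finset.erase_eq_of_notMem (by simp [hmi, h4]), ← hrest]; simp [f12]
  have g13 : b₂.N 13 = b.N 13 := by rw [hb₂]; split_ifs <;> simp [f13]
  have g14 : b₂.N 14 = b.N 14 := by rw [hb₂]; split_ifs <;> simp [f14]
  have g15 : b₂.N 15 = c1 := by rw [hb₂]; split_ifs <;> simp [h15]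
  have gX6 : b₂.X 6 = b.X 6 := by rw [hb₂]; split_ifs <;> simp [fX]
  have gX7 : b₂.X 7 = W1 := by rw [hb₂]; split_ifs <;> simp
  have gA5 : b₂.A 5 = b.A 5 := by rw [hb₂]; split_ifs <;> (funext j; simp [fA5])
  have gA6 : b₂.A 6 = b.A 6 := by rw [hb₂]; split_ifs <;> (funext j; simp [hF₁.A 6 rfl])
  have gA7 : b₂.A 7 = a.A 7 := by rw [hb₂]; split_ifs <;> (funext j; simp [hF₁.A 7 rfl, e7])
  clear_value b₂
  clear hsplit hb₂ h₁
  rw [den_flip_seq, revealStep, hF1card, hFcard]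
  simp only [RExp.eval, NExp.eval, gX7, g15, gX6, g14]
  refine Sim.bind_map fun c hc => ?_
  have hF'ne : (F.filter fun S => i ∈ S ↔ c = true).Nonempty := by
    refine revealStep_nonempty (i := i) hne ?_
    rw [revealStep, PMF.support_map, hF1card, hFcard]
    exact ⟨c, hc, rfl⟩
  rw [den_setA_seq]
  simp only [NExp.eval, Mem.setN_N, g6, if_true, Nat.reduceEqDiff, if_false]
  set b₃ : Mem := if c then ((((b₂.setN 9 1).setA 5 i 1).setX 6 W1).setN 14 c1).setN 13 (b.N 13 - 1)
    else ((((b₂.setN 9 0).setA 5 i 0).setX 6 (b.X 6 - W1)).setN 14 (b.N 14 - c1)) with hb₃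
  have hsplit : ∀ d : Code, (Code.cond (NExp.var 9)
      (.setX 6 (.var 7)⨾ .setN 14 (.var 15)⨾ .setN 13 (.sub (.var 13) (.lit 1)))
      (.setX 6 (.sub (.var 6) (.var 7))⨾ .setN 14 (.sub (.var 14) (.var 15)))⨾ d).den M val
      ((b₂.setN 9 (if c then 1 else 0)).setA 5 i (if c then 1 else 0)) = d.den M val b₃ := by
    intro d
    cases c
    · simp [hb₃, gX6, gX7, g14, g15]
    · simp [hb₃, gX6, gX7, g13, g15]
  rw [hsplit]
  have k0 : b₃.N 0 = n := by rw [hb₃]; split_ifs <;> simp [g0]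
  have k1 : b₃.N 1 = a.N 1 := by rw [hb₃]; split_ifs <;> simp [g1]
  have k6 : b₃.N 6 = i := by rw [hb₃]; split_ifs <;> simp [g6]
  have k9 : b₃.N 9 ≠ 0 ↔ c = true := by rw [hb₃]; cases c <;> simp
  have k12 : b₃.N 12 = b₂.N 12 := by rw [hb₃]; split_ifs <;> simp
  have kA6 : b₃.A 6 = b.A 6 := by rw [hb₃]; split_ifs <;> (funext j; simp [gA6])
  have kA7 : b₃.A 7 = a.A 7 := by rw [hb₃]; split_ifs <;> (funext j; simp [gA7])
  have kbits : bits n b₃ (i + 1) = if c then insert i A else A := by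
    ext j
    by_cases hj : j = i
    · subst hj
      cases c <;> simp [hb₃, bits, hA]
    · have : (j : ℕ) ≠ i := fun h' => hj (Fin.ext h')
      have h3 : ((j : ℕ) < i + 1 ↔ (j : ℕ) < i) := by omega
      cases c <;> simp [hb₃, bits, hA, this, h3, hj, gA5, -Order.lt_add_one_iff]
  have hiA : i ∉ A := fun h => lt_irrefl _ (hAlt i h)
  have hagr : ∀ S, AgreesBelow (i + 1) (if c then insert i A else A) S ↔
      AgreesBelow i A S ∧ (i ∈ S ↔ c = true) := fun S => agreesBelow_succ hAlt c
  refine (filterRowsCode_spec k0).weaken fun b₄ hb₄ hfil => ?_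
  have hF₄ := Code.frame _ _ _ hb₄
  have lbits : bits n b₄ (i + 1) = if c then insert i A else A := by
    rw [← kbits]; simp [bits, hF₄.A 5 rfl]
  refine ⟨hF'ne, ?_, ?_, ?_, ?_, ?_, ?_⟩
  · rw [lbits, hF, Finset.filter_filter]
    exact Finset.filter_congr fun S _ => (hagr S).symm
  · rw [hF₄.N 12 rfl, k12, g12]
  · rw [lbits, hF₄.N 13 rfl]
    cases c
    · simp [hb₃, g13, hneed]
    -- A set that is still possible contains both `A` and `i`, so at least one element was still
    -- needed and the truncated subtraction is exact.
    · obtain ⟨S, hS⟩ := hF'ne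
      simp only [Finset.mem_filter, iff_true] at hS
      have hS1 := hS.1
      rw [hF, Finset.mem_filter, Finset.mem_sdiff, hU, Finset.mem_powersetCard] at hS1
      have h2 := (hagr S).2 ⟨hS1.2, by simpa using hS.2⟩
      have h3 : (insert i A).card ≤ S.card := by
        rw [if_pos rfl, AgreesBelow] at h2
        rw [← h2]; exact Finset.card_filter_le _ _
      rw [Finset.card_insert_of_notMem hiA, hS1.1.1.2] at h3
      simp only [hb₃, if_true, Mem.setN_N, Finset.card_insert_of_notMem hiA]
      omega
  · rw [lbits, hF₄.X 6 rfl, Finset.filter_congr fun S _ => hagr S]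
    cases c
    · have h2 := Finset.card_filter_add_card_filter_not
        (s := U.filter (AgreesBelow i A)) (fun S => i ∈ S)
      rw [Finset.filter_filter, Finset.filter_filter] at h2
      simp only [hb₃, Bool.false_eq_true, if_false, iff_false, Mem.setN_X, Mem.setX_X, if_true,
        htot, hW1]
      rw [← h2]
      push_cast
      ring
    · simp [hb₃, hW1, U]
  · rw [lbits, hF₄.N 14 rfl, Finset.filter_congr fun e _ => hagr _]
    cases c
    · have h2 := Finset.card_filter_add_card_filter_not
        (s := (Finset.range (a.N 17)).filter fun e => AgreesBelow i A (a.row n e))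
        (fun e => i ∈ a.row n e)
      rw [Finset.filter_filter, Finset.filter_filter] at h2
      simp only [hb₃, Bool.false_eq_true, if_false, iff_false, Mem.setN_N, if_true, hcnt, hc1]
      omega
    · simp [hb₃, hc1]
  · intro e he
    rw [lbits, hagr, hfil e (by rwa [k1]), kA6]
    have hr : i ∈ a.row n e ↔ a.A 7 (e * n + i) ≠ 0 := by simp [Mem.row]
    have := hal e he
    split_ifs with h <;> rw [k9, kA7, k6, ← hr] at h
    · rw [this]
      exact ⟨fun h' => ⟨h'.1, h'.2, h⟩, fun h' => ⟨h'.1, h'.2.1⟩⟩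
    · simp only [ne_eq, not_true_eq_false, false_iff]
      exact fun h' => h h'.2.2

theorem drawCode_spec {a : Mem} (h0 : a.N 0 = n) (hq : a.N 17 ≤ a.N 1)
    (hinj : Set.InjOn (a.row n) (Finset.range (a.N 17)))
    (hrow : ∀ e < a.N 17, a.row n e ∈ (a.set n 4).powersetCard (a.N 18))
    (hne : (((a.set n 4).powersetCard (a.N 18)) \
      (Finset.range (a.N 17)).image (a.row n)).Nonempty) :
    Sim (drawCode.den M val a) (uniform (((a.set n 4).powersetCard (a.N 18)) \
      (Finset.range (a.N 17)).image (a.row n))) (fun S a' => a'.set n 5 = S) := by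
  rw [drawCode, ← foldP_revealStep_bind (List.finRange n) hne]
  refine Sim.seq_always (drawInitCode_spec h0) fun a₁ hF₁ ⟨h12, hX6, h13, h14, hal⟩ => ?_
  have g0 : a₁.N 0 = n := by rw [hF₁.N 0 rfl, h0]
  have ht : a.N 18 ≤ n := by
    obtain ⟨S, hS⟩ := hne
    rw [Finset.mem_sdiff, Finset.mem_powersetCard] at hS
    rw [← hS.1.2]
    simpa using Finset.card_le_univ S
  have hbits0 : ∀ b : Mem, bits n b 0 = ∅ := by intro b; simp [bits]
  have hag0 : ∀ S : Finset (Fin n), AgreesBelow 0 ∅ S := by intro S; simp [AgreesBelow]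
  have hloop : Sim ((Code.forLoop 6 0 drawStepCode).den M val a₁)
      (foldP revealStep (List.finRange n) (((a.set n 4).powersetCard (a.N 18)) \
        (Finset.range (a.N 17)).image (a.row n))) (DrawInv a (List.finRange n).length) := by
    refine Sim.forLoop rfl (List.finRange n) (by simp [g0]) _ (DrawInv a) ?_ ?_
    · refine ⟨hne, ?_, ?_, ?_, ?_, ?_, ?_⟩
      · rw [hbits0, Finset.filter_true_of_mem fun S _ => hag0 S]
      · simp [h12]
      · simp [hbits0, h13]
      · rw [hbits0, Finset.filter_true_of_mem fun S _ => hag0 S, Finset.card_powersetCard]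
        simp [hX6, ht]
      · rw [hbits0, Finset.filter_true_of_mem fun e _ => hag0 _]; simp [h14]
      · intro e he
        rw [hbits0]
        simp [hag0, ← hal e he]
    · intro k hk F b hF hbk hb
      have hk : k < n := by simpa using hk
      obtain ⟨i, rfl⟩ : ∃ j : Fin n, (j : ℕ) = k := ⟨⟨k, hk⟩, rfl⟩
      simp only [List.getElem_finRange, Fin.cast_mk, Fin.eta]
      refine (drawStepCode_spec (a := a) (by rw [hF.N 0 rfl, g0]) hbk
        (by rw [hF.N 1 rfl, hF₁.N 1 rfl]) (by rw [hF.A 4 rfl, hF₁.A 4 rfl])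
        (by rw [hF.A 7 rfl, hF₁.A 7 rfl]) hq hinj hrow hb).weaken fun F' _ b' _ h => ?_
      obtain ⟨a1, a2, a3, a4, a5, a6, a7⟩ := h
      exact ⟨a1, a2, by simpa using a3, by simpa using a4, a5,
        by rw [Mem.setN_N, if_neg (by decide)]; exact a6, a7⟩
  have := Sim.bind (μ' := PMF.pure) (ν' := uniform) (R' := fun S (a' : Mem) => a'.set n 5 = S) hloop
    fun F _ b _ hb => ?_
  · simpa using this
  -- With all entries decided, agreement means equality, so only the recorded set remains.
  · obtain ⟨S, hS⟩ := hb.nonempty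
    have hall : ∀ S ∈ F, S = b.set n 5 := by
      intro S hS
      rw [hb.family, Finset.mem_filter] at hS
      have := hS.2
      rw [AgreesBelow, Finset.filter_true_of_mem (fun j _ => by simp)] at this
      rw [this]
      ext j
      simp [bits, Mem.mem_set]
    have hFs : F = {b.set n 5} := by
      ext S'
      rw [Finset.mem_singleton]
      exact ⟨hall S', fun h => by rw [h, ← hall S hS]; exact hS⟩
    rw [hFs, uniform_singleton]
    exact Sim.pure rfl

/-- Each draw is uniform outside the rows already present, which is `extendStep`. A new row is
written behind the earlier ones and leaves them unchanged. -/
theorem drawRowsCode_spec {a : Mem} (h0 : a.N 0 = n)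
    (hm : a.N 1 ≤ ((a.set n 4).powersetCard (a.N 18)).card) :
    Sim (drawRowsCode.den M val a)
      (uniform (((a.set n 4).powersetCard (a.N 18)).powersetCard (a.N 1)))
      (fun T a' => T = (Finset.range (a.N 1)).image (a'.row n) ∧
        Set.InjOn (a'.row n) (Finset.range (a.N 1))) := by
  set U := (a.set n 4).powersetCard (a.N 18) with hU
  rw [drawRowsCode, den_setN_seq, ← foldP_extendStep U hm]
  refine (Sim.forLoop rfl (List.range (a.N 1)) (by simp) _
    (fun (k : ℕ) (E : Finset (Finset (Fin n))) (b : Mem) => b.N 19 = k * n ∧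
      E = (Finset.range k).image (b.row n) ∧ Set.InjOn (b.row n) (Finset.range k) ∧ E ⊆ U)
      (by simp) ?_).weaken ?_
  · rintro k hk E b hF hbk ⟨hb19, hbE, hbi, hEU⟩
    have hk : k < a.N 1 := by simpa using hk
    have e0 : b.N 0 = n := by rw [hF.N 0 rfl]; simpa using h0
    have e1 : b.N 1 = a.N 1 := by rw [hF.N 1 rfl]; simp
    have e18 : b.N 18 = a.N 18 := by rw [hF.N 18 rfl]; simp
    have e4 : b.A 4 = a.A 4 := hF.A 4 rfl
    rw [den_setN_seq, extendStep, ← PMF.bind_pure_comp]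
    have hd := drawCode_spec (M := M) (val := val) (a := b.setN 17 k) (by simpa using e0)
      (by simp [e1, hk.le]) (by simpa using hbi) (fun e he => by
        simp only [Mem.set_setN, Mem.setN_N, Mem.set_congr e4, e18, if_true, Nat.reduceEqDiff,
          if_false] at he ⊢
        exact hEU (by rw [hbE]; exact Finset.mem_image_of_mem _ (by simpa using he))) (by
        simp only [Mem.set_setN, Mem.setN_N, Mem.set_congr e4, e18, if_true, Nat.reduceEqDiff,
          if_false]
        rw [show (Finset.range k).image ((b.setN 17 k).row n) = E from hbE.symm, ← hU,
          ← Finset.card_pos, Finset.card_sdiff_of_subset hEU, hbE,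
          Finset.card_image_of_injOn hbi, Finset.card_range]
        omega)
    simp only [Mem.set_setN, Mem.setN_N, Mem.set_congr e4, e18, if_true, Nat.reduceEqDiff,
          if_false] at hd
    rw [show (Finset.range k).image ((b.setN 17 k).row n) = E from hbE.symm, ← hU] at hd
    simp only [NExp.eval, hbk]
    refine Sim.seq hd fun S hS b₁ hF₁ hb₁ => ?_
    have hSU : S ∈ U \ E := by
      have hne : (U \ E).Nonempty := by
        rw [← Finset.card_pos, Finset.card_sdiff_of_subset hEU, hbE,
          Finset.card_image_of_injOn hbi, Finset.card_range]
        omega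
      rwa [support_uniform hne, Finset.mem_coe] at hS
    have g0 : b₁.N 0 = n := by rw [hF₁.N 0 rfl]; simpa using e0
    have g19 : b₁.N 19 = k * n := by rw [hF₁.N 19 rfl]; simpa using hb19
    have g7 : b₁.A 7 = b.A 7 := by rw [hF₁.A 7 rfl]; rfl
    refine Sim.of_always ?_
    refine (Always.forLoop rfl (fun l c => c.N 19 = k * n + l ∧
      (∀ i < l, c.A 7 (k * n + i) = b₁.A 5 i) ∧ ∀ p < k * n, c.A 7 p = b.A 7 p)
      (by simp [g19, g7]) ?_).weaken ?_
    · rintro l hl c hF₂ hcl ⟨hc19, hc1, hc2⟩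
      simp only [den_setA_seq, den_setN, always_pure, NExp.eval]
      refine ⟨by simp [hc19]; ring, fun i hi => ?_, fun p hp => ?_⟩
      · rcases Nat.lt_succ_iff_lt_or_eq.1 hi with h | h
        · simp [hc19, show i ≠ l by omega, hc1 i h]
        · simp [hc19, h, hcl, hF₂.A 5 rfl]
      · simp [hc19, show p ≠ k * n + l by omega, hc2 p hp]
    · rintro c _ ⟨hc19, hc1, hc2⟩
      rw [g0] at hc19 hc1
      have rk : c.row n k = S := by
        rw [← hb₁]; ext i; simp [Mem.row, Mem.mem_set, hc1 i i.2]
      have rlt : ∀ e < k, c.row n e = b.row n e := by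
        intro e he
        ext i
        have : e * n + i < k * n := by
          calc e * n + i < e * n + n := by have := i.2; omega
            _ = (e + 1) * n := by ring
            _ ≤ k * n := Nat.mul_le_mul_right _ he
        simp [Mem.row, hc2 _ this]
      have hrw : ((c.setN 23 (k + 1)).row n) = c.row n := rfl
      have himg : (Finset.range k).image (c.row n) = E := by
        rw [hbE]
        exact Finset.image_congr fun e he => rlt e (by simpa using he)
      have hS' := Finset.mem_sdiff.1 hSU
      refine ⟨by simp [hc19]; ring, ?_, ?_, Finset.insert_subset hS'.1 hEU⟩
      · rw [hrw, Finset.range_add_one, Finset.image_insert, himg, rk]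
      · rw [hrw, Finset.range_add_one, Finset.coe_insert, Set.injOn_insert (by simp)]
        constructor
        · intro e he e' he' h
          have h1 : e < k := by simpa using he
          have h2 : e' < k := by simpa using he'
          rw [rlt e h1, rlt e' h2] at h
          exact hbi he he' h
        · rw [rk, ← Finset.coe_image, himg]
          simpa using hS'.2
  · rintro T _ b _ ⟨-, h1, h2, -⟩
    simp only [List.length_range] at h1 h2
    exact ⟨h1, h2⟩

end Prog


/-! ### Correctness of the program: the meta-algorithm -/

theorem measuredContinuousGreedy_eq_foldP {n : ℕ} (M : Matroid (Fin n)) (H : Finset (Fin n)) (s : ℕ)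
    (g : Finset (Fin n) → ℝ) :
    measuredContinuousGreedy (n - H.card) s (greedySet M H) (roundSet M H) g =
      (foldP (roundStep M H (stepSize (n - H.card)) s (greedySet M H) g)
        (List.range ((n - H.card) ^ 4)) (fun _ => 0, H)).map fun p => p.2 \ H := by
  rw [foldP_roundStep, PMF.map_bind, measuredContinuousGreedy]
  congr 1
  funext L
  rw [PMF.map_comp]
  rfl

namespace Prog
open Classical
variable {n : ℕ} {M : Matroid (Fin n)} {val : Finset (Fin n) → ℝ}

theorem rowAverage_eq_sampledSurrogate {a : Mem}
    (hinj : Set.InjOn (a.row n) (Finset.range (a.N 1))) :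
    rowAverage val a = sampledSurrogate val ((Finset.range (a.N 1)).image (a.row n)) := by
  funext S
  rw [sampledSurrogate, Finset.sum_image hinj, Finset.card_image_of_injOn hinj, Finset.card_range]
  rfl

theorem baseCode_spec {a : Mem} (h0 : a.N 0 = n) : Always (baseCode.den M val a) fun a' =>
    a'.set n 4 = greedySet M ∅ (fun _ => 1) ∧ a'.N 12 = (greedySet M ∅ fun _ => 1).card ∧
      ∀ i < n, a'.A 11 i = 0 := by
  rw [baseCode]
  refine Always.seq (Always.forLoop rfl (fun k b => ∀ i < k, b.A 0 i = 0 ∧ b.Y 0 i = 1)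
    (by simp) ?_) ?_
  · intro k hk b hF hbk hb
    simp only [den_setA_seq, den_setY, always_pure]
    intro i hi
    rcases Nat.lt_succ_iff_lt_or_eq.1 hi with h | h
    · simp [hbk, show i ≠ k by omega, hb i h]
    · simp [hbk, h]
  · intro a₁ hF₁ h₁
    rw [h0] at h₁
    have g0 : a₁.N 0 = n := by rw [hF₁.N 0 rfl, h0]
    refine Always.seq (greedyCode_spec g0) fun a₂ hF₂ h₂ => ?_
    have e0 : a₁.set n 0 = ∅ := by
      ext i; simp [Mem.mem_set, (h₁ i i.2).1]
    have e1 : (fun i : Fin n => a₁.Y 0 i) = fun _ => 1 := by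
      funext i; exact (h₁ i i.2).2
    rw [e0, e1] at h₂
    have k0 : a₂.N 0 = n := by rw [hF₂.N 0 rfl, g0]
    set B := greedySet M ∅ (fun _ => 1) with hB
    rw [den_setN_seq]
    refine (Always.forLoop rfl (fun k b => b.N 12 = (B.filter fun j : Fin n => (j : ℕ) < k).card ∧
      ∀ i < k, b.A 4 i = a₂.A 1 i ∧ b.A 11 i = 0) (by simp) ?_).weaken ?_
    · rintro k hk b hF hbk ⟨hb1, hb2⟩
      have hk : k < n := by simpa [k0] using hk
      obtain ⟨i, rfl⟩ : ∃ j : Fin n, (j : ℕ) = k := ⟨⟨k, hk⟩, rfl⟩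
      have eA1 : b.A 1 = a₂.A 1 := hF.A 1 rfl
      have hfil : B.filter (fun j : Fin n => (j : ℕ) < i + 1) =
          if i ∈ B then insert i (B.filter fun j : Fin n => (j : ℕ) < i)
          else B.filter fun j : Fin n => (j : ℕ) < i := by
        ext j
        by_cases hj : j = i
        · subst hj; split_ifs with h <;> simp [h]
        · have : (j : ℕ) ≠ i := fun h' => hj (Fin.ext h')
          have h3 : ((j : ℕ) < i + 1 ↔ (j : ℕ) < i) := by omega
          split_ifs <;> simp only [Finset.mem_filter, Finset.mem_insert, h3, hj, false_or]
      rw [hfil]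
      have hm : i ∈ B ↔ a₂.A 1 i ≠ 0 := by rw [← h₂]; exact Mem.mem_set
      have hrest : ∀ c : Mem, c.A 4 = (b.setA 4 i (a₂.A 1 i)).A 4 →
          c.A 11 = (b.setA 11 i 0).A 11 →
          ∀ j < (i : ℕ) + 1, c.A 4 j = a₂.A 1 j ∧ c.A 11 j = 0 := by
        intro c h4 h11 j hj
        rw [h4, h11]
        rcases Nat.lt_succ_iff_lt_or_eq.1 hj with h | h
        · simp [show j ≠ i by omega, hb2 j h]
        · simp [h]
      by_cases h1 : a₂.A 1 i = 0
      · rw [if_neg (by rw [hm]; simpa using h1)]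
        simp only [den_setA_seq, den_cond, NExp.eval, Mem.setA_N, hbk, Mem.setA_A, eA1, h1,
          ne_eq, den_skip, always_pure]
        simp only [Nat.reduceEqDiff, false_and, if_false, not_true_eq_false,
          OfNat.one_ne_ofNat, h1, always_pure]
        refine ⟨by simp [hb1], hrest _ ?_ ?_⟩ <;> (funext j; simp [h1])
      · rw [if_pos (hm.2 h1), Finset.card_insert_of_notMem (by simp)]
        simp only [den_setA_seq, den_cond, NExp.eval, Mem.setA_N, hbk, Mem.setA_A, eA1,
          ne_eq, den_setN]
        simp only [Nat.reduceEqDiff, false_and, if_false, not_false_eq_true, if_true,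
          OfNat.one_ne_ofNat, h1, always_pure]
        refine ⟨by simp [hb1], hrest _ ?_ ?_⟩ <;> (funext j; simp)
    · rintro b _ ⟨hb1, hb2⟩
      simp only [Mem.setN_N, show (0 : ℕ) ≠ 12 by decide, if_false, k0] at hb1 hb2
      refine ⟨?_, ?_, fun i hi => (hb2 i hi).2⟩
      · rw [← h₂]; ext i; simp [Mem.mem_set, (hb2 i i.2).1]
      · rw [hb1, Finset.filter_true_of_mem fun j _ => j.2]

theorem copyHCode_spec {a : Mem} (h0 : a.N 0 = n) : Always (copyHCode.den M val a) fun a' =>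
    a'.set n 0 = a.set n 5 ∧ a'.set n 4 = a.set n 5 ∧ a'.set n 9 = a.set n 5 ∧
      ∀ i : Fin n, a'.Y 1 i = 0 := by
  rw [copyHCode]
  refine (Always.forLoop rfl (fun k b => ∀ i < k, b.A 0 i = a.A 5 i ∧ b.A 4 i = a.A 5 i ∧
    b.A 9 i = a.A 5 i ∧ b.Y 1 i = 0) (by simp) ?_).weaken ?_
  · intro k hk b hF hbk hb
    simp only [den_setA_seq, den_setY, always_pure]
    intro i hi
    have e5 : b.A 5 = a.A 5 := hF.A 5 rfl
    rcases Nat.lt_succ_iff_lt_or_eq.1 hi with h | h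
    · simp [hbk, show i ≠ k by omega, hb i h]
    · simp [hbk, h, e5]
  · intro b _ hb
    rw [h0] at hb
    refine ⟨?_, ?_, ?_, fun i => (hb i i.2).2.2.2⟩ <;> ext i <;> simp [Mem.mem_set, hb i i.2]

theorem outputCode_spec {a : Mem} (h0 : a.N 0 = n) (h11 : ∀ i < n, a.A 11 i = 0) :
    Always (outputCode.den M val a) fun a' =>
      a'.set n 11 = (a.set n 9 \ a.set n 0) ∪ a.set n 5 := by
  rw [outputCode]
  refine (Always.forLoop rfl (fun k b => ∀ i < n, b.A 11 i ≠ 0 ↔ i < k ∧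
    ((a.A 9 i ≠ 0 ∧ a.A 0 i = 0) ∨ a.A 5 i ≠ 0)) (by simpa using h11) ?_).weaken ?_
  · intro k hk b hF hbk hb
    have hk : k < n := by simpa [h0] using hk
    have e5 : b.A 5 = a.A 5 := hF.A 5 rfl
    have e0 : b.A 0 = a.A 0 := hF.A 0 rfl
    have e9 : b.A 9 = a.A 9 := hF.A 9 rfl
    have hlt : ∀ e, e ≠ k → (e < k + 1 ↔ e < k) := by intro e h; omega
    have hbk0 : b.A 11 k = 0 := by
      by_contra h; exact lt_irrefl _ ((hb k hk).1 h).1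
    by_cases h5 : a.A 5 k = 0
    · by_cases hA0 : a.A 0 k = 0
      · simp only [den_cond, NExp.eval, hbk, e5, h5, e0, hA0, ne_eq, not_true_eq_false, if_false,
          den_setA, always_pure, e9]
        intro i hi
        by_cases h : i = k
        · simp [h, h5, hA0]
        · simpa [h, hlt i h, -Order.lt_add_one_iff] using hb i hi
      · simp only [den_cond, NExp.eval, hbk, e5, h5, e0, hA0, ne_eq, not_true_eq_false, if_false,
          den_skip, always_pure, not_false_eq_true, if_true]
        intro i hi
        by_cases h : i = k
        · simp [h, h5, hA0, hbk0]
        · simpa [h, hlt i h, -Order.lt_add_one_iff] using hb i hi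
    · simp only [den_cond, NExp.eval, hbk, e5, h5, ne_eq, den_setA, always_pure,
        not_false_eq_true, if_true]
      intro i hi
      by_cases h : i = k
      · simp [h, h5]
      · simpa [h, hlt i h, -Order.lt_add_one_iff] using hb i hi
  · intro b _ hb
    rw [h0] at hb
    ext i
    rw [Mem.mem_set, hb i i.2]
    simp only [i.2, true_and, Finset.mem_union, Finset.mem_sdiff, Mem.mem_set, not_not]

/-- The two numerical hypotheses make every family that is drawn from nonempty: enough distinct
smoothing sets exist inside `H`, and `H` has subsets of size `t`. -/
theorem mainCode_spec (hE : M.E = Set.univ) (s : ℕ → ℕ) {a : Mem} (h0 : a.N 0 = n)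
    (h2 : a.N 2 = s (n - a.N 5)) (h3 : a.N 3 = (n - a.N 5) ^ 4) (hX3 : a.X 3 = stepSize (n - a.N 5))
    (hm : a.N 1 ≤ (a.N 5).choose (a.N 4)) (ht : a.N 4 ≤ a.N 5) :
    (mainCode.den M val a).map (fun a' => a'.set n 11) =
      metaAlgorithm (greedySet M ∅ fun _ => 1) (a.N 5) (a.N 4) (a.N 1)
        (fun H => measuredContinuousGreedy (n - H.card) (s (n - H.card)) (greedySet M H)
          (roundSet M H)) val := by
  set B := greedySet M ∅ (fun _ : Fin n => (1 : ℝ)) with hB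
  have hBi : M.Indep (↑B : Set (Fin n)) := by
    have := (greedySet_isMaxWeight (M := M) (H := ∅) (by simp) (fun _ : Fin n => (1 : ℝ))).1.2
    simpa using this
  suffices hsim : Sim (mainCode.den M val a) (metaAlgorithm B (a.N 5) (a.N 4) (a.N 1)
        (fun H => measuredContinuousGreedy (n - H.card) (s (n - H.card)) (greedySet M H)
          (roundSet M H)) val) (fun S a' => a'.set n 11 = S) by
    have := hsim.map_eq (fun a' => a'.set n 11) id fun S _ a' _ h => h
    rwa [PMF.map_id] at this
  rw [mainCode]
  refine Sim.seq_always (baseCode_spec h0) fun a₁ hF₁ ⟨hb4, hb12, hb11⟩ => ?_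
  rw [← hB] at hb4 hb12
  have b0 : a₁.N 0 = n := by rw [hF₁.N 0 rfl, h0]
  have b5 : a₁.N 5 = a.N 5 := hF₁.N 5 rfl
  rw [metaAlgorithm, den_cond]
  simp only [NExp.eval, hb12, b5]
  by_cases hlt : B.card < a.N 5
  · rw [if_neg (show ¬ a.N 5 ≤ B.card by omega)]
    simp only [hlt, if_true, ne_eq, one_ne_zero, not_false_eq_true, den_skip]
    refine Sim.pure ?_
    ext i; simp [Mem.mem_set, hb11 i i.2]
  rw [if_pos (show a.N 5 ≤ B.card by omega)]
  simp only [hlt, if_false, ne_eq, not_true_eq_false]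
  rw [den_setN_seq, den_setN_seq]
  have hUne : (B.powersetCard (a.N 5)).Nonempty := Finset.powersetCard_nonempty.2 (by omega)
  have hd := drawCode_spec (M := M) (val := val)
    (a := (a₁.setN 18 ((NExp.var 5).eval n a₁)).setN 17 0)
    (by simpa using b0) (by simp) (by simp) (by simp) (by simpa [hb4, b5] using hUne)
  simp only [Mem.set_setN, Mem.setN_N, hb4, b5, if_true, Nat.reduceEqDiff, NExp.eval,
    if_false, Finset.range_zero, Finset.image_empty, Finset.sdiff_empty] at hd
  simp only [NExp.eval, b5]
  refine Sim.seq hd fun H hH a₂ hF₂ hH2 => ?_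
  rw [support_uniform hUne, Finset.mem_coe, Finset.mem_powersetCard] at hH
  have hHi : M.Indep (↑H : Set (Fin n)) := hBi.subset (by exact_mod_cast hH.1)
  have c0 : a₂.N 0 = n := by rw [hF₂.N 0 rfl]; simpa using b0
  refine Sim.seq_always (copyHCode_spec c0) fun a₃ hF₃ ⟨hc0, hc4, hc9, hcY⟩ => ?_
  rw [hH2] at hc0 hc4 hc9
  have d0 : a₃.N 0 = n := by rw [hF₃.N 0 rfl, c0]
  have dN : ∀ v ∈ [1, 2, 3, 4, 5], a₃.N v = a.N v := by
    intro v hv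
    simp only [List.mem_cons, List.not_mem_nil, or_false] at hv
    rcases hv with rfl | rfl | rfl | rfl | rfl <;>
      (rw [hF₃.N _ rfl, hF₂.N _ rfl]; exact hF₁.N _ rfl)
  rw [den_setN_seq]
  have hcard : a.N 1 ≤ (H.powersetCard (a.N 4)).card := by
    rw [Finset.card_powersetCard, hH.2]; exact hm
  have hr := drawRowsCode_spec (M := M) (val := val)
    (a := a₃.setN 18 ((NExp.var 4).eval n a₃)) (by simpa using d0)
    (by simpa [dN, hc4] using hcard)
  simp only [Mem.set_setN, Mem.setN_N, hc4, dN 4 (by simp), dN 1 (by simp), if_true,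
    Nat.reduceEqDiff, NExp.eval, if_false, OfNat.one_ne_ofNat] at hr
  simp only [NExp.eval, dN 4 (by simp)]
  refine Sim.seq hr fun T _ a₄ hF₄ ⟨hT, hTi⟩ => ?_
  have f0 : a₄.N 0 = n := by rw [hF₄.N 0 rfl]; simpa using d0
  have fN : ∀ v ∈ [1, 2, 3, 4, 5], a₄.N v = a.N v := by
    intro v hv
    rw [← dN v hv]
    simp only [List.mem_cons, List.not_mem_nil, or_false] at hv
    rcases hv with rfl | rfl | rfl | rfl | rfl <;> rw [hF₄.N _ rfl] <;> simp
  have fH0 : a₄.set n 0 = H := by rw [← hc0]; exact Mem.set_congr (hF₄.A 0 rfl)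
  have fH9 : a₄.set n 9 = H := by rw [← hc9]; exact Mem.set_congr (hF₄.A 9 rfl)
  have fX : a₄.X 3 = stepSize (n - H.card) := by
    rw [hF₄.X 3 rfl, Mem.setN_X, hF₃.X 3 rfl, hF₂.X 3 rfl, Mem.setN_X, Mem.setN_X, hF₁.X 3 rfl,
      hX3, hH.2]
  rw [← fN 1 (by simp)] at hT hTi
  have hrounds := roundsCode_spec (M := M) (val := val) hE f0 (by rwa [fH0]) (by rw [fH9, fH0])
    (fun i => by rw [hF₄.Y 1 rfl]; simpa using hcY i)
  rw [rowAverage_eq_sampledSurrogate hTi, ← hT, fH0, fX, fN 2 (by simp), fN 3 (by simp), h2, h3,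
    ← hH.2] at hrounds
  rw [measuredContinuousGreedy_eq_foldP, PMF.bind_map]
  refine Sim.seq hrounds fun p _ a₅ hF₅ hp => ?_
  have g0 : a₅.N 0 = n := by rw [hF₅.N 0 rfl, f0]
  have gH0 : a₅.set n 0 = H := by rw [← fH0]; exact Mem.set_congr (hF₅.A 0 rfl)
  have gH4 : a₅.set n 4 = H := by
    rw [← hc4]; exact Mem.set_congr ((hF₅.A 4 rfl).trans (hF₄.A 4 rfl))
  have g18 : a₅.N 18 = a.N 4 := by rw [hF₅.N 18 rfl, hF₄.N 18 rfl]; simp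
  have g11 : a₅.A 11 = a₁.A 11 := by
    rw [hF₅.A 11 rfl, hF₄.A 11 rfl]
    exact (hF₃.A 11 rfl).trans (hF₂.A 11 rfl)
  rw [den_setN_seq, Function.comp_apply, ← PMF.bind_pure_comp]
  have hVne : (H.powersetCard (a.N 4)).Nonempty :=
    Finset.powersetCard_nonempty.2 (by rw [hH.2]; exact ht)
  have hd' := drawCode_spec (M := M) (val := val) (a := a₅.setN 17 0)
    (by simpa using g0) (by simp) (by simp) (by simp) (by simpa [gH4, g18] using hVne)
  simp only [Mem.set_setN, Mem.setN_N, gH4, g18, if_true, Nat.reduceEqDiff,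
    if_false, Finset.range_zero, Finset.image_empty, Finset.sdiff_empty] at hd'
  refine Sim.seq hd' fun H' _ a₆ hF₆ hH' => ?_
  have l0 : a₆.N 0 = n := by rw [hF₆.N 0 rfl]; simpa using g0
  refine Sim.of_always ((outputCode_spec l0 fun i hi => ?_).weaken fun a₇ _ h => ?_)
  · rw [hF₆.A 11 rfl]; simpa [g11] using hb11 i hi
  · have e9 : a₆.set n 9 = p.2 := by rw [← hp]; exact Mem.set_congr (hF₆.A 9 rfl)
    have e0 : a₆.set n 0 = H := by rw [← gH0]; exact Mem.set_congr (hF₆.A 0 rfl)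
    rw [h, e9, e0, hH']

end Prog


/-! ### The parameters and the complete program -/

/-- The size of the input. -/
def inputSize (n : ℕ) (ε ν : ℝ) : ℕ := n + ⌈1 / ε⌉₊ + ⌈ν⌉₊

/-- The exponent of the least power of two that is at least the size of the input. -/
def sizeLog (n : ℕ) (ε ν : ℝ) : ℕ := Nat.clog 2 (inputSize n ε ν)

/-- The number of smoothing sets. -/
def numSets (n : ℕ) (ε ν : ℝ) : ℕ := 64 * (2 ^ sizeLog n ε ν) ^ 9

/-- The size of the smoothing sets. -/
def setSize (n : ℕ) (ε ν : ℝ) : ℕ := 8 + 9 * sizeLog n ε ν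

/-- The number of samples per round. -/
def numSamples (k : ℕ) : ℕ := 20 * k ^ 9

namespace Prog
open NExp Code

/-- The rounded-up value of real variable `x`. -/
def ceilCode (v x : ℕ) : Cmd :=
  .instr (.constN (2 + v) 0);; .instr (.castR 40 (2 + v));; .instr (.ltR 62 40 x);;
  .loop 62 (.instr (.constN 63 1);; .instr (.addN (2 + v) (2 + v) 63);;
    .instr (.castR 40 (2 + v));; .instr (.ltR 62 40 x))

/-- Multiply variable `z` by the power of variable `w` with exponent in variable `u`. -/
def powCode (z u w : ℕ) : Code :=
  forLoop 6 u (setN 22 (lit 0)⨾ forLoop 7 w (setN 22 (add (var 22) (var z)))⨾ setN z (var 22))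

/-- Variable `36` is the exponent nine of the numbers of smoothing sets and samples, and also the
factor of the logarithm in the set size; `37` and `38` are the exponents for the number of rounds
and for `h = t ^ 2`. The values in `1`, `4`, `2` are the constants of `numSets`, `setSize` and
`numSamples`, to be completed by the later loops. -/
def initCode : Code :=
  setN 0 size⨾ setN 27 (add (add size (var 25)) (var 26))⨾ setN 28 (lit 0)⨾ setN 29 (lit 1)⨾
  setN 36 (lit 9)⨾ setN 37 (lit 4)⨾ setN 38 (lit 2)⨾ setN 1 (lit 64)⨾ setN 4 (lit 8)⨾
  setN 5 (lit 1)⨾ setN 3 (lit 1)⨾ setN 2 (lit 20)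

def logCode : Code :=
  forLoop 6 27 (cond (lt (var 29) (var 27))
    (setN 29 (add (var 29) (var 29))⨾ setN 28 (add (var 28) (lit 1))) skip)

def setsCode : Code := powCode 1 36 29⨾ forLoop 6 36 (setN 4 (add (var 4) (var 28)))

def restCode : Code := powCode 5 38 4⨾ setN 24 (sub (var 0) (var 5))

def roundCountCode : Code :=
  powCode 3 37 24⨾ powCode 2 36 24⨾ setX 3 (.div (.cast (lit 1)) (.cast (var 3)))

/-- The complete program. -/
def program : Cmd :=
  (setX 10 (.div (.cast (lit 1)) (.var 0))).compile;; ceilCode 25 10;; ceilCode 26 1;;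
  initCode.compile;; logCode.compile;; setsCode.compile;; restCode.compile;;
  roundCountCode.compile;; mainCode.compile;; copyCode 11;; .instr (.constN 1 80)

variable {n : ℕ} {M : Matroid (Fin n)} {val : Finset (Fin n) → ℝ}

/-- Naturals are multiplied by repeated addition. The time is then proportional to the values, which
is harmless because all bounds are polynomial in the size of the input. -/
theorem powCode_spec {z u w : ℕ} {a : Mem} (hz : z ≠ 22 ∧ z ≠ 6 ∧ z ≠ 7)
    (hw : w ≠ z ∧ w ≠ 22 ∧ w ≠ 6 ∧ w ≠ 7) :
    Always ((powCode z u w).den M val a) fun a' => a'.N z = a.N z * a.N w ^ a.N u := by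
  rw [powCode]
  refine (Always.forLoop (by simp [Code.keepsN, hz.2.1.symm]) (fun k b => b.N z = a.N z * a.N w ^ k ∧ b.N w = a.N w)
    (by simp [hz, hw]) ?_).weaken fun b _ h => h.1
  rintro k hk b hF hbk ⟨hb1, hb2⟩
  rw [den_setN_seq]
  refine Always.seq (Always.forLoop (by simp [Code.keepsN]) (fun l c => c.N 22 = l * (a.N z * a.N w ^ k) ∧
    c.N z = a.N z * a.N w ^ k) (by simp [hz, hb1]) ?_) ?_
  · rintro l hl c hF' hcl ⟨hc1, hc2⟩
    simp only [den_setN, always_pure, NExp.eval]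
    refine ⟨by simp [hc1, hc2]; ring, by simp [hz, hc2]⟩
  · rintro c hF' ⟨hc1, hc2⟩
    have hcw : c.N w = a.N w := by
      rw [hF'.N w (by simp [Code.keepsN, hw])]; simp [hw, hb2]
    simp only [den_setN, always_pure, NExp.eval]
    refine ⟨?_, ?_⟩
    · simp only [Mem.setN_N, hz, if_true, if_false, hc1]
      simp [hw, hb2]; ring
    · simp [hw, hcw]

/-- The loop runs for as many rounds as the input size, which is at least the logarithm; once the
power of two is large enough it idles. -/
theorem logCode_spec {a : Mem} (h28 : a.N 28 = 0) (h29 : a.N 29 = 1) :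
    Always (logCode.den M val a) fun a' =>
      a'.N 28 = Nat.clog 2 (a.N 27) ∧ a'.N 29 = 2 ^ Nat.clog 2 (a.N 27) := by
  rw [logCode]
  refine (Always.forLoop rfl (fun k b => b.N 28 = min k (Nat.clog 2 (a.N 27)) ∧
    b.N 29 = 2 ^ min k (Nat.clog 2 (a.N 27))) (by simp [h28, h29]) ?_).weaken ?_
  · rintro k hk b hF hbk ⟨hb1, hb2⟩
    have h27 : b.N 27 = a.N 27 := hF.N 27 rfl
    by_cases hlt : k < Nat.clog 2 (a.N 27)
    · have e1 : min k (Nat.clog 2 (a.N 27)) = k := by omega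
      have e2 : min (k + 1) (Nat.clog 2 (a.N 27)) = k + 1 := by omega
      rw [e1] at hb1 hb2
      rw [e2]
      have : 2 ^ k < a.N 27 := (Nat.lt_clog_iff_pow_lt (by norm_num)).1 hlt
      simp [h27, hb1, hb2, this, always_pure]
      ring
    · have e1 : min k (Nat.clog 2 (a.N 27)) = Nat.clog 2 (a.N 27) := by omega
      have e2 : min (k + 1) (Nat.clog 2 (a.N 27)) = Nat.clog 2 (a.N 27) := by omega
      rw [e1] at hb1 hb2
      rw [e2]
      have : ¬ 2 ^ Nat.clog 2 (a.N 27) < a.N 27 := by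
        rw [← Nat.lt_clog_iff_pow_lt (by norm_num)]; simp
      simp [h27, hb1, hb2, this, always_pure]
  · rintro b _ ⟨hb1, hb2⟩
    have : Nat.clog 2 (a.N 27) ≤ a.N 27 := by
      rw [Nat.clog_le_iff_le_pow (by norm_num)]
      exact Nat.lt_two_pow_self.le
    rw [min_eq_right this] at hb1 hb2
    exact ⟨hb1, hb2⟩

theorem setsCode_spec {a : Mem} : Always (setsCode.den M val a) fun a' =>
    a'.N 1 = a.N 1 * a.N 29 ^ a.N 36 ∧ a'.N 4 = a.N 4 + a.N 36 * a.N 28 := by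
  rw [setsCode]
  refine Always.seq (powCode_spec (by decide) (by decide)) fun b hF hb => ?_
  have h4 : b.N 4 = a.N 4 := hF.N 4 rfl
  have h36 : b.N 36 = a.N 36 := hF.N 36 rfl
  have h28 : b.N 28 = a.N 28 := hF.N 28 rfl
  refine (Always.forLoop rfl (fun k c => c.N 4 = a.N 4 + k * a.N 28) (by simp [h4]) ?_).weaken ?_
  · intro k hk c hF' hck hc
    have : c.N 28 = a.N 28 := by rw [hF'.N 28 rfl, h28]
    simp [always_pure, hc, this]; ring
  · intro c hc hc'
    exact ⟨by rw [(Code.frame _ _ _ hc).N 1 rfl, hb], by rw [hc', h36]⟩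

theorem restCode_spec {a : Mem} : Always (restCode.den M val a) fun a' =>
    a'.N 5 = a.N 5 * a.N 4 ^ a.N 38 ∧ a'.N 24 = a.N 0 - a.N 5 * a.N 4 ^ a.N 38 := by
  rw [restCode]
  refine Always.seq (powCode_spec (by decide) (by decide)) fun b hF hb => ?_
  have h0 : b.N 0 = a.N 0 := hF.N 0 rfl
  simp [always_pure, hb, h0]

theorem roundCountCode_spec {a : Mem} : Always (roundCountCode.den M val a) fun a' =>
    a'.N 3 = a.N 3 * a.N 24 ^ a.N 37 ∧ a'.N 2 = a.N 2 * a.N 24 ^ a.N 36 ∧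
      a'.X 3 = 1 / ((a.N 3 * a.N 24 ^ a.N 37 : ℕ) : ℝ) := by
  rw [roundCountCode]
  refine Always.seq (powCode_spec (by decide) (by decide)) fun b hF hb => ?_
  refine Always.seq (powCode_spec (by decide) (by decide)) fun c hF' hc => ?_
  have h2 : b.N 2 = a.N 2 := hF.N 2 rfl
  have h24 : b.N 24 = a.N 24 := hF.N 24 rfl
  have h36 : b.N 36 = a.N 36 := hF.N 36 rfl
  have h3 : c.N 3 = a.N 3 * a.N 24 ^ a.N 37 := by rw [hF'.N 3 rfl, hb]
  rw [h2, h24, h36] at hc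
  simp [always_pure, hc, h3]

/-- A unary search, linear in the rounded value; this is affordable because the time bound is
polynomial in `1 / ε` and `ν`. For a real that is not positive the loop does not start, in
accordance with the natural ceiling. -/
theorem ceilCode_correct {v x : ℕ} (hv : v < 60) (hx : x < 40) {a : Mem} {σ : State}
    (hσ : Rep n a σ) : Reaches M val (ceilCode v x) σ (8 * ⌈a.X x⌉₊ + 7)
      (Rep n (a.setN v ⌈a.X x⌉₊)) := by
  set c := ⌈a.X x⌉₊ with hc
  have key : ∀ (k i : ℕ), i + k = c → ∀ σ : State, Rep n (a.setN v i) σ →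
      σ.nat 62 = (if (i : ℝ) < a.X x then 1 else 0) →
      Reaches M val (.loop 62 (.instr (.constN 63 1);; .instr (.addN (2 + v) (2 + v) 63);;
        .instr (.castR 40 (2 + v));; .instr (.ltR 62 40 x))) σ (8 * k + 1)
        (Rep n (a.setN v c)) := by
    intro k
    induction k with
    | zero =>
      intro i hi σ hσ h62
      have : i = c := by omega
      subst this
      refine Triple.loop_exit ?_ hσ
      rw [h62, if_neg]
      rw [not_lt]; exact Nat.le_ceil _
    | succ k ih =>
      intro i hi σ hσ h62
      have hlt : (i : ℝ) < a.X x := by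
        rw [← Nat.lt_ceil]; omega
      have hσv : σ.nat (2 + v) = i := by simpa using hσ.N v hv
      refine (Reaches.loop_iter (T := 7) (by rw [h62, if_pos hlt]; decide)
        (Q := fun τ => Rep n (a.setN v (i + 1)) τ ∧
          τ.nat 62 = if ((i + 1 : ℕ) : ℝ) < a.X x then 1 else 0) ?_ fun τ hτ =>
          ih (i + 1) (by omega) τ hτ.1 hτ.2).mono_time (by omega)
      refine Triple.mono_time (T := 1 + 2 + 2 + 2) (Triple.instr_seq rfl (Triple.instr_seq rfl
        (Triple.instr_seq rfl (Triple.instr_last rfl ⟨?_, ?_⟩)))) (by omega)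
      · refine Rep.scratch ?_ _ (by omega) (by omega)
        refine Rep.scratchReal ?_ _ (by omega) (by omega)
        have h1 : Rep n (a.setN v i) (σ.setNat 63 1) := hσ.scratch _ (by omega) (by omega)
        have h2 := h1.setN hv (i + 1)
        have e1 : (a.setN v i).setN v (i + 1) = a.setN v (i + 1) := by
          simp [Mem.setN]
        rw [e1] at h2
        simpa [show ¬ (2 + v = 63) by omega, hσv] using h2
      · have hX : σ.real x = a.X x := by simpa using hσ.X x hx
        simp [show ¬ (2 + v = 63) by omega, hσv, show ¬ (x = 40) by omega, hX]
  refine Triple.mono_time (T := 8 * c + 1 + 2 + 2 + 2) (Triple.instr_seq rfl (Triple.instr_seq rfl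
    (Triple.instr_seq rfl (key c 0 (by omega) _ ?_ ?_)))) (by omega)
  · refine Rep.scratch ?_ _ (by omega) (by omega)
    refine Rep.scratchReal ?_ _ (by omega) (by omega)
    exact hσ.setN hv 0
  · have hX : σ.real x = a.X x := hσ.X x hx
    simp [show ¬ (x = 40) by omega, hX]

/-- Compiled code with a deterministic effect, followed by another command. -/
theorem compile_then {X : Type} {c : Code} {d : Cmd} {P : List ℕ} {B : ℕ} (hB : n ≤ B)
    (hok : c.ok = true) (hbd : c.boundsIn P = true) (hk : ∀ w ∈ P, c.keepsN w = true) {a : Mem}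
    {σ : State} (ha : ∀ w ∈ P, a.N w ≤ B) (hσ : Rep n a σ) {Q : Mem → Prop}
    (hQ : Always (c.den M val a) Q) {T : ℕ} {μ : PMF X} {R : X → State → Prop}
    (hd : ∀ a' τ, Frame c a a' → Q a' → Rep n a' τ → Triple M val d τ T μ R) :
    Triple M val (c.compile;; d) σ (c.cost B + T + 1) μ R := by
  have := Triple.seq (ν := fun _ => μ) (c.compile_correct (M := M) (val := val) hB hok hbd hk ha hσ)
    (fun a' ha' τ hτ => hd a' τ (c.frame a a' ha') (hQ a' ha') hτ)
  simpa using this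

/-- A bound on the running time in terms of the size of the input. -/
def runtime (N : ℕ) : ℕ :=
  -- The largest loop bound is the number of smoothing sets, at most `64 (2 N) ^ 9 = 2 ^ 15 N ^ 9`;
  -- this also covers the other bounds.
  let B := 2 ^ 15 * (N + 1) ^ 9
  (setX 10 (.div (.cast (lit 1)) (.var 0))).cost B + initCode.cost B + logCode.cost B +
    setsCode.cost B + restCode.cost B + roundCountCode.cost B + mainCode.cost B + 100 * (N + 1)

theorem runtime_le_poly : ∃ K d, ∀ N, runtime N ≤ K * (N + 1) ^ d := by
  have hadd : ∀ f g : ℕ → ℕ, (∃ K d, ∀ N, f N ≤ K * (N + 1) ^ d) →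
      (∃ K d, ∀ N, g N ≤ K * (N + 1) ^ d) → ∃ K d, ∀ N, f N + g N ≤ K * (N + 1) ^ d := by
    rintro f g ⟨K, d, hf⟩ ⟨K', d', hg⟩
    refine ⟨K + K', d + d', fun N => ?_⟩
    have h1 : (N + 1) ^ d ≤ (N + 1) ^ (d + d') := Nat.pow_le_pow_right (by omega) (by omega)
    have h2 : (N + 1) ^ d' ≤ (N + 1) ^ (d + d') := Nat.pow_le_pow_right (by omega) (by omega)
    have := Nat.mul_le_mul_left K h1
    have := Nat.mul_le_mul_left K' h2
    have := hf N
    have := hg N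
    rw [add_mul]
    omega
  have hcode : ∀ c : Code, ∃ K d, ∀ N, c.cost (2 ^ 15 * (N + 1) ^ 9) ≤ K * (N + 1) ^ d := by
    intro c
    obtain ⟨K, d, h⟩ := c.cost_le_poly
    refine ⟨K * (2 ^ 16) ^ d, 9 * d, fun N => (h _).trans ?_⟩
    have h1 : 2 ^ 15 * (N + 1) ^ 9 + 1 ≤ 2 ^ 16 * (N + 1) ^ 9 := by
      have : 1 ≤ (N + 1) ^ 9 := Nat.one_le_pow _ _ (by omega)
      omega
    calc K * (2 ^ 15 * (N + 1) ^ 9 + 1) ^ d ≤ K * (2 ^ 16 * (N + 1) ^ 9) ^ d :=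
          Nat.mul_le_mul_left _ (Nat.pow_le_pow_left h1 d)
      _ = K * (2 ^ 16) ^ d * (N + 1) ^ (9 * d) := by rw [mul_pow, pow_mul]; ring
  exact hadd _ _ (hadd _ _ (hadd _ _ (hadd _ _ (hadd _ _ (hadd _ _ (hadd _ _ (hcode _) (hcode _))
    (hcode _)) (hcode _)) (hcode _)) (hcode _)) (hcode _)) ⟨100, 1, fun N => by simp⟩

end Prog

/-! ### Numerical bounds for the parameters of the algorithm -/

theorem le_pow_sizeLog (n : ℕ) (ε ν : ℝ) : inputSize n ε ν ≤ 2 ^ sizeLog n ε ν :=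
  Nat.le_pow_clog (by norm_num) _

theorem pow_sizeLog_le {n : ℕ} (hn : 0 < n) (ε ν : ℝ) :
    2 ^ sizeLog n ε ν ≤ 2 * inputSize n ε ν := by
  have hN : 0 < inputSize n ε ν := by unfold inputSize; omega
  rcases Nat.eq_zero_or_pos (sizeLog n ε ν) with h | h
  · rw [h]; omega
  · have h1 : 2 ^ (sizeLog n ε ν - 1) < inputSize n ε ν := by
      rw [← Nat.lt_clog_iff_pow_lt (by norm_num)]
      exact Nat.sub_lt h (by norm_num)
    have h2 : 2 ^ sizeLog n ε ν = 2 * 2 ^ (sizeLog n ε ν - 1) := by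
      rw [← pow_succ']; congr 1; omega
    omega

/-- The binomial coefficient is at least `(t² + 1 - t) ^ t / t!`, where `t! ≤ t ^ t` and `2 t ≤ t² +
1 - t`. This guarantees that a set of `t²` elements has enough distinct smoothing subsets. -/
theorem two_pow_le_choose_sq {t : ℕ} (ht : 3 ≤ t) : 2 ^ t ≤ (t ^ 2).choose t := by
  have h := Nat.pow_le_choose (α := ℚ) t (t ^ 2)
  have h1 : 2 * t ≤ t ^ 2 + 1 - t := by
    have : 3 * t ≤ t ^ 2 := by nlinarith
    omega
  have h2 : 2 ^ t * t.factorial ≤ (t ^ 2 + 1 - t) ^ t := by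
    calc 2 ^ t * t.factorial ≤ 2 ^ t * t ^ t := Nat.mul_le_mul_left _ (Nat.factorial_le_pow t)
      _ = (2 * t) ^ t := (mul_pow _ _ _).symm
      _ ≤ _ := Nat.pow_le_pow_left h1 t
  have h3 : (2 ^ t : ℚ) ≤ ((t ^ 2 + 1 - t : ℕ) ^ t : ℚ) / (t.factorial : ℚ) := by
    rw [le_div_iff₀ (by exact_mod_cast t.factorial_pos)]
    exact_mod_cast h2
  exact_mod_cast h3.trans h

/-- The reason for rounding the input size up to a power of two: the logarithm of `4 m` is then an
integer, and `t` can be equal to it. -/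
theorem numSets_eq (n : ℕ) (ε ν : ℝ) : 4 * numSets n ε ν = 2 ^ setSize n ε ν := by
  rw [numSets, setSize, ← pow_mul, pow_add, mul_comm (sizeLog n ε ν)]
  ring

theorem numSets_le_choose (n : ℕ) (ε ν : ℝ) :
    numSets n ε ν ≤ (setSize n ε ν ^ 2).choose (setSize n ε ν) := by
  have h1 := numSets_eq n ε ν
  have h2 := two_pow_le_choose_sq (t := setSize n ε ν) (by unfold setSize; omega)
  omega

/-- With `N` the input size, the three factors are at most `8 N ^ 2`, `N ^ 6` and `8 N`; this is the
origin of the constant `64` and the exponent `9`. -/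
theorem numSets_lower {n : ℕ} {ε ν : ℝ} (hn : 0 < n) (hε : 0 < ε) (hν : 0 ≤ ν) :
    max 2 (8 * ν ^ 2) * ((n : ℝ) ^ 4 / ε ^ 2) * (n + Real.log (4 * n)) ≤ numSets n ε ν := by
  set N : ℝ := (inputSize n ε ν : ℝ) with hN
  have hn1 : (1 : ℝ) ≤ n := by exact_mod_cast hn
  have hce : 1 / ε ≤ (⌈1 / ε⌉₊ : ℝ) := Nat.le_ceil _
  have hcn : ν ≤ (⌈ν⌉₊ : ℝ) := Nat.le_ceil _
  have hNe : N = n + (⌈1 / ε⌉₊ : ℝ) + (⌈ν⌉₊ : ℝ) := by rw [hN, inputSize]; push_cast; ring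
  have hce0 : (0 : ℝ) ≤ (⌈1 / ε⌉₊ : ℝ) := by positivity
  have hcn0 : (0 : ℝ) ≤ (⌈ν⌉₊ : ℝ) := by positivity
  have h1 : (n : ℝ) ≤ N := by linarith
  have h2 : 1 / ε ≤ N := by linarith
  have h3 : ν ≤ N := by linarith
  have hN1 : 1 ≤ N := hn1.trans h1
  have hmax : max 2 (8 * ν ^ 2) ≤ 8 * N ^ 2 := by
    refine max_le (by nlinarith) ?_
    have : ν ^ 2 ≤ N ^ 2 := pow_le_pow_left₀ hν h3 2
    linarith
  have hdiv : (n : ℝ) ^ 4 / ε ^ 2 ≤ N ^ 6 := by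
    have : (n : ℝ) ^ 4 / ε ^ 2 = n ^ 4 * (1 / ε) ^ 2 := by field_simp
    rw [this, show N ^ 6 = N ^ 4 * N ^ 2 by ring]
    gcongr
  have hlog : n + Real.log (4 * n) ≤ 8 * N := by
    have := Real.log_le_sub_one_of_pos (show (0 : ℝ) < 4 * n by positivity)
    linarith
  have hlog0 : 0 ≤ n + Real.log (4 * n) := by
    have := Real.log_nonneg (show (1 : ℝ) ≤ 4 * n by linarith)
    linarith
  have hp : N ≤ ((2 ^ sizeLog n ε ν : ℕ) : ℝ) := by
    rw [hN]; exact_mod_cast le_pow_sizeLog n ε ν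
  calc max 2 (8 * ν ^ 2) * ((n : ℝ) ^ 4 / ε ^ 2) * (n + Real.log (4 * n))
      ≤ (8 * N ^ 2) * N ^ 6 * (8 * N) := by gcongr
    _ = 64 * N ^ 9 := by ring
    _ ≤ 64 * ((2 ^ sizeLog n ε ν : ℕ) : ℝ) ^ 9 := by gcongr
    _ = numSets n ε ν := by rw [numSets]; push_cast; ring

theorem setSize_lower (n : ℕ) (ε ν : ℝ) :
    Real.logb 2 (4 * numSets n ε ν) ≤ setSize n ε ν := by
  have : (4 * numSets n ε ν : ℝ) = (2 : ℝ) ^ setSize n ε ν := by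
    exact_mod_cast numSets_eq n ε ν
  rw [this, Real.logb_pow]
  simp

/-- From `log (2 k) ≤ 2 k`. For `k = 0` the left side vanishes because division by zero gives zero.
-/
theorem numSamples_lower (k : ℕ) :
    10 / stepSize k ^ 2 * Real.log (2 * k) ≤ numSamples k := by
  rcases Nat.eq_zero_or_pos k with rfl | hk
  · simp [stepSize]
  · have hk0 : (0 : ℝ) < k := by exact_mod_cast hk
    have h1 : 10 / stepSize k ^ 2 = 10 * (k : ℝ) ^ 8 := by
      rw [stepSize]; field_simp
    have h2 : Real.log (2 * k) ≤ 2 * k := by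
      have := Real.log_le_sub_one_of_pos (show (0 : ℝ) < 2 * k by positivity)
      linarith
    rw [h1, numSamples]
    push_cast
    calc 10 * (k : ℝ) ^ 8 * Real.log (2 * k) ≤ 10 * (k : ℝ) ^ 8 * (2 * k) := by gcongr
      _ = 20 * (k : ℝ) ^ 9 := by ring

namespace Prog
variable {n : ℕ} {M : Matroid (Fin n)} {val : Finset (Fin n) → ℝ}

/-- The memory at the start. -/
def inputMem (ε ν α : ℝ) : Mem where
  N := fun _ => 0
  A := fun _ _ => 0
  X := fun i => if i = 0 then ε else if i = 1 then ν else if i = 2 then α else 0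
  Y := fun _ _ => 0

theorem rep_input (n : ℕ) (ε ν α : ℝ) : Rep n (inputMem ε ν α) (inputState n ε ν α) := by
  constructor
  · simp [inputState]
  · intro v _; simp [inputState, inputMem]
  · intro j _ i
    simp [inputState, inputMem]
  · intro x _; simp [inputState, inputMem]
  · intro j _ i
    simp only [inputState, inputMem]
    rw [if_neg (by omega), if_neg (by omega), if_neg (by omega)]

/-- The phases are chained by their specifications. Each phase that computes parameters has an exact
deterministic effect, so the only randomness to be simulated is that of `mainCode`. -/
theorem program_settles (hn : 0 < n) {ε ν α : ℝ} (hE : M.E = Set.univ) :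
    Settles M val ([program], inputState n ε ν α) (runtime (inputSize n ε ν))
      (metaAlgorithm (greedySet M ∅ fun _ => 1) (setSize n ε ν ^ 2) (setSize n ε ν)
        (numSets n ε ν) (fun H => measuredContinuousGreedy (n - H.card) (numSamples (n - H.card))
          (greedySet M H) (roundSet M H)) val) := by
  set N := inputSize n ε ν with hN
  set B := 2 ^ 15 * (N + 1) ^ 9 with hBdef
  have hNn : n ≤ N := by rw [hN, inputSize]; omega
  have hpow : ∀ j, 1 ≤ j → j ≤ 9 → N ^ j ≤ (N + 1) ^ 9 := fun j h1 h9 =>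
    (Nat.pow_le_pow_left (by omega) j).trans (Nat.pow_le_pow_right (by omega) h9)
  have hN1 : N ≤ (N + 1) ^ 9 := by simpa using hpow 1 le_rfl (by norm_num)
  have hone : 1 ≤ (N + 1) ^ 9 := Nat.one_le_pow _ _ (by omega)
  have hnB : n ≤ B := by omega
  have hp2 : 2 ^ sizeLog n ε ν ≤ 2 * N := pow_sizeLog_le hn ε ν
  have hlogN : sizeLog n ε ν < 2 * N := Nat.lt_two_pow_self.trans_le hp2
  have hmB : numSets n ε ν ≤ B := by
    calc numSets n ε ν ≤ 64 * (2 * N) ^ 9 := Nat.mul_le_mul_left _ (Nat.pow_le_pow_left hp2 9)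
      _ = 2 ^ 15 * N ^ 9 := by rw [mul_pow]; ring
      _ ≤ B := Nat.mul_le_mul_left _ (hpow 9 (by norm_num) le_rfl)
  have htB : setSize n ε ν ≤ B := by unfold setSize; omega
  set h := setSize n ε ν ^ 2 with hh
  have hkN : n - h ≤ N := by omega
  have hk4 : (n - h) ^ 4 ≤ B := by
    have := (Nat.pow_le_pow_left hkN 4).trans (hpow 4 (by norm_num) (by norm_num))
    omega
  have hk9 : numSamples (n - h) ≤ B := by
    have := (Nat.pow_le_pow_left hkN 9).trans (hpow 9 (by norm_num) le_rfl)
    unfold numSamples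
    omega
  set law := metaAlgorithm (greedySet M ∅ fun _ => 1) h (setSize n ε ν)
        (numSets n ε ν) (fun H => measuredContinuousGreedy (n - H.card) (numSamples (n - H.card))
          (greedySet M H) (roundSet M H)) val with hlaw
  have htr : Triple M val program (inputState n ε ν α) (runtime N) law
      (fun S τ => τ.block n 1 = S) := by
    refine Triple.mono_time (T := (Code.setX 10 (.div (.cast (.lit 1)) (.var 0))).cost B +
      (8 * N + 7 + (8 * N + 7 + (initCode.cost B + (logCode.cost B + (setsCode.cost B +
      (restCode.cost B + (roundCountCode.cost B + (mainCode.cost B + (28 * n + 6 + 1 + 1) + 1)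
      + 1) + 1) + 1) + 1) + 1) + 1) + 1) + 1) ?_ ?_
    · refine compile_then (P := []) hnB rfl rfl (by simp) (by simp) (rep_input n ε ν α)
        (Q := fun a' => a' = (inputMem ε ν α).setX 10 (1 / ε)) ?_ fun a₁ τ₁ _ ha₁ hτ₁ => ?_
      · simp [always_pure, inputMem]
      have x1 : a₁.X 1 = ν := by rw [ha₁]; simp [inputMem]
      have x10 : a₁.X 10 = 1 / ε := by rw [ha₁]; simp
      refine Reaches.then (Triple.mono_time (ceilCode_correct (v := 25) (x := 10) (by norm_num)
        (by norm_num) hτ₁)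
        (by rw [x10, hN, inputSize]; omega))
        fun τ₂ hτ₂ => ?_
      refine Reaches.then (Triple.mono_time (ceilCode_correct (v := 26) (x := 1) (by norm_num)
        (by norm_num) hτ₂) (by rw [Mem.setN_X, x1, hN, inputSize]; omega))
        fun τ₃ hτ₃ => ?_
      simp only [Mem.setN_X, x1, x10] at hτ₃
      refine compile_then (P := []) hnB rfl rfl (by simp) (by simp) hτ₃
        (Q := fun a' => a'.N 0 = n ∧ a'.N 27 = N ∧ a'.N 28 = 0 ∧ a'.N 29 = 1 ∧ a'.N 36 = 9 ∧
          a'.N 37 = 4 ∧ a'.N 38 = 2 ∧ a'.N 1 = 64 ∧ a'.N 4 = 8 ∧ a'.N 5 = 1 ∧ a'.N 3 = 1 ∧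
          a'.N 2 = 20) (by simp [initCode, always_pure, hN, inputSize])
          fun a₄ τ₄ _ ⟨q0, q27, q28, q29, q36, q37, q38, q1, q4, q5, q3, q2⟩ hτ₄ => ?_
      refine compile_then (P := [27]) hnB rfl rfl (by simp; rfl) (by simp [q27]; omega) hτ₄
        (logCode_spec q28 q29) fun a₅ τ₅ hF₅ ⟨r28, r29⟩ hτ₅ => ?_
      rw [q27] at r28 r29
      refine compile_then (P := [29, 36]) hnB rfl rfl (by simp; exact ⟨rfl, rfl⟩)
        (by
          have : Nat.clog 2 N = sizeLog n ε ν := rfl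
          have h36 : a₅.N 36 = 9 := by rw [hF₅.N 36 rfl, q36]
          simp only [List.mem_cons, List.not_mem_nil, or_false, forall_eq_or_imp, forall_eq, r29,
            h36, this]
          omega) hτ₅ setsCode_spec fun a₆ τ₆ hF₆ ⟨s1, s4⟩ hτ₆ => ?_
      have s1' : a₆.N 1 = numSets n ε ν := by
        rw [s1, hF₅.N 1 rfl, q1, r29, hF₅.N 36 rfl, q36]; rfl
      have s4' : a₆.N 4 = setSize n ε ν := by
        rw [s4, hF₅.N 4 rfl, q4, r28, hF₅.N 36 rfl, q36]; rfl
      refine compile_then (P := [4, 38]) hnB rfl rfl (by simp; exact ⟨rfl, rfl⟩)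
        (by
          have h38 : a₆.N 38 = 2 := by rw [hF₆.N 38 rfl, hF₅.N 38 rfl, q38]
          simp only [List.mem_cons, List.not_mem_nil, or_false, forall_eq_or_imp, forall_eq, s4',
            h38]
          omega) hτ₆ restCode_spec fun a₇ τ₇ hF₇ ⟨u5, u24⟩ hτ₇ => ?_
      have u5' : a₇.N 5 = h := by
        rw [u5, s4', hF₆.N 5 rfl, hF₅.N 5 rfl, q5, hF₆.N 38 rfl, hF₅.N 38 rfl, q38, one_mul]
      have u0 : a₇.N 0 = n := by rw [hF₇.N 0 rfl, hF₆.N 0 rfl, hF₅.N 0 rfl, q0]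
      have u24' : a₇.N 24 = n - h := by
        rw [u24, ← u5, u5', hF₆.N 0 rfl, hF₅.N 0 rfl, q0]
      have u36 : a₇.N 36 = 9 := by rw [hF₇.N 36 rfl, hF₆.N 36 rfl, hF₅.N 36 rfl, q36]
      have u37 : a₇.N 37 = 4 := by rw [hF₇.N 37 rfl, hF₆.N 37 rfl, hF₅.N 37 rfl, q37]
      refine compile_then (P := [24, 36, 37]) hnB rfl rfl (by simp; exact ⟨rfl, rfl, rfl⟩)
        (by
          simp only [List.mem_cons, List.not_mem_nil, or_false, forall_eq_or_imp, forall_eq, u24',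
            u36, u37]
          omega) hτ₇ roundCountCode_spec fun a₈ τ₈ hF₈ ⟨w3, w2, wX⟩ hτ₈ => ?_
      have e3 : a₇.N 3 = 1 := by rw [hF₇.N 3 rfl, hF₆.N 3 rfl, hF₅.N 3 rfl, q3]
      have e2 : a₇.N 2 = 20 := by rw [hF₇.N 2 rfl, hF₆.N 2 rfl, hF₅.N 2 rfl, q2]
      rw [e3, u24', u37, one_mul] at w3 wX
      rw [e2, u24', u36] at w2
      have z0 : a₈.N 0 = n := by rw [hF₈.N 0 rfl, u0]
      have z5 : a₈.N 5 = h := by rw [hF₈.N 5 rfl, u5']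
      have z1 : a₈.N 1 = numSets n ε ν := by rw [hF₈.N 1 rfl, hF₇.N 1 rfl, s1']
      have z4 : a₈.N 4 = setSize n ε ν := by rw [hF₈.N 4 rfl, hF₇.N 4 rfl, s4']
      have hspec := mainCode_spec (M := M) (val := val) hE numSamples (a := a₈) z0
        (by rw [w2, z5]; rfl) (by rw [w3, z5])
        (by rw [wX, z5, stepSize]; push_cast; rw [one_div])
        (by rw [z1, z5, z4]; exact numSets_le_choose n ε ν)
        (by rw [z4, z5, hh, sq]; exact Nat.le_mul_of_pos_left _ (by unfold setSize; omega))
      rw [z1, z4, z5, ← hlaw] at hspec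
      have hcomp := mainCode.compile_correct (M := M) (val := val) hnB mainCode_ok
        mainCode_boundsIn mainCode_keeps (a := a₈) (σ := τ₈) (by
          simp only [List.mem_cons, List.not_mem_nil, or_false, forall_eq_or_imp, forall_eq, z0, z1,
            w2, w3]
          exact ⟨hnB, hmB, hk9, hk4⟩) hτ₈
      rw [← hspec, ← PMF.bind_pure_comp]
      refine Triple.seq hcomp fun a₉ _ τ₉ hτ₉ => ?_
      refine Reaches.then (T := 28 * n + 6) (T' := 1) (copyCode_correct (j := 11) (by norm_num) hτ₉) fun τ hτ => ?_
      refine Triple.instr_last rfl ?_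
      refine block_eq_set (by simp) fun i hi => ?_
      rw [State.setNat_nat, if_neg (by omega)]
      exact hτ.2 i hi
    · simp only [runtime, ← hBdef]
      omega
  -- Taking the empty stack as continuation turns the triple into a statement about the halted
  -- machine.
  have := htr [] 0 PMF.pure fun S _ τ hτ => by rw [← hτ]; exact settles_nil τ
  rw [PMF.bind_pure, zero_add] at this
  exact this

end Prog


/-! ### Feasibility -/

section Feasibility
variable {n : ℕ} {M : Matroid (Fin n)} {H : Finset (Fin n)}

/-- An integral point of the hull is one of the generating vertices. The functional with
coefficients `1` on `S` and `-1` off `S` has value `|S|` at the indicator of `S` and, by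
integrality, at most `|S| - 1` at the indicator of any other set. -/
theorem contractIndep_of_indicator_mem {S : Finset (Fin n)} (h : indicator S ∈ polytope M H) :
    ContractIndep M H S := by
  by_contra hS
  let φ : (Fin n → ℝ) →ₗ[ℝ] ℝ := ∑ i, (if i ∈ S then (1 : ℝ) else -1) • LinearMap.proj i
  have hφ : ∀ y, φ y = ∑ i, (if i ∈ S then 1 else -1) * y i := fun y => by
    simp only [φ, LinearMap.sum_apply, LinearMap.smul_apply, LinearMap.proj_apply, smul_eq_mul]
  have hsub : polytope M H ⊆ {y | φ y ≤ S.card - 1} := by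
    refine convexHull_min ?_ (convex_halfSpace_le φ.isLinear _)
    rintro _ ⟨S', hS', rfl⟩
    rw [Set.mem_ofPred_eq] at hS' ⊢
    have hne : S' ≠ S := fun h => hS (h ▸ hS')
    have e : φ (indicator S') = ((S ∩ S').card : ℝ) - (S' \ S).card := by
      rw [hφ]
      have : ∀ i, (if i ∈ S then (1 : ℝ) else -1) * indicator S' i =
          (if i ∈ S ∩ S' then 1 else 0) - if i ∈ S' \ S then 1 else 0 := by
        intro i
        by_cases h1 : i ∈ S <;> by_cases h2 : i ∈ S' <;> simp [indicator, h1, h2]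
      simp only [this, Finset.sum_sub_distrib, Finset.sum_ite_mem, Finset.univ_inter,
        Finset.sum_const, nsmul_eq_mul, mul_one]
    rw [e]
    by_cases hsub : S ⊆ S'
    · have h1 : (S' \ S).Nonempty := by
        rw [Finset.sdiff_nonempty]; exact fun h => hne (h.antisymm hsub)
      have h2 : (1 : ℝ) ≤ (S' \ S).card := by exact_mod_cast h1.card_pos
      have h3 : ((S ∩ S').card : ℝ) ≤ S.card := by
        exact_mod_cast Finset.card_le_card Finset.inter_subset_left
      linarith
    · have h1 : (S ∩ S').card < S.card := Finset.card_lt_card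
        ⟨Finset.inter_subset_left, fun h => hsub (h.trans Finset.inter_subset_right)⟩
      have h2 : ((S ∩ S').card : ℝ) + 1 ≤ S.card := by exact_mod_cast h1
      have h3 : (0 : ℝ) ≤ (S' \ S).card := by positivity
      linarith
  have h1 := hsub h
  have h2 : φ (indicator S) = S.card := by
    rw [hφ]
    have : ∀ i, (if i ∈ S then (1 : ℝ) else -1) * indicator S i = if i ∈ S then 1 else 0 := by
      intro i; by_cases h1 : i ∈ S <;> simp [indicator, h1]
    simp [this]
  rw [Set.mem_ofPred_eq, h2] at h1
  linarith

theorem PipageRounding.support {Q : Set (Fin n → ℝ)} {y : Fin n → ℝ} {μ : PMF (Finset (Fin n))}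
    (h : PipageRounding Q y μ) : ∀ S ∈ μ.support, indicator S ∈ Q := by
  induction h with
  | integral S hS => intro S' h; simp only [PMF.support_pure, Set.mem_singleton_iff] at h; rwa [h]
  | step y d a b μ₁ μ₂ hd ha hb hab hy h₁ h₂ r₁ r₂ ih₁ ih₂ =>
    intro S hS
    rw [PMF.mem_support_bind_iff] at hS
    obtain ⟨c, -, hS⟩ := hS
    cases c
    · exact ih₂ S hS
    · exact ih₁ S hS

theorem greedyHistory_mem {δ : ℝ} {s : ℕ} {sel : (Fin n → ℝ) → Finset (Fin n)}
    {g : Finset (Fin n) → ℝ} {Q : Finset (Fin n) → Prop} (hsel : ∀ w, Q (sel w)) (k : ℕ) :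
    ∀ L ∈ (greedyHistory δ s sel g k).support, ∀ I ∈ L, Q I := by
  induction k with
  | zero => simp [greedyHistory]
  | succ k ih =>
    intro L hL
    rw [greedyHistory, PMF.mem_support_bind_iff] at hL
    obtain ⟨L', hL', hL⟩ := hL
    rw [PMF.support_map] at hL
    obtain ⟨Rs, -, rfl⟩ := hL
    simp only [List.mem_cons, forall_eq_or_imp]
    exact ⟨hsel _, ih L' hL'⟩

/-- Pipage steps never leave the polytope, and the integral points of the polytope are the
independent sets of the contraction. -/
theorem measuredContinuousGreedy_contractIndep (hE : M.E = Set.univ)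
    (hH : M.Indep (↑H : Set (Fin n))) {s : ℕ} {g : Finset (Fin n) → ℝ} :
    ∀ S ∈ (measuredContinuousGreedy (n - H.card) s (greedySet M H) (roundSet M H) g).support,
      ContractIndep M H S := by
  intro S hS
  rw [measuredContinuousGreedy, PMF.mem_support_bind_iff] at hS
  obtain ⟨L, hL, hS⟩ := hS
  exact contractIndep_of_indicator_mem ((roundSet_pipage hE hH L (greedyHistory_length _ L hL)
    (greedyHistory_mem (fun w => (greedySet_isMaxWeight hH w).1) _ L hL)).support S hS)

theorem metaAlgorithm_indep (hE : M.E = Set.univ) {B₀ : Finset (Fin n)}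
    (hB : M.Indep (↑B₀ : Set (Fin n))) {h t m : ℕ} (ht : t ≤ h) {s : ℕ → ℕ}
    {v : Finset (Fin n) → ℝ} :
    ∀ S ∈ (metaAlgorithm B₀ h t m (fun H => measuredContinuousGreedy (n - H.card)
      (s (n - H.card)) (greedySet M H) (roundSet M H)) v).support, M.Indep (↑S : Set (Fin n)) := by
  intro S hS
  rw [metaAlgorithm] at hS
  split_ifs at hS with hh
  · rw [PMF.mem_support_bind_iff] at hS
    obtain ⟨H, hH, hS⟩ := hS
    rw [support_uniform (Finset.powersetCard_nonempty.2 hh), Finset.mem_coe,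
      Finset.mem_powersetCard] at hH
    have hHi : M.Indep (↑H : Set (Fin n)) := hB.subset (by exact_mod_cast hH.1)
    rw [PMF.mem_support_bind_iff] at hS
    obtain ⟨T, -, hS⟩ := hS
    rw [PMF.mem_support_bind_iff] at hS
    obtain ⟨S', hS', hS⟩ := hS
    rw [PMF.support_map] at hS
    obtain ⟨H', hH', rfl⟩ := hS
    rw [support_uniform (Finset.powersetCard_nonempty.2 (by omega)), Finset.mem_coe,
      Finset.mem_powersetCard] at hH'
    refine (measuredContinuousGreedy_contractIndep hE hHi S' hS').2.subset ?_
    exact_mod_cast Finset.union_subset_union_right hH'.1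
  · simp only [PMF.support_pure, Set.mem_singleton_iff] at hS
    rw [hS]; simp

end Feasibility


/-! ### Expectations under finitely supported laws -/

section Expectation
variable {α β : Type}

/-- The expectation of `φ` under `μ`. -/
def ev (μ : PMF α) (φ : α → ℝ) : ℝ := ∑' x, (μ x).toReal * φ x

theorem ev_eq_sum {μ : PMF α} {A : Finset α} (hA : μ.support ⊆ A) (φ : α → ℝ) :
    ev μ φ = ∑ x ∈ A, (μ x).toReal * φ x := by
  refine tsum_eq_sum fun x hx => ?_
  rw [(PMF.apply_eq_zero_iff μ x).2 fun h => hx (hA h)]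
  simp

theorem ev_fintype [Fintype α] (μ : PMF α) (φ : α → ℝ) : ev μ φ = ∑ x, (μ x).toReal * φ x :=
  ev_eq_sum (by simp) φ

theorem expect_eq_ev {n : ℕ} (μ : PMF (Finset (Fin n))) (f : Finset (Fin n) → ℝ) :
    expect μ f = ev μ f := (ev_fintype μ f).symm

theorem ev_pure (a : α) (φ : α → ℝ) : ev (PMF.pure a) φ = φ a := by
  rw [ev_eq_sum (A := {a}) (by simp)]; simp

/-- Some laws here live on infinite types such as lists, but all have finite support, which replaces
every question of summability. -/
theorem ev_bind {μ : PMF α} {κ : α → PMF β} (hμ : μ.support.Finite)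
    (hκ : ∀ a, (κ a).support.Finite) (φ : β → ℝ) :
    ev (μ.bind κ) φ = ev μ fun a => ev (κ a) φ := by
  classical
  let B : Finset β := hμ.toFinset.biUnion fun a => (hκ a).toFinset
  have hB : (μ.bind κ).support ⊆ B := by
    intro b hb
    obtain ⟨a, ha, hb⟩ := (PMF.mem_support_bind_iff _ _ _).1 hb
    simp only [B, Finset.coe_biUnion, Set.mem_iUnion, Set.Finite.mem_toFinset, Finset.mem_coe]
    exact ⟨a, by simpa using ha, hb⟩
  have hA : μ.support ⊆ hμ.toFinset := by simp
  rw [ev_eq_sum hB, ev_eq_sum hA]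
  have h1 : ∀ a ∈ hμ.toFinset, ev (κ a) φ = ∑ b ∈ B, (κ a b).toReal * φ b := fun a ha =>
    ev_eq_sum (fun b hb => Finset.mem_coe.2 (Finset.mem_biUnion.2 ⟨a, ha, by simpa using hb⟩)) φ
  have h2 : ∀ a ∈ hμ.toFinset, (μ a).toReal * ev (κ a) φ =
      ∑ b ∈ B, (μ a).toReal * ((κ a b).toReal * φ b) := fun a ha => by
    rw [h1 a ha, Finset.mul_sum]
  rw [Finset.sum_congr rfl h2, Finset.sum_comm]
  refine Finset.sum_congr rfl fun b _ => ?_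
  rw [PMF.bind_apply, tsum_eq_sum (s := hμ.toFinset), ENNReal.toReal_sum, Finset.sum_mul]
  · exact Finset.sum_congr rfl fun a _ => by rw [ENNReal.toReal_mul, mul_assoc]
  · exact fun a _ => ENNReal.mul_ne_top (PMF.apply_ne_top _ _) (PMF.apply_ne_top _ _)
  · intro a ha
    rw [(PMF.apply_eq_zero_iff μ a).2 (by simpa using ha), zero_mul]

theorem support_bind_finite {μ : PMF α} {κ : α → PMF β} (hμ : μ.support.Finite)
    (hκ : ∀ a, (κ a).support.Finite) : (μ.bind κ).support.Finite := by
  rw [PMF.support_bind]; exact hμ.biUnion fun a _ => hκ a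

theorem support_map_finite {μ : PMF α} (g : α → β) (hμ : μ.support.Finite) :
    (μ.map g).support.Finite := by
  rw [PMF.support_map]; exact hμ.image g

theorem ev_map {μ : PMF α} (g : α → β) (hμ : μ.support.Finite) (φ : β → ℝ) :
    ev (μ.map g) φ = ev μ fun a => φ (g a) := by
  rw [← PMF.bind_pure_comp, ev_bind hμ fun a => by simp [PMF.support_pure]]
  simp only [Function.comp_apply, ev_pure]

theorem ev_mono {μ : PMF α} (hμ : μ.support.Finite) {φ ψ : α → ℝ}
    (h : ∀ x ∈ μ.support, φ x ≤ ψ x) : ev μ φ ≤ ev μ ψ := by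
  have hA : μ.support ⊆ hμ.toFinset := by simp
  rw [ev_eq_sum hA, ev_eq_sum hA]
  exact Finset.sum_le_sum fun x hx => mul_le_mul_of_nonneg_left (h x (by simpa using hx))
    ENNReal.toReal_nonneg

theorem ev_congr {μ : PMF α} {φ ψ : α → ℝ}
    (h : ∀ x ∈ μ.support, φ x = ψ x) : ev μ φ = ev μ ψ := by
  refine tsum_congr fun x => ?_
  by_cases hx : x ∈ μ.support
  · rw [h x hx]
  · rw [(PMF.apply_eq_zero_iff μ x).2 hx]; simp

theorem ev_add {μ : PMF α} (hμ : μ.support.Finite) (φ ψ : α → ℝ) :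
    ev μ (fun x => φ x + ψ x) = ev μ φ + ev μ ψ := by
  have hA : μ.support ⊆ hμ.toFinset := by simp
  rw [ev_eq_sum hA, ev_eq_sum hA, ev_eq_sum hA, ← Finset.sum_add_distrib]
  exact Finset.sum_congr rfl fun x _ => mul_add _ _ _

theorem ev_const_mul (μ : PMF α) (c : ℝ) (φ : α → ℝ) :
    ev μ (fun x => c * φ x) = c * ev μ φ := by
  rw [ev, ev, ← tsum_mul_left]
  exact tsum_congr fun x => by ring

theorem ev_const {μ : PMF α} (hμ : μ.support.Finite) (c : ℝ) : ev μ (fun _ => c) = c := by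
  have hA : μ.support ⊆ hμ.toFinset := by simp
  rw [ev_eq_sum hA, ← Finset.sum_mul, ← ENNReal.toReal_sum fun a _ => PMF.apply_ne_top _ _]
  have h := μ.tsum_coe
  rw [tsum_eq_sum (s := hμ.toFinset)
    fun x hx => (PMF.apply_eq_zero_iff μ x).2 (by simpa using hx)] at h
  rw [h]; simp

theorem ev_sub {μ : PMF α} (hμ : μ.support.Finite) (φ ψ : α → ℝ) :
    ev μ (fun x => φ x - ψ x) = ev μ φ - ev μ ψ := by
  have := ev_add hμ φ (fun x => (-1) * ψ x)
  rw [ev_const_mul] at this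
  simpa [sub_eq_add_neg] using this

theorem ev_sum {ι : Type} {μ : PMF α} (hμ : μ.support.Finite) (s : Finset ι) (φ : ι → α → ℝ) :
    ev μ (fun x => ∑ i ∈ s, φ i x) = ∑ i ∈ s, ev μ (φ i) := by
  have hA : μ.support ⊆ hμ.toFinset := by simp
  simp only [ev_eq_sum hA, Finset.mul_sum]
  exact Finset.sum_comm

theorem ev_nonneg {μ : PMF α} {φ : α → ℝ} (h : ∀ x, 0 ≤ φ x) : 0 ≤ ev μ φ :=
  tsum_nonneg fun x => mul_nonneg ENNReal.toReal_nonneg (h x)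

theorem ev_coin {p : ℝ} (h0 : 0 ≤ p) (h1 : p ≤ 1) (φ : Bool → ℝ) :
    ev (coin p) φ = p * φ true + (1 - p) * φ false := by
  rw [ev_fintype]; simp [coin_toReal h0 h1]

theorem ev_uniform [Inhabited β] {s : Finset β} (hs : s.Nonempty) (φ : β → ℝ) :
    ev (uniform s) φ = (∑ x ∈ s, φ x) / s.card := by
  classical
  rw [ev_eq_sum (support_uniform hs).subset, div_eq_inv_mul, Finset.mul_sum]
  exact Finset.sum_congr rfl fun x hx => by rw [uniform_apply hs, if_pos hx]; simp

theorem support_iid_finite {μ : PMF α} (hμ : μ.support.Finite) (s : ℕ) :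
    (iid μ s).support.Finite := by
  induction s with
  | zero => simp [iid]
  | succ s ih => exact support_bind_finite hμ fun _ => support_map_finite _ ih

theorem mem_support_iid {μ : PMF α} (s : ℕ) :
    ∀ L ∈ (iid μ s).support, L.length = s ∧ ∀ a ∈ L, a ∈ μ.support := by
  induction s with
  | zero => simp [iid]
  | succ s ih =>
    intro L hL
    rw [iid, PMF.mem_support_bind_iff] at hL
    obtain ⟨a, ha, hL⟩ := hL
    rw [PMF.support_map] at hL
    obtain ⟨L', hL', rfl⟩ := hL
    obtain ⟨h1, h2⟩ := ih L' hL'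
    simp only [List.length_cons, h1, List.mem_cons, forall_eq_or_imp, true_and]
    exact ⟨ha, h2⟩

/-- The first moment of a sum of independent samples. -/
theorem ev_iid_sum {μ : PMF α} (hμ : μ.support.Finite) (φ : α → ℝ) (s : ℕ) :
    ev (iid μ s) (fun L => (L.map φ).sum) = s * ev μ φ := by
  induction s with
  | zero => simp [iid, ev_pure]
  | succ s ih =>
    rw [iid, ev_bind hμ fun _ => support_map_finite _ (support_iid_finite hμ s)]
    simp only [ev_map _ (support_iid_finite hμ s), List.map_cons, List.sum_cons,
      ev_add (support_iid_finite hμ s), ev_const (support_iid_finite hμ s), ih, ev_add hμ,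
      ev_const hμ]
    push_cast; ring

/-- The second moment of a sum of independent centred samples. -/
theorem ev_iid_sum_sq {μ : PMF α} (hμ : μ.support.Finite) {φ : α → ℝ} (h0 : ev μ φ = 0) (s : ℕ) :
    ev (iid μ s) (fun L => (L.map φ).sum ^ 2) = s * ev μ fun a => φ a ^ 2 := by
  induction s with
  | zero => simp [iid, ev_pure]
  | succ s ih =>
    have hs := support_iid_finite hμ s
    rw [iid, ev_bind hμ fun _ => support_map_finite _ hs]
    have : ∀ a, ev ((iid μ s).map fun L => a :: L) (fun L => (L.map φ).sum ^ 2) =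
        φ a ^ 2 + s * ev μ fun a => φ a ^ 2 := by
      intro a
      rw [ev_map _ hs, ← ih]
      have e : ∀ L : List α, ((a :: L).map φ).sum ^ 2 =
          φ a ^ 2 + (2 * φ a * (L.map φ).sum + (L.map φ).sum ^ 2) := fun L => by
        rw [List.map_cons, List.sum_cons]; ring
      simp only [e, ev_add hs, ev_const hs, ev_const_mul, ev_iid_sum hμ, h0]
      ring
    simp only [this, ev_add hμ, ev_const hμ]
    push_cast; ring

/-- The mean absolute deviation of an empirical average from its mean. -/
theorem ev_iid_abs_le {μ : PMF α} (hμ : μ.support.Finite) {φ : α → ℝ} {V : ℝ} (hV : 0 < V)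
    (hφ : ∀ a ∈ μ.support, 0 ≤ φ a ∧ φ a ≤ V) {q : ℝ} (hq : 0 < q) {s : ℕ} (hs : q ^ 2 ≤ s) :
    ev (iid μ s) (fun L => |(L.map φ).sum / s - ev μ φ|) ≤ V / q := by
  have hs0 : (0 : ℝ) < s := lt_of_lt_of_le (by positivity) hs
  set w := ev μ φ with hw
  have hw0 : 0 ≤ w ∧ w ≤ V := by
    rw [hw]
    constructor
    · rw [← ev_const hμ 0]; exact ev_mono hμ fun a ha => (hφ a ha).1
    · rw [← ev_const hμ V]; exact ev_mono hμ fun a ha => (hφ a ha).2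
  have h0 : ev μ (fun a => φ a - w) = 0 := by rw [ev_sub hμ, ev_const hμ]; simp [hw]
  have h2 : ev μ (fun a => (φ a - w) ^ 2) ≤ V ^ 2 := by
    rw [← ev_const hμ (V ^ 2)]
    refine ev_mono hμ fun a ha => ?_
    obtain ⟨h3, h4⟩ := hφ a ha
    rw [sq_le_sq, abs_of_pos hV, abs_le]
    constructor <;> linarith
  have hS := support_iid_finite hμ s
  have hsq := ev_iid_sum_sq hμ h0 s
  -- A linearised Cauchy–Schwarz inequality, `|d| ≤ q d² / (2 V) + V / (2 q)`. The weights are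
  -- chosen so that, with a mean square deviation of at most `V² / q²`, both terms contribute at
  -- most `V / (2 q)`.
  calc ev (iid μ s) (fun L => |(L.map φ).sum / s - w|)
      ≤ ev (iid μ s) (fun L => q / (2 * V * s ^ 2) * (L.map fun a => φ a - w).sum ^ 2 +
          V / (2 * q)) := by
        refine ev_mono hS fun L hL => ?_
        have hl := (mem_support_iid s L hL).1
        have e : (L.map φ).sum / s - w = (L.map fun a => φ a - w).sum / s := by
          have e' : ∀ L : List α, (L.map fun a => φ a - w).sum = (L.map φ).sum - L.length * w := by
            intro L
            induction L with
            | nil => simp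
            | cons a L ih => simp only [List.map_cons, List.sum_cons, ih, List.length_cons]
                             push_cast; ring
          rw [e', hl]
          field_simp
        rw [e]
        set d := (L.map fun a => φ a - w).sum / s with hd
        have hd2 : (L.map fun a => φ a - w).sum = d * s := by rw [hd]; field_simp
        rw [hd2]
        have h5 : 0 ≤ (q * |d| - V) ^ 2 := sq_nonneg _
        have h6 : q / (2 * V * s ^ 2) * (d * s) ^ 2 + V / (2 * q) - |d| =
            (q * |d| - V) ^ 2 / (2 * V * q) := by
          rw [sub_sq, mul_pow q, sq_abs]; field_simp; ring
        have h7 : 0 ≤ (q * |d| - V) ^ 2 / (2 * V * q) := by positivity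
        linarith
    _ = q / (2 * V * s ^ 2) * (s * ev μ fun a => (φ a - w) ^ 2) + V / (2 * q) := by
        rw [ev_add hS, ev_const_mul, ev_const hS, hsq]
    _ ≤ q / (2 * V * s ^ 2) * (s * V ^ 2) + V / (2 * q) := by gcongr
    _ = q * V / (2 * s) + V / (2 * q) := by field_simp
    _ ≤ q * V / (2 * q ^ 2) + V / (2 * q) := by gcongr
    _ = V / q := by field_simp; ring

end Expectation

/-! ### The multilinear extension -/

section Multilinear
variable {n : ℕ}

/-- Diminishing marginal values, also for elements that are already present. -/
def DimRet (f : Finset (Fin n) → ℝ) : Prop :=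
  ∀ A B : Finset (Fin n), A ⊆ B → ∀ x, f (insert x B) - f B ≤ f (insert x A) - f A

/-- Monotonicity covers the elements already present in the larger set, whose marginal value there
is zero. -/
theorem Submodular.dimRet {f : Finset (Fin n) → ℝ} (h : Submodular f) (hm : Monotone f) :
    DimRet f := by
  intro A B hAB x
  by_cases hx : x ∈ B
  · rw [Finset.insert_eq_of_mem hx, sub_self, sub_nonneg]
    exact hm (Finset.subset_insert _ _)
  · exact h A B hAB x hx

theorem DimRet.sub_le_sum {f : Finset (Fin n) → ℝ} (h : DimRet f) (A B : Finset (Fin n)) :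
    f (A ∪ B) - f A ≤ ∑ i ∈ B, (f (insert i A) - f A) := by
  induction B using Finset.induction_on with
  | empty => simp
  | insert i B hi ih =>
    rw [Finset.sum_insert hi, Finset.union_insert]
    linarith [h A (A ∪ B) Finset.subset_union_left i]

/-- The expectation of `f` at `S` enlarged by each `i` in the list with probability `x i`. -/
def ml (f : Finset (Fin n) → ℝ) (x : Fin n → ℝ) : List (Fin n) → Finset (Fin n) → ℝ
  | [], S => f S
  | i :: L, S => x i * ml f x L (insert i S) + (1 - x i) * ml f x L S

variable {f : Finset (Fin n) → ℝ} {x : Fin n → ℝ}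

/-- Samples avoid the coordinates where the point vanishes. This confines all oracle queries of
greedy to elements that are not loops of the contraction. -/
theorem support_randomSubset_subset (hx : ∀ i, 0 ≤ x i ∧ x i ≤ 1) (L : List (Fin n)) :
    ∀ R ∈ (randomSubset x L).support, ∀ i ∈ R, x i ≠ 0 := by
  induction L with
  | nil => simp [randomSubset]
  | cons j L ih =>
    intro R hR i hi
    rw [randomSubset, PMF.mem_support_bind_iff] at hR
    obtain ⟨b, hb, hR⟩ := hR
    rw [PMF.support_map] at hR
    obtain ⟨R', hR', rfl⟩ := hR
    cases b
    · exact ih R' hR' i (by simpa using hi)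
    · rcases Finset.mem_insert.1 (by simpa using hi) with rfl | h
      · intro h0
        rw [h0, coin_zero] at hb
        simp at hb
      · exact ih R' hR' i h

theorem ev_randomSubset (hx : ∀ i, 0 ≤ x i ∧ x i ≤ 1) (L : List (Fin n)) (S : Finset (Fin n)) :
    ev (randomSubset x L) (fun R => f (S ∪ R)) = ml f x L S := by
  induction L generalizing S with
  | nil => simp [randomSubset, ev_pure, ml]
  | cons i L ih =>
    rw [randomSubset, ev_bind (Set.toFinite _) fun _ => Set.toFinite _,
      ev_coin (hx i).1 (hx i).2, ml, ← ih, ← ih]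
    simp only [ev_map _ (Set.toFinite _), if_true, Bool.false_eq_true, if_false,
      Finset.insert_union, Finset.union_insert]

theorem ml_mono (hx : ∀ i, 0 ≤ x i ∧ x i ≤ 1) (hf : Monotone f) (L : List (Fin n)) :
    Monotone (ml f x L) := by
  induction L with
  | nil => exact hf
  | cons i L ih =>
    intro A B hAB
    have h1 := (hx i).1
    have h2 := sub_nonneg.2 (hx i).2
    exact add_le_add (mul_le_mul_of_nonneg_left (ih (Finset.insert_subset_insert i hAB)) h1)
      (mul_le_mul_of_nonneg_left (ih hAB) h2)

theorem ml_dimRet (hx : ∀ i, 0 ≤ x i ∧ x i ≤ 1) (hf : DimRet f) (L : List (Fin n)) :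
    DimRet (ml f x L) := by
  induction L with
  | nil => exact hf
  | cons i L ih =>
    intro A B hAB j
    have h1 := mul_le_mul_of_nonneg_left (ih _ _ (Finset.insert_subset_insert i hAB) j) (hx i).1
    have h2 := mul_le_mul_of_nonneg_left (ih _ _ hAB j) (sub_nonneg.2 (hx i).2)
    simp only [ml, Finset.insert_comm i j]
    linarith

theorem le_ml (hx : ∀ i, 0 ≤ x i ∧ x i ≤ 1) (hf : Monotone f) (L : List (Fin n))
    (S : Finset (Fin n)) : f S ≤ ml f x L S := by
  rw [← ev_randomSubset hx, ← ev_const (μ := randomSubset x L) (Set.toFinite _) (f S)]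
  exact ev_mono (Set.toFinite _) fun R _ => hf Finset.subset_union_left

theorem ml_zero (L : List (Fin n)) (S : Finset (Fin n)) : ml f (fun _ => 0) L S = f S := by
  induction L with
  | nil => rfl
  | cons i L ih => simp [ml, ih]

theorem ml_indicator (A : Finset (Fin n)) (L : List (Fin n)) (S : Finset (Fin n)) :
    ml f (indicator A) L S = f (S ∪ L.toFinset ∩ A) := by
  induction L generalizing S with
  | nil => simp [ml]
  | cons i L ih =>
    rw [ml, ih, ih]
    by_cases hi : i ∈ A
    · simp [indicator, hi, Finset.insert_inter_of_mem, Finset.insert_union, Finset.union_insert]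
    · simp [indicator, hi, Finset.insert_inter_of_notMem]

/-- Independence of the order allows an expansion in any one or two chosen coordinates. -/
theorem ml_perm {L L' : List (Fin n)} (h : L.Perm L') (S : Finset (Fin n)) :
    ml f x L S = ml f x L' S := by
  induction h generalizing S with
  | nil => rfl
  | cons i _ ih => simp only [ml, ih]
  | swap i j L => simp only [ml, Finset.insert_comm i j]; ring
  | trans _ _ ih₁ ih₂ => rw [ih₁, ih₂]

theorem ml_congr {y : Fin n → ℝ} {L : List (Fin n)} (h : ∀ i ∈ L, x i = y i)
    (S : Finset (Fin n)) : ml f x L S = ml f y L S := by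
  induction L generalizing S with
  | nil => rfl
  | cons i L ih =>
    have h' : ∀ j ∈ L, x j = y j := fun j hj => h j (List.mem_cons_of_mem _ hj)
    simp only [ml, ih h', h i List.mem_cons_self]

/-- The progress of a measured continuous greedy step towards `I`. -/
theorem ml_step (hx : ∀ i, 0 ≤ x i ∧ x i ≤ 1) (hf : Monotone f) {δ : ℝ} (h0 : 0 ≤ δ) (h1 : δ ≤ 1)
    (I : Finset (Fin n)) (L : List (Fin n)) (S : Finset (Fin n)) :
    ml f x L S + δ * (1 - δ) ^ L.length *
        (L.map fun i => if i ∈ I then ml f x L (insert i S) - ml f x L S else 0).sum ≤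
      ml f (fun i => x i + δ * (1 - x i) * indicator I i) L S := by
  -- In probabilistic terms, the random set of the new point is that of `x` together with an
  -- independent set containing each element of `I` with probability `δ`. The events that this extra
  -- set is a given singleton are disjoint and have probability at least `δ (1 - δ) ^ n` for a list
  -- of length `n`, and otherwise monotonicity suffices. The induction carries this out by
  -- conditioning on one coordinate at a time.
  have h1' : 0 ≤ 1 - δ := sub_nonneg.2 h1
  have hpos : ∀ (L L' : List (Fin n)) S,
      0 ≤ (L'.map fun i => if i ∈ I then ml f x L (insert i S) - ml f x L S else 0).sum := by
    intro L L' S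
    refine List.sum_nonneg fun a ha => ?_
    obtain ⟨i, -, rfl⟩ := List.mem_map.1 ha
    split_ifs
    · exact sub_nonneg.2 (ml_mono hx hf L (Finset.subset_insert _ _))
    · exact le_rfl
  induction L generalizing S with
  | nil => simp [ml]
  | cons j L ih =>
    set y : Fin n → ℝ := fun i => x i + δ * (1 - x i) * indicator I i with hy
    set c := (1 - δ) ^ L.length with hc
    have hc0 : 0 ≤ c := pow_nonneg h1' _
    have hc1 : c ≤ 1 := pow_le_one₀ h1' (by linarith)
    obtain ⟨hx0, hx1⟩ := hx j
    have e : (L.map fun i => if i ∈ I then ml f x (j :: L) (insert i S) - ml f x (j :: L) S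
          else 0).sum =
        x j * (L.map fun i => if i ∈ I then ml f x L (insert i (insert j S)) -
            ml f x L (insert j S) else 0).sum +
          (1 - x j) * (L.map fun i => if i ∈ I then ml f x L (insert i S) - ml f x L S
            else 0).sum := by
      rw [← List.sum_map_mul_left, ← List.sum_map_mul_left, ← List.sum_map_add]
      congr 1
      refine List.map_congr_left fun i _ => ?_
      split_ifs
      · simp only [ml, Finset.insert_comm j i]; ring
      · ring
    have hA := ih (insert j S)
    have hB := ih S
    set a := (L.map fun i => if i ∈ I then ml f x L (insert i (insert j S)) -
            ml f x L (insert j S) else 0).sum with ha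
    set b := (L.map fun i => if i ∈ I then ml f x L (insert i S) - ml f x L S else 0).sum with hb
    have ha0 : 0 ≤ a := hpos L L _
    have hb0 : 0 ≤ b := hpos L L _
    rw [List.map_cons, List.sum_cons, e, List.length_cons, pow_succ, ← hc, ml, ml, ml,
      Finset.insert_idem]
    set g₁ := ml f x L (insert j S)
    set g₀ := ml f x L S
    set g₁' := ml f y L (insert j S)
    set g₀' := ml f y L S
    have hg : g₀ ≤ g₁ := ml_mono hx hf L (Finset.subset_insert _ _)
    have hs0 : 0 ≤ x j * a + (1 - x j) * b :=
      add_nonneg (mul_nonneg hx0 ha0) (mul_nonneg (sub_nonneg.2 hx1) hb0)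
    have hmix : x j * g₁ + (1 - x j) * g₀ + δ * c * (x j * a + (1 - x j) * b) ≤
        x j * g₁' + (1 - x j) * g₀' := by
      nlinarith [mul_le_mul_of_nonneg_left hA hx0,
        mul_le_mul_of_nonneg_left hB (sub_nonneg.2 hx1)]
    by_cases hj : j ∈ I
    · have hyj : y j = x j + δ * (1 - x j) := by simp [hy, indicator, hj]
      rw [if_pos hj, hyj]
      have h3 : g₁ ≤ g₁' := le_trans (by have := mul_nonneg (mul_nonneg h0 hc0) ha0; linarith) hA
      have h4 : 0 ≤ δ * (1 - c * (1 - δ)) * ((1 - x j) * (g₁ - g₀)) :=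
        mul_nonneg (mul_nonneg h0 (by nlinarith))
          (mul_nonneg (sub_nonneg.2 hx1) (sub_nonneg.2 hg))
      have h5 := mul_le_mul_of_nonneg_left hmix h1'
      have h6 := mul_le_mul_of_nonneg_left h3 h0
      nlinarith
    · have hyj : y j = x j := by simp [hy, indicator, hj]
      rw [if_neg hj, hyj, zero_add]
      have h4 : 0 ≤ δ * c * δ * (x j * a + (1 - x j) * b) := by positivity
      linarith

theorem mem_Icc_of_mem_polytope {M : Matroid (Fin n)} {H : Finset (Fin n)} (h : x ∈ polytope M H)
    (i : Fin n) : 0 ≤ x i ∧ x i ≤ 1 := by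
  have hsub : polytope M H ⊆ Set.Icc 0 1 := by
    refine convexHull_min ?_ (convex_Icc 0 1)
    rintro _ ⟨S, -, rfl⟩
    constructor <;> intro i <;> simp only [indicator] <;> split_ifs <;> simp
  exact ⟨(hsub h).1 i, (hsub h).2 i⟩

/-- Pipage rounding does not decrease the multilinear extension on average. -/
theorem PipageRounding.le_ev {Q : Set (Fin n → ℝ)} (hQ : ∀ y ∈ Q, ∀ i, 0 ≤ y i ∧ y i ≤ 1)
    (hf : DimRet f) {y : Fin n → ℝ} {μ : PMF (Finset (Fin n))} (h : PipageRounding Q y μ) :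
    ml f y (List.finRange n) ∅ ≤ ev μ f := by
  induction h with
  | integral S hS =>
    rw [ml_indicator, ev_pure]
    simp
  | step y d a b μ₁ μ₂ hd ha hb hab hy h₁ h₂ r₁ r₂ ih₁ ih₂ =>
    have hp0 : 0 ≤ b / (a + b) := by positivity
    have hp1 : b / (a + b) ≤ 1 := (div_le_one hab).2 (by linarith)
    have hp : (1 - b / (a + b)) = a / (a + b) := by field_simp; ring
    rw [ev_bind (Set.toFinite _) fun _ => Set.toFinite _, ev_coin hp0 hp1, hp]
    simp only [if_true, Bool.false_eq_true, if_false]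
    refine le_trans ?_ (add_le_add (mul_le_mul_of_nonneg_left ih₁ hp0)
      (mul_le_mul_of_nonneg_left ih₂ (by positivity)))
    -- Along `e_i` the extension is affine, so the mean is unchanged. Along `e_i - e_j` it is a
    -- quadratic whose leading coefficient is `B + C - A - D` below; this is nonnegative by
    -- diminishing returns, so the extension is convex and the mean does not decrease.
    rcases hd with ⟨i, rfl⟩ | ⟨i, j, hij, rfl⟩
    · have hperm := (List.perm_cons_erase (List.mem_finRange i))
      have hni : ∀ k ∈ (List.finRange n).erase i, k ≠ i := fun k hk =>
        ((List.nodup_finRange n).mem_erase_iff.1 hk).1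
      rw [ml_perm hperm, ml_perm hperm, ml_perm hperm]
      simp only [ml]
      have c₁ : ∀ S, ml f (y + a • Pi.single i 1) ((List.finRange n).erase i) S =
          ml f y ((List.finRange n).erase i) S := fun S =>
        ml_congr (fun k hk => by simp [hni k hk]) S
      have c₂ : ∀ S, ml f (y - b • Pi.single i 1) ((List.finRange n).erase i) S =
          ml f y ((List.finRange n).erase i) S := fun S =>
        ml_congr (fun k hk => by simp [hni k hk]) S
      simp only [c₁, c₂, Pi.add_apply, Pi.sub_apply, Pi.smul_apply, Pi.single_eq_same, smul_eq_mul,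
        mul_one]
      apply le_of_eq
      field_simp
      ring
    · have hperm : (List.finRange n).Perm (i :: j :: ((List.finRange n).erase i).erase j) :=
        (List.perm_cons_erase (List.mem_finRange i)).trans
          ((List.perm_cons_erase ((List.nodup_finRange n).mem_erase_iff.2
            ⟨hij.symm, List.mem_finRange j⟩)).cons i)
      have hni : ∀ k ∈ ((List.finRange n).erase i).erase j, k ≠ i ∧ k ≠ j := fun k hk =>
        ⟨((List.nodup_finRange n).mem_erase_iff.1 (List.mem_of_mem_erase hk)).1,
          ((List.nodup_finRange n).erase i).mem_erase_iff.1 hk |>.1⟩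
      rw [ml_perm hperm, ml_perm hperm, ml_perm hperm]
      simp only [ml]
      have c₁ : ∀ S, ml f (y + a • (Pi.single i 1 - Pi.single j 1))
          (((List.finRange n).erase i).erase j) S =
          ml f y (((List.finRange n).erase i).erase j) S := fun S =>
        ml_congr (fun k hk => by simp [hni k hk]) S
      have c₂ : ∀ S, ml f (y - b • (Pi.single i 1 - Pi.single j 1))
          (((List.finRange n).erase i).erase j) S =
          ml f y (((List.finRange n).erase i).erase j) S := fun S =>
        ml_congr (fun k hk => by simp [hni k hk]) S
      simp only [c₁, c₂, Pi.add_apply, Pi.sub_apply, Pi.smul_apply, Pi.single_eq_same, smul_eq_mul,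
        Pi.single_eq_of_ne hij, Pi.single_eq_of_ne hij.symm]
      have hd := ml_dimRet (hQ y hy) hf (((List.finRange n).erase i).erase j) ∅ {i} (by simp) j
      simp only [insert_empty_eq] at hd ⊢
      set A := ml f y (((List.finRange n).erase i).erase j) {j, i}
      set B := ml f y (((List.finRange n).erase i).erase j) {i}
      set C := ml f y (((List.finRange n).erase i).erase j) {j}
      set D := ml f y (((List.finRange n).erase i).erase j) ∅
      rw [← sub_nonneg]
      have : 0 ≤ (a + b) * (a * b * (B + C - A - D)) := by
        have : 0 ≤ B + C - A - D := by linarith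
        positivity
      have e : ∀ X Y Z : ℝ, b / (a + b) * X + a / (a + b) * Y - Z =
          (b * X + a * Y - (a + b) * Z) / (a + b) := fun X Y Z => by field_simp
      rw [e]
      refine div_nonneg (le_of_le_of_eq this ?_) hab.le
      ring

end Multilinear


/-! ### Measured continuous greedy with an approximate value oracle -/

section Greedy
variable {n : ℕ}

theorem support_greedyHistory_finite {δ : ℝ} {s : ℕ} {sel : (Fin n → ℝ) → Finset (Fin n)}
    {g : Finset (Fin n) → ℝ} (k : ℕ) : (greedyHistory δ s sel g k).support.Finite := by
  induction k with
  | zero => simp [greedyHistory]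
  | succ k ih => exact support_bind_finite ih fun _ =>
      support_map_finite _ (support_iid_finite (Set.toFinite _) s)

theorem fracPoint_eq_zero {δ : ℝ} {U : Finset (Fin n)} {L : List (Finset (Fin n))}
    (hL : ∀ I ∈ L, I ⊆ U) {i : Fin n} (hi : i ∉ U) : fracPoint δ L i = 0 := by
  induction L with
  | nil => rfl
  | cons I L ih =>
    have h : i ∉ I := fun h => hi (hL I List.mem_cons_self h)
    simp [fracPoint, ih fun I hI => hL I (List.mem_cons_of_mem _ hI), indicator, h]

theorem abs_list_average_sub_le {β : Type} {φ ψ : β → ℝ} {c : ℝ} {s : ℕ} (hs : 0 < s) {L : List β}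
    (hl : L.length = s) (h : ∀ a ∈ L, |φ a - ψ a| ≤ c) :
    |(L.map φ).sum / s - (L.map ψ).sum / s| ≤ c := by
  have key : ∀ L : List β, (∀ a ∈ L, |φ a - ψ a| ≤ c) →
      |(L.map φ).sum - (L.map ψ).sum| ≤ L.length * c := by
    intro L
    induction L with
    | nil => simp
    | cons a L ih =>
      intro h
      have h1 := h a List.mem_cons_self
      have h2 := ih fun b hb => h b (List.mem_cons_of_mem _ hb)
      simp only [List.map_cons, List.sum_cons, List.length_cons]
      rw [abs_le] at h1 h2 ⊢
      push_cast
      constructor <;> linarith [h1.1, h1.2, h2.1, h2.2]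
  have hs' : (0 : ℝ) < s := by exact_mod_cast hs
  rw [← sub_div, abs_div, abs_of_pos hs', div_le_iff₀ hs', mul_comm, ← hl]
  exact key L h

/-- The chosen set is nearly optimal for the weights `w` if the estimates `u` are accurate. -/
theorem IsMaxWeight.sum_ge {M : Matroid (Fin n)} {H I J U : Finset (Fin n)} {u w : Fin n → ℝ}
    (hI : IsMaxWeight M H u I) (hJ : ContractIndep M H J) (hIU : I ⊆ U) (hJU : J ⊆ U) :
    ∑ i ∈ J, w i - ∑ i ∈ U, |u i - w i| ≤ ∑ i ∈ I, w i := by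
  have h := hI.2 J hJ
  have e : ∀ {A : Finset (Fin n)} (z : Fin n → ℝ), A ⊆ U →
      ∑ i ∈ A, z i = ∑ i ∈ U, if i ∈ A then z i else 0 := fun {A} z hA => by
    rw [Finset.sum_ite_mem, Finset.inter_eq_right.2 hA]
  have h1 : ∑ i ∈ J, (w i - u i) - ∑ i ∈ U, |u i - w i| ≤ ∑ i ∈ I, (w i - u i) := by
    rw [e _ hIU, e _ hJU, ← Finset.sum_sub_distrib]
    refine Finset.sum_le_sum fun i _ => ?_
    have h2 := le_abs_self (u i - w i)
    have h3 := neg_abs_le (u i - w i)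
    split_ifs <;> linarith [abs_nonneg (u i - w i)]
  simp only [Finset.sum_sub_distrib] at h1
  linarith

variable {M : Matroid (Fin n)} {H U : Finset (Fin n)} {F g : Finset (Fin n) → ℝ}
  {sel : (Fin n → ℝ) → Finset (Fin n)} {δ e V q : ℝ} {s : ℕ} {J : Finset (Fin n)}

/-- The expected progress of one round. -/
theorem greedyRound_ge (hsel : ∀ w, IsMaxWeight M H w (sel w))
    (hU : ∀ I, ContractIndep M H I → I ⊆ U) (hF : Monotone F) (hF' : DimRet F)
    (hF0 : ∀ S, 0 ≤ F S) (hV : 0 < V) (hFV : ∀ S ⊆ U, F S ≤ V) (hg : ∀ S ⊆ U, |g S - F S| ≤ e)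
    (hJ : ContractIndep M H J) (h0 : 0 ≤ δ) (h1 : n * δ ≤ 1) (hδ1 : δ ≤ 1) (hq : 0 < q)
    (hs : q ^ 2 ≤ s) {L : List (Finset (Fin n))} (hL : ∀ I ∈ L, I ⊆ U) :
    ml F (fracPoint δ L) (List.finRange n) ∅ + δ * (1 - n * δ) *
        (F J - n * (2 * e + V / q) - ml F (fracPoint δ L) (List.finRange n) ∅) ≤
      ev (iid (randomSubset (fracPoint δ L) (List.finRange n)) s) fun Rs =>
        ml F (fracPoint δ (sel (estimate g s Rs) :: L)) (List.finRange n) ∅ := by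
  set x := fracPoint δ L with hx
  set μ := randomSubset x (List.finRange n) with hμ
  have hx01 : ∀ i, 0 ≤ x i ∧ x i ≤ 1 := fracPoint_mem h0 hδ1 L
  have hs0 : 0 < s := by
    have : (0 : ℝ) < s := lt_of_lt_of_le (by positivity) hs
    exact_mod_cast this
  have hμf : μ.support.Finite := Set.toFinite _
  have hS : (iid μ s).support.Finite := support_iid_finite hμf s
  -- All samples lie in `U`, the only place where `g` is known to be close to `F`.
  have hRU : ∀ R ∈ μ.support, R ⊆ U := fun R hR i hi => by
    by_contra h
    exact support_randomSubset_subset hx01 _ R hR i hi (fracPoint_eq_zero hL h)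
  set Φ := ml F x (List.finRange n) with hΦ
  set w : Fin n → ℝ := fun i => Φ (insert i ∅) - Φ ∅ with hw
  have hmono : Monotone Φ := ml_mono hx01 hF _
  have hw0 : ∀ i, 0 ≤ w i := fun i => sub_nonneg.2 (hmono (Finset.subset_insert _ _))
  have hev : ∀ i, ev μ (fun R => F (insert i R) - F R) = w i := by
    intro i
    rw [ev_sub hμf]
    simp only [hw, hΦ, ← ev_randomSubset hx01]
    simp [hμ]
  have he : 0 ≤ e := (abs_nonneg _).trans (hg ∅ (Finset.empty_subset _))
  set dev : Fin n → List (Finset (Fin n)) → ℝ := fun i Rs =>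
    |(Rs.map fun R => F (insert i R) - F R).sum / s - w i| with hdev
  have hdev_ev : ∀ i ∈ U, ev (iid μ s) (dev i) ≤ V / q := by
    intro i hi
    have := ev_iid_abs_le hμf hV (φ := fun R => F (insert i R) - F R) (fun R hR => ⟨sub_nonneg.2
      (hF (Finset.subset_insert _ _)), by
        have := hFV _ (Finset.insert_subset hi (hRU R hR))
        linarith [hF0 R]⟩) hq hs
    rwa [hev i] at this
  -- The value of `J` joined with the random set is at least `F J`, and diminishing returns of the
  -- extension bound the gain by the sum of the single marginals.
  have hJw : F J - Φ ∅ ≤ ∑ i ∈ J, w i := by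
    have h2 := (ml_dimRet hx01 hF' (List.finRange n)).sub_le_sum ∅ J
    have h3 := le_ml hx01 hF (List.finRange n) J
    rw [Finset.empty_union] at h2
    linarith
  have hpow : 1 - n * δ ≤ (1 - δ) ^ n := by
    have := one_add_mul_le_pow (a := -δ) (by linarith) n
    simpa [sub_eq_add_neg, mul_comm] using this
  have hpt : ∀ Rs ∈ (iid μ s).support,
      Φ ∅ + δ * (1 - n * δ) * (F J - Φ ∅ - ∑ i ∈ U, (2 * e + dev i Rs)) ≤
        ml F (fracPoint δ (sel (estimate g s Rs) :: L)) (List.finRange n) ∅ := by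
    intro Rs hRs
    obtain ⟨hlen, hmem⟩ := mem_support_iid s Rs hRs
    set I := sel (estimate g s Rs) with hI
    have hIm : IsMaxWeight M H (estimate g s Rs) I := hsel _
    have h2 := hIm.sum_ge (w := w) hJ (hU I hIm.1) (hU J hJ)
    have h3 : ∑ i ∈ U, |estimate g s Rs i - w i| ≤ ∑ i ∈ U, (2 * e + dev i Rs) := by
      refine Finset.sum_le_sum fun i hi => ?_
      refine (abs_sub_le _ ((Rs.map fun R => F (insert i R) - F R).sum / s) _).trans ?_
      refine add_le_add_left (abs_list_average_sub_le hs0 hlen fun R hR => ?_) _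
      have h4 := abs_le.1 (hg R (hRU R (hmem R hR)))
      have h5 := abs_le.1 (hg _ (Finset.insert_subset hi (hRU R (hmem R hR))))
      rw [abs_le]
      constructor <;> linarith [h4.1, h4.2, h5.1, h5.2]
    have h6 := ml_step hx01 hF h0 hδ1 I (List.finRange n) ∅
    rw [← Fin.sum_univ_def, List.length_finRange] at h6
    have h7 : ∑ i, (if i ∈ I then ml F x (List.finRange n) (insert i ∅) -
        ml F x (List.finRange n) ∅ else 0) = ∑ i ∈ I, w i := by
      rw [Finset.sum_ite_mem, Finset.univ_inter]
    rw [h7] at h6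
    refine le_trans ?_ h6
    have h8 : 0 ≤ ∑ i ∈ I, w i := Finset.sum_nonneg fun i _ => hw0 i
    have h9 : F J - Φ ∅ - ∑ i ∈ U, (2 * e + dev i Rs) ≤ ∑ i ∈ I, w i := by linarith
    rw [mul_assoc, mul_assoc]
    refine add_le_add_right (mul_le_mul_of_nonneg_left ?_ h0) _
    exact (mul_le_mul_of_nonneg_left h9 (by linarith)).trans (mul_le_mul_of_nonneg_right hpow h8)
  refine le_trans ?_ (ev_mono hS hpt)
  rw [ev_add hS, ev_const hS, ev_const_mul, ev_sub hS, ev_const hS, ev_sum hS]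
  have h10 : ∑ i ∈ U, ev (iid μ s) (fun Rs => 2 * e + dev i Rs) ≤ n * (2 * e + V / q) := by
    calc _ ≤ ∑ i ∈ U, (2 * e + V / q) := Finset.sum_le_sum fun i hi => by
          rw [ev_add hS, ev_const hS]
          linarith [hdev_ev i hi]
      _ = U.card * (2 * e + V / q) := by rw [Finset.sum_const, nsmul_eq_mul]
      _ ≤ n * (2 * e + V / q) := by
          have : (U.card : ℝ) ≤ n := by exact_mod_cast (Finset.card_le_univ U).trans_eq (by simp)
          gcongr
  refine add_le_add_right (mul_le_mul_of_nonneg_left ?_ (mul_nonneg h0 (by linarith))) _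
  linarith

/-- In expectation, each round multiplies the gap to the target by at most `1 - δ (1 - n δ)`; the
target already contains the loss from inaccurate values and from sampling. -/
theorem greedyHistory_ge (hsel : ∀ w, IsMaxWeight M H w (sel w))
    (hU : ∀ I, ContractIndep M H I → I ⊆ U) (hF : Monotone F) (hF' : DimRet F)
    (hF0 : ∀ S, 0 ≤ F S) (hV : 0 < V) (hFV : ∀ S ⊆ U, F S ≤ V) (hg : ∀ S ⊆ U, |g S - F S| ≤ e)
    (hJ : ContractIndep M H J) (h0 : 0 ≤ δ) (h1 : n * δ ≤ 1) (hδ1 : δ ≤ 1) (hq : 0 < q)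
    (hs : q ^ 2 ≤ s) (k : ℕ) :
    (1 - δ * (1 - n * δ)) ^ k * (F ∅ - (F J - n * (2 * e + V / q))) ≤
      ev (greedyHistory δ s sel g k) (fun L => ml F (fracPoint δ L) (List.finRange n) ∅) -
        (F J - n * (2 * e + V / q)) := by
  set G := F J - n * (2 * e + V / q) with hG
  have hnδ : 0 ≤ n * δ := by positivity
  have hd1 : δ * (1 - n * δ) ≤ 1 := mul_le_one₀ hδ1 (by linarith) (by linarith)
  induction k with
  | zero =>
    have : fracPoint δ ([] : List (Finset (Fin n))) = fun _ => 0 := rfl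
    rw [greedyHistory, ev_pure, this, ml_zero]
    simp
  | succ k ih =>
    have hfin := support_greedyHistory_finite (δ := δ) (s := s) (sel := sel) (g := g) k
    have hi : ∀ L : List (Finset (Fin n)),
        (iid (randomSubset (fracPoint δ L) (List.finRange n)) s).support.Finite := fun L =>
      support_iid_finite (Set.toFinite _) s
    rw [greedyHistory, ev_bind hfin fun L => support_map_finite _ (hi L)]
    simp only [fun L => ev_map (fun Rs => sel (estimate g s Rs) :: L) (hi L)]
    have h2 := ev_mono hfin fun L hL => greedyRound_ge hsel hU hF hF' hF0 hV hFV hg hJ h0 h1 hδ1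
      hq hs (L := L) (greedyHistory_mem (Q := fun I => I ⊆ U) (fun w => hU _ (hsel w).1) k L hL)
    rw [ev_add hfin, ev_const_mul, ev_sub hfin, ev_const hfin, ← hG] at h2
    have h3 := mul_le_mul_of_nonneg_left ih (sub_nonneg.2 hd1)
    rw [pow_succ']
    nlinarith

/-- The guarantee of measured continuous greedy followed by pipage rounding, in terms of the value
of an arbitrary independent set `J` of the contraction. -/
theorem measuredContinuousGreedy_ge {k : ℕ} {round : List (Finset (Fin n)) → PMF (Finset (Fin n))}
    (hsel : ∀ w, IsMaxWeight M H w (sel w))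
    (hround : ∀ L : List (Finset (Fin n)), L.length = k ^ 4 → (∀ I ∈ L, ContractIndep M H I) →
      PipageRounding (polytope M H) (fracPoint (stepSize k) L) (round L))
    (hU : ∀ I, ContractIndep M H I → I ⊆ U) (hF : Monotone F) (hF' : DimRet F)
    (hF0 : ∀ S, 0 ≤ F S) (hV : 0 < V) (hFV : ∀ S ⊆ U, F S ≤ V) (hg : ∀ S ⊆ U, |g S - F S| ≤ e)
    (hJ : ContractIndep M H J) (hk : 0 < k) (h1 : n * stepSize k ≤ 1) (hs : k ^ 8 ≤ s) :
    (1 - Real.exp (-1)) * (F J - n * (2 * e + V * stepSize k)) - n * stepSize k * V ≤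
      ev (measuredContinuousGreedy k s sel round g) F := by
  have hk' : (0 : ℝ) < (k : ℝ) ^ 4 := by positivity
  have h0 : 0 ≤ stepSize k := by rw [stepSize]; positivity
  have hδ1 : stepSize k ≤ 1 := by
    rw [stepSize]
    exact inv_le_one_of_one_le₀ (one_le_pow₀ (by exact_mod_cast hk))
  have hs' : ((k : ℝ) ^ 4) ^ 2 ≤ s := by
    rw [← pow_mul]; exact_mod_cast hs
  have hfin := support_greedyHistory_finite (δ := stepSize k) (s := s) (sel := sel) (g := g) (k ^ 4)
  have hmain := greedyHistory_ge hsel hU hF hF' hF0 hV hFV hg hJ h0 h1 hδ1 hk' hs' (k ^ 4)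
  have he : 0 ≤ e := (abs_nonneg _).trans (hg ∅ (Finset.empty_subset _))
  have hVq : V / (k : ℝ) ^ 4 = V * stepSize k := by rw [stepSize, div_eq_mul_inv]
  rw [hVq] at hmain
  set δ := stepSize k with hδ
  set G := F J - n * (2 * e + V * δ) with hG
  have hround' : ev (greedyHistory δ s sel g (k ^ 4))
      (fun L => ml F (fracPoint δ L) (List.finRange n) ∅) ≤
        ev (measuredContinuousGreedy k s sel round g) F := by
    rw [measuredContinuousGreedy, ev_bind hfin fun _ => Set.toFinite _]
    exact ev_mono hfin fun L hL => (hround L (greedyHistory_length _ L hL)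
      (greedyHistory_mem (fun w => (hsel w).1) _ L hL)).le_ev
      (fun y hy => mem_Icc_of_mem_polytope hy) hF'
  have hpos : 0 ≤ ev (measuredContinuousGreedy k s sel round g) F := ev_nonneg hF0
  have hexp1 : Real.exp (-1) ≤ 1 / 2 := by
    rw [Real.exp_neg, one_div]
    exact inv_anti₀ (by norm_num) (by linarith [Real.add_one_le_exp (1 : ℝ)])
  have hnδ : 0 ≤ n * δ := by positivity
  -- If the target is already reached at the start, the expectation stays above it; a negative
  -- target is handled by the nonnegativity of `F`.
  rcases le_or_gt G (F ∅) with hGF | hGF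
  · have h2 : (1 - δ * (1 - n * δ)) ^ k ^ 4 * (F ∅ - G) ≥ 0 :=
      mul_nonneg (pow_nonneg (by nlinarith) _) (by linarith)
    have h3 : 0 ≤ n * δ * V := by positivity
    have h4 := Real.exp_pos (-1)
    rcases le_or_gt 0 G with h5 | h5 <;> nlinarith
  · have hG0 : 0 ≤ G := (hF0 ∅).trans hGF.le
    have hGV : G ≤ V := by
      have h2 := hFV J (hU J hJ)
      have h3 : 0 ≤ n * (2 * e + V * δ) := by positivity
      linarith
    -- The power is at most `e ^ (-1 + n δ)`, and `e ^ y ≤ 1 + 2 y` on the unit interval together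
    -- with `e ^ (-1) ≤ 1 / 2` gives the claim.
    have hp : (1 - δ * (1 - n * δ)) ^ k ^ 4 ≤ Real.exp (-1) + n * δ := by
      have h2 : 1 - δ * (1 - n * δ) ≤ Real.exp (-(δ * (1 - n * δ))) := by
        linarith [Real.add_one_le_exp (-(δ * (1 - n * δ)))]
      have h3 : 0 ≤ 1 - δ * (1 - n * δ) := by nlinarith
      have h4 : ((k ^ 4 : ℕ) : ℝ) * δ = 1 := by
        rw [hδ, stepSize]; push_cast; exact mul_inv_cancel₀ hk'.ne'
      calc _ ≤ Real.exp (-(δ * (1 - n * δ))) ^ k ^ 4 := pow_le_pow_left₀ h3 h2 _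
        _ = Real.exp (-1 + n * δ) := by
            rw [← Real.exp_nat_mul]
            congr 1
            linear_combination (-(1 - n * δ)) * h4
        _ = Real.exp (-1) * Real.exp (n * δ) := Real.exp_add _ _
        _ ≤ Real.exp (-1) * (1 + 2 * (n * δ)) := by
            have := Real.abs_exp_sub_one_le (x := n * δ) (by rwa [abs_of_nonneg hnδ])
            rw [abs_of_nonneg hnδ] at this
            exact mul_le_mul_of_nonneg_left (by linarith [le_abs_self (Real.exp (n * δ) - 1)])
              (Real.exp_pos _).le
        _ ≤ _ := by nlinarith
    have h2 : (Real.exp (-1) + n * δ) * (F ∅ - G) ≤ (1 - δ * (1 - n * δ)) ^ k ^ 4 * (F ∅ - G) :=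
      mul_le_mul_of_nonpos_right hp (by linarith)
    have h3 : 0 ≤ (Real.exp (-1) + n * δ) * F ∅ :=
      mul_nonneg (by have := Real.exp_pos (-1); positivity) (hF0 ∅)
    have h4 : n * δ * G ≤ n * δ * V := mul_le_mul_of_nonneg_left hGV hnδ
    linarith

end Greedy


/-! ### Averages of products over subsets of given size -/

section Symmetric
variable {β : Type} [DecidableEq β]

/-- The elementary symmetric function of degree `m` of the family `a` on `X`. -/
def symSum (a : β → ℝ) (m : ℕ) (X : Finset β) : ℝ := ∑ T ∈ X.powersetCard m, ∏ i ∈ T, a i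

variable {a : β → ℝ} {X : Finset β}

theorem symSum_insert {i : β} (hi : i ∉ X) (m : ℕ) :
    symSum a (m + 1) (insert i X) = symSum a (m + 1) X + a i * symSum a m X := by
  have hni : ∀ T ∈ X.powersetCard m, i ∉ T := fun T hT h => hi ((Finset.mem_powersetCard.1 hT).1 h)
  rw [symSum, Finset.powersetCard_succ_insert hi, Finset.sum_union, symSum, symSum,
    Finset.sum_image, Finset.mul_sum]
  · exact congrArg _ (Finset.sum_congr rfl fun T hT => Finset.prod_insert (hni T hT))
  · intro T hT T' hT' h
    rw [← Finset.erase_insert (hni T hT), ← Finset.erase_insert (hni T' hT'), h]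
  · rw [Finset.disjoint_left]
    intro T hT hT'
    obtain ⟨T', -, rfl⟩ := Finset.mem_image.1 hT'
    exact hi ((Finset.mem_powersetCard.1 hT).1 (Finset.mem_insert_self _ _))

theorem symSum_nonneg (ha : ∀ i ∈ X, 0 ≤ a i) (m : ℕ) : 0 ≤ symSum a m X :=
  Finset.sum_nonneg fun _ hT => Finset.prod_nonneg fun i hi =>
    ha i ((Finset.mem_powersetCard.1 hT).1 hi)

/-- Double counting: an `m`-subset survives the removal of each of the elements outside it. -/
theorem sum_symSum_erase (m : ℕ) :
    ∑ i ∈ X, symSum a m (X.erase i) = (X.card - m) * symSum a m X := by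
  have h : ∑ i ∈ X, symSum a m (X.erase i) =
      ∑ T ∈ X.powersetCard m, ∑ _i ∈ X \ T, ∏ j ∈ T, a j := by
    refine Finset.sum_comm' fun i T => ?_
    simp only [Finset.mem_powersetCard, Finset.subset_erase, Finset.mem_sdiff]
    constructor <;> intro h <;> simp_all
  rw [h, symSum, Finset.mul_sum]
  refine Finset.sum_congr rfl fun T hT => ?_
  obtain ⟨h1, h2⟩ := Finset.mem_powersetCard.1 hT
  rw [Finset.sum_const, nsmul_eq_mul, Finset.cast_card_sdiff h1, h2]

/-- The product over a subset of size `m + 1` appears once for each of its elements. -/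
theorem sum_mul_symSum_erase (m : ℕ) :
    ∑ i ∈ X, a i * symSum a m (X.erase i) = (m + 1) * symSum a (m + 1) X := by
  have h : ∀ i ∈ X, a i * symSum a m (X.erase i) =
      symSum a (m + 1) X - symSum a (m + 1) (X.erase i) := fun i hi => by
    have := symSum_insert (a := a) (Finset.notMem_erase i X) m
    rw [Finset.insert_erase hi] at this
    linarith
  rw [Finset.sum_congr rfl h, Finset.sum_sub_distrib, sum_symSum_erase, Finset.sum_const,
    nsmul_eq_mul]
  push_cast; ring

/-- Removing `i` or removing `j` leaves symmetric sums that differ by `a j - a i` times a symmetric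
sum over the remaining elements; removing the larger entry leaves the smaller sum. -/
theorem symSum_erase_antivary (ha : ∀ i ∈ X, 0 ≤ a i) (m : ℕ) :
    AntivaryOn a (fun i => symSum a m (X.erase i)) X := by
  intro i hi j hj hlt
  by_contra hij
  rw [not_le] at hij
  refine absurd hlt (not_lt.2 ?_)
  cases m with
  | zero => simp [symSum]
  | succ m =>
    have hne : i ≠ j := fun h => by simp [h] at hij
    have e1 : X.erase i = insert j ((X.erase i).erase j) :=
      (Finset.insert_erase (Finset.mem_erase.2 ⟨hne.symm, hj⟩)).symm
    have e2 : X.erase j = insert i ((X.erase i).erase j) := by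
      rw [Finset.erase_right_comm]
      exact (Finset.insert_erase (Finset.mem_erase.2 ⟨hne, hi⟩)).symm
    simp only
    rw [e1, e2, symSum_insert (by simp), symSum_insert (by simp)]
    have h0 : 0 ≤ symSum a m ((X.erase i).erase j) := symSum_nonneg (fun k hk =>
      ha k (Finset.mem_of_mem_erase (Finset.mem_of_mem_erase hk))) m
    nlinarith

/-- **Maclaurin's inequality**, comparing degree `m` with degree one. -/
theorem symSum_le (ha : ∀ i ∈ X, 0 ≤ a i) {m : ℕ} (hm : m ≤ X.card) :
    symSum a m X ≤ X.card.choose m * ((∑ i ∈ X, a i) / X.card) ^ m := by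
  induction m with
  | zero => simp [symSum]
  | succ m ih =>
    have hX : (0 : ℝ) < X.card := by exact_mod_cast (Nat.succ_pos m).trans_le hm
    -- Chebyshev's sum inequality for oppositely ordered families. The two double counts turn it
    -- into a recursion from degree `m` to degree `m + 1`.
    have h1 := (symSum_erase_antivary ha m).card_mul_sum_le_sum_mul_sum
    rw [sum_mul_symSum_erase, sum_symSum_erase] at h1
    have h2 := ih (by omega)
    have hc : (X.card.choose (m + 1) : ℝ) * (m + 1) = X.card.choose m * (X.card - m) := by
      have := Nat.choose_succ_right_eq X.card m
      rw [← Nat.cast_sub (by omega : m ≤ X.card)]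
      exact_mod_cast this
    have hs : 0 ≤ (∑ i ∈ X, a i) / X.card := div_nonneg (Finset.sum_nonneg ha) hX.le
    have hm' : (0 : ℝ) ≤ X.card - m := by
      rw [sub_nonneg]; exact_mod_cast (by omega : m ≤ X.card)
    have hm1 : (0 : ℝ) < m + 1 := by positivity
    refine le_of_mul_le_mul_left ?_ hm1
    calc ((m : ℝ) + 1) * symSum a (m + 1) X
        ≤ (∑ i ∈ X, a i) / X.card * ((X.card - m) * symSum a m X) := by
          rw [div_mul_eq_mul_div, le_div_iff₀ hX]; linarith
      _ ≤ (∑ i ∈ X, a i) / X.card * ((X.card - m) *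
          (X.card.choose m * ((∑ i ∈ X, a i) / X.card) ^ m)) := by gcongr
      _ = (m + 1) * (X.card.choose (m + 1) * ((∑ i ∈ X, a i) / X.card) ^ (m + 1)) := by
          rw [pow_succ]
          linear_combination (-((∑ i ∈ X, a i) / X.card) ^ m * ((∑ i ∈ X, a i) / X.card)) * hc

end Symmetric

/-! ### Concentration of the sampled surrogate -/

section Concentration
open MeasureTheory ProbabilityTheory
variable {n : ℕ} {Ω : Type*} [MeasurableSpace Ω] {P : Measure Ω} [IsProbabilityMeasure P]
  {ξ : Finset (Fin n) → Ω → ℝ} {D : Measure ℝ} {ν α : ℝ}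

/-- The moment generating function of a centred noisy value. -/
theorem IsNoise.mgf_le (hξ : IsNoise P ξ D) (hD : IsSubExponential D ν α) (A : Finset (Fin n))
    {y c l : ℝ} (hl : |l * y| * α ≤ 1) :
    Integrable (fun ω => Real.exp (l * (ξ A ω * y - c))) P ∧
      mgf (fun ω => ξ A ω * y - c) P l ≤
        Real.exp (l * (y - c)) * Real.exp (ν ^ 2 * (l * y) ^ 2 / 2) := by
  obtain ⟨hi, hle⟩ := hD (l * y) hl
  rw [hξ.unbiased] at hi hle
  have e : ∀ ω, Real.exp (l * (ξ A ω * y - c)) =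
      Real.exp (l * (y - c)) * Real.exp (l * y * (ξ A ω - 1)) := fun ω => by
    rw [← Real.exp_add]; ring_nf
  have hm : AEStronglyMeasurable (fun x : ℝ => Real.exp (l * y * (x - 1))) (P.map (ξ A)) := by
    apply Measurable.aestronglyMeasurable
    fun_prop
  have hi' : Integrable (fun ω => Real.exp (l * y * (ξ A ω - 1))) P := by
    rw [← hξ.law A, integrable_map_measure hm (hξ.measurable A).aemeasurable] at hi
    exact hi
  simp only [mgf, e]
  refine ⟨hi'.const_mul _, ?_⟩
  rw [integral_const_mul]
  refine mul_le_mul_of_nonneg_left ?_ (Real.exp_pos _).le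
  rw [← hξ.law A, integral_map (hξ.measurable A).aemeasurable hm] at hle
  exact hle

/-- The expected value of `f` after adding a uniformly random `t`-element subset of `H`. -/
def surrogate (f : Finset (Fin n) → ℝ) (t : ℕ) (H S : Finset (Fin n)) : ℝ :=
  (∑ H' ∈ H.powersetCard t, f (S ∪ H')) / (H.powersetCard t).card

variable {f : Finset (Fin n) → ℝ} {H S : Finset (Fin n)}

/-- Distinct smoothing sets lead to distinct queries, hence to independent noise multipliers. -/
theorem union_injOn (hS : Disjoint S H) {T : Finset (Finset (Fin n))} (hT : ∀ H' ∈ T, H' ⊆ H) :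
    Set.InjOn (fun H' => S ∪ H') (T : Set (Finset (Fin n))) := by
  intro A hA B hB h
  have hd : ∀ C ∈ T, (S ∪ C) \ S = C := fun C hC =>
    Finset.union_sdiff_cancel_left (hS.mono_right (hT C hC))
  simp only at h
  rw [← hd A hA, ← hd B hB, h]

/-- One-sided tail of the noise for a fixed collection of smoothing sets. -/
theorem IsNoise.tail_le (hξ : IsNoise P ξ D) (hD : IsSubExponential D ν α) (hS : Disjoint S H)
    {T : Finset (Finset (Fin n))} (hT : ∀ H' ∈ T, H' ⊆ H) {c l σ u : ℝ} (hl : 0 ≤ l)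
    (hlα : ∀ H' ∈ T, |l * (σ * f (S ∪ H'))| * α ≤ 1) :
    P.real {ω | u ≤ ∑ H' ∈ T, (ξ (S ∪ H') ω * (σ * f (S ∪ H')) - σ * c)} ≤
      Real.exp (-l * u) * ∏ H' ∈ T, (Real.exp (l * (σ * f (S ∪ H') - σ * c)) *
        Real.exp (ν ^ 2 * (l * (σ * f (S ∪ H'))) ^ 2 / 2)) := by
  -- The factor `σ`, later `1` or `-1`, lets a single computation serve both tails.
  set X : Finset (Fin n) → Ω → ℝ := fun A ω => ξ A ω * (σ * f A) - σ * c with hX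
  have hXm : ∀ A, Measurable (X A) := fun A => ((hξ.measurable A).mul_const _).sub_const _
  have hXi : iIndepFun X P :=
    hξ.indep.comp (fun A y => y * (σ * f A) - σ * c) fun A => by fun_prop
  have hA : ∀ A ∈ T.image (S ∪ ·), |l * (σ * f A)| * α ≤ 1 := by
    intro A hA
    obtain ⟨H', hH', rfl⟩ := Finset.mem_image.1 hA
    exact hlα H' hH'
  have hinteg : Integrable (fun ω => Real.exp (l * (∑ A ∈ T.image (S ∪ ·), X A) ω)) P :=
    hXi.integrable_exp_mul_sum hXm fun A h => (hξ.mgf_le hD A (hA A h)).1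
  have h1 := measure_ge_le_exp_mul_mgf (μ := P) (X := ∑ A ∈ T.image (S ∪ ·), X A) u hl hinteg
  rw [hXi.mgf_sum hXm] at h1
  have hinj := union_injOn hS hT
  rw [Finset.prod_image hinj] at h1
  have e : ∀ ω, (∑ A ∈ T.image (S ∪ ·), X A) ω =
      ∑ H' ∈ T, (ξ (S ∪ H') ω * (σ * f (S ∪ H')) - σ * c) := fun ω => by
    rw [Finset.sum_apply, Finset.sum_image hinj]
  simp only [e] at h1
  refine h1.trans (mul_le_mul_of_nonneg_left ?_ (Real.exp_pos _).le)
  exact Finset.prod_le_prod (fun _ _ => mgf_nonneg) fun H' hH' =>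
    (hξ.mgf_le hD (S ∪ H') (hlα H' hH')).2

variable {t m : ℕ} {V η : ℝ}

/-- One-sided tail of the sampled surrogate, averaged over the choice of the smoothing sets. -/
theorem IsNoise.sum_tail_le (hξ : IsNoise P ξ D) (hD : IsSubExponential D ν α)
    (hS : Disjoint S H) (hf0 : ∀ S, 0 ≤ f S) (hV : 0 < V)
    (hfV : ∀ H' ⊆ H, f (S ∪ H') ≤ V) (hα : 0 ≤ α) (hη : 0 ≤ η) (hη1 : η / (2 + ν ^ 2) ≤ 1)
    (hηα : η / (2 + ν ^ 2) * α ≤ 1) (hm : m ≤ (H.powersetCard t).card)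
    (hne : (H.powersetCard t).Nonempty) {σ : ℝ} (hσ : |σ| = 1) :
    ∑ T ∈ (H.powersetCard t).powersetCard m,
        P.real {ω | m * (η * V) ≤
          ∑ H' ∈ T, (ξ (S ∪ H') ω * (σ * f (S ∪ H')) - σ * surrogate f t H S)} ≤
      ((H.powersetCard t).powersetCard m).card * Real.exp (-(m * η ^ 2 / (2 * (2 + ν ^ 2)))) := by
  -- The minimiser of the exponent `m (-η x + (2 + ν²) x² / 2)` that the Chernoff bound yields; the
  -- parameter `l` is this value divided by the range `V`.
  set x := η / (2 + ν ^ 2) with hx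
  have hx0 : 0 ≤ x := by positivity
  set c := surrogate f t H S with hc
  set X := H.powersetCard t with hX
  have hXpos : (0 : ℝ) < X.card := by exact_mod_cast hne.card_pos
  have hsub : ∀ H' ∈ X, H' ⊆ H := fun H' h => (Finset.mem_powersetCard.1 h).1
  have hc0 : 0 ≤ c := div_nonneg (Finset.sum_nonneg fun _ _ => hf0 _) hXpos.le
  have hcV : c ≤ V := by
    rw [hc, surrogate, div_le_iff₀ hXpos, mul_comm, ← nsmul_eq_mul]
    exact Finset.sum_le_card_nsmul _ _ _ fun H' h => hfV H' (hsub H' h)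
  set l := x / V with hl
  have hl0 : 0 ≤ l := by positivity
  have hlV : l * V = x := by rw [hl]; field_simp
  have hly : ∀ {y : ℝ}, |y| ≤ V → |l * y| ≤ x := fun {y} hy => by
    rw [abs_mul, abs_of_nonneg hl0, ← hlV]
    exact mul_le_mul_of_nonneg_left hy hl0
  have hσf : ∀ H' ∈ X, |σ * f (S ∪ H')| ≤ V := fun H' h => by
    rw [abs_mul, hσ, one_mul, abs_of_nonneg (hf0 _)]; exact hfV H' (hsub H' h)
  set φ : Finset (Fin n) → ℝ := fun H' => Real.exp (l * (σ * f (S ∪ H') - σ * c)) *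
        Real.exp (ν ^ 2 * (l * (σ * f (S ∪ H'))) ^ 2 / 2) with hφ
  -- By `e ^ y ≤ 1 + y + y²` for `|y| ≤ 1`. The linear term averages to zero over all `t`-subsets,
  -- since `c` is their mean value.
  have hφle : ∀ H' ∈ X, φ H' ≤ (1 + l * (σ * f (S ∪ H') - σ * c) + x ^ 2) *
      Real.exp (ν ^ 2 * x ^ 2 / 2) := by
    intro H' hH'
    have h1 : |l * (σ * f (S ∪ H') - σ * c)| ≤ x := hly (by
      rw [← mul_sub, abs_mul, hσ, one_mul, abs_le]
      have := hfV H' (hsub H' hH')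
      have := hf0 (S ∪ H')
      constructor <;> linarith)
    have h2 := Real.abs_exp_sub_one_sub_id_le (h1.trans hη1)
    have h3 : (l * (σ * f (S ∪ H') - σ * c)) ^ 2 ≤ x ^ 2 := sq_le_sq.2 (by rwa [abs_of_nonneg hx0])
    have h4 : (l * (σ * f (S ∪ H'))) ^ 2 ≤ x ^ 2 :=
      sq_le_sq.2 (by rw [abs_of_nonneg hx0]; exact hly (hσf H' hH'))
    have h5 := le_abs_self (Real.exp (l * (σ * f (S ∪ H') - σ * c)) - 1 -
      l * (σ * f (S ∪ H') - σ * c))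
    refine mul_le_mul (by linarith) (Real.exp_le_exp.2 (by gcongr)) (Real.exp_pos _).le ?_
    have := (Real.exp_pos (l * (σ * f (S ∪ H') - σ * c)))
    linarith
  have hsum : ∑ H' ∈ X, l * (σ * f (S ∪ H') - σ * c) = 0 := by
    rw [← Finset.mul_sum, Finset.sum_sub_distrib, ← Finset.mul_sum, Finset.sum_const, nsmul_eq_mul]
    have : ∑ H' ∈ X, f (S ∪ H') = X.card * c := by
      rw [hc, surrogate, ← hX]; field_simp
    rw [this]; ring
  have havg : (∑ H' ∈ X, φ H') / X.card ≤ Real.exp (x ^ 2 * (2 + ν ^ 2) / 2) := by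
    calc (∑ H' ∈ X, φ H') / X.card ≤ (∑ H' ∈ X, (1 + l * (σ * f (S ∪ H') - σ * c) + x ^ 2) *
        Real.exp (ν ^ 2 * x ^ 2 / 2)) / X.card := by
          gcongr with H' hH'; exact hφle H' hH'
      _ = (1 + x ^ 2) * Real.exp (ν ^ 2 * x ^ 2 / 2) := by
          rw [← Finset.sum_mul, Finset.sum_add_distrib, Finset.sum_add_distrib, hsum]
          simp only [Finset.sum_const, nsmul_eq_mul]
          field_simp
          ring
      _ ≤ Real.exp (x ^ 2) * Real.exp (ν ^ 2 * x ^ 2 / 2) := by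
          gcongr
          linarith [Real.add_one_le_exp (x ^ 2)]
      _ = _ := by rw [← Real.exp_add]; ring_nf
  have hφ0 : ∀ H', 0 ≤ φ H' := fun H' => by positivity
  calc _ ≤ ∑ T ∈ X.powersetCard m, Real.exp (-l * (m * (η * V))) * ∏ H' ∈ T, φ H' := by
        refine Finset.sum_le_sum fun T hT => ?_
        have hTX := (Finset.mem_powersetCard.1 hT).1
        refine hξ.tail_le hD hS (fun H' h => hsub H' (hTX h)) hl0 fun H' h => ?_
        exact (mul_le_mul_of_nonneg_right (hly (hσf H' (hTX h))) hα).trans hηα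
    -- The sum over all choices without replacement is an elementary symmetric function; Maclaurin's
    -- inequality reduces it to the case of independent choices.
    _ = Real.exp (-l * (m * (η * V))) * symSum φ m X := by rw [← Finset.mul_sum]; rfl
    _ ≤ Real.exp (-l * (m * (η * V))) * (X.card.choose m * ((∑ i ∈ X, φ i) / X.card) ^ m) :=
        mul_le_mul_of_nonneg_left (symSum_le (fun H' _ => hφ0 H') hm) (Real.exp_pos _).le
    _ ≤ Real.exp (-l * (m * (η * V))) * (X.card.choose m *
          Real.exp (x ^ 2 * (2 + ν ^ 2) / 2) ^ m) := by
        have h0 : 0 ≤ (∑ i ∈ X, φ i) / X.card :=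
          div_nonneg (Finset.sum_nonneg fun i _ => hφ0 i) hXpos.le
        gcongr
    _ = _ := by
        rw [Finset.card_powersetCard m X, ← Real.exp_nat_mul, mul_left_comm, ← Real.exp_add]
        congr 2
        have h1 : (2 + ν ^ 2) ≠ 0 := by positivity
        have h2 : -l * (m * (η * V)) = -(m * η * (l * V)) := by ring
        rw [h2, hlV, hx]
        field_simp
        ring

/-- The sampled surrogate is uniformly close to the surrogate, for most smoothing sets and most
outcomes of the noise. -/
theorem IsNoise.sum_bad_le (hξ : IsNoise P ξ D) (hD : IsSubExponential D ν α) {U : Finset (Fin n)}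
    (hU : Disjoint U H) (hf0 : ∀ S, 0 ≤ f S) (hV : 0 < V)
    (hfV : ∀ S ⊆ U, ∀ H' ⊆ H, f (S ∪ H') ≤ V) (hα : 0 ≤ α) (hη : 0 ≤ η)
    (hη1 : η / (2 + ν ^ 2) ≤ 1) (hηα : η / (2 + ν ^ 2) * α ≤ 1)
    (hm : m ≤ (H.powersetCard t).card) (hm0 : 0 < m) :
    ∑ T ∈ (H.powersetCard t).powersetCard m,
        P.real {ω | ¬ ∀ S ⊆ U,
          |sampledSurrogate (noisyValue f ξ ω) T S - surrogate f t H S| ≤ η * V} ≤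
      ((H.powersetCard t).powersetCard m).card *
        (2 ^ (n + 1) * Real.exp (-(m * η ^ 2 / (2 * (2 + ν ^ 2))))) := by
  have hne : (H.powersetCard t).Nonempty := Finset.card_pos.1 (hm0.trans_le hm)
  have hm' : (0 : ℝ) < m := by exact_mod_cast hm0
  set E : ℝ → Finset (Finset (Fin n)) → Finset (Fin n) → Set Ω := fun σ T S =>
    {ω | m * (η * V) ≤
      ∑ H' ∈ T, (ξ (S ∪ H') ω * (σ * f (S ∪ H')) - σ * surrogate f t H S)} with hE
  set b := ((H.powersetCard t).powersetCard m).card *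
    Real.exp (-(m * η ^ 2 / (2 * (2 + ν ^ 2)))) with hb
  have hEb : ∀ σ : ℝ, |σ| = 1 → ∀ S ∈ U.powerset,
      ∑ T ∈ (H.powersetCard t).powersetCard m, P.real (E σ T S) ≤ b := fun σ hσ S hS =>
    hξ.sum_tail_le hD (hU.mono_left (Finset.mem_powerset.1 hS)) hf0 hV
      (hfV S (Finset.mem_powerset.1 hS)) hα hη hη1 hηα hm hne hσ
  -- A union bound over at most `2 ^ n` sets `S` and the two signs, whence `2 ^ (n + 1)`.
  calc _ ≤ ∑ T ∈ (H.powersetCard t).powersetCard m,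
        ∑ S ∈ U.powerset, (P.real (E 1 T S) + P.real (E (-1) T S)) := by
        refine Finset.sum_le_sum fun T hT => ?_
        obtain ⟨-, hTc⟩ := Finset.mem_powersetCard.1 hT
        calc _ ≤ P.real (⋃ S ∈ U.powerset, (E 1 T S ∪ E (-1) T S)) := by
              refine measureReal_mono ?_ (measure_ne_top _ _)
              intro ω hω
              rw [Set.mem_ofPred_eq] at hω
              push Not at hω
              obtain ⟨S, hS, hlt⟩ := hω
              refine Set.mem_biUnion (Finset.mem_coe.2 (Finset.mem_powerset.2 hS)) ?_
              have e : ∀ σ : ℝ, ∑ H' ∈ T, (ξ (S ∪ H') ω * (σ * f (S ∪ H')) -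
                  σ * surrogate f t H S) =
                  m * (σ * (sampledSurrogate (noisyValue f ξ ω) T S - surrogate f t H S)) := by
                intro σ
                rw [Finset.sum_sub_distrib, Finset.sum_const, hTc, nsmul_eq_mul, sampledSurrogate,
                  hTc]
                have : ∑ H' ∈ T, ξ (S ∪ H') ω * (σ * f (S ∪ H')) =
                    σ * ∑ H' ∈ T, noisyValue f ξ ω (S ∪ H') := by
                  rw [Finset.mul_sum]
                  exact Finset.sum_congr rfl fun H' _ => by rw [noisyValue]; ring
                rw [this]
                field_simp
              simp only [hE, Set.mem_union, Set.mem_ofPred_eq, e]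
              rcases lt_abs.1 hlt with h | h
              · left; exact mul_le_mul_of_nonneg_left (by linarith) hm'.le
              · right; exact mul_le_mul_of_nonneg_left (by linarith) hm'.le
          _ ≤ ∑ S ∈ U.powerset, P.real (E 1 T S ∪ E (-1) T S) :=
              measureReal_biUnion_finset_le _ _
          _ ≤ _ := Finset.sum_le_sum fun S _ => measureReal_union_le _ _
    _ = ∑ S ∈ U.powerset, (∑ T ∈ (H.powersetCard t).powersetCard m, P.real (E 1 T S) +
          ∑ T ∈ (H.powersetCard t).powersetCard m, P.real (E (-1) T S)) := by
        rw [Finset.sum_comm]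
        exact Finset.sum_congr rfl fun S _ => Finset.sum_add_distrib
    _ ≤ ∑ _S ∈ U.powerset, (b + b) := Finset.sum_le_sum fun S hS =>
        add_le_add (hEb 1 (by simp) S hS) (hEb (-1) (by simp) S hS)
    _ = 2 ^ U.card * (b + b) := by
        rw [Finset.sum_const, Finset.card_powerset, nsmul_eq_mul]; push_cast; rfl
    _ ≤ 2 ^ n * (b + b) := by
        have hUn : U.card ≤ n := (Finset.card_le_univ U).trans_eq (by simp)
        have hb0 : 0 ≤ b := by positivity
        gcongr
        norm_num
    _ = _ := by rw [hb, pow_succ]; ring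

end Concentration


/-! ### The optimum of a random contraction -/

section Contraction
variable {n : ℕ} {M : Matroid (Fin n)}

/-- The additive minorant of a submodular function that is exact on `O`. -/
theorem DimRet.exists_additive {f : Finset (Fin n) → ℝ} (hf : DimRet f) (hm : Monotone f)
    (O : Finset (Fin n)) : ∃ w : Fin n → ℝ, (∀ i, 0 ≤ w i) ∧ ∑ i ∈ O, w i = f O - f ∅ ∧
      ∀ S ⊆ O, ∑ i ∈ S, w i ≤ f S - f ∅ := by
  -- The weights are the marginal values in the order in which `O` is built up; within a subset of
  -- `O`, diminishing returns make the corresponding marginals at least as large.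
  induction O using Finset.induction_on with
  | empty =>
    refine ⟨0, fun _ => le_rfl, by simp, fun S hS => ?_⟩
    rw [Finset.subset_empty.1 hS]; simp
  | insert a O ha ih =>
    obtain ⟨w, hw0, hwO, hwS⟩ := ih
    have hne : ∀ S ⊆ O, ∑ i ∈ S, Function.update w a (f (insert a O) - f O) i = ∑ i ∈ S, w i :=
      fun S hS => Finset.sum_congr rfl fun i hi =>
        Function.update_of_ne (fun h : i = a => ha (hS (h ▸ hi))) _ _
    refine ⟨Function.update w a (f (insert a O) - f O), fun i => ?_, ?_, fun S hS => ?_⟩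
    · by_cases hi : i = a
      · subst hi
        rw [Function.update_self, sub_nonneg]; exact hm (Finset.subset_insert _ _)
      · rw [Function.update_of_ne hi]; exact hw0 i
    · rw [Finset.sum_insert ha, hne O subset_rfl, Function.update_self, hwO]; ring
    · by_cases haS : a ∈ S
      · have hS' : S.erase a ⊆ O := fun i hi =>
          (Finset.mem_insert.1 (hS (Finset.mem_of_mem_erase hi))).resolve_left
            (Finset.ne_of_mem_erase hi)
        rw [← Finset.add_sum_erase _ _ haS, hne _ hS', Function.update_self]
        have h1 := hwS _ hS'
        have h2 := hf _ _ hS' a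
        rw [Finset.insert_erase haS] at h2
        linarith
      · have hS' : S ⊆ O := fun i hi => (Finset.mem_insert.1 (hS hi)).resolve_left
          fun h => haS (h ▸ hi)
        rw [hne S hS']
        exact hwS S hS'

theorem exists_max_indep_between (hE : M.E = Set.univ) {I X : Finset (Fin n)}
    (hI : M.Indep (↑I : Set (Fin n))) (hIX : I ⊆ X) :
    ∃ J : Finset (Fin n), I ⊆ J ∧ J ⊆ X ∧ M.Indep (↑J : Set (Fin n)) ∧
      ∀ K ⊆ X, M.Indep (↑K : Set (Fin n)) → K.card ≤ J.card := by
  obtain ⟨J, hJ, hIJ⟩ := hI.subset_isBasis_of_subset (X := (↑X : Set (Fin n)))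
    (by exact_mod_cast hIX) (by simp [hE])
  obtain ⟨J, rfl⟩ := (Set.toFinite J).exists_finset_coe
  refine ⟨J, by exact_mod_cast hIJ, by exact_mod_cast hJ.subset, hJ.indep, fun K hK hKi => ?_⟩
  have h1 := hKi.encard_le_eRk_of_subset (X := (↑X : Set (Fin n))) (by exact_mod_cast hK)
  rw [hJ.eRk_eq_encard, Set.encard_coe_eq_coe_finsetCard, Set.encard_coe_eq_coe_finsetCard] at h1
  exact_mod_cast h1

/-- Each element of the base lies in a proportion `h / |B|` of its `h`-subsets. -/
theorem sum_card_inter_powersetCard {β : Type} [DecidableEq β] {B Y : Finset β} (hY : Y ⊆ B)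
    {h : ℕ} (hh : h ≤ B.card) :
    (B.card : ℝ) * ∑ H ∈ B.powersetCard h, ((H ∩ Y).card : ℝ) =
      h * (B.powersetCard h).card * Y.card := by
  have key : ∀ y ∈ Y, (B.card : ℝ) * ∑ H ∈ B.powersetCard h, (if y ∈ H then (1 : ℝ) else 0) =
      h * (B.powersetCard h).card := by
    intro y hy
    have h1 : ∑ H ∈ B.powersetCard h, (if y ∈ H then (1 : ℝ) else 0) =
        (B.powersetCard h).card - ((B.erase y).powersetCard h).card := by
      have h2 : (B.powersetCard h).filter (fun H => y ∉ H) = (B.erase y).powersetCard h := by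
        ext H
        simp only [Finset.mem_filter, Finset.mem_powersetCard, Finset.subset_erase]
        constructor <;> intro h <;> simp_all
      have h3 := Finset.card_filter_add_card_filter_not (s := B.powersetCard h) (fun H => y ∈ H)
      rw [Finset.sum_boole, ← h2, ← h3]
      push_cast; ring
    have hc : (B.erase y).card + 1 = B.card := Finset.card_erase_add_one (hY hy)
    rw [h1, Finset.card_powersetCard, Finset.card_powersetCard]
    have h4 := Nat.choose_mul_succ_eq (B.erase y).card h
    rw [hc] at h4
    have h5 : ((B.erase y).card.choose h : ℝ) * B.card = B.card.choose h * (B.card - h) := by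
      rw [← Nat.cast_sub hh]; exact_mod_cast h4
    linear_combination -h5
  have e : ∀ H ∈ B.powersetCard h, ((H ∩ Y).card : ℝ) = ∑ y ∈ Y, if y ∈ H then (1 : ℝ) else 0 := by
    intro H _
    rw [Finset.sum_boole, Finset.inter_comm, Finset.filter_mem_eq_inter]
  rw [Finset.sum_congr rfl e, Finset.sum_comm, Finset.mul_sum, Finset.sum_congr rfl key,
    Finset.sum_const, nsmul_eq_mul]
  ring

/-- An independent set keeps, on average over the contracted part `H` of a base, at least the
proportion `1 - h / r` of its weight. -/
theorem exists_contractIndep_weight (hE : M.E = Set.univ) {B : Finset (Fin n)}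
    (hB : M.IsBase (↑B : Set (Fin n))) {h : ℕ} (hh : h ≤ B.card) (O : Finset (Fin n)) :
    M.Indep (↑O : Set (Fin n)) → ∀ w : Fin n → ℝ, (∀ i ∈ O, 0 ≤ w i) →
    ∃ J : Finset (Fin n) → Finset (Fin n), (∀ H ∈ B.powersetCard h, ContractIndep M H (J H)) ∧
      (∀ H ∈ B.powersetCard h, J H ⊆ O) ∧
      (B.powersetCard h).card * ((B.card - h) * ∑ i ∈ O, w i) ≤
        B.card * ∑ H ∈ B.powersetCard h, ∑ i ∈ J H, w i := by
  induction O using Finset.strongInduction with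
  | H O ih =>
  intro hO w hw
  have hHi : ∀ H ∈ B.powersetCard h, M.Indep (↑H : Set (Fin n)) := fun H hH =>
    hB.indep.subset (by exact_mod_cast (Finset.mem_powersetCard.1 hH).1)
  rcases O.eq_empty_or_nonempty with rfl | hne
  · exact ⟨fun _ => ∅, fun H hH => ⟨Finset.disjoint_empty_left _, by simpa using hHi H hH⟩,
      fun _ _ => subset_rfl, by simp⟩
  -- The weight splits into the constant `w o` on `O` and the nonnegative remainder, which vanishes
  -- at `o`. The remainder is handled by induction on `O` without `o`. For the constant part only
  -- the average cardinality matters, so the sets from the induction are enlarged inside `O` as far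
  -- as independence allows.
  obtain ⟨o, ho, hmin⟩ := O.exists_min_image w hne
  obtain ⟨J', hJ'c, hJ'O, hJ'w⟩ := ih (O.erase o) (Finset.erase_ssubset ho)
    (hO.subset (by exact_mod_cast Finset.erase_subset o O)) (fun i => w i - w o)
    fun i hi => sub_nonneg.2 (hmin i (Finset.mem_of_mem_erase hi))
  -- a base `O ∪ Y` with `Y ⊆ B`
  obtain ⟨B', hB', hOB', hB'O⟩ := hO.exists_isBase_subset_union_isBase hB
  obtain ⟨B', rfl⟩ := (Set.toFinite B').exists_finset_coe
  rw [Finset.coe_subset] at hOB'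
  have hB'O : B' ⊆ O ∪ B := by exact_mod_cast hB'O
  have hcard : B'.card = B.card := by
    have := hB'.encard_eq_encard_of_isBase hB
    rw [Set.encard_coe_eq_coe_finsetCard, Set.encard_coe_eq_coe_finsetCard] at this
    exact_mod_cast this
  have hYB : B' \ O ⊆ B := fun i hi => by
    rw [Finset.mem_sdiff] at hi
    exact (Finset.mem_union.1 (hB'O hi.1)).resolve_left hi.2
  have hYcard : ((B' \ O).card : ℝ) = B.card - O.card := by
    rw [Finset.cast_card_sdiff hOB', hcard]
  -- extend each set as far as possible
  have hex : ∀ H : Finset (Fin n), ∃ K : Finset (Fin n), H ∈ B.powersetCard h →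
      ContractIndep M H K ∧ J' H ⊆ K ∧ K ⊆ O ∧
        (O.card : ℝ) + (H ∩ (B' \ O)).card - h ≤ K.card := by
    intro H
    by_cases hH : H ∈ B.powersetCard h
    swap
    · exact ⟨∅, fun h => absurd h hH⟩
    obtain ⟨hHB, hHc⟩ := Finset.mem_powersetCard.1 hH
    obtain ⟨J, hJ1, hJ2, hJ3, hJ4⟩ := exists_max_indep_between hE (X := O ∪ H) (hJ'c H hH).2
      (Finset.union_subset_union_left ((hJ'O H hH).trans (Finset.erase_subset _ _)))
    have hHJ : H ⊆ J := Finset.subset_union_right.trans hJ1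
    refine ⟨J \ H, fun _ => ⟨⟨Finset.sdiff_disjoint, ?_⟩, ?_, ?_, ?_⟩⟩
    · rwa [Finset.sdiff_union_of_subset hHJ]
    · exact Finset.subset_sdiff.2 ⟨Finset.subset_union_left.trans hJ1, (hJ'c H hH).1⟩
    · intro i hi
      rw [Finset.mem_sdiff] at hi
      exact (Finset.mem_union.1 (hJ2 hi.1)).resolve_right hi.2
    -- This competitor inside `O ∪ H` is independent as a part of the base `B'`, and it forces the
    -- maximal extension to be large.
    · have h1 := hJ4 (O ∪ H ∩ (B' \ O))
        (Finset.union_subset_union_right Finset.inter_subset_left)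
        (hB'.indep.subset (by
          rw [Finset.coe_subset]
          exact Finset.union_subset hOB' (Finset.inter_subset_right.trans Finset.sdiff_subset)))
      rw [Finset.card_union_of_disjoint (Finset.disjoint_sdiff.mono_right
        Finset.inter_subset_right)] at h1
      have h2 : ((J \ H).card : ℝ) = J.card - h := by rw [Finset.cast_card_sdiff hHJ, hHc]
      rw [h2]
      have h3 : (O.card : ℝ) + (H ∩ (B' \ O)).card ≤ J.card := by exact_mod_cast h1
      linarith
  choose J hJ using hex
  refine ⟨J, fun H hH => (hJ H hH).1, fun H hH => (hJ H hH).2.2.1, ?_⟩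
  set N := ((B.powersetCard h).card : ℝ) with hN
  set r := (B.card : ℝ) with hr
  have hr0 : 0 ≤ r := Nat.cast_nonneg _
  have hwo := hw o ho
  -- With `Y` the part of `B'` outside `O`, the mean of `|H ∩ Y|` is `h (r - |O|) / r`. Adding `|O|
  -- - h` leaves `|O| (1 - h / r)`.
  have h1 : N * ((r - h) * O.card) ≤ r * ∑ H ∈ B.powersetCard h, ((J H).card : ℝ) := by
    have h2 := mul_le_mul_of_nonneg_left
      (Finset.sum_le_sum fun H hH => (hJ H hH).2.2.2) hr0
    rw [Finset.sum_sub_distrib, Finset.sum_add_distrib, mul_sub, mul_add,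
      sum_card_inter_powersetCard hYB hh, hYcard, Finset.sum_const, Finset.sum_const,
      nsmul_eq_mul, nsmul_eq_mul] at h2
    linarith
  have h2 : ∑ H ∈ B.powersetCard h, ∑ i ∈ J' H, (w i - w o) +
      w o * ∑ H ∈ B.powersetCard h, ((J H).card : ℝ) ≤
        ∑ H ∈ B.powersetCard h, ∑ i ∈ J H, w i := by
    rw [Finset.mul_sum, ← Finset.sum_add_distrib]
    refine Finset.sum_le_sum fun H hH => ?_
    have h3 : ∑ i ∈ J' H, (w i - w o) ≤ ∑ i ∈ J H, (w i - w o) :=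
      Finset.sum_le_sum_of_subset_of_nonneg (hJ H hH).2.1 fun i hi _ =>
        sub_nonneg.2 (hmin i ((hJ H hH).2.2.1 hi))
    rw [Finset.sum_sub_distrib (s := J H), Finset.sum_const, nsmul_eq_mul] at h3
    linarith
  have h3 : ∑ i ∈ O, w i = ∑ i ∈ O.erase o, (w i - w o) + O.card * w o := by
    have : ∑ i ∈ O, (w i - w o) = ∑ i ∈ O.erase o, (w i - w o) := by
      rw [← Finset.add_sum_erase _ _ ho]; simp
    rw [← this, Finset.sum_sub_distrib, Finset.sum_const, nsmul_eq_mul]; ring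
  rw [h3]
  have h4 := mul_le_mul_of_nonneg_left h2 hr0
  have h5 := mul_le_mul_of_nonneg_left h1 hwo
  linarith

/-- Contracting a random part of a base costs a proportion `h / r` of the optimum. -/
theorem exists_contractIndep_value (hE : M.E = Set.univ) {B : Finset (Fin n)}
    (hB : M.IsBase (↑B : Set (Fin n))) {h : ℕ} (hh : h ≤ B.card) {O : Finset (Fin n)}
    (hO : M.Indep (↑O : Set (Fin n))) {f : Finset (Fin n) → ℝ} (hf : DimRet f) (hm : Monotone f)
    (hf0 : f ∅ = 0) :
    ∃ J : Finset (Fin n) → Finset (Fin n), (∀ H ∈ B.powersetCard h, ContractIndep M H (J H)) ∧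
      (B.powersetCard h).card * ((B.card - h) * f O) ≤
        B.card * ∑ H ∈ B.powersetCard h, f (J H) := by
  obtain ⟨w, hw0, hwO, hwS⟩ := hf.exists_additive hm O
  obtain ⟨J, hJ1, hJ2, hJ3⟩ := exists_contractIndep_weight hE hB hh O hO w fun i _ => hw0 i
  refine ⟨J, hJ1, ?_⟩
  rw [hwO, hf0, sub_zero] at hJ3
  refine hJ3.trans (mul_le_mul_of_nonneg_left (Finset.sum_le_sum fun H hH => ?_)
    (Nat.cast_nonneg _))
  simpa [hf0] using hwS _ (hJ2 H hH)

end Contraction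


/-! ### Measurability in the value oracle -/

section Measurability
variable {X α β : Type} [MeasurableSpace X]

/-- A function with values in a discrete space is measurable. -/
def MeasFun (g : X → α) : Prop := ∀ a, MeasurableSet {x | g x = a}

/-- The point masses of a law depend measurably on the parameter. -/
def MeasLaw (κ : X → PMF α) : Prop := ∀ a, Measurable fun x => κ x a

theorem MeasFun.const (a : α) : MeasFun fun _ : X => a := fun _ => MeasurableSet.const _

theorem MeasFun.comp [Countable α] {g : X → α} (hg : MeasFun g) {F : X → α → β}
    (hF : ∀ a, MeasFun fun x => F x a) : MeasFun fun x => F x (g x) := by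
  intro b
  have : {x | F x (g x) = b} = ⋃ a, {x | g x = a} ∩ {x | F x a = b} := by
    ext x; simp
  rw [this]
  exact MeasurableSet.iUnion fun a => (hg a).inter (hF a b)

theorem MeasFun.ite {c : X → Prop} {_ : ∀ x, Decidable (c x)} (hc : MeasurableSet {x | c x}) (a b : α) :
    MeasFun fun x => if c x then a else b := by
  intro d
  have : {x | (if c x then a else b) = d} =
      ({x | c x} ∩ {_x | a = d}) ∪ ({x | c x}ᶜ ∩ {_x | b = d}) := by
    ext x; by_cases h : c x <;> simp [h]
  rw [this]
  exact (hc.inter (MeasurableSet.const _)).union (hc.compl.inter (MeasurableSet.const _))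

theorem MeasLaw.const (μ : PMF α) : MeasLaw fun _ : X => μ := fun _ => measurable_const

theorem MeasFun.pure {g : X → α} (hg : MeasFun g) : MeasLaw fun x => PMF.pure (g x) := by
  classical
  intro a
  simp only [PMF.pure_apply, eq_comm (a := a)]
  exact Measurable.ite (hg a) measurable_const measurable_const

theorem MeasLaw.bind [Countable α] {κ : X → PMF α} (hκ : MeasLaw κ) {κ' : X → α → PMF β}
    (hκ' : ∀ a, MeasLaw fun x => κ' x a) : MeasLaw fun x => (κ x).bind (κ' x) := by
  intro b
  simp only [PMF.bind_apply]
  exact Measurable.ennreal_tsum fun a => (hκ a).mul (hκ' a b)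

theorem MeasLaw.map [Countable α] {κ : X → PMF α} (hκ : MeasLaw κ) {g : X → α → β}
    (hg : ∀ a, MeasFun fun x => g x a) : MeasLaw fun x => (κ x).map (g x) := by
  simp only [← PMF.bind_pure_comp]
  exact hκ.bind fun a => (hg a).pure

variable {n : ℕ}

/-- Oracle values influence the discrete choices of the algorithm only through comparisons of
weights, and these are measurable. -/
theorem measFun_pick {w : X → Fin n → ℝ} (hw : Measurable w) (D : Finset (Fin n)) :
    MeasFun fun x => pick (w x) D := by
  have hs : ∀ b i, MeasFun fun x => pickStep (w x) D b i := by
    intro b i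
    simp only [pickStep]
    split_ifs
    · exact MeasFun.const _
    · cases b with
      | none => exact MeasFun.const _
      | some j => exact MeasFun.ite (measurableSet_lt ((measurable_pi_apply j).comp hw)
          ((measurable_pi_apply i).comp hw)) _ _
  have key : ∀ (l : List (Fin n)) (g : X → Option (Fin n)), MeasFun g →
      MeasFun fun x => l.foldl (pickStep (w x) D) (g x) := by
    intro l
    induction l with
    | nil => exact fun g hg => hg
    | cons i l ih => exact fun g hg => ih _ (hg.comp (F := fun x b => pickStep (w x) D b i)
        fun b => hs b i)
  exact key _ _ (MeasFun.const _)

theorem measFun_greedySet (M : Matroid (Fin n)) (H : Finset (Fin n)) {w : X → Fin n → ℝ}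
    (hw : Measurable w) : MeasFun fun x => greedySet M H (w x) := by
  have ht : ∀ p b, MeasFun fun x => greedyTake M H (w x) p b := by
    intro p b
    cases b with
    | none => exact MeasFun.const _
    | some e =>
      simp only [greedyTake]
      refine (MeasFun.ite ?_ _ _).comp (F := fun _ S => (insert e p.1, S)) fun _ => MeasFun.const _
      exact (MeasurableSet.const _).inter ((measurableSet_lt measurable_const
        ((measurable_pi_apply e).comp hw)).inter (MeasurableSet.const _))
  have hs : ∀ p, MeasFun fun x => greedyStep M H (w x) p := fun p =>
    (measFun_pick hw p.1).comp fun b => ht p b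
  have key : ∀ k, MeasFun fun x => (greedyStep M H (w x))^[k] (∅, ∅) := by
    intro k
    induction k with
    | zero => exact MeasFun.const _
    | succ k ih =>
      simp only [Function.iterate_succ_apply']
      exact ih.comp hs
  exact (key n).comp (F := fun _ p => p.2) fun _ => MeasFun.const _

theorem measurable_estimate {g : X → Finset (Fin n) → ℝ} (hg : Measurable g) (s : ℕ)
    (Rs : List (Finset (Fin n))) : Measurable fun x => estimate (g x) s Rs := by
  refine measurable_pi_lambda _ fun i => ?_
  simp only [estimate]
  refine Measurable.div_const ?_ _
  induction Rs with
  | nil => exact measurable_const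
  | cons R Rs ih =>
    simp only [List.map_cons, List.sum_cons]
    exact (((measurable_pi_apply _).comp hg).sub ((measurable_pi_apply _).comp hg)).add ih

theorem measLaw_greedyHistory (M : Matroid (Fin n)) (H : Finset (Fin n)) (δ : ℝ) (s : ℕ)
    {g : X → Finset (Fin n) → ℝ} (hg : Measurable g) (k : ℕ) :
    MeasLaw fun x => greedyHistory δ s (greedySet M H) (g x) k := by
  induction k with
  | zero => exact MeasLaw.const _
  | succ k ih =>
    refine ih.bind fun L => (MeasLaw.const _).map fun Rs => ?_
    exact (measFun_greedySet M H (measurable_estimate hg s Rs)).comp (F := fun _ I => I :: L)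
      fun _ => MeasFun.const _

theorem measurable_sampledSurrogate {v : X → Finset (Fin n) → ℝ} (hv : Measurable v)
    (T : Finset (Finset (Fin n))) : Measurable fun x => sampledSurrogate (v x) T := by
  refine measurable_pi_lambda _ fun S => ?_
  simp only [sampledSurrogate]
  refine Measurable.div_const (Finset.measurable_fun_sum _ fun H' _ => ?_) _
  exact (measurable_pi_apply _).comp hv

/-- The law of the output depends on the noise through the oracle; this makes its expectation a
measurable function of the noise, which can then be integrated. -/
theorem measLaw_metaAlgorithm (M : Matroid (Fin n)) (B : Finset (Fin n)) (h t m : ℕ) (s : ℕ → ℕ)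
    (round : Finset (Fin n) → List (Finset (Fin n)) → PMF (Finset (Fin n)))
    {v : X → Finset (Fin n) → ℝ} (hv : Measurable v) :
    MeasLaw fun x => metaAlgorithm B h t m (fun H => measuredContinuousGreedy (n - H.card)
      (s (n - H.card)) (greedySet M H) (round H)) (v x) := by
  unfold metaAlgorithm
  split_ifs
  · refine (MeasLaw.const _).bind fun H => (MeasLaw.const _).bind fun T => MeasLaw.bind ?_ fun S =>
      MeasLaw.const _
    exact (measLaw_greedyHistory M H _ _ (measurable_sampledSurrogate hv T) _).bind fun L =>
      MeasLaw.const _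
  · exact MeasLaw.const _

theorem MeasLaw.measurable_expect {κ : X → PMF (Finset (Fin n))} (hκ : MeasLaw κ)
    (f : Finset (Fin n) → ℝ) : Measurable fun x => expect (κ x) f :=
  Finset.measurable_fun_sum _ fun S _ => (hκ S).ennreal_toReal.mul_const _

end Measurability


/-! ### The surrogate function -/

section Surrogate
variable {n : ℕ} {f : Finset (Fin n) → ℝ} {t : ℕ} {H : Finset (Fin n)}

theorem surrogate_mono (hf : Monotone f) : Monotone (surrogate f t H) := fun A B hAB => by
  unfold surrogate
  gcongr
  exact hf (Finset.union_subset_union_left hAB)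

theorem surrogate_dimRet (hf : DimRet f) : DimRet (surrogate f t H) := by
  intro A B hAB x
  simp only [surrogate, ← sub_div, ← Finset.sum_sub_distrib, Finset.insert_union]
  refine div_le_div_of_nonneg_right (Finset.sum_le_sum fun H' _ => ?_) (Nat.cast_nonneg _)
  exact hf _ _ (Finset.union_subset_union_left hAB) x

theorem surrogate_nonneg (hf : ∀ S, 0 ≤ f S) (S : Finset (Fin n)) : 0 ≤ surrogate f t H S :=
  div_nonneg (Finset.sum_nonneg fun _ _ => hf _) (Nat.cast_nonneg _)

theorem surrogate_le {S : Finset (Fin n)} {V : ℝ} (hne : (H.powersetCard t).Nonempty)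
    (h : ∀ H' ⊆ H, f (S ∪ H') ≤ V) : surrogate f t H S ≤ V := by
  have hpos : (0 : ℝ) < (H.powersetCard t).card := by exact_mod_cast hne.card_pos
  rw [surrogate, div_le_iff₀ hpos, mul_comm, ← nsmul_eq_mul]
  exact Finset.sum_le_card_nsmul _ _ _ fun H' hH' => h H' (Finset.mem_powersetCard.1 hH').1

theorem le_surrogate (hf : Monotone f) (hne : (H.powersetCard t).Nonempty) (S : Finset (Fin n)) :
    f S ≤ surrogate f t H S := by
  have hpos : (0 : ℝ) < (H.powersetCard t).card := by exact_mod_cast hne.card_pos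
  rw [surrogate, le_div_iff₀ hpos, mul_comm, ← nsmul_eq_mul]
  exact Finset.card_nsmul_le_sum _ _ _ fun H' _ => hf Finset.subset_union_left

open Classical in
/-- The elements that are not loops of the contraction by `H`. -/
def candidates (M : Matroid (Fin n)) (H : Finset (Fin n)) : Finset (Fin n) :=
  Finset.univ.filter fun i => i ∉ H ∧ M.Indep (↑(insert i H) : Set (Fin n))

variable {M : Matroid (Fin n)}

theorem mem_candidates {i : Fin n} :
    i ∈ candidates M H ↔ i ∉ H ∧ M.Indep (↑(insert i H) : Set (Fin n)) := by
  simp [candidates]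

theorem ContractIndep.subset_candidates {I : Finset (Fin n)} (hI : ContractIndep M H I) :
    I ⊆ candidates M H := fun i hi => by
  refine mem_candidates.2 ⟨Finset.disjoint_left.1 hI.1 hi, hI.2.subset ?_⟩
  exact_mod_cast Finset.insert_subset (Finset.mem_union_left _ hi) Finset.subset_union_right

/-- Sampled sets need not be independent, but each of their elements can be added to `H'` alone. So
the marginal value of each element over `H'` is at most `b - f H'`, and the marginals add up by
diminishing returns. -/
theorem value_le_of_subset_candidates (hn : 0 < n) (hf : DimRet f) (hf0 : ∀ S, 0 ≤ f S) {b : ℝ}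
    (hb : ∀ S : Finset (Fin n), M.Indep (↑S : Set (Fin n)) → f S ≤ b)
    (hH : M.Indep (↑H : Set (Fin n))) :
    ∀ S ⊆ candidates M H, ∀ H' ⊆ H, f (S ∪ H') ≤ n * b := by
  intro S hS H' hH'
  have h1 := hf.sub_le_sum H' S
  have hH'b : f H' ≤ b := hb H' (hH.subset (by exact_mod_cast hH'))
  have h2 : ∑ i ∈ S, (f (insert i H') - f H') ≤ S.card * (b - f H') := by
    rw [← nsmul_eq_mul]
    refine Finset.sum_le_card_nsmul _ _ _ fun i hi => ?_
    have := hb (insert i H') ((mem_candidates.1 (hS hi)).2.subset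
      (by exact_mod_cast Finset.insert_subset_insert i hH'))
    linarith
  have h3 : (S.card : ℝ) * (b - f H') ≤ n * (b - f H') := by
    have : (S.card : ℝ) ≤ n := by exact_mod_cast (Finset.card_le_univ S).trans_eq (by simp)
    exact mul_le_mul_of_nonneg_right this (by linarith)
  have hn1 : (1 : ℝ) ≤ n := by exact_mod_cast hn
  rw [Finset.union_comm]
  nlinarith [hf0 H']

end Surrogate

/-! ### The parameters -/

section Parameters
variable {n : ℕ} {ε ν α : ℝ}

/-- The failure probability of the sampled surrogate. -/
theorem failure_le (hε : 0 < ε) (hν : 0 ≤ ν) (hn : 0 < n) :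
    2 ^ (n + 1) * Real.exp (-(numSets n ε ν * (ε / n ^ 2) ^ 2 / (2 * (2 + ν ^ 2)))) ≤ ε := by
  set N : ℝ := (inputSize n ε ν : ℝ) with hN
  have hn1 : (1 : ℝ) ≤ n := by exact_mod_cast hn
  have hce : 1 / ε ≤ (⌈1 / ε⌉₊ : ℝ) := Nat.le_ceil _
  have hcn : ν ≤ (⌈ν⌉₊ : ℝ) := Nat.le_ceil _
  have hNe : N = n + (⌈1 / ε⌉₊ : ℝ) + (⌈ν⌉₊ : ℝ) := by rw [hN, inputSize]; push_cast; ring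
  have hε' : 0 < 1 / ε := by positivity
  have hNn : (n : ℝ) ≤ N := by linarith
  have hNε : 1 / ε ≤ N := by linarith
  have hNν : ν ≤ N := by linarith
  have hN1 : 1 ≤ N := by linarith
  have hεN : 1 / N ≤ ε := by
    rw [div_le_iff₀ (by linarith)]
    rw [div_le_iff₀ hε] at hNε
    linarith
  have hm : 64 * N ^ 9 ≤ numSets n ε ν := by
    have h1 : N ≤ ((2 ^ sizeLog n ε ν : ℕ) : ℝ) := by
      rw [hN]; exact_mod_cast le_pow_sizeLog n ε ν
    rw [numSets]
    push_cast at h1 ⊢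
    gcongr
  have hη : 1 / N ^ 3 ≤ ε / n ^ 2 := by
    calc 1 / N ^ 3 = 1 / N / N ^ 2 := by field_simp
      _ ≤ ε / n ^ 2 := by gcongr
  have hν2 : 2 * (2 + ν ^ 2) ≤ 6 * N ^ 2 := by nlinarith
  -- The ninth power in the number of smoothing sets pays for the sixth power from the accuracy and
  -- the square from the noise parameter; the factor `N` that remains beats `2 ^ (n + 1)`.
  have hexp : 10 * N ≤ numSets n ε ν * (ε / n ^ 2) ^ 2 / (2 * (2 + ν ^ 2)) := by
    calc 10 * N ≤ 64 * N ^ 9 * (1 / N ^ 3) ^ 2 / (6 * N ^ 2) := by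
          have : 64 * N ^ 9 * (1 / N ^ 3) ^ 2 / (6 * N ^ 2) = 64 / 6 * N := by
            field_simp
          rw [this]; linarith
      _ ≤ _ := by gcongr
  calc 2 ^ (n + 1) * Real.exp (-(numSets n ε ν * (ε / n ^ 2) ^ 2 / (2 * (2 + ν ^ 2))))
      ≤ Real.exp 1 ^ (n + 1) * Real.exp (-(10 * N)) := by
        gcongr
        linarith [Real.add_one_le_exp (1 : ℝ)]
    _ = Real.exp (n + 1 - 10 * N) := by
        rw [← Real.exp_nat_mul, ← Real.exp_add]; push_cast; ring_nf
    _ ≤ Real.exp (-(8 * N)) := Real.exp_le_exp.2 (by linarith)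
    _ ≤ 1 / N := by
        rw [Real.exp_neg, ← one_div]
        exact one_div_le_one_div_of_le (by linarith) (by linarith [Real.add_one_le_exp (8 * N)])
    _ ≤ ε := hεN

/-- The contracted part of the base is a small proportion of it. -/
theorem setSize_sq_le (hε : 0 < ε) (hε4 : ε < 1 / 4) (hn : 1 / ε ≤ n) {r : ℝ}
    (hr : (44 + 18 * (⌈ν⌉₊ : ℝ)) ^ 2 * (1 / ε * Real.log (n / ε) ^ 2) ≤ r) :
    ((setSize n ε ν ^ 2 : ℕ) : ℝ) ≤ ε * r := by
  have h4 : 4 < 1 / ε := by rw [lt_div_iff₀ hε]; linarith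
  have hn4 : (4 : ℝ) < n := by linarith
  have hn0 : 0 < n := by exact_mod_cast (by linarith : (0 : ℝ) < n)
  set c : ℝ := (⌈ν⌉₊ : ℝ) with hc
  have hc0 : 0 ≤ c := Nat.cast_nonneg _
  set l := Real.log (n / ε) with hl
  have hnε : (n : ℝ) ≤ n / ε := by rw [le_div_iff₀ hε]; nlinarith
  have hl1 : 1 ≤ l := by
    rw [hl, Real.le_log_iff_exp_le (by positivity)]
    linarith [Real.exp_one_lt_d9]
  have hpow : (2 : ℝ) ^ sizeLog n ε ν ≤ 4 * n * (1 + c) := by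
    have h1 := pow_sizeLog_le hn0 ε ν
    have h2 : ⌈1 / ε⌉₊ ≤ n := Nat.ceil_le.2 hn
    have h3 : 2 ^ sizeLog n ε ν ≤ 2 * (n + n + ⌈ν⌉₊) := by unfold inputSize at h1; omega
    have h5 : (2 : ℝ) ^ sizeLog n ε ν ≤ 2 * (n + n + c) := by rw [hc]; exact_mod_cast h3
    nlinarith
  have hlog : sizeLog n ε ν * Real.log 2 ≤ 2 * Real.log 2 + l + c := by
    have h1 := Real.log_le_log (by positivity) hpow
    rw [Real.log_pow, Real.log_mul (by positivity) (by positivity),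
      Real.log_mul (by norm_num) (by positivity)] at h1
    have h2 : Real.log 4 = 2 * Real.log 2 := by
      rw [show (4 : ℝ) = 2 ^ 2 by norm_num, Real.log_pow]; norm_num
    have h3 : Real.log n ≤ l := Real.log_le_log (by positivity) hnε
    have h5 := Real.log_le_sub_one_of_pos (show 0 < 1 + c by positivity)
    linarith
  have hlog2 := Real.log_two_gt_d9
  have ha : (sizeLog n ε ν : ℝ) ≤ 2 + 2 * l + 2 * c := by nlinarith
  -- From `8 + 9 (2 + 2 l + 2 c) = 26 + 18 l + 18 c` and `l ≥ 1`.
  have ht : (setSize n ε ν : ℝ) ≤ (44 + 18 * c) * l := by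
    rw [setSize]; push_cast
    nlinarith
  calc ((setSize n ε ν ^ 2 : ℕ) : ℝ) = (setSize n ε ν : ℝ) ^ 2 := by push_cast; rfl
    _ ≤ ((44 + 18 * c) * l) ^ 2 := by gcongr
    _ = ε * ((44 + 18 * c) ^ 2 * (1 / ε * l ^ 2)) := by field_simp
    _ ≤ ε * r := by gcongr

/-- At least half of the ground set remains, so the step is at most `16 / n ^ 4`; since `n` is at
least `1 / ε`, so is `n²`. -/
theorem stepSize_bounds {h : ℕ} (hε : 0 < ε) (hε4 : ε < 1 / 4) (hn : 1 / ε ≤ n)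
    (hh : (h : ℝ) ≤ n / 4) :
    0 < n - h ∧ n * stepSize (n - h) ≤ 1 ∧ (n : ℝ) ^ 2 * stepSize (n - h) ≤ 16 * ε := by
  have h4 : 4 < 1 / ε := by rw [lt_div_iff₀ hε]; linarith
  have hn4 : (4 : ℝ) < n := by linarith
  have hnε : 1 ≤ n * ε := by rwa [div_le_iff₀ hε] at hn
  have hkn : (n : ℝ) / 2 ≤ ((n - h : ℕ) : ℝ) := by
    rw [Nat.cast_sub (by exact_mod_cast (by linarith : (h : ℝ) ≤ n))]
    linarith
  generalize n - h = k at hkn ⊢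
  have hk0 : 0 < k := by exact_mod_cast (by linarith : (0 : ℝ) < k)
  have hδ0 : 0 ≤ stepSize k := by rw [stepSize]; positivity
  have hδ : stepSize k ≤ 16 / n ^ 4 := by
    rw [stepSize]
    calc ((k : ℝ) ^ 4)⁻¹ ≤ (((n : ℝ) / 2) ^ 4)⁻¹ := by gcongr
      _ = 16 / n ^ 4 := by field_simp; norm_num
  have hn2δ : (n : ℝ) ^ 2 * stepSize k ≤ 16 * ε := by
    calc (n : ℝ) ^ 2 * stepSize k ≤ n ^ 2 * (16 / n ^ 4) := by gcongr
      _ = 16 * (1 / (n : ℝ) ^ 2) := by field_simp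
      _ ≤ 16 * ε := by
          gcongr
          rw [div_le_iff₀ (by positivity)]
          nlinarith
  refine ⟨hk0, ?_, hn2δ⟩
  have : 4 * (n * stepSize k) ≤ (n : ℝ) ^ 2 * stepSize k := by
    nlinarith [mul_nonneg (Nat.cast_nonneg (α := ℝ) n) hδ0]
  linarith

/-- The parameter of the Chernoff bound lies in the range where both the quadratic estimate of the
exponential and the sub-exponential condition apply; the latter is where `ε < 2 ν² / α` enters. -/
theorem noise_parameter_bounds (hε : 0 < ε) (hε4 : ε < 1 / 4) (hα : 0 ≤ α)
    (hεα : α = 0 ∨ ε < 2 * ν ^ 2 / α) (hn : 1 / ε ≤ n) :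
    ε / (n : ℝ) ^ 2 / (2 + ν ^ 2) ≤ 1 ∧ ε / (n : ℝ) ^ 2 / (2 + ν ^ 2) * α ≤ 1 := by
  have h4 : 4 < 1 / ε := by rw [lt_div_iff₀ hε]; linarith
  have hn16 : (16 : ℝ) ≤ n ^ 2 := by nlinarith
  have hηε : 16 * (ε / (n : ℝ) ^ 2) ≤ ε := by
    rw [mul_div_assoc', div_le_iff₀ (by positivity)]; nlinarith
  have hη0 : 0 ≤ ε / (n : ℝ) ^ 2 := by positivity
  have hν2 : 0 ≤ ν ^ 2 := sq_nonneg ν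
  refine ⟨by rw [div_le_one (by positivity)]; linarith, ?_⟩
  rcases hα.eq_or_lt with rfl | hα'
  · simp
  · rw [div_mul_eq_mul_div, div_le_one (by positivity)]
    have h := hεα.resolve_left hα'.ne'
    rw [lt_div_iff₀ hα'] at h
    nlinarith

end Parameters

/-! ### The approximation guarantee -/

section Approximation
open MeasureTheory
variable {n : ℕ} {M : Matroid (Fin n)} {f : Finset (Fin n) → ℝ} {O : Finset (Fin n)}

theorem expect_mem_Icc (hf0 : ∀ S, 0 ≤ f S) (hf : Monotone f) (μ : PMF (Finset (Fin n))) :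
    0 ≤ expect μ f ∧ expect μ f ≤ f Finset.univ := by
  rw [expect_eq_ev]
  refine ⟨ev_nonneg hf0, ?_⟩
  rw [← ev_const (μ := μ) (Set.toFinite _) (f Finset.univ)]
  exact ev_mono (Set.toFinite _) fun S _ => hf (Finset.subset_univ S)

/-- The value of the meta-algorithm in terms of the surrogate. -/
theorem expect_metaAlgorithm {B : Finset (Fin n)} {h t m : ℕ} (hh : h ≤ B.card) (ht : t ≤ h)
    (hm : m ≤ h.choose t) (A : Finset (Fin n) → (Finset (Fin n) → ℝ) → PMF (Finset (Fin n)))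
    (v : Finset (Fin n) → ℝ) :
    expect (metaAlgorithm B h t m A v) f =
      (∑ H ∈ B.powersetCard h, (∑ T ∈ (H.powersetCard t).powersetCard m,
        ev (A H (sampledSurrogate v T)) (surrogate f t H)) /
          ((H.powersetCard t).powersetCard m).card) / (B.powersetCard h).card := by
  have hBne : (B.powersetCard h).Nonempty := Finset.powersetCard_nonempty.2 hh
  rw [expect_eq_ev, metaAlgorithm, if_pos hh, ev_bind (Set.toFinite _) fun _ => Set.toFinite _,
    ev_uniform hBne]
  congr 1
  refine Finset.sum_congr rfl fun H hH => ?_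
  have hHc := (Finset.mem_powersetCard.1 hH).2
  have hHne : (H.powersetCard t).Nonempty := Finset.powersetCard_nonempty.2 (by omega)
  have hTne : ((H.powersetCard t).powersetCard m).Nonempty :=
    Finset.powersetCard_nonempty.2 (by rw [Finset.card_powersetCard, hHc]; exact hm)
  rw [ev_bind (Set.toFinite _) fun _ => Set.toFinite _, ev_uniform hTne]
  congr 1
  refine Finset.sum_congr rfl fun T _ => ?_
  rw [ev_bind (Set.toFinite _) fun _ => Set.toFinite _]
  refine ev_congr fun S _ => ?_
  -- The random `H'` of the last step turns `f` into the surrogate.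
  rw [ev_map _ (Set.toFinite _), ev_uniform hHne, surrogate]

variable {Ω : Type*} [MeasurableSpace Ω] {P : Measure Ω} [IsProbabilityMeasure P]
  {ξ : Finset (Fin n) → Ω → ℝ} {D : Measure ℝ} {ε ν α : ℝ}

theorem IsNoise.measurable_noisyValue (hξ : IsNoise P ξ D) : Measurable (noisyValue f ξ) :=
  measurable_pi_lambda _ fun S => (hξ.measurable S).mul_const _

/-- Averaging a lower bound that holds up to rare failures. -/
theorem le_integral_average {ι κ : Type} {𝓗 : Finset ι} {𝓣 : ι → Finset κ} (hH : 𝓗.Nonempty)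
    (hT : ∀ H ∈ 𝓗, (𝓣 H).Nonempty) {X : ι → κ → Ω → ℝ} {bad : ι → κ → Set Ω}
    (hbad : ∀ H T, MeasurableSet (bad H T)) {a : ι → ℝ} {b p : ℝ} (hb : 0 ≤ b)
    (hX : ∀ H ∈ 𝓗, ∀ T ∈ 𝓣 H, ∀ ω, a H - b * (bad H T).indicator 1 ω ≤ X H T ω)
    (hp : ∀ H ∈ 𝓗, ∑ T ∈ 𝓣 H, P.real (bad H T) ≤ (𝓣 H).card * p) {Y : Ω → ℝ}
    (hY : Integrable Y P)
    (hYX : ∀ ω, Y ω = (∑ H ∈ 𝓗, (∑ T ∈ 𝓣 H, X H T ω) / (𝓣 H).card) / 𝓗.card) :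
    (∑ H ∈ 𝓗, a H) / 𝓗.card - b * p ≤ ∫ ω, Y ω ∂P := by
  have hind : ∀ H T, Integrable (fun ω => (bad H T).indicator (1 : Ω → ℝ) ω) P := fun H T =>
    (integrable_const (1 : ℝ)).indicator (hbad H T)
  have hterm : ∀ H T, Integrable (fun ω => a H - b * (bad H T).indicator (1 : Ω → ℝ) ω) P :=
    fun H T => (integrable_const _).sub ((hind H T).const_mul b)
  have hinteg : ∀ H, Integrable (fun ω => (∑ T ∈ 𝓣 H, (a H - b * (bad H T).indicator 1 ω)) /
      ((𝓣 H).card : ℝ)) P := fun H => (integrable_finsetSum _ fun T _ => hterm H T).div_const _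
  have hc : (0 : ℝ) < 𝓗.card := by exact_mod_cast hH.card_pos
  calc (∑ H ∈ 𝓗, a H) / 𝓗.card - b * p = (∑ H ∈ 𝓗, (a H - b * p)) / 𝓗.card := by
        rw [Finset.sum_sub_distrib, Finset.sum_const, nsmul_eq_mul]; field_simp
    _ ≤ (∑ H ∈ 𝓗, (∑ T ∈ 𝓣 H, (a H - b * P.real (bad H T))) / (𝓣 H).card) / 𝓗.card := by
        gcongr with H hHm
        have hc' : (0 : ℝ) < (𝓣 H).card := by exact_mod_cast (hT H hHm).card_pos
        rw [Finset.sum_sub_distrib, ← Finset.mul_sum, Finset.sum_const, nsmul_eq_mul,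
          le_div_iff₀ hc']
        nlinarith [mul_le_mul_of_nonneg_left (hp H hHm) hb]
    _ = ∫ ω, (∑ H ∈ 𝓗, (∑ T ∈ 𝓣 H, (a H - b * (bad H T).indicator 1 ω)) /
          ((𝓣 H).card : ℝ)) / 𝓗.card ∂P := by
        rw [integral_div, integral_finsetSum _ fun H _ => hinteg H]
        congr 1
        refine Finset.sum_congr rfl fun H _ => ?_
        rw [integral_div, integral_finsetSum _ fun T _ => hterm H T]
        congr 1
        refine Finset.sum_congr rfl fun T _ => ?_
        rw [integral_sub (integrable_const _) ((hind H T).const_mul b), integral_const_mul,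
          integral_indicator_one (hbad H T)]
        simp
    _ ≤ ∫ ω, Y ω ∂P := by
        refine integral_mono ((integrable_finsetSum _ fun H _ => hinteg H).div_const _) hY fun ω => ?_
        simp only [hYX]
        gcongr with H hHm T hTm
        exact hX H hHm T hTm ω

theorem average_mul_sub {ι : Type} {𝓗 : Finset ι} (hH : 𝓗.Nonempty) (g : ι → ℝ) (c d : ℝ) :
    (∑ H ∈ 𝓗, (c * g H - d)) / 𝓗.card = c * ((∑ H ∈ 𝓗, g H) / 𝓗.card) - d := by
  have hc : (0 : ℝ) < 𝓗.card := by exact_mod_cast hH.card_pos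
  rw [Finset.sum_sub_distrib, ← Finset.mul_sum, Finset.sum_const, nsmul_eq_mul]
  field_simp

/-- The outcomes of the noise for which the sampled surrogate is inaccurate. -/
def badNoise (M : Matroid (Fin n)) (f : Finset (Fin n) → ℝ) (ξ : Finset (Fin n) → Ω → ℝ) (t : ℕ)
    (e : ℝ) (H : Finset (Fin n)) (T : Finset (Finset (Fin n))) : Set Ω :=
  {ω | ¬ ∀ S ⊆ candidates M H,
    |sampledSurrogate (noisyValue f ξ ω) T S - surrogate f t H S| ≤ e}

theorem IsNoise.measurableSet_badNoise (hξ : IsNoise P ξ D) (t : ℕ) (e : ℝ) (H : Finset (Fin n))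
    (T : Finset (Finset (Fin n))) : MeasurableSet (badNoise M f ξ t e H T) := by
  have hms := measurable_sampledSurrogate (X := Finset (Fin n) → ℝ) measurable_id T
  have : badNoise M f ξ t e H T = (⋂ S ∈ {S | S ⊆ candidates M H},
      {ω | |sampledSurrogate (noisyValue f ξ ω) T S - surrogate f t H S| ≤ e})ᶜ := by
    ext ω; simp [badNoise]
  rw [this]
  refine (MeasurableSet.biInter (Set.to_countable _) fun S _ =>
    measurableSet_le ?_ measurable_const).compl
  exact ((((measurable_pi_apply S).comp hms).comp hξ.measurable_noisyValue).sub_const _).abs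

/-- The value found in a contraction when the value oracle is accurate. -/
theorem contraction_value_ge (hE : M.E = Set.univ) {H J : Finset (Fin n)}
    (hH : M.Indep (↑H : Set (Fin n))) (hf0 : ∀ S, 0 ≤ f S) (hf : Monotone f) (hf' : DimRet f)
    (hmax : ∀ S : Finset (Fin n), M.Indep (↑S : Set (Fin n)) → f S ≤ f O) (hpos : 0 < f O)
    (hJ : ContractIndep M H J) {t : ℕ} (hne : (H.powersetCard t).Nonempty) (hε : 0 < ε)
    (hk : 0 < n - H.card) (hδ1 : n * stepSize (n - H.card) ≤ 1)
    (hδ : (n : ℝ) ^ 2 * stepSize (n - H.card) ≤ 16 * ε) {g : Finset (Fin n) → ℝ}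
    (hg : ∀ S ⊆ candidates M H, |g S - surrogate f t H S| ≤ ε / n ^ 2 * (n * f O)) :
    (1 - Real.exp (-1)) * f J - 34 * ε * f O ≤
      ev (measuredContinuousGreedy (n - H.card) (numSamples (n - H.card)) (greedySet M H)
        (roundSet M H) g) (surrogate f t H) := by
  have hn0 : 0 < n := by omega
  have hn0' : (0 : ℝ) < n := by exact_mod_cast hn0
  have hVc := value_le_of_subset_candidates hn0 hf' hf0 hmax hH
  refine le_trans ?_ (measuredContinuousGreedy_ge (M := M) (H := H) (k := n - H.card)
    (s := numSamples (n - H.card)) (greedySet_isMaxWeight hH)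
    (fun L hL hL' => roundSet_pipage hE hH L hL hL')
    (fun I hI => hI.subset_candidates) (surrogate_mono hf) (surrogate_dimRet hf')
    (surrogate_nonneg hf0) (by positivity : 0 < n * f O)
    (fun S hS => surrogate_le hne (hVc S hS)) hg hJ hk hδ1 ?_)
  -- The inaccurate oracle costs `2 ε`, and the terms with the step size cost at most `16 ε` each,
  -- so `34 ε` in total.
  · have hq := le_surrogate hf hne J
    set δ := stepSize (n - H.card) with hδdef
    have hδ0 : 0 ≤ δ := by rw [hδdef, stepSize]; positivity
    have e1 : (n : ℝ) * (2 * (ε / n ^ 2 * (n * f O)) + n * f O * δ) =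
        2 * ε * f O + n ^ 2 * δ * f O := by
      field_simp
    have e2 : n * δ * (n * f O) = n ^ 2 * δ * f O := by ring
    rw [e1, e2]
    have he1 : Real.exp (-1) ≤ 1 := Real.exp_le_one_iff.2 (by norm_num)
    have h1 := mul_le_mul_of_nonneg_right hδ hpos.le
    have h2 := mul_le_mul_of_nonneg_left hq (sub_nonneg.2 he1)
    have h3 : 0 ≤ Real.exp (-1) * (2 * ε * f O + n ^ 2 * δ * f O) := by positivity
    linarith
  · rw [numSamples, pow_succ (n - H.card) 8]
    have h8 : (n - H.card) ^ 8 ≤ (n - H.card) ^ 8 * (n - H.card) := Nat.le_mul_of_pos_right _ hk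
    omega

/-- Averaging over `H` replaces `f (J H)` by at least `(1 - ε) f O`. The inner algorithm loses `34 ε
f O`, and inaccurate outcomes, of probability at most `ε`, lose at most `f O` each. Everything fits
into `100 ε`. -/
theorem approximation_of_parameters (hα : 0 ≤ α) (hε : 0 < ε) (hε4 : ε < 1 / 4)
    (hεα : α = 0 ∨ ε < 2 * ν ^ 2 / α) (hE : M.E = Set.univ) (hn : 1 / ε ≤ n)
    {B : Finset (Fin n)} (hB : M.IsBase (↑B : Set (Fin n))) {t m : ℕ} (ht : 0 < t) (hm : 0 < m)
    (hmc : m ≤ (t ^ 2).choose t) (hh : ((t ^ 2 : ℕ) : ℝ) ≤ ε * B.card)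
    (hfail : 2 ^ (n + 1) * Real.exp (-(m * (ε / n ^ 2) ^ 2 / (2 * (2 + ν ^ 2)))) ≤ ε)
    (hf0 : ∀ S, 0 ≤ f S) (hfe : f ∅ = 0) (hf : Monotone f) (hf' : DimRet f)
    (hO : M.Indep (↑O : Set (Fin n)))
    (hmax : ∀ S : Finset (Fin n), M.Indep (↑S : Set (Fin n)) → f S ≤ f O) (hpos : 0 < f O)
    (hD : IsSubExponential D ν α) (hξ : IsNoise P ξ D)
    (hinteg : Integrable (fun ω => expect (metaAlgorithm B (t ^ 2) t m
      (fun H => measuredContinuousGreedy (n - H.card) (numSamples (n - H.card))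
        (greedySet M H) (roundSet M H)) (noisyValue f ξ ω)) f) P) :
    (1 - 1 / Real.exp 1 - 100 * ε) * f O ≤
      ∫ ω, expect (metaAlgorithm B (t ^ 2) t m
        (fun H => measuredContinuousGreedy (n - H.card) (numSamples (n - H.card))
          (greedySet M H) (roundSet M H)) (noisyValue f ξ ω)) f ∂P := by
  have hn0' : (0 : ℝ) < n := lt_of_lt_of_le (by positivity) hn
  have hn0 : 0 < n := by exact_mod_cast hn0'
  have hrn : (B.card : ℝ) ≤ n := by exact_mod_cast (Finset.card_le_univ B).trans_eq (by simp)
  have hB0 : (0 : ℝ) ≤ B.card := Nat.cast_nonneg _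
  have hhB : t ^ 2 ≤ B.card := by
    have : ((t ^ 2 : ℕ) : ℝ) ≤ B.card := by nlinarith
    exact_mod_cast this
  have htt : t ≤ t ^ 2 := Nat.le_self_pow two_ne_zero t
  obtain ⟨hk0, hnδ, hn2δ⟩ := stepSize_bounds (h := t ^ 2) hε hε4 hn (by nlinarith)
  obtain ⟨hη1, hηα⟩ := noise_parameter_bounds (ν := ν) hε hε4 hα hεα hn
  obtain ⟨J, hJc, hJv⟩ := exists_contractIndep_value hE hB hhB hO hf' hf hfe
  have hHi : ∀ H ∈ B.powersetCard (t ^ 2), M.Indep (↑H : Set (Fin n)) := fun H hH =>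
    hB.indep.subset (by exact_mod_cast (Finset.mem_powersetCard.1 hH).1)
  have hHne : ∀ H ∈ B.powersetCard (t ^ 2), (H.powersetCard t).Nonempty := fun H hH =>
    Finset.powersetCard_nonempty.2 (by rw [(Finset.mem_powersetCard.1 hH).2]; exact htt)
  have hmH : ∀ H ∈ B.powersetCard (t ^ 2), m ≤ (H.powersetCard t).card := fun H hH => by
    rw [Finset.card_powersetCard, (Finset.mem_powersetCard.1 hH).2]; exact hmc
  have hBne : (B.powersetCard (t ^ 2)).Nonempty := Finset.powersetCard_nonempty.2 hhB
  have he0 := Real.exp_pos (-1)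
  have he1 : Real.exp (-1) ≤ 1 := Real.exp_le_one_iff.2 (by norm_num)
  have key := le_integral_average (P := P) hBne
    (𝓣 := fun H => (H.powersetCard t).powersetCard m)
    (fun H hH => Finset.powersetCard_nonempty.2 (hmH H hH))
    (X := fun H T ω => ev (measuredContinuousGreedy (n - H.card) (numSamples (n - H.card))
        (greedySet M H) (roundSet M H) (sampledSurrogate (noisyValue f ξ ω) T)) (surrogate f t H))
    (bad := badNoise M f ξ t (ε / n ^ 2 * (n * f O))) (hξ.measurableSet_badNoise t (ε / n ^ 2 * (n * f O)))
    (a := fun H => (1 - Real.exp (-1)) * f (J H) - 34 * ε * f O) (b := f O) (p := ε)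
    hpos.le ?_ ?_ hinteg fun ω => expect_metaAlgorithm hhB htt hmc _ _
  · refine le_trans ?_ key
    have hN : (0 : ℝ) < (B.powersetCard (t ^ 2)).card := by exact_mod_cast hBne.card_pos
    have h1 : (1 - ε) * f O ≤
        (∑ H ∈ B.powersetCard (t ^ 2), f (J H)) / (B.powersetCard (t ^ 2)).card := by
      rw [le_div_iff₀ hN]
      have hBpos : (0 : ℝ) < B.card := by
        exact_mod_cast (pow_pos ht 2).trans_le hhB
      refine le_of_mul_le_mul_left (le_trans ?_ hJv) hBpos
      have : (B.card : ℝ) * (1 - ε) ≤ B.card - (t ^ 2 : ℕ) := by linarith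
      have := mul_le_mul_of_nonneg_right (mul_le_mul_of_nonneg_right this hpos.le) hN.le
      linarith
    rw [average_mul_sub hBne, one_div, ← Real.exp_neg]
    have h3 := mul_le_mul_of_nonneg_left h1 (sub_nonneg.2 he1)
    have h5 : 0 ≤ ε * f O := by positivity
    have h6 : Real.exp (-1) * (ε * f O) ≥ 0 := by positivity
    nlinarith
  · intro H hH T _ ω
    obtain ⟨hHB, hHc⟩ := Finset.mem_powersetCard.1 hH
    have hX0 : 0 ≤ ev (measuredContinuousGreedy (n - H.card) (numSamples (n - H.card))
        (greedySet M H) (roundSet M H) (sampledSurrogate (noisyValue f ξ ω) T))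
        (surrogate f t H) := ev_nonneg (surrogate_nonneg hf0)
    have hJO : f (J H) ≤ f O := hmax _ ((hJc H hH).2.subset (by simp))
    by_cases hω : ω ∈ badNoise M f ξ t (ε / n ^ 2 * (n * f O)) H T
    -- On an inaccurate outcome nonnegativity suffices: the target minus `f O` is not positive.
    · rw [Set.indicator_of_mem hω]
      refine le_trans ?_ hX0
      have h1 : 0 ≤ ε * f O := by positivity
      have h2 := mul_nonneg he0.le (hf0 (J H))
      rw [Pi.one_apply]
      linarith
    · rw [Set.indicator_of_notMem hω, mul_zero, sub_zero]
      exact contraction_value_ge hE (hHi H hH) hf0 hf hf' hmax hpos (hJc H hH) (hHne H hH) hε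
        (by rw [hHc]; exact hk0) (by rw [hHc]; exact hnδ) (by rw [hHc]; exact hn2δ)
        (not_not.1 hω)
  · intro H hH
    have h1 := hξ.sum_bad_le hD (f := f) (U := candidates M H) (H := H) (t := t) (m := m)
      (V := n * f O) (η := ε / n ^ 2) (Finset.disjoint_left.2 fun i hi => (mem_candidates.1 hi).1) hf0
      (by positivity)
      (value_le_of_subset_candidates hn0 hf' hf0 hmax (hHi H hH)) hα
      (by positivity) hη1 hηα (hmH H hH) hm
    refine h1.trans (mul_le_mul_of_nonneg_left ?_ (Nat.cast_nonneg _))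
    exact hfail

/-- The meta-algorithm is a `1 - 1 / e - O(ε)` approximation. -/
theorem approximation (hν : 0 ≤ ν) (hα : 0 ≤ α) (hε : 0 < ε)
    (hεα : α = 0 ∨ ε < 2 * ν ^ 2 / α) (hE : M.E = Set.univ) (hn : 1 / ε ≤ n)
    {B : Finset (Fin n)} (hB : M.IsBase (↑B : Set (Fin n)))
    (hr : (44 + 18 * (⌈ν⌉₊ : ℝ)) ^ 2 * (1 / ε * Real.log (n / ε) ^ 2) ≤ B.card)
    (hf0 : ∀ S, 0 ≤ f S) (hfe : f ∅ = 0) (hf : Monotone f) (hf' : DimRet f)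
    (hO : M.Indep (↑O : Set (Fin n)))
    (hmax : ∀ S : Finset (Fin n), M.Indep (↑S : Set (Fin n)) → f S ≤ f O)
    (hD : IsSubExponential D ν α) (hξ : IsNoise P ξ D) :
    Integrable (fun ω => expect (metaAlgorithm B (setSize n ε ν ^ 2) (setSize n ε ν)
      (numSets n ε ν) (fun H => measuredContinuousGreedy (n - H.card) (numSamples (n - H.card))
        (greedySet M H) (roundSet M H)) (noisyValue f ξ ω)) f) P ∧
    (1 - 1 / Real.exp 1 - 100 * ε) * f O ≤
      ∫ ω, expect (metaAlgorithm B (setSize n ε ν ^ 2) (setSize n ε ν)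
        (numSets n ε ν) (fun H => measuredContinuousGreedy (n - H.card) (numSamples (n - H.card))
          (greedySet M H) (roundSet M H)) (noisyValue f ξ ω)) f ∂P := by
  have hmeas := ((measLaw_metaAlgorithm (X := Finset (Fin n) → ℝ) M B (setSize n ε ν ^ 2)
    (setSize n ε ν) (numSets n ε ν) numSamples (roundSet M) measurable_id).measurable_expect
      f).comp (hξ.measurable_noisyValue (f := f))
  have hinteg := Integrable.of_bound (μ := P) hmeas.aestronglyMeasurable (f Finset.univ)
    (Filter.Eventually.of_forall fun ω =>
      (abs_of_nonneg (expect_mem_Icc hf0 hf _).1).trans_le (expect_mem_Icc hf0 hf _).2)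
  refine ⟨hinteg, ?_⟩
  have h0 : 0 ≤ ∫ ω, expect (metaAlgorithm B (setSize n ε ν ^ 2) (setSize n ε ν)
        (numSets n ε ν) (fun H => measuredContinuousGreedy (n - H.card) (numSamples (n - H.card))
          (greedySet M H) (roundSet M H)) (noisyValue f ξ ω)) f ∂P :=
    integral_nonneg fun ω => (expect_mem_Icc hf0 hf _).1
  rcases (hf0 O).eq_or_lt with hz | hpos
  · rw [← hz, mul_zero]; exact h0
  rcases le_or_gt (1 / 4) ε with hε4 | hε4
  -- For `ε` at least `1 / 4` the claimed factor is negative and the bound is void.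
  · refine le_trans (mul_nonpos_of_nonpos_of_nonneg ?_ hpos.le) h0
    have : 0 < 1 / Real.exp 1 := by positivity
    linarith
  · have hn0 : 0 < n := by exact_mod_cast lt_of_lt_of_le (one_div_pos.2 hε) hn
    exact approximation_of_parameters hα hε hε4 hεα hE hn hB (by rw [setSize]; positivity)
      (by rw [numSets]; positivity) (numSets_le_choose n ε ν) (setSize_sq_le hε hε4 hn hr)
      (failure_le hε hν hn0) hf0 hfe hf hf' hO hmax hpos hD hξ hinteg

end Approximation


/-! ### The program -/

theorem Prog.program_settles_poly : ∃ K d : ℕ, ∀ (n : ℕ) (ε ν α : ℝ) (M : Matroid (Fin n)),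
    0 < n → M.E = Set.univ → ∀ v : Finset (Fin n) → ℝ,
      HaltsWithin Prog.program ε ν α M v (timeBound K d n ε ν) ∧
      outputLaw Prog.program ε ν α M v (timeBound K d n ε ν) =
        metaAlgorithm (greedySet M ∅ fun _ => 1) (setSize n ε ν ^ 2) (setSize n ε ν)
          (numSets n ε ν) (fun H => measuredContinuousGreedy (n - H.card) (numSamples (n - H.card))
            (greedySet M H) (roundSet M H)) v := by
  obtain ⟨K, d, hKd⟩ := Prog.runtime_le_poly
  exact ⟨K, d, fun n ε ν α M hn hE v => Prog.program_settles hn hE _ (hKd _)⟩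

theorem greedySet_isBase {n : ℕ} (M : Matroid (Fin n)) :
    M.IsBase (↑(greedySet M ∅ fun _ => 1) : Set (Fin n)) :=
  isBase_of_isMaxWeight_one (greedySet_isMaxWeight (by simp) _)

end
end NoisySubmodular

theorem theorem4p2 :
    ∃ (prog : NoisySubmodular.Cmd) (K d : ℕ) (C : ℝ) (c : ℝ → ℝ)
      (m t : ℕ → ℝ → ℝ → ℕ) (s : ℕ → ℕ),
      0 < C ∧ (∀ ν, 0 < c ν) ∧
      -- the parameters of the algorithm
      (∀ (n : ℕ) (ε ν : ℝ), 0 < n → 0 < ε → 0 ≤ ν →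
        max 2 (8 * ν ^ 2) * ((n : ℝ) ^ 4 / ε ^ 2) * (n + Real.log (4 * n)) ≤ m n ε ν ∧
        Real.logb 2 (4 * m n ε ν) ≤ t n ε ν) ∧
      (∀ k : ℕ, 10 / NoisySubmodular.stepSize k ^ 2 * Real.log (2 * k) ≤ s k) ∧
      -- the program runs in polynomial time and is the meta-algorithm with measured
      -- continuous greedy
      (∀ (n : ℕ) (ε ν α : ℝ) (M : Matroid (Fin n)), 0 < n → 0 < ε → 0 ≤ ν → 0 ≤ α →
        M.E = Set.univ →
        ∃ (B₀ : Finset (Fin n)) (sel : Finset (Fin n) → (Fin n → ℝ) → Finset (Fin n))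
          (round : Finset (Fin n) → List (Finset (Fin n)) → PMF (Finset (Fin n))),
          M.IsBase (↑B₀ : Set (Fin n)) ∧
          (∀ H ⊆ B₀, ∀ w, NoisySubmodular.IsMaxWeight M H w (sel H w)) ∧
          (∀ H ⊆ B₀, ∀ L : List (Finset (Fin n)), L.length = (n - H.card) ^ 4 →
            (∀ I ∈ L, NoisySubmodular.ContractIndep M H I) →
            NoisySubmodular.PipageRounding (NoisySubmodular.polytope M H)
              (NoisySubmodular.fracPoint (NoisySubmodular.stepSize (n - H.card)) L)
              (round H L)) ∧
          ∀ v : Finset (Fin n) → ℝ,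
            NoisySubmodular.HaltsWithin prog ε ν α M v (NoisySubmodular.timeBound K d n ε ν) ∧
            NoisySubmodular.outputLaw prog ε ν α M v (NoisySubmodular.timeBound K d n ε ν) =
              NoisySubmodular.metaAlgorithm B₀ (t n ε ν ^ 2) (t n ε ν) (m n ε ν)
                (fun H => NoisySubmodular.measuredContinuousGreedy (n - H.card)
                  (s (n - H.card)) (sel H) (round H)) v ∧
            ∀ S ∈ (NoisySubmodular.outputLaw prog ε ν α M v
                (NoisySubmodular.timeBound K d n ε ν)).support,
              M.Indep (↑S : Set (Fin n))) ∧
      -- the approximation guarantee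
      (∀ (n : ℕ) (ε ν α : ℝ) (M : Matroid (Fin n)) (f : Finset (Fin n) → ℝ)
        (O : Finset (Fin n)) (D : MeasureTheory.Measure ℝ)
        (Ω : Type*) (_ : MeasurableSpace Ω) (P : MeasureTheory.Measure Ω)
        (_ : MeasureTheory.IsProbabilityMeasure P) (ξ : Finset (Fin n) → Ω → ℝ),
        0 ≤ ν → 0 ≤ α → 0 < ε → (α = 0 ∨ ε < 2 * ν ^ 2 / α) →
        M.E = Set.univ → 1 / ε ≤ n →
        c ν * (1 / ε * Real.log (n / ε) ^ 2) ≤ (M.eRank.toNat : ℝ) →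
        (∀ S, 0 ≤ f S) → f ∅ = 0 → Monotone f → NoisySubmodular.Submodular f →
        M.Indep (↑O : Set (Fin n)) →
        (∀ S : Finset (Fin n), M.Indep (↑S : Set (Fin n)) → f S ≤ f O) →
        NoisySubmodular.IsSubExponential D ν α → NoisySubmodular.IsNoise P ξ D →
        MeasureTheory.Integrable (fun ω => NoisySubmodular.expect
          (NoisySubmodular.outputLaw prog ε ν α M (NoisySubmodular.noisyValue f ξ ω)
            (NoisySubmodular.timeBound K d n ε ν)) f) P ∧
        (1 - 1 / Real.exp 1 - C * ε) * f O ≤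
          ∫ ω, NoisySubmodular.expect
            (NoisySubmodular.outputLaw prog ε ν α M (NoisySubmodular.noisyValue f ξ ω)
              (NoisySubmodular.timeBound K d n ε ν)) f ∂P) := by
  obtain ⟨K, d, hrun⟩ := NoisySubmodular.Prog.program_settles_poly
  -- The constant `100` exceeds the sum of the losses and makes the claim void for large `ε`; the
  -- rank constant is the square of the factor that bounds the size of the smoothing sets by the
  -- logarithm.
  refine ⟨NoisySubmodular.Prog.program, K, d, 100, fun ν => (44 + 18 * (⌈ν⌉₊ : ℝ)) ^ 2,
    NoisySubmodular.numSets, NoisySubmodular.setSize, NoisySubmodular.numSamples, by norm_num,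
    fun ν => by positivity, fun n ε ν hn hε hν => ⟨NoisySubmodular.numSets_lower hn hε hν,
      NoisySubmodular.setSize_lower n ε ν⟩, NoisySubmodular.numSamples_lower, ?_, ?_⟩
  · intro n ε ν α M hn hε hν hα hE
    have hB := NoisySubmodular.greedySet_isBase M
    have hH : ∀ H ⊆ NoisySubmodular.greedySet M ∅ fun _ => 1, M.Indep (↑H : Set (Fin n)) :=
      fun H hH => hB.indep.subset (by exact_mod_cast hH)
    refine ⟨NoisySubmodular.greedySet M ∅ fun _ => 1, NoisySubmodular.greedySet M,
      NoisySubmodular.roundSet M, hB,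
      fun H hHB w => NoisySubmodular.greedySet_isMaxWeight (hH H hHB) w,
      fun H hHB L hlen hL => NoisySubmodular.roundSet_pipage hE (hH H hHB) L hlen hL,
      fun v => ⟨(hrun n ε ν α M hn hE v).1, (hrun n ε ν α M hn hE v).2, ?_⟩⟩
    rw [(hrun n ε ν α M hn hE v).2]
    exact NoisySubmodular.metaAlgorithm_indep hE hB.indep (Nat.le_self_pow two_ne_zero _)
  · intro n ε ν α M f O D Ω _ P _ ξ hν hα hε hεα hE hn hr hf0 hfe hf hf' hO hmax hD hξ
    have hn0 : 0 < n := by exact_mod_cast lt_of_lt_of_le (one_div_pos.2 hε) hn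
    have hB := NoisySubmodular.greedySet_isBase M
    have hcard : M.eRank.toNat = (NoisySubmodular.greedySet M ∅ fun _ => 1).card := by
      rw [← hB.encard_eq_eRank, Set.encard_coe_eq_coe_finsetCard]; rfl
    rw [hcard] at hr
    simp only [fun v => (hrun n ε ν α M hn0 hE v).2]
    exact NoisySubmodular.approximation hν hα hε hεα hE hn hB hr hf0 hfe hf (hf'.dimRet hf) hO hmax
      hD hξ
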